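/- **Setting.** Let $(S,o)$ be a smooth germ of complex surface, with completed local ring $\hat{\mathcal O}_{S,o}\simeq\mathbb C[[x,y]]$. Curve germs, branches and crosses are formal. Let $L$ be a smooth branch on $(S,o)$ and $C=Z(f)$ a reduced plane curve singularity on $(S,o)$ (that is, $f$ is a square-free element of the maximal ideal) of which $L$ is not a branch. A *cross* at a smooth point is a pair of transversal smooth branches $(A,B)=(Z(a),Z(b))$, where $(a,b)$ are local coordinates there. The *Newton fan* of $C$ relative to $(A,B)$ is the subdivision of $\sigma_0=\mathbb R_+^2$ by the rays orthogonal to the compact edges of the Newton polygon of a defining function of $C$, expanded as a series in $(a,b)$. The *Newton modification* is the toric modification associated with this fan in the coordinates $(a,b)$. **Algorithm.** Start with the surface $S$, the boundary $L$ and the point $o$. At every current point $p$, let $A$ be the germ at $p$ of the current boundary and $C$ the germ at $p$ of the strict transform of the initial curve. 1. If $(A,C)$ is a cross, put $B:=C$ and stop at $p$. 2. Otherwise choose any smooth branch $B$ at $p$, possibly included in $C$, such that $(A,B)$ is a cross. 3. In the second case, perform at $p$ the Newton modification of $C$ relative to $(A,B)$. 4. The new boundary is the reduced total transform of the old boundary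 and of all the branches $B$. The new current points are the points above the points $p$ modified in step 3 through which passes the strict transform of a branch of $C$ different from $B$ (so, if $B$ is not a branch of $C$, all the points above $p$ of the strict transform of $C$). Repeat at these points. **Theorem.** At every stage there are finitely many current points, and the algorithm can be continued at each of them. Whatever choices are made, it stops after finitely many iterations. Let $\Sigma$ be the final surface, $\partial\Sigma$ its final boundary, $\pi:\Sigma\to S$ the composed morphism and $(L,L')$ the cross considered at $o$. Then: * $\pi:(\Sigma,\partial\Sigma)\to(S,L+L')$ is a modification in the toroidal category: $\Sigma$ is normal, $\pi$ is proper and birational (bimeromorphic), the pairs $(\Sigma,\partial\Sigma)$ and $(S,L+L')$ are toroidal, and $\pi^{-1}(L+L')\subseteq\partial\Sigma$; * $\partial\Sigma$ contains the reduced total transform $\pi^*(C)$; * the strict transform by $\pi$ of every branch of $C$ which was never chosen as a branch $B$ in step 2 does not contain singular points of $\Sigma$. In particular, if no branch chosen in step 2 is a branch of (the strict transform of) $C$, then $\pi$ is a toroidal pseudo-resolution of $C$: moreover $\partial\Sigma\supseteq\pi^*(C)_{\mathrm{red}}$ and the whole strict transform of $C$ avoids the singular points of $\Sigma$. -/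

import Mathlib

open IsLocalRing

noncomputable section

namespace ToroidalRes

/-! ### The germ of smooth surface

All curve germs, branches and crosses are formal, so the smooth germ `(S, o)` enters only through its
completed local ring, which is `ℂ⟦x, y⟧`. -/

/-- The completed local ring of the smooth germ of surface `(S, o)`. -/
abbrev R : Type := MvPowerSeries (Fin 2) ℂ

/-- The field of fractions of the completed local ring. -/
abbrev K : Type := FractionRing R

/-! ### Surfaces as Zariski models

An integral scheme `X`, separated and birational over `Spec R`, is represented by the set of the
local rings `𝒪_{X, P} ⊆ K` of all its points `P` (closed or not). In this language
* `P` is a specialization of `Q` (i.e. `P` lies in the closure of `Q`) iff `𝒪_P ⊆ 𝒪_Q`;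
* a morphism of such schemes sends `P` to the point `Q` whose local ring is dominated by the one
  of `P`; domination is the order `≤` of `LocalSubring K`. -/

/-- The points of the affine model `Spec A`: the localizations of `A` at its primes. -/
def affinePoints (A : Subring K) : Set (LocalSubring K) :=
  {P | ∃ (p : Ideal A) (_ : p.IsPrime), P = LocalSubring.ofPrime A p}

/-- The germ `S`, as the set of points of `Spec R`. -/
def S : Set (LocalSubring K) := affinePoints (algebraMap R K).range

/-- The closed point of `S`. -/
def origin : LocalSubring K := LocalSubring.range (algebraMap R K)

/-- `X` is a modification of `S`: a finite union of affine models of finite type over `R`, separated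
and proper over `S` by the valuative criterion (every valuation ring of `K` containing `R` has one
and only one center on `X`). Such an `X` is birational to `S`, having the same function field. -/
structure IsModification (X : Set (LocalSubring K)) : Prop where
  finite_type : ∃ 𝒜 : Set (Subalgebra R K), 𝒜.Finite ∧ (∀ A ∈ 𝒜, A.FG) ∧
    X = ⋃ A ∈ 𝒜, affinePoints A.toSubring
  valuative : ∀ W : ValuationSubring K, (algebraMap R K).range ≤ W.toSubring →
    ∃! P, P ∈ X ∧ P ≤ W.toLocalSubring

/-- The closed points of `X`. -/
def IsClosedPoint (X : Set (LocalSubring K)) (P : LocalSubring K) : Prop :=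
  P ∈ X ∧ ∀ Q ∈ X, Q.toSubring ≤ P.toSubring → Q = P

/-- The prime divisors (irreducible curves) of a normal surface `X`, identified with their generic
points: the points of `X` whose local ring is a discrete valuation ring. A reduced
divisor on `X` is then a finite set of prime divisors. If a modification `X' → X` is an isomorphism
above the generic point of a curve on `X`, then the strict transform of this curve on `X'` has the
same local ring at its generic point: it is the same element of `LocalSubring K`. -/
def IsPrimeDivisor (X : Set (LocalSubring K)) (V : LocalSubring K) : Prop :=
  V ∈ X ∧ IsDiscreteValuationRing V.toSubring

/-- The set of points of `X` lying on the reduced divisor `D`. -/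
def support (X D : Set (LocalSubring K)) : Set (LocalSubring K) :=
  {P | P ∈ X ∧ ∃ V ∈ D, P.toSubring ≤ V.toSubring}

/-- The preimage, by the morphism `X' → X`, of a set `Z` of points of `X`. -/
def preimage (X' X Z : Set (LocalSubring K)) : Set (LocalSubring K) :=
  {P | P ∈ X' ∧ ∃ Q ∈ X, Q ≤ P ∧ Q ∈ Z}

/-- The reduced total transform on `X'` of the divisor `D` of `X`: the prime divisors of `X'` which
are contained in the preimage of the support of `D`. -/
def totalTransform (X' X D : Set (LocalSubring K)) : Set (LocalSubring K) :=
  {V | IsPrimeDivisor X' V ∧ V ∈ preimage X' X (support X D)}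

/-- The ideal, in the local ring of the point `P`, of the germ at `P` of the reduced divisor `D`
(the unit ideal if `D` does not pass through `P`). -/
def idealAt (P : LocalSubring K) (D : Set (LocalSubring K)) : Ideal P.toSubring :=
  ⨅ V ∈ D, ⨅ h : P.toSubring ≤ V.toSubring,
    (maximalIdeal V.toSubring).comap (Subring.inclusion h)

/-- The set of branches of the curve germ `Z(f)` on `S`, for `f ≠ 0`: the points of codimension one
of `S` at which `f` vanishes. When `f` is square-free, this set is the reduced curve `Z(f)`. -/
def curve (f : R) : Set (LocalSubring K) :=
  {V | IsPrimeDivisor S V ∧ ∃ g ∈ maximalIdeal V.toSubring, (g : K) = algebraMap R K f}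

/-- The germs at `P` of the divisors `D` and `D'` form a cross: they are the zero loci of the two
members of a local coordinate system `(a, b)` at `P`. -/
def IsCross (P : LocalSubring K) (D D' : Set (LocalSubring K)) : Prop :=
  ∃ a b : P.toSubring, idealAt P D = Ideal.span {a} ∧ idealAt P D' = Ideal.span {b} ∧
    maximalIdeal P.toSubring = Ideal.span {a, b}

/-! ### Newton polygons and Newton fans -/

/-- The Newton polygon of a series: the convex hull of `supp F + ℕ²`. -/
def newtonPolygon (F : R) : Set (ℝ × ℝ) :=
  convexHull ℝ {p | ∃ e : Fin 2 →₀ ℕ, MvPowerSeries.coeff e F ≠ 0 ∧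
    ∃ i j : ℕ, p = ((e 0 : ℝ) + i, (e 1 : ℝ) + j)}

/-- The face of the Newton polygon on which the weight `w` is minimal. -/
def newtonFace (F : R) (w : ℤ × ℤ) : Set (ℝ × ℝ) :=
  {p | p ∈ newtonPolygon F ∧ ∀ q ∈ newtonPolygon F,
    (w.1 : ℝ) * p.1 + (w.2 : ℝ) * p.2 ≤ (w.1 : ℝ) * q.1 + (w.2 : ℝ) * q.2}

/-- The primitive generators of the rays of the Newton fan of `F`: the two edges of the
quadrant `σ₀`, and the rays orthogonal to the compact edges of the Newton polygon. -/
def newtonFanRays (F : R) : Set (ℤ × ℤ) :=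
  {(1, 0), (0, 1)} ∪
    {w | 0 < w.1 ∧ 0 < w.2 ∧ IsCoprime w.1 w.2 ∧ (newtonFace F w).Nontrivial}

/-- The determinant of two weight vectors. -/
def det (w₁ w₂ : ℤ × ℤ) : ℤ := w₁.1 * w₂.2 - w₁.2 * w₂.1

/-- `w₁`, `w₂` are the primitive generators of the edges of a two-dimensional cone of the Newton
fan of `F`, that is, they generate consecutive rays. -/
def IsNewtonCone (F : R) (w₁ w₂ : ℤ × ℤ) : Prop :=
  w₁ ∈ newtonFanRays F ∧ w₂ ∈ newtonFanRays F ∧ 0 < det w₁ w₂ ∧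
    ∀ w ∈ newtonFanRays F, ¬ (0 < det w₁ w ∧ 0 < det w w₂)

/-- `F` is the expansion of `f` as a power series in the local coordinates `a`, `b` at `P`: for every
`n`, the partial sum of terms of exponents smaller than `n` is equal to `f` modulo `𝔪_P ^ n`. -/
def IsExpansion (P : LocalSubring K) (a b f : P.toSubring) (F : R) : Prop :=
  ∀ n : ℕ, ∃ r ∈ maximalIdeal P.toSubring ^ n,
    (f : K) = (∑ i ∈ Finset.range n, ∑ j ∈ Finset.range n,
      algebraMap ℂ K (MvPowerSeries.coeff (Finsupp.single 0 i + Finsupp.single 1 j) F)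
        * (a : K) ^ i * (b : K) ^ j) + (r : K)

/-- `(a, b)` is a local coordinate system at `P` defining the cross formed by the germs of `D` and
`D'`, and `F` is the expansion in these coordinates of a defining function of the germ of `C`. -/
def IsNewtonData (P : LocalSubring K) (D D' C : Set (LocalSubring K))
    (a b : P.toSubring) (F : R) : Prop :=
  idealAt P D = Ideal.span {a} ∧ idealAt P D' = Ideal.span {b} ∧
    maximalIdeal P.toSubring = Ideal.span {a, b} ∧
    ∃ f : P.toSubring, idealAt P C = Ideal.span {f} ∧ IsExpansion P a b f F

/-- The coordinate ring `𝒪_P[σ^∨ ∩ M]` of the toric chart over `P` defined by the cone `σ` generated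
by `w₁`, `w₂`, with respect to the local coordinates `a`, `b`. -/
def chartRing (P : LocalSubring K) (a b : P.toSubring) (w₁ w₂ : ℤ × ℤ) : Subring K :=
  Subring.closure ((P.toSubring : Set K) ∪
    {z | ∃ m : ℤ × ℤ, 0 ≤ w₁.1 * m.1 + w₁.2 * m.2 ∧ 0 ≤ w₂.1 * m.1 + w₂.2 * m.2 ∧
      z = (a : K) ^ m.1 * (b : K) ^ m.2})

/-- The points lying above `P` of the modification of the germ at `P` which is associated with
the Newton fan of `F`, with respect to the local coordinates `a`, `b`. -/
def newtonFiber (P : LocalSubring K) (a b : P.toSubring) (F : R) : Set (LocalSubring K) :=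
  {Q | P ≤ Q ∧ ∃ w₁ w₂, IsNewtonCone F w₁ w₂ ∧ Q ∈ affinePoints (chartRing P a b w₁ w₂)}

/-! ### The algorithm -/

/-- A stage of the algorithm: the current surface, its current boundary, and the set of those
points of the surface at which STEP 1 is going to be executed. -/
structure Stage where
  surface : Set (LocalSubring K)
  boundary : Set (LocalSubring K)
  points : Set (LocalSubring K)

/-- The initial stage, for the smooth branch `L`: the surface `S` with boundary `L`, at `o`. -/
def initialStage (L : Set (LocalSubring K)) : Stage := ⟨S, L, {origin}⟩

/-- The points at which STEP 1 does not stop: at `P`, the germ of the boundary (a smooth branch)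
and the germ of the strict transform of `C` do not form a cross. -/
def Stage.continuing (C : Set (LocalSubring K)) (s : Stage) : Set (LocalSubring K) :=
  {P | P ∈ s.points ∧ ¬ IsCross P s.boundary C}

/-- The surface obtained by performing simultaneously the Newton modifications at all the points
where STEP 1 does not stop. -/
def Stage.nextSurface (C : Set (LocalSubring K)) (s : Stage) (a b : ∀ P : LocalSubring K, P.toSubring)
    (F : LocalSubring K → R) : Set (LocalSubring K) :=
  (s.surface \ s.continuing C) ∪ ⋃ P ∈ s.continuing C, newtonFiber P (a P) (b P) (F P)

/-- The stage reached after executing one iteration at each one of the current points.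
The new boundary is the total transform of the old one together with the second branches `B P` of
all the crosses. The new points are the closed points above the points `P` treated by a
Newton modification, through which passes the strict transform of a branch of `C` (other than
the branch `B P`, which is already part of the boundary, if `B P` was chosen inside `C`). -/
def Stage.next (C : Set (LocalSubring K)) (s : Stage) (B : LocalSubring K → LocalSubring K)
    (a b : ∀ P : LocalSubring K, P.toSubring) (F : LocalSubring K → R) : Stage where
  surface := s.nextSurface C a b F
  boundary := totalTransform (s.nextSurface C a b F) s.surface (s.boundary ∪ B '' s.points)
  points := {Q | IsClosedPoint (s.nextSurface C a b F) Q ∧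
    ∃ P ∈ s.continuing C, P ≤ Q ∧ ∃ V ∈ C, V ≠ B P ∧ Q.toSubring ≤ V.toSubring}

/-- One iteration of the algorithm at each one of the current points. At each of them, the germ of
the boundary is completed by a smooth branch `B P` into a cross: if STEP 1 stops at `P`, then `B P` is
the branch of `C` at `P`; otherwise `B P` is any smooth branch making a cross, as chosen in
STEP 2, and the Newton modification of STEP 3 is performed at `P`. -/
def IsStep (C : Set (LocalSubring K)) (B : LocalSubring K → LocalSubring K) (s s' : Stage) : Prop :=
  (∀ P ∈ s.points, IsCross P s.boundary {B P} ∧ (IsCross P s.boundary C → B P ∈ C)) ∧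
  ∃ (a b : ∀ P : LocalSubring K, P.toSubring) (F : LocalSubring K → R),
    (∀ P ∈ s.continuing C, IsNewtonData P s.boundary {B P} C (a P) (b P) (F P)) ∧
    s' = s.next C B a b F

/-- An execution of the algorithm for the curve `C` and the smooth branch `L`, with
the choices of branches `B 0`, `B 1`, … at the successive stages. The algorithm has stopped at
stage `k` when `(s k).points` is empty; the following stages are then all equal to that one. -/
structure IsExecution (C L : Set (LocalSubring K)) (B : ℕ → LocalSubring K → LocalSubring K)
    (s : ℕ → Stage) : Prop where
  init : s 0 = initialStage L
  step : ∀ k, IsStep C (B k) (s k) (s (k + 1))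

/-- The stages which can be reached by executing finitely many steps of the algorithm. -/
def IsReachable (C L : Set (LocalSubring K)) (s : Stage) : Prop :=
  Relation.ReflTransGen (fun s s' => ∃ B, IsStep C B s s') (initialStage L) s

/-- The branches of `C` which were chosen at some execution of STEP 2, in order to complete a
cross. -/
def chosenBranches (C : Set (LocalSubring K)) (B : ℕ → LocalSubring K → LocalSubring K)
    (s : ℕ → Stage) : Set (LocalSubring K) :=
  {V | V ∈ C ∧ ∃ k, ∃ P ∈ (s k).continuing C, V = B k P}

/-! ### Toroidal surfaces -/

/-- For a cone `σ` of `ℤ²` generated by `w₁`, `w₂`, the monoid `σ^∨ ∩ M`, embedded in `ℕ²` by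
`m ↦ (w₁ ⬝ m, w₂ ⬝ m)`. -/
def toricMonoid (w₁ w₂ : ℤ × ℤ) : AddSubmonoid (Fin 2 →₀ ℕ) where
  carrier := {e | ∃ m : ℤ × ℤ,
    (e 0 : ℤ) = w₁.1 * m.1 + w₁.2 * m.2 ∧ (e 1 : ℤ) = w₂.1 * m.1 + w₂.2 * m.2}
  zero_mem' := ⟨0, by simp⟩
  add_mem' := by
    rintro e e' ⟨m, h0, h1⟩ ⟨m', h0', h1'⟩
    refine ⟨m + m', ?_, ?_⟩
    · simp only [Finsupp.add_apply, Nat.cast_add, h0, h0', Prod.fst_add, Prod.snd_add]; ring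
    · simp only [Finsupp.add_apply, Nat.cast_add, h1, h1', Prod.fst_add, Prod.snd_add]; ring

/-- The completed local ring `ℂ⟦σ^∨ ∩ M⟧` of the affine toric surface `X_σ` at its fixed point, as a
ring of power series in two variables with restricted support. -/
def toricRing (w₁ w₂ : ℤ × ℤ) : Subring R where
  carrier := {g | ∀ e, MvPowerSeries.coeff e g ≠ 0 → e ∈ toricMonoid w₁ w₂}
  zero_mem' := by intro e he; simp at he
  one_mem' := by
    intro e he
    classical
    rw [MvPowerSeries.coeff_one] at he
    have : e = 0 := by by_contra h; simp [h] at he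
    rw [this]; exact zero_mem _
  add_mem' := by
    intro g g' hg hg' e he
    rw [map_add] at he
    by_cases h : MvPowerSeries.coeff e g = 0
    · exact hg' e (by intro h'; simp [h, h'] at he)
    · exact hg e h
  neg_mem' := by
    intro g hg e he
    exact hg e (by simpa using he)
  mul_mem' := by
    intro g g' hg hg' e he
    classical
    rw [MvPowerSeries.coeff_mul] at he
    obtain ⟨p, hp, hne⟩ := Finset.exists_ne_zero_of_sum_ne_zero he
    rw [← Finset.HasAntidiagonal.mem_antidiagonal.mp hp]
    exact add_mem (hg _ (left_ne_zero_of_mul hne)) (hg' _ (right_ne_zero_of_mul hne))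

/-- The maximal ideal of `toricRing w₁ w₂`: the series without constant term. -/
def toricMaximalIdeal (w₁ w₂ : ℤ × ℤ) : Ideal (toricRing w₁ w₂) :=
  RingHom.ker ((MvPowerSeries.constantCoeff (σ := Fin 2) (R := ℂ)).comp (toricRing w₁ w₂).subtype)

/-- The ideal of the union of those edges (orbit closures) of `X_σ` which are indexed by `J`. -/
def toricBoundaryIdeal (w₁ w₂ : ℤ × ℤ) (J : Set (Fin 2)) : Ideal (toricRing w₁ w₂) :=
  (⨅ j ∈ J, Ideal.span {(MvPowerSeries.X j : R)}).comap (toricRing w₁ w₂).subtype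

/-- The pair `(X, D)` has a toric chart centered at the closed point `P` of `X`: the completion
of the local ring of `P`, with the ideal of the germ of `D`, is isomorphic over `ℂ` to the completed
local ring of an affine toric surface at one of its points, with the ideal of the toric boundary.
The germs of pairs occurring there are that of `X_σ` at its fixed point, for `σ` of dimension two,
with both edges as boundary, and, along the orbits of dimension one or two, that of a smooth
surface with boundary one smooth branch or the empty set. The isomorphism of completions is given by
a homomorphism `φ` inducing isomorphisms modulo all powers of the maximal ideals. -/
def HasToricChart (P : LocalSubring K) (D : Set (LocalSubring K)) : Prop :=
  ∃ (w₁ w₂ : ℤ × ℤ) (J : Set (Fin 2)) (φ : P.toSubring →+* toricRing w₁ w₂),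
    IsCoprime w₁.1 w₁.2 ∧ IsCoprime w₂.1 w₂.2 ∧ det w₁ w₂ ≠ 0 ∧
    (J = Set.univ ∨ (det w₁ w₂).natAbs = 1) ∧
    (∀ (c : ℂ) (x : P.toSubring), (x : K) = algebraMap ℂ K c → (φ x : R) = MvPowerSeries.C c) ∧
    (∀ (n : ℕ) (x : P.toSubring),
      φ x ∈ toricMaximalIdeal w₁ w₂ ^ n ↔ x ∈ maximalIdeal P.toSubring ^ n) ∧
    (∀ (n : ℕ) (y : toricRing w₁ w₂), ∃ x, y - φ x ∈ toricMaximalIdeal w₁ w₂ ^ n) ∧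
    (idealAt P D).map φ = toricBoundaryIdeal w₁ w₂ J

/-- `(X, D)` is a toroidal surface: `X` is normal, `D` is a reduced divisor on it, and there are
toric charts centered at all the closed points. -/
structure IsToroidal (X D : Set (LocalSubring K)) : Prop where
  normal : ∀ P ∈ X, IsIntegrallyClosed P.toSubring
  finite : D.Finite
  divisor : ∀ V ∈ D, IsPrimeDivisor X V
  chart : ∀ P, IsClosedPoint X P → HasToricChart P D

/-- `(X, D) → (S, L + L')` is a modification in the toroidal category, where `(L, L')` is a cross on
`(S, o)`. -/
structure IsToroidalModification (X D L L' : Set (LocalSubring K)) : Prop where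
  cross : IsCross origin L L'
  modification : IsModification X
  toroidal_source : IsToroidal X D
  toroidal_target : IsToroidal S (L ∪ L')
  boundary : preimage X S (support S (L ∪ L')) ⊆ support X D

/-- The boundary `D` of `X` contains the reduction of the total transform of `C`. -/
def BoundaryContainsTotalTransform (X D C : Set (LocalSubring K)) : Prop :=
  preimage X S (support S C) ⊆ support X D

/-- The strict transform on `X` of the curve `C` of `S` does not contain singular points of `X`. -/
def StrictTransformAvoidsSing (X C : Set (LocalSubring K)) : Prop :=
  ∀ P ∈ support X C, IsRegularLocalRing P.toSubring

/-- `(X, D) → (S, L + L')` is a toroidal pseudo-resolution of `C`. -/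
structure IsToroidalPseudoResolution (X D L L' C : Set (LocalSubring K)) : Prop where
  toroidal : IsToroidalModification X D L L'
  total : BoundaryContainsTotalTransform X D C
  strict : StrictTransformAvoidsSing X C

end ToroidalRes

end

/-!
A point of a surface over `S` is its local ring in `K`, so that all geometric statements become statements on local subrings
of one field; `mI` is the maximal ideal of such a subring, `IsLocAt` is localization, and `RegPair`, `SmoothAt` are local
coordinates.

**One step.** Let `P` be a current point, with coordinates `a` (the boundary) and `b` (the chosen branch), and let `f` be
an equation of the strict transform of the curve. By `newtonFiber_cases` a point of the Newton modification above `P` is of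
one of three kinds. It is the fixed point of a chart; then the expansion in the toric coordinates identifies its completion
with the completion of a toric surface (`SmoothAt.toricAt`), which gives normality and the toric chart. Or it is the generic
point of the exceptional component defined by a ray `w`. Or it is a closed point in the interior of this component; then it is
smooth, with coordinates `u` (a monomial of weight one, which defines the boundary) and `z - c` (where `z` is the monomial
which generates the invertible ones, and `c ≠ 0`), see `EdgeBasis.smoothAt`. At a fixed point, the two edges of the cone are
minimal at a common vertex of the Newton polygon, therefore `f` is the product of a monomial and of a unit
(`SmoothAt.eq_chi_mul_unit`): no branch of the curve other than the chosen one passes there. Hence all the new current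
points are smooth, and the boundary is there a smooth branch. This is the invariant `Inv`, preserved by
`StepData.inv_next`. Properness (`isModification_newton`) comes from the comparison of the slopes of the cones with the
values of `a` and `b`. There are finitely many current points because a branch passes through at most one closed point of
a modification: by Weierstrass preparation, it has only one place (`valuation_unique`).

**Termination.** The intersection number `k` of the boundary with the strict transform of the curve does not increase, and if
it is unchanged, then `w = (1, w₂)` and `f = u ^ (k * w₂) * f'`, with `f'` an equation of the strict transform
(`EdgeBasis.exists_strict`). That `k` cannot be stationary forever is where it matters that `Z(l)` is not a branch of the
reduced curve `Z(f₀)`. The level sets of `l` are the integral curves of a derivation `D` whose only invariant branch is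
`Z(l)` (`exists_tangent`), so the curve is not tangent to them away from `l = 0`: a power `l ^ N` belongs to the ideal
generated by `f₀` and `D f₀` (`exists_pow_mem`). Let `h`, `M`, `j` be the order of `f₀`, the order of the poles of `D`, and
the order of `l`, along the boundary at a current point. As `D` is logarithmic along the boundary, `h ≤ N * j + M`
(`Compares.le`). When `k` is stationary, `j` is unchanged, `M` increases by `w₂`, and `h` by `k * w₂ ≥ 2 * w₂`, since the
boundary and the curve do not form a cross. So the gap `N * j + M - h` decreases, and the pair formed by `k` and this gap
decreases for the lexicographic order (`StepData.exists_measure_lt`).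

**The final stage.** A branch of the curve which is not in the boundary passes through a current point; when there are none
left, the curve is in the boundary. A point which is not regular is a fixed point of a chart, and only chosen branches pass there.
-/

open IsLocalRing
noncomputable section
namespace ToroidalRes
open Ideal (span mem_span_singleton mem_span_singleton_self)
open LocalSubring (ofPrime le_ofPrime)
open MvPowerSeries (coeff monomial constantCoeff)

/-! ### Local subrings of a field -/

section LocalSubrings
variable {F : Type*} [Field F]

/-- The maximal ideal of a local subring of a field, as a set of elements of the field. -/
def mI (P : LocalSubring F) : Set F := {x | ∃ h : x ∈ P.toSubring, (⟨x, h⟩ : P.toSubring) ∈ maximalIdeal P.toSubring}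

lemma coe_mem_mI {P : LocalSubring F} {x : P.toSubring} : (x : F) ∈ mI P ↔ x ∈ maximalIdeal P.toSubring :=
  ⟨fun h => h.2, fun h => ⟨x.2, h⟩⟩

lemma mk_mem_maximalIdeal {P : LocalSubring F} {x : F} (h : x ∈ P.toSubring) :
    (⟨x, h⟩ : P.toSubring) ∈ maximalIdeal P.toSubring ↔ x ∈ mI P := ⟨fun k => ⟨h, k⟩, fun k => k.2⟩

lemma isUnit_iff_inv_mem {A : Subring F} {x : A} : IsUnit x ↔ (x : F) ≠ 0 ∧ (x : F)⁻¹ ∈ A := by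
  constructor
  · intro h
    obtain ⟨y, hy⟩ := isUnit_iff_exists_inv.mp h
    have hy' : (x : F) * y = 1 := by exact_mod_cast congrArg Subtype.val hy
    have h0 : (x : F) ≠ 0 := left_ne_zero_of_mul_eq_one hy'
    exact ⟨h0, by rw [inv_eq_of_mul_eq_one_right hy']; exact y.2⟩
  · rintro ⟨h0, h⟩
    exact isUnit_iff_exists_inv.mpr ⟨⟨_, h⟩, Subtype.ext (mul_inv_cancel₀ h0)⟩

lemma mem_mI_iff {P : LocalSubring F} {x : F} :
    x ∈ mI P ↔ x ∈ P.toSubring ∧ (x = 0 ∨ x⁻¹ ∉ P.toSubring) := by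
  constructor
  · rintro ⟨h, hx⟩
    refine ⟨h, ?_⟩
    rw [mem_maximalIdeal, mem_nonunits_iff, isUnit_iff_inv_mem] at hx
    by_contra hc
    push Not at hc
    exact hx hc
  · rintro ⟨h, hx⟩
    refine ⟨h, ?_⟩
    rw [mem_maximalIdeal, mem_nonunits_iff, isUnit_iff_inv_mem]
    rintro ⟨h0, hi⟩
    rcases hx with hx | hx
    · exact h0 hx
    · exact hx hi

lemma zero_mem_mI (P : LocalSubring F) : (0 : F) ∈ mI P := mem_mI_iff.2 ⟨zero_mem _, Or.inl rfl⟩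

lemma one_notMem_mI (P : LocalSubring F) : (1 : F) ∉ mI P := by
  intro h
  rcases (mem_mI_iff.1 h).2 with h | h
  · exact one_ne_zero h
  · exact h (by simp [one_mem])

lemma add_mem_mI {P : LocalSubring F} {x y : F} (hx : x ∈ mI P) (hy : y ∈ mI P) : x + y ∈ mI P :=
  ⟨add_mem hx.1 hy.1, add_mem hx.2 hy.2⟩

lemma neg_mem_mI {P : LocalSubring F} {x : F} (hx : x ∈ mI P) : -x ∈ mI P :=
  ⟨neg_mem hx.1, neg_mem hx.2⟩

lemma sub_mem_mI {P : LocalSubring F} {x y : F} (hx : x ∈ mI P) (hy : y ∈ mI P) : x - y ∈ mI P :=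
  ⟨sub_mem hx.1 hy.1, sub_mem hx.2 hy.2⟩

lemma mul_mem_mI {P : LocalSubring F} {x y : F} (hx : x ∈ P.toSubring) (hy : y ∈ mI P) : x * y ∈ mI P :=
  ⟨mul_mem hx hy.1, Ideal.mul_mem_left _ ⟨x, hx⟩ hy.2⟩

lemma mul_mem_mI' {P : LocalSubring F} {x y : F} (hx : x ∈ mI P) (hy : y ∈ P.toSubring) : x * y ∈ mI P := by
  rw [mul_comm]; exact mul_mem_mI hy hx

lemma mI_mul_iff {P : LocalSubring F} {x y : F} (hx : x ∈ P.toSubring) (hy : y ∈ P.toSubring) :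
    x * y ∈ mI P ↔ x ∈ mI P ∨ y ∈ mI P := by
  constructor
  · rintro ⟨h1, h2⟩
    have : (⟨x * y, h1⟩ : P.toSubring) = ⟨x, hx⟩ * ⟨y, hy⟩ := rfl
    rw [this] at h2
    rcases (Ideal.IsPrime.mem_or_mem (maximalIdeal.isMaximal P.toSubring).isPrime h2) with h | h
    · exact Or.inl ⟨hx, h⟩
    · exact Or.inr ⟨hy, h⟩
  · rintro (h | h)
    · exact mul_mem_mI' h hy
    · exact mul_mem_mI hx h

lemma mI_pow_iff {P : LocalSubring F} {x : F} (hx : x ∈ P.toSubring) {n : ℕ} (hn : n ≠ 0) :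
    x ^ n ∈ mI P ↔ x ∈ mI P := by
  constructor
  · induction n with
    | zero => exact absurd rfl hn
    | succ n ih =>
      intro h
      rw [pow_succ, mI_mul_iff (pow_mem hx n) hx] at h
      rcases h with h | h
      · by_cases h0 : n = 0
        · subst h0; exact absurd (by simpa using h) (one_notMem_mI P)
        · exact ih h0 h
      · exact h
  · intro h
    obtain ⟨m, rfl⟩ := Nat.exists_eq_succ_of_ne_zero hn
    rw [pow_succ]; exact mul_mem_mI (pow_mem hx m) h

lemma unit_of_notMem_mI {P : LocalSubring F} {x : F} (hx : x ∈ P.toSubring) (h : x ∉ mI P) :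
    x ≠ 0 ∧ x⁻¹ ∈ P.toSubring := by
  rw [mem_mI_iff] at h
  push Not at h
  exact h hx

lemma notMem_mI_of_inv {P : LocalSubring F} {x : F} (h0 : x ≠ 0) (hi : x⁻¹ ∈ P.toSubring) : x ∉ mI P := by
  intro h
  rcases (mem_mI_iff.1 h).2 with h | h
  · exact h0 h
  · exact h hi

lemma inv_notMem_mI {P : LocalSubring F} {x : F} (h0 : x ≠ 0) (hx : x ∈ P.toSubring) : x⁻¹ ∉ mI P :=
  notMem_mI_of_inv (inv_ne_zero h0) (by simpa using hx)

lemma le_iff_mI {P Q : LocalSubring F} :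
    P ≤ Q ↔ P.toSubring ≤ Q.toSubring ∧ ∀ x ∈ mI P, x ∈ mI Q := by
  rw [LocalSubring.le_def]
  constructor
  · rintro ⟨h, hl⟩
    refine ⟨h, fun x hx => ⟨h hx.1, ?_⟩⟩
    have := hx.2
    rw [mem_maximalIdeal, mem_nonunits_iff] at this ⊢
    intro hu
    exact this (hl.1 _ hu)
  · rintro ⟨h, hm⟩
    refine ⟨h, ⟨fun x hu => ?_⟩⟩
    by_contra hx
    have := hm x (coe_mem_mI.2 ((mem_maximalIdeal _).2 hx))
    exact this.2 hu

lemma mem_mI_of_le {P Q : LocalSubring F} (h : P ≤ Q) {x : F} (hx : x ∈ P.toSubring) :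
    x ∈ mI Q ↔ x ∈ mI P := by
  refine ⟨fun hq => ?_, (le_iff_mI.1 h).2 x⟩
  by_contra hc
  obtain ⟨h0, hi⟩ := unit_of_notMem_mI hx hc
  exact notMem_mI_of_inv h0 ((le_iff_mI.1 h).1 hi) hq

lemma mI_le_of_le {V W : LocalSubring F} (h : W.toSubring ≤ V.toSubring) {x : F} (hx : x ∈ W.toSubring) (hV : x ∈ mI V) :
    x ∈ mI W := by
  by_contra hc
  obtain ⟨h0, hi⟩ := unit_of_notMem_mI hx hc
  exact notMem_mI_of_inv h0 (h hi) hV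

/-- `Q` is a localization of the subring `A` at a prime ideal, in terms of elements. -/
def IsLocAt (A : Subring F) (Q : LocalSubring F) : Prop :=
  A ≤ Q.toSubring ∧ ∀ x ∈ Q.toSubring, ∃ s ∈ A, ∃ t ∈ A, t ≠ 0 ∧ t⁻¹ ∈ Q.toSubring ∧ x = s * t⁻¹

lemma mem_ofPrime {A : Subring F} {p : Ideal A} [p.IsPrime] {x : F} :
    x ∈ (LocalSubring.ofPrime A p).toSubring ↔
      ∃ s t : A, t ∉ p ∧ x = s * (t : F)⁻¹ := by
  constructor
  · intro h
    obtain ⟨⟨s, t⟩, hst⟩ := IsLocalization.surj p.primeCompl (⟨x, h⟩ : (LocalSubring.ofPrime A p).toSubring)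
    refine ⟨s, t, t.2, ?_⟩
    have h1 : x * (t : A) = (s : F) := congrArg Subtype.val hst
    have h0 : ((t : A) : F) ≠ 0 := by
      intro h0
      have : (t : A) = 0 := Subtype.ext h0
      exact t.2 (this ▸ p.zero_mem)
    rw [← h1, mul_inv_cancel_right₀ h0]
  · rintro ⟨s, t, ht, rfl⟩
    refine mul_mem (LocalSubring.le_ofPrime A p s.2) ?_
    have hu := IsLocalization.map_units (LocalSubring.ofPrime A p).toSubring (⟨t, ht⟩ : p.primeCompl)
    exact (isUnit_iff_inv_mem.1 hu).2

lemma mem_mI_ofPrime {A : Subring F} {p : Ideal A} [p.IsPrime] {x : F} (hx : x ∈ A) :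
    x ∈ mI (LocalSubring.ofPrime A p) ↔ (⟨x, hx⟩ : A) ∈ p := by
  have := IsLocalization.AtPrime.to_map_mem_maximal_iff (LocalSubring.ofPrime A p).toSubring p ⟨x, hx⟩
  rw [← this]
  constructor
  · rintro ⟨h, h'⟩; exact h'
  · intro h; exact ⟨LocalSubring.le_ofPrime A p hx, h⟩

lemma isLocAt_ofPrime (A : Subring F) (p : Ideal A) [p.IsPrime] : IsLocAt A (LocalSubring.ofPrime A p) := by
  refine ⟨LocalSubring.le_ofPrime A p, fun x hx => ?_⟩
  obtain ⟨s, t, ht, rfl⟩ := mem_ofPrime.1 hx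
  have h0 : (t : F) ≠ 0 := by
    intro h0
    exact ht ((Subtype.ext h0 : t = 0) ▸ p.zero_mem)
  exact ⟨s, s.2, t, t.2, h0, mem_ofPrime.2 ⟨1, t, ht, by simp⟩, rfl⟩

/-- The contraction to a subring of the maximal ideal of a local ring containing it. -/
def contr {A : Subring F} {Q : LocalSubring F} (h : A ≤ Q.toSubring) : Ideal A :=
  (maximalIdeal Q.toSubring).comap (Subring.inclusion h)

instance {A : Subring F} {Q : LocalSubring F} (h : A ≤ Q.toSubring) : (contr h).IsPrime := by
  unfold contr; infer_instance

lemma mem_contr {A : Subring F} {Q : LocalSubring F} (h : A ≤ Q.toSubring) {x : A} :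
    x ∈ contr h ↔ (x : F) ∈ mI Q := by
  unfold contr
  rw [Ideal.mem_comap]
  exact ⟨fun k => ⟨h x.2, k⟩, fun k => k.2⟩

lemma ofPrime_contr_le {A : Subring F} {Q : LocalSubring F} (h : A ≤ Q.toSubring) :
    LocalSubring.ofPrime A (contr h) ≤ Q := by
  rw [le_iff_mI]
  have h1 : ∀ t : A, t ∉ contr h → (t : F)⁻¹ ∈ Q.toSubring := by
    intro t ht
    rw [mem_contr] at ht
    exact (unit_of_notMem_mI (h t.2) ht).2
  constructor
  · intro x hx
    obtain ⟨s, t, ht, rfl⟩ := mem_ofPrime.1 hx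
    exact mul_mem (h s.2) (h1 t ht)
  · intro x hx
    obtain ⟨s, t, ht, rfl⟩ := mem_ofPrime.1 hx.1
    refine mul_mem_mI' ?_ (h1 t ht)
    have h0 : (t : F) ≠ 0 := by
      intro h0
      exact ht ((Subtype.ext h0 : t = 0) ▸ (contr h).zero_mem)
    have : (s : F) ∈ mI (LocalSubring.ofPrime A (contr h)) := by
      have := mul_mem_mI' hx (LocalSubring.le_ofPrime A (contr h) t.2)
      rwa [inv_mul_cancel_right₀ h0] at this
    rw [mem_mI_ofPrime s.2] at this
    exact (mem_contr h).1 this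

lemma isLocAt_iff {A : Subring F} {Q : LocalSubring F} :
    IsLocAt A Q ↔ ∃ (p : Ideal A) (_ : p.IsPrime), Q = LocalSubring.ofPrime A p := by
  constructor
  · rintro ⟨h, hl⟩
    refine ⟨contr h, inferInstance, (LocalSubring.toSubring_injective ?_)⟩
    refine le_antisymm (fun x hx => ?_) (le_iff_mI.1 (ofPrime_contr_le h)).1
    obtain ⟨s, hs, t, ht, h0, hti, rfl⟩ := hl x hx
    refine mem_ofPrime.2 ⟨⟨s, hs⟩, ⟨t, ht⟩, ?_, rfl⟩
    rw [mem_contr]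
    exact notMem_mI_of_inv h0 hti
  · rintro ⟨p, hp, rfl⟩
    exact isLocAt_ofPrime A p

lemma IsLocAt.eq_ofPrime {A : Subring F} {Q : LocalSubring F} (h : IsLocAt A Q) :
    Q = LocalSubring.ofPrime A (contr h.1) := by
  refine (LocalSubring.toSubring_injective ?_)
  refine le_antisymm (fun x hx => ?_) (le_iff_mI.1 (ofPrime_contr_le h.1)).1
  obtain ⟨s, hs, t, ht, h0, hti, rfl⟩ := h.2 x hx
  refine mem_ofPrime.2 ⟨⟨s, hs⟩, ⟨t, ht⟩, ?_, rfl⟩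
  rw [mem_contr]
  exact notMem_mI_of_inv h0 hti

/-- Localizing is transitive. -/
lemma IsLocAt.trans {A : Subring F} {Q T : LocalSubring F} (hQ : IsLocAt A Q)
    (hT : IsLocAt Q.toSubring T) : IsLocAt A T := by
  refine ⟨hQ.1.trans hT.1, fun x hx => ?_⟩
  obtain ⟨s, hs, t, ht, h0, hti, rfl⟩ := hT.2 x hx
  obtain ⟨s1, hs1, s2, hs2, hs0, hsi, rfl⟩ := hQ.2 s hs
  obtain ⟨t1, ht1, t2, ht2, ht0, hti', rfl⟩ := hQ.2 t ht
  have h1 : t1 ≠ 0 := left_ne_zero_of_mul h0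
  refine ⟨s1 * t2, mul_mem hs1 ht2, s2 * t1, mul_mem hs2 ht1, mul_ne_zero hs0 h1, ?_, ?_⟩
  · have : (s2 * t1)⁻¹ = s2⁻¹ * ((t1 * t2⁻¹)⁻¹ * t2⁻¹) := by field_simp
    rw [this]
    exact mul_mem (hT.1 hsi) (mul_mem hti (hT.1 hti'))
  · field_simp

/-- Two localizations of the same subring, at the same prime, are equal. -/
lemma IsLocAt.ext {A : Subring F} {Q T : LocalSubring F} (hQ : IsLocAt A Q) (hT : IsLocAt A T)
    (h : ∀ x ∈ A, x ∈ mI Q ↔ x ∈ mI T) : Q = T := by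
  rw [hQ.eq_ofPrime, hT.eq_ofPrime]
  congr 1
  ext x
  rw [mem_contr, mem_contr, h x x.2]

lemma IsLocAt.mono {A B : Subring F} {Q : LocalSubring F} (hQ : IsLocAt A Q) (h : A ≤ B) (hB : B ≤ Q.toSubring) :
    IsLocAt B Q := by
  refine ⟨hB, fun x hx => ?_⟩
  obtain ⟨s, hs, t, ht, h0, hti, rfl⟩ := hQ.2 x hx
  exact ⟨s, h hs, t, h ht, h0, hti, rfl⟩

lemma IsLocAt.eq_of_le {A : Subring F} {Q T W : LocalSubring F} (hQ : IsLocAt A Q) (hT : IsLocAt A T)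
    (hQW : Q ≤ W) (hTW : T ≤ W) : Q = T :=
  hQ.ext hT fun _ hx => by rw [← mem_mI_of_le hQW (hQ.1 hx), ← mem_mI_of_le hTW (hT.1 hx)]

lemma mem_mI_span {P : LocalSubring F} {a b : P.toSubring} (h : maximalIdeal P.toSubring = Ideal.span {a, b})
    {x : F} : x ∈ mI P ↔ ∃ r ∈ P.toSubring, ∃ s ∈ P.toSubring, x = r * a + s * b := by
  constructor
  · rintro ⟨hx, hm⟩
    rw [h, Ideal.mem_span_pair] at hm
    obtain ⟨r, s, hrs⟩ := hm
    exact ⟨r, r.2, s, s.2, (congrArg Subtype.val hrs).symm⟩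
  · rintro ⟨r, hr, s, hs, rfl⟩
    refine add_mem_mI (mul_mem_mI hr ?_) (mul_mem_mI hs ?_) <;> rw [coe_mem_mI, h] <;>
      exact Ideal.subset_span (by simp)

lemma isNoetherianRing_of_isLocAt {A : Subring F} {Q : LocalSubring F} (hQ : IsLocAt A Q) [IsNoetherianRing A] :
    IsNoetherianRing Q.toSubring := by
  rw [hQ.eq_ofPrime]
  exact IsLocalization.isNoetherianRing (contr hQ.1).primeCompl _ inferInstance

lemma isIntegrallyClosed_of_isLocAt {A : Subring F} {Q : LocalSubring F} (hQ : IsLocAt A Q) [IsIntegrallyClosed A] :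
    IsIntegrallyClosed Q.toSubring := by
  rw [hQ.eq_ofPrime]
  exact isIntegrallyClosed_of_isLocalization _ (contr hQ.1).primeCompl (Ideal.primeCompl_le_nonZeroDivisors _)

lemma isLocAt_self (Q : LocalSubring F) : IsLocAt Q.toSubring Q :=
  ⟨le_rfl, fun x hx => ⟨x, hx, 1, one_mem _, one_ne_zero, by simp [one_mem], by simp⟩⟩

/-- A discrete valuation ring of fractions field `F` is a valuation ring of `F`. -/
lemma mem_or_inv_mem_of_dvr {V : LocalSubring F} [IsDiscreteValuationRing V.toSubring]
    (hV : ∀ x : F, ∃ s ∈ V.toSubring, ∃ t ∈ V.toSubring, x = s * t⁻¹) (x : F) : x ∈ V.toSubring ∨ x⁻¹ ∈ V.toSubring := by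
  obtain ⟨s, hs, t, ht, rfl⟩ := hV x
  rcases ValuationRing.dvd_total (⟨s, hs⟩ : V.toSubring) ⟨t, ht⟩ with ⟨c, hc⟩ | ⟨c, hc⟩
  · have h : t = s * c := congrArg Subtype.val hc
    right
    by_cases h0 : s = 0
    · subst h0; simp [zero_mem]
    · have : (s * t⁻¹)⁻¹ = c := by rw [h]; by_cases hc0 : (c : F) = 0 <;> [simp [hc0]; field_simp]
      rw [this]; exact c.2
  · have h : s = t * c := congrArg Subtype.val hc
    left
    by_cases h0 : t = 0
    · subst h0; simp [zero_mem]
    · have : s * t⁻¹ = c := by rw [h]; field_simp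
      rw [this]; exact c.2

end LocalSubrings

/-! ### Valuation rings -/

lemma mem_affinePoints {A : Subring K} {Q : LocalSubring K} : Q ∈ affinePoints A ↔ IsLocAt A Q :=
  isLocAt_iff.symm

section Valuations
variable {F : Type*} [Field F]

lemma mem_mI_toLocalSubring {W : ValuationSubring F} {x : F} :
    x ∈ mI W.toLocalSubring ↔ x ∈ W.nonunits := by
  rw [mem_mI_iff, ← W.inv_mem_nonunits_iff.symm.trans (by rw [inv_inv] : _ ↔ x ∈ W.nonunits)]
  constructor
  · rintro ⟨h, rfl | h'⟩
    · exact Or.inl (by simp)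
    · exact Or.inr h'
  · rintro (h | h)
    · exact ⟨by rw [inv_eq_zero.1 h]; exact zero_mem _, Or.inl (inv_eq_zero.1 h)⟩
    · exact ⟨(W.mem_or_inv_mem x).resolve_right h, Or.inr h⟩

/-- Composition of valuations: a proper ideal `I` of a subring `A` of a valuation ring `V`, such that
`I` contains the maximal ideal of `V`, is contained in the maximal ideal of a valuation ring
between `A` and `V`. -/
lemma exists_valuationSubring_le {V : LocalSubring F} (hV : ∀ x : F, x ∈ V.toSubring ∨ x⁻¹ ∈ V.toSubring)
    {A : Subring F} (I : Ideal A) (hI : I ≠ ⊤)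
    (hVI : ∀ x ∈ mI V, ∃ h : x ∈ A, (⟨x, h⟩ : A) ∈ I) :
    ∃ W : ValuationSubring F, A ≤ W.toSubring ∧ (∀ x : A, x ∈ I → (x : F) ∈ mI W.toLocalSubring) ∧
      W.toSubring ≤ V.toSubring := by
  obtain ⟨W, hW, hWI⟩ := Ideal.image_subset_nonunits_valuationSubring I hI
  have h2 : ∀ x : A, x ∈ I → (x : F) ∈ mI W.toLocalSubring := fun x hx =>
    mem_mI_toLocalSubring.2 (hWI ⟨x, hx, rfl⟩)
  refine ⟨W, hW, h2, fun x hx => ?_⟩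
  by_contra hc
  have h3 := (hV x).resolve_left hc
  have hx0 : x ≠ 0 := by rintro rfl; exact hc (zero_mem _)
  have h4 : x⁻¹ ∈ mI V := mem_mI_iff.2 ⟨h3, Or.inr (by simpa using hc)⟩
  obtain ⟨h5, h6⟩ := hVI _ h4
  exact inv_notMem_mI hx0 (show x ∈ W.toLocalSubring.toSubring from hx) (h2 _ h6)

/-- The elements of a local ring `V` which are congruent modulo its maximal ideal to an element
of the subring `A`. -/
def addMax (A : Subring F) (V : LocalSubring F) (h : A ≤ V.toSubring) : Subring F where
  carrier := {x | ∃ q ∈ A, x - q ∈ mI V}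
  zero_mem' := ⟨0, zero_mem _, by simpa using zero_mem_mI V⟩
  one_mem' := ⟨1, one_mem _, by simpa using zero_mem_mI V⟩
  add_mem' := by
    rintro x y ⟨q, hq, hx⟩ ⟨r, hr, hy⟩
    exact ⟨q + r, add_mem hq hr, by simpa [add_sub_add_comm] using add_mem_mI hx hy⟩
  neg_mem' := by
    rintro x ⟨q, hq, hx⟩
    exact ⟨-q, neg_mem hq, by simpa [sub_eq_add_neg, add_comm] using neg_mem_mI hx⟩
  mul_mem' := by
    rintro x y ⟨q, hq, hx⟩ ⟨r, hr, hy⟩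
    refine ⟨q * r, mul_mem hq hr, ?_⟩
    have hyV : y ∈ V.toSubring := by simpa using add_mem hy.1 (h hr)
    have : x * y - q * r = (x - q) * y + q * (y - r) := by ring
    rw [this]
    exact add_mem_mI (mul_mem_mI' hx hyV) (mul_mem_mI (h hq) hy)

/-- Every local ring contained in a valuation ring `V` is dominated by a valuation ring
contained in `V`. -/
lemma exists_dominating_le {V Q : LocalSubring F} (hV : ∀ x : F, x ∈ V.toSubring ∨ x⁻¹ ∈ V.toSubring)
    (h : Q.toSubring ≤ V.toSubring) :
    ∃ W : ValuationSubring F, Q ≤ W.toLocalSubring ∧ W.toSubring ≤ V.toSubring := by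
  let A := addMax Q.toSubring V h
  have hQA : Q.toSubring ≤ A := fun x hx => ⟨x, hx, by simpa using zero_mem_mI V⟩
  let I : Ideal A :=
    { carrier := {x | ∃ q ∈ mI Q, (x : F) - q ∈ mI V}
      zero_mem' := ⟨0, zero_mem_mI Q, by simpa using zero_mem_mI V⟩
      add_mem' := by
        rintro x y ⟨q, hq, hx⟩ ⟨r, hr, hy⟩
        exact ⟨q + r, add_mem_mI hq hr, by simpa [add_sub_add_comm] using add_mem_mI hx hy⟩
      smul_mem' := by
        rintro ⟨x, q, hq, hx⟩ ⟨y, hyA⟩ ⟨r, hr, hy⟩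
        refine ⟨q * r, mul_mem_mI hq hr, ?_⟩
        have hyV : y ∈ V.toSubring := by simpa using add_mem hy.1 (h hr.1)
        have : x * y - q * r = (x - q) * y + q * (y - r) := by ring
        simp only [smul_eq_mul, Subring.coe_mul]
        rw [this]
        exact add_mem_mI (mul_mem_mI' hx hyV) (mul_mem_mI (h hq) hy) }
  have hI : I ≠ ⊤ := by
    intro hI
    have h1 : (1 : A) ∈ I := hI ▸ Submodule.mem_top
    obtain ⟨q, hq, hx⟩ := h1
    -- `1 - q` is a unit of `Q`, hence of `V`
    have h2 : (1 : F) - q ∉ mI Q := fun hc => one_notMem_mI Q (by simpa using add_mem_mI hc hq)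
    obtain ⟨h0, hi⟩ := unit_of_notMem_mI (sub_mem (one_mem _) hq.1) h2
    exact notMem_mI_of_inv h0 (h hi) hx
  obtain ⟨W, hW, hWI, hWV⟩ := exists_valuationSubring_le hV I hI fun x hx =>
    ⟨⟨0, zero_mem _, by simpa using hx⟩, ⟨0, zero_mem_mI Q, by simpa using hx⟩⟩
  refine ⟨W, le_iff_mI.2 ⟨hQA.trans hW, fun x hx => ?_⟩, hWV⟩
  exact hWI ⟨x, hQA hx.1⟩ ⟨x, hx, by simpa using zero_mem_mI V⟩

/-- A discrete valuation ring is a maximal subring of its field of fractions. -/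
lemma dvr_maximal {V T : LocalSubring F} [IsDiscreteValuationRing V.toSubring]
    (hV : ∀ x : F, x ∈ V.toSubring ∨ x⁻¹ ∈ V.toSubring) (h : V.toSubring ≤ T.toSubring)
    {x : F} (hx : x ∈ mI T) (hx0 : x ≠ 0) : T = V := by
  have key : ∀ y ∈ mI V, y ∈ mI T := by
    intro y hy
    have hxV : x ∈ mI V := by
      rcases hV x with h1 | h1
      · by_contra hc
        exact notMem_mI_of_inv hx0 (h (unit_of_notMem_mI h1 hc).2) hx
      · exact absurd hx (notMem_mI_of_inv hx0 (h h1))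
    obtain ⟨ϖ, hϖ⟩ := IsDiscreteValuationRing.exists_irreducible V.toSubring
    obtain ⟨n, hn⟩ := IsDiscreteValuationRing.associated_pow_irreducible
      (x := (⟨x, hxV.1⟩ : V.toSubring)) (fun h0 => hx0 (congrArg Subtype.val h0)) hϖ
    obtain ⟨m, hm⟩ : ϖ ∣ ⟨y, hy.1⟩ := by
      have := hy.2
      rw [(IsDiscreteValuationRing.irreducible_iff_uniformizer _).1 hϖ, Ideal.mem_span_singleton] at this
      exact this
    obtain ⟨u, hu⟩ := hn.symm
    have h3 : ((ϖ : F)) ^ n * ((u : V.toSubring) : F) = x := congrArg Subtype.val hu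
    have h4 : (ϖ : F) ^ n ∈ mI T := by
      have : (ϖ : F) ^ n = ((↑u⁻¹ : V.toSubring) : F) * x := by
        rw [← h3]
        have : ((u : V.toSubring) : F) * ((↑u⁻¹ : V.toSubring) : F) = 1 := congrArg Subtype.val (u.mul_inv)
        linear_combination (-(ϖ : F) ^ n) * this
      rw [this]
      exact mul_mem_mI (h (SetLike.coe_mem _)) hx
    have hn0 : n ≠ 0 := by
      rintro rfl
      exact one_notMem_mI T (by simpa using h4)
    have h5 := (mI_pow_iff (h ϖ.2) hn0).1 h4
    have h6 : y = (ϖ : F) * m := congrArg Subtype.val hm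
    rw [h6]
    exact mul_mem_mI' h5 (h m.2)
  refine LocalSubring.toSubring_injective (le_antisymm (fun y hy => ?_) h)
  by_contra hc
  have hy0 : y ≠ 0 := by rintro rfl; exact hc (zero_mem _)
  have h3 := (hV y).resolve_left hc
  have h4 : y⁻¹ ∈ mI V := mem_mI_iff.2 ⟨h3, Or.inr (by simpa using hc)⟩
  exact inv_notMem_mI hy0 hy (key _ h4)

end Valuations

/-! ### Modifications of the germ -/

/-- The completed local ring of the germ, as a subring of its field of fractions. -/
abbrev RK : Subring K := (algebraMap R K).range

lemma algebraMap_C_mem (c : ℂ) : algebraMap ℂ K c ∈ RK := by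
  rw [IsScalarTower.algebraMap_apply ℂ R K]
  exact ⟨_, rfl⟩

lemma exists_frac (x : K) : ∃ s ∈ RK, ∃ t ∈ RK, x = s * t⁻¹ := by
  obtain ⟨a, b, hb, rfl⟩ := IsFractionRing.div_surjective (A := R) x
  exact ⟨_, ⟨a, rfl⟩, _, ⟨b, rfl⟩, by rw [div_eq_mul_inv]⟩

lemma mem_or_inv_mem {V : LocalSubring K} [IsDiscreteValuationRing V.toSubring] (h : RK ≤ V.toSubring)
    (x : K) : x ∈ V.toSubring ∨ x⁻¹ ∈ V.toSubring := by
  refine mem_or_inv_mem_of_dvr (fun x => ?_) x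
  obtain ⟨s, hs, t, ht, rfl⟩ := exists_frac x
  exact ⟨s, h hs, t, h ht, rfl⟩

section Modification
variable {X : Set (LocalSubring K)}

lemma IsModification.exists_chart (hX : IsModification X) {P : LocalSubring K} (hP : P ∈ X) :
    ∃ A : Subalgebra R K, A.FG ∧ affinePoints A.toSubring ⊆ X ∧ IsLocAt A.toSubring P := by
  obtain ⟨𝒜, hf, hFG, hU⟩ := hX.finite_type
  have hP' := hP
  rw [hU] at hP'
  simp only [Set.mem_iUnion] at hP'
  obtain ⟨A, hA, h⟩ := hP'
  refine ⟨A, hFG A hA, ?_, mem_affinePoints.1 h⟩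
  rw [hU]
  exact Set.subset_biUnion_of_mem (u := fun A : Subalgebra R K => affinePoints A.toSubring) hA

lemma RK_le_subalgebra (A : Subalgebra R K) : RK ≤ A.toSubring := by
  rintro _ ⟨r, rfl⟩
  exact A.algebraMap_mem r

lemma noetherian_of_FG {A : Subalgebra R K} (h : A.FG) : IsNoetherianRing A.toSubring := by
  have : Algebra.FiniteType R A := A.fg_iff_finiteType.1 h
  exact Algebra.FiniteType.isNoetherianRing R A

lemma IsModification.base_le (hX : IsModification X) {P : LocalSubring K} (hP : P ∈ X) :
    RK ≤ P.toSubring := by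
  obtain ⟨A, -, -, h⟩ := hX.exists_chart hP
  exact (RK_le_subalgebra A).trans h.1

lemma IsModification.mem_of_isLocAt (hX : IsModification X) {P Q : LocalSubring K} (hP : P ∈ X)
    (h : IsLocAt P.toSubring Q) : Q ∈ X := by
  obtain ⟨A, hA, hAX, hl⟩ := hX.exists_chart hP
  exact hAX (mem_affinePoints.2 (hl.trans h))

lemma IsModification.eq_of_le (hX : IsModification X) {P Q T : LocalSubring K} (hP : P ∈ X) (hQ : Q ∈ X)
    (hPT : P ≤ T) (hQT : Q ≤ T) : P = Q := by
  obtain ⟨W, hW⟩ := LocalSubring.exists_le_valuationSubring T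
  have hR : RK ≤ W.toSubring := (hX.base_le hP).trans ((le_iff_mI.1 (hPT.trans hW)).1)
  exact (hX.valuative W hR).unique ⟨hP, hPT.trans hW⟩ ⟨hQ, hQT.trans hW⟩

lemma IsModification.exists_center (hX : IsModification X) {T : LocalSubring K} (hT : ∃ P ∈ X, P.toSubring ≤ T.toSubring)
    : ∃ P ∈ X, P ≤ T := by
  obtain ⟨P, hP, h⟩ := hT
  exact ⟨_, hX.mem_of_isLocAt hP (isLocAt_ofPrime _ (contr h)), ofPrime_contr_le h⟩

lemma IsModification.isLocAt_of_le (hX : IsModification X) {Q T : LocalSubring K} (hQ : Q ∈ X) (hT : T ∈ X)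
    (h : Q.toSubring ≤ T.toSubring) : IsLocAt Q.toSubring T := by
  have h1 := hX.mem_of_isLocAt hQ (isLocAt_ofPrime _ (contr h))
  rw [← hX.eq_of_le h1 hT (ofPrime_contr_le h) le_rfl]
  exact isLocAt_ofPrime _ _

/-- A point with residue field `ℂ` is closed. -/
lemma IsModification.isClosedPoint (hX : IsModification X) {Q : LocalSubring K} (hQ : Q ∈ X)
    (hres : ∀ x ∈ Q.toSubring, ∃ c : ℂ, x - algebraMap ℂ K c ∈ mI Q) : IsClosedPoint X Q := by
  refine ⟨hQ, fun T hT hTQ => ?_⟩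
  have hl := hX.isLocAt_of_le hT hQ hTQ
  refine hX.eq_of_le hT hQ (le_iff_mI.2 ⟨hTQ, fun x hx => ?_⟩) le_rfl
  by_contra hc
  obtain ⟨c, hxc⟩ := hres x (hTQ hx.1)
  have hcT : algebraMap ℂ K c ∈ T.toSubring := hX.base_le hT (algebraMap_C_mem c)
  have hxT : x - algebraMap ℂ K c ∈ mI T := mI_le_of_le hTQ (sub_mem hx.1 hcT) hxc
  have hcm : algebraMap ℂ K c ∈ mI T := by simpa using sub_mem_mI hx hxT
  by_cases h0 : c = 0
  · subst h0
    exact hc (by simpa using hxc)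
  · refine notMem_mI_of_inv (by simpa using h0) ?_ hcm
    rw [← map_inv₀]
    exact hX.base_le hT (algebraMap_C_mem _)

/-- The center of a discrete valuation ring which is contained in it as a localization of the base. -/
lemma IsModification.dvr_mem (hX : IsModification X) {V : LocalSubring K} [IsDiscreteValuationRing V.toSubring]
    (hV : IsLocAt RK V) : V ∈ X := by
  let W : ValuationSubring K := ⟨V.toSubring, mem_or_inv_mem hV.1⟩
  obtain ⟨P, ⟨hP, hPW⟩, -⟩ := hX.valuative W hV.1
  have hPV : P ≤ V := hPW
  have : V.toSubring ≤ P.toSubring := by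
    intro x hx
    obtain ⟨s, hs, t, ht, h0, hti, rfl⟩ := hV.2 x hx
    refine mul_mem (hX.base_le hP hs) (unit_of_notMem_mI (hX.base_le hP ht) fun h => ?_).2
    exact notMem_mI_of_inv h0 hti ((le_iff_mI.1 hPV).2 _ h)
  rwa [← LocalSubring.toSubring_injective (le_antisymm (le_iff_mI.1 hPV).1 this)]

end Modification

/-! ### Two-dimensional regular local rings -/

section Exponents

/-- The exponent `(i, j)`. -/
abbrev ex (i j : ℕ) : Fin 2 →₀ ℕ := Finsupp.single 0 i + Finsupp.single 1 j

@[simp] theorem ex_zero (i j : ℕ) : ex i j 0 = i := by simp [ex]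
@[simp] theorem ex_one (i j : ℕ) : ex i j 1 = j := by simp [ex]

lemma ex_eta (e : Fin 2 →₀ ℕ) : ex (e 0) (e 1) = e := by
  ext i; fin_cases i <;> simp [ex]

lemma degree_ex (i j : ℕ) : (ex i j).degree = i + j := by simp [ex]

lemma degree_eq (e : Fin 2 →₀ ℕ) : e.degree = e 0 + e 1 := by
  rw [← ex_eta e, degree_ex]; simp [ex]

end Exponents

section RegularPairs

variable {A : Type*} [CommRing A]

/-- In a Noetherian local ring every ideal is closed for the topology defined by the powers of the
maximal ideal. -/
lemma mem_of_forall_mem_sup_pow [IsLocalRing A] [IsNoetherianRing A] (I : Ideal A) {x : A}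
    (h : ∀ n : ℕ, x ∈ I ⊔ maximalIdeal A ^ n) : x ∈ I := by
  have h0 : (Ideal.Quotient.mk I x) = 0 := by
    have := Ideal.iInf_pow_smul_eq_bot_of_isLocalRing (M := A ⧸ I) (maximalIdeal A)
      (maximalIdeal.isMaximal A).ne_top
    have hx : Ideal.Quotient.mk I x ∈ (⨅ i : ℕ, maximalIdeal A ^ i • ⊤ : Submodule A (A ⧸ I)) := by
      rw [Submodule.mem_iInf]
      intro n
      obtain ⟨y, hy, z, hz, rfl⟩ := Submodule.mem_sup.1 (h n)
      rw [map_add, Ideal.Quotient.eq_zero_iff_mem.2 hy, zero_add]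
      have : Ideal.Quotient.mk I z = z • (1 : A ⧸ I) := by
        rw [Algebra.smul_def, mul_one]; rfl
      rw [this]
      exact Submodule.smul_mem_smul hz trivial
    rw [this] at hx
    simpa using hx
  exact Ideal.Quotient.eq_zero_iff_mem.1 h0

/-- A local coordinate system `(a, b)` of a two-dimensional regular local ring, in the form which is
used below: `a` is prime and does not divide `b`. -/
structure RegPair [IsLocalRing A] (a b : A) : Prop where
  span : maximalIdeal A = Ideal.span {a, b}
  prime : Prime a
  not_dvd : ¬ a ∣ b

namespace RegPair

/-- Evaluation of the polynomials at the coordinates. -/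
def ev (ι : ℂ →+* A) (a b : A) : MvPolynomial (Fin 2) ℂ →+* A := MvPolynomial.eval₂Hom ι ![a, b]

lemma ev_eq_sum (ι : ℂ →+* A) (a b : A) (p : MvPolynomial (Fin 2) ℂ) :
    ev ι a b p = ∑ e ∈ p.support, ι (p.coeff e) * a ^ (e 0) * b ^ (e 1) := by
  simp [ev, MvPolynomial.eval₂_eq', mul_assoc]

variable [IsLocalRing A] {a b : A}

lemma mem_left (h : RegPair a b) : a ∈ maximalIdeal A := h.span ▸ Ideal.subset_span (by simp)
lemma mem_right (h : RegPair a b) : b ∈ maximalIdeal A := h.span ▸ Ideal.subset_span (by simp)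

lemma mem_iff (h : RegPair a b) {x : A} : x ∈ maximalIdeal A ↔ ∃ r s, r * a + s * b = x := by
  rw [h.span, Ideal.mem_span_pair]

lemma not_dvd_pow (h : RegPair a b) (n : ℕ) : ¬ a ∣ b ^ n := fun hc => h.not_dvd (h.prime.dvd_of_dvd_pow hc)

lemma not_dvd_unit (h : RegPair a b) {e : A} (he : IsUnit e) : ¬ a ∣ e :=
  fun hc => h.prime.not_isUnit (isUnit_of_dvd_unit hc he)

/-- Modulo `a`, every element which is not divisible by `a` is the product of a unit and
of a power of `b`. -/
lemma exists_order [IsNoetherianRing A] (h : RegPair a b) {x : A} (hx : ¬ a ∣ x) :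
    ∃ n e, IsUnit e ∧ a ∣ x - e * b ^ n := by
  have h1 : ∃ n, ¬ ∃ s, a ∣ x - s * b ^ n := by
    by_contra hc
    push Not at hc
    apply hx
    rw [← Ideal.mem_span_singleton]
    refine mem_of_forall_mem_sup_pow _ fun n => ?_
    obtain ⟨s, r, hr⟩ := hc n
    rw [Submodule.mem_sup]
    refine ⟨a * r, Ideal.mem_span_singleton.2 ⟨r, rfl⟩, s * b ^ n,
      Ideal.mul_mem_left _ _ (Ideal.pow_mem_pow h.mem_right n), by rw [← hr]; ring⟩
  classical
  have h2 := Nat.find_spec h1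
  have h3 : Nat.find h1 ≠ 0 := by
    intro h0
    rw [h0] at h2
    exact h2 ⟨x, by simp⟩
  obtain ⟨n, hn⟩ := Nat.exists_eq_succ_of_ne_zero h3
  obtain ⟨e, r, hr⟩ := not_not.1 (Nat.find_min h1 (m := n) (by omega))
  refine ⟨n, e, ?_, r, hr⟩
  by_contra he
  obtain ⟨s, t, hst⟩ := h.mem_iff.1 ((mem_maximalIdeal e).2 he)
  rw [hn] at h2
  exact h2 ⟨t, r + s * b ^ n, by rw [pow_succ]; linear_combination hr - b ^ n * hst⟩

lemma order_unique (h : RegPair a b) {n m : ℕ} {x e e' : A} (he : IsUnit e)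
    (h1 : a ∣ x - e * b ^ n) (h2 : a ∣ x - e' * b ^ m) : m ≤ n := by
  by_contra! hc
  obtain ⟨k, rfl⟩ := Nat.exists_eq_add_of_lt hc
  have h3 : a ∣ b ^ n * (e - e' * b ^ (k + 1)) := by
    have := dvd_sub h2 h1
    have e1 : (x - e' * b ^ (n + k + 1)) - (x - e * b ^ n) = b ^ n * (e - e' * b ^ (k + 1)) := by ring
    rwa [e1] at this
  rcases h.prime.dvd_or_dvd h3 with h4 | h4
  · exact h.not_dvd_pow n h4
  · refine h.not_dvd_unit ?_ h4
    by_contra hu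
    have h5 : e - e' * b ^ (k + 1) + e' * b ^ (k + 1) ∈ maximalIdeal A :=
      add_mem ((mem_maximalIdeal _).2 hu) (Ideal.mul_mem_left _ _ (Ideal.pow_mem_of_mem _ h.mem_right _ (by omega)))
    rw [sub_add_cancel] at h5
    exact (mem_maximalIdeal e).1 h5 he

/-- Extraction of the powers of `a`. -/
lemma exists_eq_pow_mul [IsDomain A] [IsNoetherianRing A] (h : RegPair a b) {x : A} (hx : x ≠ 0) :
    ∃ n y, x = a ^ n * y ∧ ¬ a ∣ y := by
  have hf : FiniteMultiplicity a x := FiniteMultiplicity.of_prime_left h.prime hx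
  obtain ⟨y, hy, hn⟩ := hf.exists_eq_pow_mul_and_not_dvd
  exact ⟨_, y, hy, hn⟩

lemma principal_of_notMem [IsDomain A] [IsNoetherianRing A] (h : RegPair a b) (p : Ideal A) [p.IsPrime]
    (hp : a ∉ p) : ∃ g, p = Ideal.span {g} := by
  by_cases h0 : p = ⊥
  · exact ⟨0, by simp [h0]⟩
  have h1 : ∃ n, ∃ x ∈ p, ∃ e, IsUnit e ∧ a ∣ x - e * b ^ n := by
    obtain ⟨x, hx, hx0⟩ := Submodule.exists_mem_ne_zero_of_ne_bot h0
    obtain ⟨n, y, rfl, hy⟩ := h.exists_eq_pow_mul hx0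
    obtain ⟨k, e, he, hk⟩ := h.exists_order hy
    refine ⟨k, y, ?_, e, he, hk⟩
    exact (Ideal.IsPrime.mem_or_mem ‹_› hx).resolve_left fun hc => hp (Ideal.IsPrime.mem_of_pow_mem ‹_› _ hc)
  classical
  obtain ⟨g, hg, e, he, r, hr⟩ := Nat.find_spec h1
  refine ⟨g, le_antisymm ?_ ((Ideal.span_singleton_le_iff_mem _).2 hg)⟩
  refine Submodule.le_of_le_smul_of_le_jacobson_bot (I := maximalIdeal A)
    (IsNoetherian.noetherian _) (maximalIdeal_le_jacobson _) fun y hy => ?_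
  have key : ∃ c z, y = c * g + a * z := by
    by_cases hay : a ∣ y
    · obtain ⟨z, rfl⟩ := hay; exact ⟨0, z, by ring⟩
    obtain ⟨k, e', he', s, hs⟩ := h.exists_order hay
    have hk : Nat.find h1 ≤ k := Nat.find_min' h1 ⟨y, hy, e', he', s, hs⟩
    obtain ⟨j, hj⟩ := Nat.exists_eq_add_of_le hk
    obtain ⟨u, rfl⟩ := he
    refine ⟨e' * ↑u⁻¹ * b ^ j, s - e' * ↑u⁻¹ * b ^ j * r, ?_⟩
    rw [hj, pow_add] at hs
    have hu : (u : A) * ↑u⁻¹ = 1 := u.mul_inv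
    linear_combination hs - e' * ↑u⁻¹ * b ^ j * hr - e' * b ^ j * b ^ (Nat.find h1) * hu
  obtain ⟨c, z, hcz⟩ := key
  have hz : z ∈ p := by
    have : a * z ∈ p := by
      have : a * z = y - c * g := by rw [hcz]; ring
      rw [this]; exact sub_mem hy (Ideal.mul_mem_left _ _ hg)
    exact (Ideal.IsPrime.mem_or_mem ‹_› this).resolve_left hp
  rw [hcz]
  exact Submodule.add_mem_sup (Ideal.mem_span_singleton'.2 ⟨c, rfl⟩) (Submodule.smul_mem_smul h.mem_left hz)

lemma eq_of_mem [IsNoetherianRing A] (h : RegPair a b) (p : Ideal A) [hp : p.IsPrime] (ha : a ∈ p)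
    (hm : p ≠ maximalIdeal A) : p = Ideal.span {a} := by
  refine le_antisymm (fun x hx => ?_) ((Ideal.span_singleton_le_iff_mem _).2 ha)
  rw [Ideal.mem_span_singleton]
  by_contra hc
  obtain ⟨n, e, he, r, hr⟩ := h.exists_order hc
  have h1 : e * b ^ n ∈ p := by
    have : e * b ^ n = x - a * r := by rw [← hr]; ring
    rw [this]; exact sub_mem hx (Ideal.mul_mem_right _ _ ha)
  have h2 : b ∈ p := by
    rcases hp.mem_or_mem h1 with h2 | h2
    · exact absurd (Ideal.eq_top_of_isUnit_mem _ h2 he) hp.ne_top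
    · exact hp.mem_of_pow_mem _ h2
  apply hm
  refine le_antisymm (le_maximalIdeal hp.ne_top) ?_
  rw [h.span, Ideal.span_le]
  rintro y (rfl | rfl) <;> assumption

/-- A nonzero prime ideal which is not maximal is generated by a prime element. -/
lemma exists_prime_generator [IsDomain A] [IsNoetherianRing A] (h : RegPair a b) (p : Ideal A) [hp : p.IsPrime]
    (h0 : p ≠ ⊥) (hm : p ≠ maximalIdeal A) : ∃ g, Prime g ∧ p = Ideal.span {g} := by
  obtain ⟨g, hg⟩ : ∃ g, p = Ideal.span {g} := by
    by_cases ha : a ∈ p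
    · exact ⟨a, h.eq_of_mem p ha hm⟩
    · exact h.principal_of_notMem p ha
  refine ⟨g, ?_, hg⟩
  have hg0 : g ≠ 0 := by rintro rfl; exact h0 (by simpa using hg)
  rw [hg] at hp
  exact (Ideal.span_singleton_prime hg0).1 hp

lemma ufd [IsDomain A] [IsNoetherianRing A] (h : RegPair a b) : UniqueFactorizationMonoid A := by
  rw [UniqueFactorizationMonoid.iff_exists_prime_mem_of_isPrime]
  intro p h0 hp
  by_cases hm : p = maximalIdeal A
  · exact ⟨a, hm ▸ h.mem_left, h.prime⟩
  · obtain ⟨g, hg, h1⟩ := h.exists_prime_generator p h0 hm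
    exact ⟨g, h1 ▸ Ideal.mem_span_singleton_self g, hg⟩

lemma not_principal [IsDomain A] (h : RegPair a b) (g : A) : maximalIdeal A ≠ Ideal.span {g} := by
  intro hg
  obtain ⟨r, hr⟩ : g ∣ a := Ideal.mem_span_singleton.1 (hg ▸ h.mem_left)
  obtain ⟨s, hs⟩ : g ∣ b := Ideal.mem_span_singleton.1 (hg ▸ h.mem_right)
  have hgu : ¬ IsUnit g := (mem_maximalIdeal g).1 (hg ▸ Ideal.mem_span_singleton_self g)
  rcases h.prime.dvd_or_dvd (⟨1, by rw [mul_one, ← hr]⟩ : a ∣ g * r) with h1 | ⟨t, ht⟩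
  · exact h.not_dvd (h1.trans ⟨s, hs⟩)
  · apply hgu
    refine isUnit_iff_exists_inv.mpr ⟨t, ?_⟩
    have h3 : a * (g * t) = a * 1 := by
      calc a * (g * t) = g * (a * t) := by ring
        _ = a * 1 := by rw [← ht, ← hr, mul_one]
    exact mul_left_cancel₀ h.prime.ne_zero h3

lemma mem_pow_succ (h : RegPair a b) (n : ℕ) {x : A} (hx : x ∈ maximalIdeal A ^ (n + 1)) :
    ∃ r ∈ maximalIdeal A ^ n, ∃ s, x = a * r + b ^ (n + 1) * s := by
  induction n generalizing x with
  | zero =>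
    rw [zero_add, pow_one] at hx
    obtain ⟨r, s, rfl⟩ := h.mem_iff.1 hx
    exact ⟨r, by simp, s, by ring⟩
  | succ n ih =>
    rw [pow_succ'] at hx
    refine Submodule.mul_induction_on hx ?_ ?_
    · intro y hy z hz
      obtain ⟨u, v, rfl⟩ := h.mem_iff.1 hy
      obtain ⟨r, hr, s, hs⟩ := ih hz
      refine ⟨u * z + v * b * r, add_mem (Ideal.mul_mem_left _ _ hz) ?_, v * s, ?_⟩
      · rw [mul_assoc]
        refine Ideal.mul_mem_left _ _ ?_
        rw [pow_succ']; exact Ideal.mul_mem_mul h.mem_right hr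
      · rw [hs]; ring
    · rintro y z ⟨r, hr, s, rfl⟩ ⟨r', hr', s', rfl⟩
      exact ⟨r + r', add_mem hr hr', s + s', by ring⟩

/-- The monomials of degree `n` in `a`, `b` are linearly independent modulo the power of exponent
`n + 1` of the maximal ideal. -/
lemma form_eq_zero [IsDomain A] (h : RegPair a b) (ι : ℂ →+* A) (n : ℕ) (c : ℕ → ℂ)
    (hc : ∑ i ∈ Finset.range (n + 1), ι (c i) * a ^ i * b ^ (n - i) ∈ maximalIdeal A ^ (n + 1)) :
    ∀ i ≤ n, c i = 0 := by
  have hunit : ∀ z : ℂ, ι z ∈ maximalIdeal A → z = 0 := by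
    intro z hz
    by_contra h0
    exact (mem_maximalIdeal _).1 hz ((IsUnit.mk0 z h0).map ι)
  induction n generalizing c with
  | zero =>
    intro i hi
    obtain rfl : i = 0 := by omega
    simp only [zero_add, Finset.sum_range_one, pow_zero, mul_one, pow_one, Nat.sub_zero] at hc
    exact hunit _ hc
  | succ n ih =>
    rw [Finset.sum_range_succ'] at hc
    have h1 : ∑ i ∈ Finset.range (n + 1), ι (c (i + 1)) * a ^ (i + 1) * b ^ (n + 1 - (i + 1))
        = a * ∑ i ∈ Finset.range (n + 1), ι (c (i + 1)) * a ^ i * b ^ (n - i) := by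
      rw [Finset.mul_sum]
      refine Finset.sum_congr rfl fun i _ => ?_
      rw [Nat.add_sub_add_right, pow_succ]; ring
    rw [h1] at hc
    set G := ∑ i ∈ Finset.range (n + 1), ι (c (i + 1)) * a ^ i * b ^ (n - i)
    simp only [pow_zero, mul_one, Nat.sub_zero] at hc
    obtain ⟨r, hr, s, hs⟩ := h.mem_pow_succ _ hc
    have h0 : c 0 = 0 := by
      have h2 : a ∣ b ^ (n + 1) * (ι (c 0) - b * s) := ⟨r - G, by rw [pow_succ] at hs ⊢; linear_combination hs⟩
      rcases h.prime.dvd_or_dvd h2 with h3 | ⟨t, ht⟩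
      · exact absurd h3 (h.not_dvd_pow _)
      · apply hunit
        have : ι (c 0) = t * a + s * b := by linear_combination ht
        rw [this]; exact h.mem_iff.2 ⟨t, s, rfl⟩
    rw [h0, map_zero, zero_mul, add_zero] at hc hs
    have hG : G ∈ maximalIdeal A ^ (n + 1) := by
      have h2 : a ∣ b ^ (n + 1 + 1) * s := ⟨G - r, by linear_combination -hs⟩
      obtain ⟨t, rfl⟩ := (h.prime.dvd_or_dvd h2).resolve_left (h.not_dvd_pow _)
      have h3 : a * G = a * (r + b ^ (n + 1 + 1) * t) := by rw [hs]; ring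
      rw [mul_left_cancel₀ h.prime.ne_zero h3]
      refine add_mem hr (Ideal.mul_mem_right _ _ ?_)
      exact Ideal.pow_le_pow_right (Nat.le_succ _) (Ideal.pow_mem_pow h.mem_right _)
    intro i hi
    rcases i with _ | i
    · exact h0
    · exact ih (fun i => c (i + 1)) hG i (by omega)

lemma ev_mem_pow (h : RegPair a b) (ι : ℂ →+* A) {n : ℕ} {p : MvPolynomial (Fin 2) ℂ}
    (hp : ∀ e : Fin 2 →₀ ℕ, e.degree < n → p.coeff e = 0) : ev ι a b p ∈ maximalIdeal A ^ n := by
  rw [ev_eq_sum]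
  refine sum_mem fun e he => ?_
  have hd : n ≤ e.degree := by
    by_contra! hc
    exact MvPolynomial.mem_support_iff.1 he (hp e hc)
  rw [mul_assoc]
  refine Ideal.mul_mem_left _ _ (Ideal.pow_le_pow_right hd ?_)
  rw [degree_eq, pow_add]
  exact Ideal.mul_mem_mul (Ideal.pow_mem_pow h.mem_left _) (Ideal.pow_mem_pow h.mem_right _)

lemma coeff_eq_zero [IsDomain A] (h : RegPair a b) (ι : ℂ →+* A) {n : ℕ} {p : MvPolynomial (Fin 2) ℂ}
    (hp : ev ι a b p ∈ maximalIdeal A ^ n) : ∀ e : Fin 2 →₀ ℕ, e.degree < n → p.coeff e = 0 := by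
  induction n with
  | zero => intro e he; omega
  | succ n ih =>
    have h1 := ih (Ideal.pow_le_pow_right (Nat.le_succ n) hp)
    -- the homogeneous part of degree `n` of `p`
    let q : MvPolynomial (Fin 2) ℂ :=
      ∑ i ∈ Finset.range (n + 1), MvPolynomial.monomial (ex i (n - i)) (p.coeff (ex i (n - i)))
    have hq : ∀ e : Fin 2 →₀ ℕ, e.degree < n + 1 → (p - q).coeff e = 0 := by
      intro e he
      rw [MvPolynomial.coeff_sub, MvPolynomial.coeff_sum]
      simp only [MvPolynomial.coeff_monomial]
      rcases Nat.lt_succ_iff_lt_or_eq.1 he with hlt | heq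
      · rw [h1 e hlt, Finset.sum_eq_zero, sub_zero]
        intro i hi
        rw [if_neg]
        rintro rfl
        rw [degree_ex] at hlt
        have := Finset.mem_range.1 hi
        omega
      · rw [degree_eq] at heq
        rw [Finset.sum_eq_single (e 0)]
        · have : ex (e 0) (n - e 0) = e := by
            rw [← heq, Nat.add_sub_cancel_left, ex_eta]
          rw [this, if_pos rfl, sub_self]
        · intro i _ hi
          rw [if_neg]
          rintro rfl
          simp at hi
        · intro hc
          exact absurd (Finset.mem_range.2 (by omega)) hc
    have h2 : ev ι a b q ∈ maximalIdeal A ^ (n + 1) := by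
      have h3 := h.ev_mem_pow ι hq
      have : ev ι a b q = ev ι a b p - ev ι a b (p - q) := by rw [map_sub]; ring
      rw [this]; exact sub_mem hp h3
    have h4 : ev ι a b q = ∑ i ∈ Finset.range (n + 1), ι (p.coeff (ex i (n - i))) * a ^ i * b ^ (n - i) := by
      rw [map_sum]
      refine Finset.sum_congr rfl fun i _ => ?_
      simp [ev, MvPolynomial.eval₂_monomial, Finsupp.prod_fintype, mul_assoc]
    rw [h4] at h2
    have h5 := h.form_eq_zero ι n _ h2
    intro e he
    rcases Nat.lt_succ_iff_lt_or_eq.1 he with hlt | heq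
    · exact h1 e hlt
    · rw [degree_eq] at heq
      have := h5 (e 0) (by omega)
      rwa [← heq, Nat.add_sub_cancel_left, ex_eta] at this

lemma exists_ev_sub_mem (h : RegPair a b) (ι : ℂ →+* A) (hres : ∀ x : A, ∃ c, x - ι c ∈ maximalIdeal A)
    (x : A) (n : ℕ) : ∃ p, x - ev ι a b p ∈ maximalIdeal A ^ n := by
  induction n generalizing x with
  | zero => exact ⟨0, by simp⟩
  | succ n ih =>
    obtain ⟨c, hc⟩ := hres x
    obtain ⟨r, s, hrs⟩ := h.mem_iff.1 hc
    obtain ⟨p, hp⟩ := ih r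
    obtain ⟨q, hq⟩ := ih s
    refine ⟨MvPolynomial.C c + p * MvPolynomial.X 0 + q * MvPolynomial.X 1, ?_⟩
    have : x - ev ι a b (MvPolynomial.C c + p * MvPolynomial.X 0 + q * MvPolynomial.X 1)
        = a * (r - ev ι a b p) + b * (s - ev ι a b q) := by
      simp only [map_add, map_mul]
      simp only [ev, MvPolynomial.coe_eval₂Hom, MvPolynomial.eval₂_C, MvPolynomial.eval₂_X,
        Matrix.cons_val_zero, Matrix.cons_val_one]
      linear_combination -hrs
    rw [this, pow_succ']
    exact add_mem (Ideal.mul_mem_mul h.mem_left hp) (Ideal.mul_mem_mul h.mem_right hq)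

section Expansion
variable (ι : ℂ →+* A)

open Classical in
/-- A polynomial approximating `x` modulo the `n`-th power of the maximal ideal. -/
def approx (a b x : A) (n : ℕ) : MvPolynomial (Fin 2) ℂ :=
  if h : ∃ p, x - ev ι a b p ∈ maximalIdeal A ^ n then h.choose else 0

lemma approx_spec (h : RegPair a b) (hres : ∀ x : A, ∃ c, x - ι c ∈ maximalIdeal A) (x : A) (n : ℕ) :
    x - ev ι a b (approx ι a b x n) ∈ maximalIdeal A ^ n := by
  have := h.exists_ev_sub_mem ι hres x n
  rw [approx, dif_pos this]
  exact this.choose_spec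

/-- The expansion of `x` as a power series in the coordinates. -/
def expand (a b x : A) : R := fun e => (approx ι a b x (e.degree + 1)).coeff e

lemma coeff_expand [IsDomain A] (h : RegPair a b) (hres : ∀ x : A, ∃ c, x - ι c ∈ maximalIdeal A) {x : A} {n : ℕ}
    {p : MvPolynomial (Fin 2) ℂ} (hp : x - ev ι a b p ∈ maximalIdeal A ^ n) {e : Fin 2 →₀ ℕ} (he : e.degree < n) :
    coeff e (expand ι a b x) = p.coeff e := by
  have h1 : coeff e (expand ι a b x) = (approx ι a b x (e.degree + 1)).coeff e := rfl
  rw [h1, ← sub_eq_zero, ← MvPolynomial.coeff_sub]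
  refine h.coeff_eq_zero ι (n := e.degree + 1) ?_ e (Nat.lt_succ_self _)
  have h2 := approx_spec ι h hres x (e.degree + 1)
  have : ev ι a b (approx ι a b x (e.degree + 1) - p) = (x - ev ι a b p) - (x - ev ι a b (approx ι a b x (e.degree + 1))) := by
    rw [map_sub]; ring
  rw [this]
  exact sub_mem (Ideal.pow_le_pow_right he hp) h2

variable [IsDomain A] (h : RegPair a b) (hres : ∀ x : A, ∃ c, x - ι c ∈ maximalIdeal A)

/-- The expansion homomorphism: it identifies the completion of a two-dimensional regular
local ring of residue field `ℂ` with the ring of power series in two variables. -/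
def expandHom : A →+* R where
  toFun := expand ι a b
  map_zero' := by
    ext e
    rw [coeff_expand ι h hres (p := 0) (n := e.degree + 1) (by simp) (Nat.lt_succ_self _)]; simp
  map_one' := by
    ext e
    rw [coeff_expand ι h hres (p := 1) (n := e.degree + 1) (by simp) (Nat.lt_succ_self _)]
    classical
    rw [MvPolynomial.coeff_one, MvPowerSeries.coeff_one]
    simp only [eq_comm]
  map_add' x y := by
    ext e
    have hx := approx_spec ι h hres x (e.degree + 1)
    have hy := approx_spec ι h hres y (e.degree + 1)
    rw [map_add, coeff_expand ι h hres hx (Nat.lt_succ_self _), coeff_expand ι h hres hy (Nat.lt_succ_self _),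
      ← MvPolynomial.coeff_add, coeff_expand ι h hres (n := e.degree + 1) _ (Nat.lt_succ_self _)]
    rw [map_add, add_sub_add_comm]; exact add_mem hx hy
  map_mul' x y := by
    ext e
    classical
    set n := e.degree + 1
    have hx := approx_spec ι h hres x n
    have hy := approx_spec ι h hres y n
    rw [coeff_expand ι h hres (n := n) (p := approx ι a b x n * approx ι a b y n) _ (Nat.lt_succ_self _),
      MvPowerSeries.coeff_mul, MvPolynomial.coeff_mul]
    · refine Finset.sum_congr rfl fun d hd => ?_
      have hd' : d.1 + d.2 = e := Finset.HasAntidiagonal.mem_antidiagonal.mp hd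
      have hdeg : d.1.degree + d.2.degree = e.degree := by rw [← hd', map_add]
      rw [coeff_expand ι h hres hx (by omega), coeff_expand ι h hres hy (by omega)]
    · have : x * y - ev ι a b (approx ι a b x n * approx ι a b y n)
          = (x - ev ι a b (approx ι a b x n)) * y + ev ι a b (approx ι a b x n) * (y - ev ι a b (approx ι a b y n)) := by
        rw [map_mul]; ring
      rw [this]
      exact add_mem (Ideal.mul_mem_right _ _ hx) (Ideal.mul_mem_left _ _ hy)

lemma coeff_expandHom {x : A} {n : ℕ} {p : MvPolynomial (Fin 2) ℂ} (hp : x - ev ι a b p ∈ maximalIdeal A ^ n)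
    {e : Fin 2 →₀ ℕ} (he : e.degree < n) : coeff e (expandHom ι h hres x) = p.coeff e :=
  coeff_expand ι h hres hp he

lemma expandHom_ev (p : MvPolynomial (Fin 2) ℂ) : expandHom ι h hres (ev ι a b p) = p := by
  ext e
  rw [coeff_expandHom ι h hres (p := p) (n := e.degree + 1) (by simp) (Nat.lt_succ_self _)]
  simp

lemma expandHom_left : expandHom ι h hres a = MvPowerSeries.X 0 := by
  have := expandHom_ev ι h hres (MvPolynomial.X 0)
  simpa [ev] using this

lemma expandHom_right : expandHom ι h hres b = MvPowerSeries.X 1 := by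
  have := expandHom_ev ι h hres (MvPolynomial.X 1)
  simpa [ev] using this

lemma expandHom_const (c : ℂ) : expandHom ι h hres (ι c) = MvPowerSeries.C c := by
  have := expandHom_ev ι h hres (MvPolynomial.C c)
  simpa [ev] using this

lemma mem_pow_of_coeff {x : A} {n : ℕ}
    (hx : ∀ e : Fin 2 →₀ ℕ, e.degree < n → coeff e (expandHom ι h hres x) = 0) : x ∈ maximalIdeal A ^ n := by
  have h1 := approx_spec ι h hres x n
  have h2 : ev ι a b (approx ι a b x n) ∈ maximalIdeal A ^ n :=
    h.ev_mem_pow ι fun e he => by rw [← coeff_expandHom ι h hres h1 he, hx e he]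
  simpa using add_mem h1 h2

lemma coeff_of_mem_pow {x : A} {n : ℕ} (hx : x ∈ maximalIdeal A ^ n) (e : Fin 2 →₀ ℕ) (he : e.degree < n) :
    coeff e (expandHom ι h hres x) = 0 := by
  rw [coeff_expandHom ι h hres (p := 0) (n := n) (by simpa using hx) he]; simp

lemma expandHom_injective [IsNoetherianRing A] : Function.Injective (expandHom ι h hres) := by
  rw [injective_iff_map_eq_zero]
  intro x hx
  have : x ∈ (⊥ : Ideal A) := mem_of_forall_mem_sup_pow _ fun n => by
    rw [bot_sup_eq]
    exact mem_pow_of_coeff ι h hres fun e _ => by rw [hx]; simp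
  simpa using this

end Expansion

end RegPair
end RegularPairs

/-! ### The ring of formal power series -/

instance isDomain_mvPowerSeries {n : ℕ} : IsDomain (MvPowerSeries (Fin n) ℂ) := NoZeroDivisors.to_isDomain _

lemma mem_maximalIdeal_R {f : R} : f ∈ maximalIdeal R ↔ constantCoeff f = 0 := by
  rw [mem_maximalIdeal, mem_nonunits_iff, MvPowerSeries.isUnit_iff_constantCoeff, isUnit_iff_ne_zero, not_not]

lemma X_zero_prime : Prime (MvPowerSeries.X 0 : R) := by
  rw [← MulEquiv.prime_iff (MvPowerSeries.finSuccEquiv ℂ 1).toMulEquiv]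
  simpa using PowerSeries.X_prime

lemma regPair_X : RegPair (MvPowerSeries.X 0 : R) (MvPowerSeries.X 1) where
  span := by
    refine le_antisymm (fun f hf => ?_) ?_
    · rw [mem_maximalIdeal_R] at hf
      rw [Ideal.mem_span_pair]
      let g : R := fun e => coeff (e + Finsupp.single 0 1) f
      let h : R := fun e => if e 0 = 0 then coeff (e + Finsupp.single 1 1) f else 0
      have hg : ∀ e, coeff e g = coeff (e + Finsupp.single 0 1) f := fun _ => rfl
      have hh : ∀ e, coeff e h = if e 0 = 0 then coeff (e + Finsupp.single 1 1) f else 0 :=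
        fun _ => rfl
      refine ⟨g, h, ?_⟩
      ext e
      rw [map_add]
      have hX : ∀ i : Fin 2, (MvPowerSeries.X i : R) = monomial (Finsupp.single i 1) 1 := fun _ => rfl
      rw [hX, hX, MvPowerSeries.coeff_mul_monomial, MvPowerSeries.coeff_mul_monomial]
      simp only [hg, hh, Finsupp.single_le_iff, mul_one]
      by_cases h0 : 1 ≤ e 0
      · rw [if_pos h0, tsub_add_cancel_of_le (by simpa using h0)]
        have : (e - Finsupp.single (1 : Fin 2) 1 : Fin 2 →₀ ℕ) 0 ≠ 0 := by simp; omega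
        rw [if_neg this]; simp
      · have h0' : e 0 = 0 := by omega
        rw [if_neg h0]
        by_cases h1 : 1 ≤ e 1
        · have : (e - Finsupp.single (1 : Fin 2) 1 : Fin 2 →₀ ℕ) 0 = 0 := by simp [h0']
          rw [if_pos h1, if_pos this, tsub_add_cancel_of_le (by simpa using h1), zero_add]
        · have : e = 0 := by
            ext i; fin_cases i
            · exact h0'
            · simp only [Fin.mk_one, Finsupp.coe_zero, Pi.zero_apply]; omega
          rw [if_neg h1, this, MvPowerSeries.coeff_zero_eq_constantCoeff_apply, hf, zero_add]
    · rw [Ideal.span_le]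
      rintro x (rfl | rfl) <;> exact mem_maximalIdeal_R.2 (by simp)
  prime := X_zero_prime
  not_dvd := by
    rw [MvPowerSeries.X_dvd_iff]
    push Not
    refine ⟨Finsupp.single 1 1, by simp, ?_⟩
    rw [MvPowerSeries.coeff_X, if_pos rfl]; exact one_ne_zero

instance : UniqueFactorizationMonoid R := regPair_X.ufd

/-- A smooth branch is part of a coordinate system, the other member of which is one of the variables. -/
lemma exists_regPair {l : R} (hl : l ∈ maximalIdeal R) (hl' : l ∉ maximalIdeal R ^ 2) :
    ∃ (i j : Fin 2), i ≠ j ∧ RegPair l (MvPowerSeries.X j) ∧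
      ∃ r s : R, IsUnit r ∧ l = r * MvPowerSeries.X i + s * MvPowerSeries.X j := by
  obtain ⟨r, s, hrs⟩ := regPair_X.mem_iff.1 hl
  have hirr : Irreducible l := by
    refine ⟨(mem_maximalIdeal l).1 hl, fun x y hxy => ?_⟩
    by_contra! hc
    apply hl'
    rw [hxy, pow_two]
    exact Ideal.mul_mem_mul ((mem_maximalIdeal x).2 hc.1) ((mem_maximalIdeal y).2 hc.2)
  have main : ∀ (i j : Fin 2) (r s : R), maximalIdeal R = span {MvPowerSeries.X i, MvPowerSeries.X j} →
      (∀ g : R, maximalIdeal R ≠ span {g}) → IsUnit r → l = r * MvPowerSeries.X i + s * MvPowerSeries.X j →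
      RegPair l (MvPowerSeries.X j) := by
    rintro i j r s hm hnp ⟨u, rfl⟩ hl1
    have hX : (MvPowerSeries.X i : R) = (↑u⁻¹ : R) * l - (↑u⁻¹ : R) * s * MvPowerSeries.X j := by
      have : (↑u⁻¹ : R) * u = 1 := u.inv_mul
      rw [hl1]; linear_combination (-MvPowerSeries.X i : R) * this
    have hspan : maximalIdeal R = span {l, MvPowerSeries.X j} := by
      rw [hm]
      apply le_antisymm <;> rw [Ideal.span_le]
      · rintro x (rfl | rfl)
        · exact Ideal.mem_span_pair.2 ⟨(↑u⁻¹ : R), -((↑u⁻¹ : R) * s), by rw [hX]; ring⟩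
        · exact Ideal.subset_span (by simp)
      · rintro x (rfl | rfl)
        · exact Ideal.mem_span_pair.2 ⟨u, s, hl1.symm⟩
        · exact Ideal.subset_span (by simp)
    refine ⟨hspan, hirr.prime, fun hd => hnp l ?_⟩
    rw [hspan]
    refine le_antisymm ?_ (Ideal.span_mono (by simp))
    rw [Ideal.span_le]
    rintro x (rfl | rfl)
    · exact mem_span_singleton_self _
    · exact mem_span_singleton.2 hd
  have hnp := regPair_X.not_principal
  have hr : IsUnit r ∨ IsUnit s := by
    by_contra! hc
    apply hl'
    rw [← hrs, pow_two]
    exact add_mem (Ideal.mul_mem_mul ((mem_maximalIdeal r).2 hc.1) regPair_X.mem_left)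
      (Ideal.mul_mem_mul ((mem_maximalIdeal s).2 hc.2) regPair_X.mem_right)
  rcases hr with hr | hs
  · exact ⟨0, 1, by decide, main 0 1 r s regPair_X.span hnp hr hrs.symm, r, s, hr, hrs.symm⟩
  · have h1 : l = s * MvPowerSeries.X 1 + r * MvPowerSeries.X 0 := by rw [← hrs]; ring
    exact ⟨1, 0, by decide, main 1 0 s r (by rw [regPair_X.span, Set.pair_comm]) hnp hs h1, s, r, hs, h1⟩

lemma algebraMap_injective : Function.Injective (algebraMap R K) := IsFractionRing.injective R K

lemma mem_mI_origin {r : R} : algebraMap R K r ∈ mI origin ↔ r ∈ maximalIdeal R := by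
  rw [mem_mI_iff, mem_maximalIdeal, mem_nonunits_iff]
  have h1 : algebraMap R K r ∈ origin.toSubring := ⟨r, rfl⟩
  rw [← not_iff_not]
  push Not
  constructor
  · intro h
    obtain ⟨h0, s, hs⟩ := h h1
    rw [isUnit_iff_exists_inv]
    refine ⟨s, algebraMap_injective ?_⟩
    rw [map_mul, hs, map_one, mul_inv_cancel₀ h0]
  · intro h _
    obtain ⟨s, hs⟩ := isUnit_iff_exists_inv.1 h
    have h2 : algebraMap R K r * algebraMap R K s = 1 := by rw [← map_mul, hs, map_one]
    exact ⟨left_ne_zero_of_mul_eq_one h2, by rw [inv_eq_of_mul_eq_one_right h2]; exact ⟨s, rfl⟩⟩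

/-- The ring isomorphism of the ring of power series with the local ring of the origin. -/
def originEquiv : R ≃+* origin.toSubring := RingEquiv.ofBijective (algebraMap R K).rangeRestrict
  ⟨fun _ _ h => algebraMap_injective (congrArg Subtype.val h), (algebraMap R K).rangeRestrict_surjective⟩

lemma coe_originEquiv (r : R) : (originEquiv r : K) = algebraMap R K r := rfl

lemma RegPair.map {A B : Type*} [CommRing A] [CommRing B] [IsLocalRing A] [IsLocalRing B] (f : A ≃+* B) {a b : A}
    (h : RegPair a b) : RegPair (f a) (f b) where
  span := by
    have h1 : maximalIdeal B = (maximalIdeal A).map f := by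
      rw [IsLocalRing.map_ringEquiv_maximalIdeal]
    rw [h1, h.span, Ideal.map_span]
    congr 1
    simp [Set.image_pair]
  prime := (MulEquiv.prime_iff f.toMulEquiv).2 h.prime
  not_dvd := fun hc => h.not_dvd ((map_dvd_iff f).1 hc)

lemma exists_const_R (f : R) : f - MvPowerSeries.C (constantCoeff f) ∈ maximalIdeal R := by
  rw [mem_maximalIdeal_R]; simp

lemma algebraMap_eq_C (c : ℂ) : algebraMap ℂ K c = algebraMap R K (MvPowerSeries.C c) := by
  rw [IsScalarTower.algebraMap_apply ℂ R K]; rfl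

/-- `P` is the local ring of a smooth point of residue field `ℂ`, with local coordinates `a`, `b`. -/
structure SmoothAt (P : LocalSubring K) (a b : P.toSubring) : Prop where
  base : RK ≤ P.toSubring
  noeth : IsNoetherianRing P.toSubring
  reg : RegPair a b
  res : ∀ x ∈ P.toSubring, ∃ c : ℂ, x - algebraMap ℂ K c ∈ mI P

/-- The field of constants in a local ring which contains that of the origin. -/
def constHom {P : LocalSubring K} (h : RK ≤ P.toSubring) : ℂ →+* P.toSubring :=
  (algebraMap ℂ K).codRestrict P.toSubring fun c => h (algebraMap_C_mem c)

lemma constHom_res {P : LocalSubring K} (h : RK ≤ P.toSubring)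
    (hres : ∀ x ∈ P.toSubring, ∃ c : ℂ, x - algebraMap ℂ K c ∈ mI P) (x : P.toSubring) :
    ∃ c, x - constHom h c ∈ maximalIdeal P.toSubring := by
  obtain ⟨c, hc⟩ := hres x x.2
  exact ⟨c, coe_mem_mI.1 hc⟩

lemma isFractionRing_of_base {A : Subring K} (h : RK ≤ A) : IsFractionRing A K := by
  refine IsFractionRing.of_field A K fun x => ?_
  obtain ⟨s, hs, t, ht, rfl⟩ := exists_frac x
  exact ⟨⟨s, h hs⟩, ⟨t, h ht⟩, by rw [div_eq_mul_inv]; rfl⟩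

lemma smoothAt_origin {a b : R} (h : RegPair a b) : SmoothAt origin (originEquiv a) (originEquiv b) where
  base := le_rfl
  noeth := isNoetherianRing_of_ringEquiv R originEquiv
  reg := h.map originEquiv
  res := by
    rintro _ ⟨r, rfl⟩
    refine ⟨constantCoeff r, ?_⟩
    rw [algebraMap_eq_C, ← map_sub]
    exact mem_mI_origin.2 (exists_const_R r)

/-! ### Completions of toric points -/

section ToricRing
variable {w₁ w₂ : ℤ × ℤ}

/-- The lattice of exponents containing `toricMonoid w₁ w₂` is saturated in `ℕ²`. -/
lemma sub_mem_toricMonoid {e d : Fin 2 →₀ ℕ} (he : e ∈ toricMonoid w₁ w₂) (hd : d ∈ toricMonoid w₁ w₂)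
    (h : d ≤ e) : e - d ∈ toricMonoid w₁ w₂ := by
  obtain ⟨m, h0, h1⟩ := he
  obtain ⟨n, k0, k1⟩ := hd
  refine ⟨m - n, ?_, ?_⟩
  · rw [Finsupp.tsub_apply, Nat.cast_sub (h 0), h0, k0]; simp; ring
  · rw [Finsupp.tsub_apply, Nat.cast_sub (h 1), h1, k1]; simp; ring

lemma mem_toricMonoid_of_add {e d : Fin 2 →₀ ℕ} (he : e + d ∈ toricMonoid w₁ w₂) (hd : d ∈ toricMonoid w₁ w₂) :
    e ∈ toricMonoid w₁ w₂ := by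
  have := sub_mem_toricMonoid he hd (by simp)
  simpa using this

lemma monomial_mem_toricRing {e : Fin 2 →₀ ℕ} (he : e ∈ toricMonoid w₁ w₂) (c : ℂ) :
    (monomial e c : R) ∈ toricRing w₁ w₂ := by
  classical
  intro d hd
  rw [MvPowerSeries.coeff_monomial] at hd
  split_ifs at hd with h
  · rwa [h]
  · exact absurd rfl hd

/-- The monomials whose exponents lie in a set of exponents. -/
def tmonSet (w₁ w₂ : ℤ × ℤ) (I : Set (Fin 2 →₀ ℕ)) : Set (toricRing w₁ w₂) :=
  {g | ∃ e ∈ I, (g : R) = monomial e 1}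

/-- Dickson's lemma, for sets of exponents. -/
lemma exists_finite_minimal (I : Set (Fin 2 →₀ ℕ)) :
    ∃ I₀ : Set (Fin 2 →₀ ℕ), I₀.Finite ∧ I₀ ⊆ I ∧ ∀ e ∈ I, ∃ d ∈ I₀, d ≤ e := by
  refine ⟨{e | Minimal (· ∈ I) e}, ?_, fun e he => he.1, fun e he => ?_⟩
  · exact WellQuasiOrderedLE.finite_of_isAntichain (setOfPred_minimal_antichain _)
  · obtain ⟨d, hd, hm⟩ := exists_minimal_le_of_wellFoundedLT (· ∈ I) e he
    exact ⟨d, hm, hd⟩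

/-- A series whose exponents lie in `I` belongs to the ideal generated by the monomials with
exponents in `I`. -/
lemma mem_span_tmonSet {I : Set (Fin 2 →₀ ℕ)} (hI : I ⊆ toricMonoid w₁ w₂) {g : toricRing w₁ w₂}
    (hg : ∀ e, coeff e (g : R) ≠ 0 → e ∈ I) : g ∈ span (tmonSet w₁ w₂ I) := by
  classical
  obtain ⟨I₀, hfin, hsub, hmin⟩ := exists_finite_minimal I
  choose! pick hpick hle using hmin
  let s : (Fin 2 →₀ ℕ) → R := fun d => fun e => if d + e ∈ I ∧ pick (d + e) = d then coeff (d + e) (g : R) else 0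
  have hs : ∀ d e, coeff e (s d) =
      if d + e ∈ I ∧ pick (d + e) = d then coeff (d + e) (g : R) else 0 := fun _ _ => rfl
  have hst : ∀ d ∈ I₀, s d ∈ toricRing w₁ w₂ := by
    intro d hd e he
    rw [hs] at he
    split_ifs at he with h
    · have := hI h.1
      rw [add_comm] at this
      exact mem_toricMonoid_of_add this (hI (hsub hd))
    · exact absurd rfl he
  have hsum : (g : R) = ∑ d ∈ hfin.toFinset, monomial d 1 * s d := by
    ext e
    rw [map_sum]
    simp only [MvPowerSeries.coeff_monomial_mul, hs, one_mul]
    by_cases he : e ∈ I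
    · rw [Finset.sum_eq_single (pick e)]
      · rw [if_pos (hle e he), add_tsub_cancel_of_le (hle e he), if_pos ⟨he, rfl⟩]
      · intro d _ hd
        split_ifs with h1 h2
        · rw [add_tsub_cancel_of_le h1] at h2
          exact absurd h2.2.symm hd
        · rfl
        · rfl
      · intro h
        exact absurd (hfin.mem_toFinset.2 (hpick e he)) h
    · rw [Finset.sum_eq_zero]
      · by_contra hc
        exact he (hg e hc)
      · intro d _
        split_ifs with h1 h2
        · rw [add_tsub_cancel_of_le h1] at h2
          exact absurd h2.1 he
        · rfl
        · rfl
  have hsum' : g = ∑ d ∈ hfin.toFinset.attach,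
      (⟨monomial d 1, monomial_mem_toricRing (hI (hsub (hfin.mem_toFinset.1 d.2))) 1⟩ : toricRing w₁ w₂) *
        ⟨s d, hst d (hfin.mem_toFinset.1 d.2)⟩ := by
    apply Subtype.ext
    rw [hsum]
    push_cast
    rw [← Finset.sum_attach]
  rw [hsum']
  refine sum_mem fun d _ => Ideal.mul_mem_right _ _ (Ideal.subset_span ?_)
  exact ⟨d, hsub (hfin.mem_toFinset.1 d.2), rfl⟩

lemma mem_toricMaximalIdeal {g : toricRing w₁ w₂} :
    g ∈ toricMaximalIdeal w₁ w₂ ↔ constantCoeff (g : R) = 0 := by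
  unfold toricMaximalIdeal; rw [RingHom.mem_ker]; rfl

/-- The set of sums of `n` nonzero exponents (and of any exponent). -/
def expPow (w₁ w₂ : ℤ × ℤ) : ℕ → Set (Fin 2 →₀ ℕ)
  | 0 => toricMonoid w₁ w₂
  | n + 1 => {e | ∃ d ∈ toricMonoid w₁ w₂, d ≠ 0 ∧ ∃ c ∈ expPow w₁ w₂ n, e = d + c}

lemma expPow_subset (n : ℕ) : expPow w₁ w₂ n ⊆ toricMonoid w₁ w₂ := by
  induction n with
  | zero => exact le_rfl
  | succ n ih =>
    rintro _ ⟨d, hd, -, c, hc, rfl⟩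
    exact add_mem hd (ih hc)

lemma coeff_mem_expPow {n : ℕ} {g : toricRing w₁ w₂} (hg : g ∈ toricMaximalIdeal w₁ w₂ ^ n) (e : Fin 2 →₀ ℕ)
    (he : coeff e (g : R) ≠ 0) : e ∈ expPow w₁ w₂ n := by
  classical
  induction n generalizing g e with
  | zero => exact g.2 e he
  | succ n ih =>
    rw [pow_succ'] at hg
    induction hg using Submodule.mul_induction_on' generalizing e with
    | mem_mul_mem y hy z hz =>
      have he' : coeff e ((y : R) * (z : R)) ≠ 0 := he
      rw [MvPowerSeries.coeff_mul] at he'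
      obtain ⟨p, hp, hne⟩ := Finset.exists_ne_zero_of_sum_ne_zero he'
      refine ⟨p.1, y.2 _ (left_ne_zero_of_mul hne), ?_, p.2, ih hz _ (right_ne_zero_of_mul hne),
        (Finset.HasAntidiagonal.mem_antidiagonal.mp hp).symm⟩
      intro h0
      rw [mem_toricMaximalIdeal] at hy
      rw [h0] at hne
      exact left_ne_zero_of_mul hne hy
    | add y hy z hz ihy ihz =>
      have he' : coeff e ((y : R) + (z : R)) ≠ 0 := he
      rw [map_add] at he'
      by_cases h : coeff e (y : R) = 0
      · exact ihz e (by intro h'; exact he' (by rw [h, h', add_zero]))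
      · exact ihy e h

/-- A series of `R` which is a quotient of elements of the toric ring lies in the toric ring. -/
lemma mem_toricRing_of_mul {t g : R} (ht : t ∈ toricRing w₁ w₂) (h0 : t ≠ 0) (hs : t * g ∈ toricRing w₁ w₂) :
    g ∈ toricRing w₁ w₂ := by
  classical
  -- `g'` is the part of `g` whose exponents lie outside of the toric monoid
  let g' : R := fun e => if e ∈ toricMonoid w₁ w₂ then 0 else coeff e g
  have hg' : ∀ e, coeff e g' = if e ∈ toricMonoid w₁ w₂ then 0 else coeff e g := fun _ => rfl
  have h1 : g - g' ∈ toricRing w₁ w₂ := by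
    intro e he
    by_contra hc
    apply he
    rw [map_sub, hg', if_neg hc, sub_self]
  have h2 : t * g' = 0 := by
    have h3 : t * g' ∈ toricRing w₁ w₂ := by
      have : t * g' = t * g - t * (g - g') := by ring
      rw [this]; exact sub_mem hs (mul_mem ht h1)
    ext e
    rw [map_zero]
    by_contra hc
    have he := h3 e hc
    rw [MvPowerSeries.coeff_mul] at hc
    obtain ⟨p, hp, hne⟩ := Finset.exists_ne_zero_of_sum_ne_zero hc
    have hp1 := ht _ (left_ne_zero_of_mul hne)
    have hp2 := right_ne_zero_of_mul hne
    rw [hg'] at hp2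
    split_ifs at hp2 with h4
    · exact hp2 rfl
    · rw [← Finset.HasAntidiagonal.mem_antidiagonal.mp hp, add_comm] at he
      exact h4 (mem_toricMonoid_of_add he hp1)
  have h3 : g' = 0 := (mul_eq_zero.1 h2).resolve_left h0
  rwa [h3, sub_zero] at h1

end ToricRing

/-- `ψ` identifies the completion of the local ring `Q` with the completed local ring of an affine
toric surface at its fixed point. -/
structure ToricAt (Q : LocalSubring K) (w₁ w₂ : ℤ × ℤ) (ψ : K →+* K) : Prop where
  base : RK ≤ Q.toSubring
  noeth : IsNoetherianRing Q.toSubring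
  res : ∀ x ∈ Q.toSubring, ∃ c : ℂ, x - algebraMap ℂ K c ∈ mI Q
  const : ∀ c : ℂ, ψ (algebraMap ℂ K c) = algebraMap ℂ K c
  maps : ∀ x ∈ Q.toSubring, ∃ g ∈ toricRing w₁ w₂, algebraMap R K g = ψ x
  monos : ∀ e ∈ toricMonoid w₁ w₂, ∃ x ∈ Q.toSubring, ψ x = algebraMap R K (monomial e 1)
  gen : maximalIdeal Q.toSubring ≤ span {y : Q.toSubring | ∃ e ∈ toricMonoid w₁ w₂, e ≠ 0 ∧
    ψ (y : K) = algebraMap R K (monomial e 1)}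

namespace ToricAt
variable {Q : LocalSubring K} {w₁ w₂ : ℤ × ℤ} {ψ : K →+* K} (h : ToricAt Q w₁ w₂ ψ)

/-- The completion homomorphism. -/
def hom : Q.toSubring →+* toricRing w₁ w₂ where
  toFun x := ⟨(h.maps x x.2).choose, (h.maps x x.2).choose_spec.1⟩
  map_zero' := Subtype.ext (algebraMap_injective (by
    rw [(h.maps _ (0 : Q.toSubring).2).choose_spec.2]; simp))
  map_one' := Subtype.ext (algebraMap_injective (by
    rw [(h.maps _ (1 : Q.toSubring).2).choose_spec.2]; simp))
  map_add' x y := Subtype.ext (algebraMap_injective (by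
    rw [(h.maps _ (x + y).2).choose_spec.2, Subring.coe_add, map_add, Subring.coe_add, map_add,
      (h.maps _ x.2).choose_spec.2, (h.maps _ y.2).choose_spec.2]))
  map_mul' x y := Subtype.ext (algebraMap_injective (by
    rw [(h.maps _ (x * y).2).choose_spec.2, Subring.coe_mul, map_mul, Subring.coe_mul, map_mul,
      (h.maps _ x.2).choose_spec.2, (h.maps _ y.2).choose_spec.2]))

lemma hom_spec (x : Q.toSubring) : algebraMap R K (h.hom x : R) = ψ x := (h.maps x x.2).choose_spec.2

lemma hom_eq {x : Q.toSubring} {g : R} (hx : ψ x = algebraMap R K g) : (h.hom x : R) = g :=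
  algebraMap_injective (by rw [h.hom_spec, hx])

lemma hom_injective : Function.Injective h.hom := by
  intro x y hxy
  have := congrArg (fun g : toricRing w₁ w₂ => algebraMap R K (g : R)) hxy
  simp only [h.hom_spec] at this
  exact Subtype.ext (ψ.injective this)

open Classical in
/-- The element of `Q` the expansion of which is the monomial of exponent `e`. -/
def chi (e : Fin 2 →₀ ℕ) : Q.toSubring :=
  if he : e ∈ toricMonoid w₁ w₂ then ⟨(h.monos e he).choose, (h.monos e he).choose_spec.1⟩ else 0

lemma psi_chi {e : Fin 2 →₀ ℕ} (he : e ∈ toricMonoid w₁ w₂) :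
    ψ (h.chi e) = algebraMap R K (monomial e 1) := by
  rw [chi, dif_pos he]; exact (h.monos e he).choose_spec.2

lemma hom_chi {e : Fin 2 →₀ ℕ} (he : e ∈ toricMonoid w₁ w₂) : (h.hom (h.chi e) : R) = monomial e 1 :=
  h.hom_eq (h.psi_chi he)

lemma eq_chi {e : Fin 2 →₀ ℕ} (he : e ∈ toricMonoid w₁ w₂) {y : K}
    (hy : ψ y = algebraMap R K (monomial e 1)) : y = h.chi e :=
  ψ.injective (by rw [hy, h.psi_chi he])

lemma chi_add {e d : Fin 2 →₀ ℕ} (he : e ∈ toricMonoid w₁ w₂) (hd : d ∈ toricMonoid w₁ w₂) :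
    h.chi (e + d) = h.chi e * h.chi d := by
  apply h.hom_injective
  apply Subtype.ext
  rw [map_mul, Subring.coe_mul, h.hom_chi he, h.hom_chi hd, h.hom_chi (add_mem he hd),
    MvPowerSeries.monomial_mul_monomial, mul_one]

lemma hom_const (c : ℂ) (hc : algebraMap ℂ K c ∈ Q.toSubring) : (h.hom ⟨algebraMap ℂ K c, hc⟩ : R) = MvPowerSeries.C c := by
  apply h.hom_eq
  rw [← algebraMap_eq_C]; exact h.const c

/-- A unit of the toric ring is not in the image of the maximal ideal. -/
lemma mem_maximal_iff (x : Q.toSubring) : h.hom x ∈ toricMaximalIdeal w₁ w₂ ↔ x ∈ maximalIdeal Q.toSubring := by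
  constructor
  · intro hx
    rw [mem_maximalIdeal, mem_nonunits_iff]
    intro hu
    have h1 := Ideal.eq_top_of_isUnit_mem _ hx (hu.map h.hom)
    have h2 : (1 : toricRing w₁ w₂) ∈ toricMaximalIdeal w₁ w₂ := h1 ▸ Submodule.mem_top
    rw [mem_toricMaximalIdeal] at h2
    simp at h2
  · intro hx
    have h1 := h.gen hx
    have h2 : span {y : Q.toSubring | ∃ e ∈ toricMonoid w₁ w₂, e ≠ 0 ∧
        ψ (y : K) = algebraMap R K (monomial e 1)} ≤ (toricMaximalIdeal w₁ w₂).comap h.hom := by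
      rw [Ideal.span_le]
      rintro y ⟨e, he, h0, hy⟩
      rw [SetLike.mem_coe, Ideal.mem_comap, mem_toricMaximalIdeal, h.hom_eq hy]
      classical
      rw [← MvPowerSeries.coeff_zero_eq_constantCoeff_apply, MvPowerSeries.coeff_monomial, if_neg (Ne.symm h0)]
    exact h2 h1

lemma hom_mem_pow {n : ℕ} {x : Q.toSubring} (hx : x ∈ maximalIdeal Q.toSubring ^ n) :
    h.hom x ∈ toricMaximalIdeal w₁ w₂ ^ n := by
  have h1 : (maximalIdeal Q.toSubring).map h.hom ≤ toricMaximalIdeal w₁ w₂ := by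
    rw [Ideal.map_le_iff_le_comap]
    intro y hy
    exact (h.mem_maximal_iff y).2 hy
  have h2 := Ideal.mem_map_of_mem h.hom hx
  rw [Ideal.map_pow] at h2
  exact Ideal.pow_right_mono h1 n h2

lemma chi_mem_pow {n : ℕ} {e : Fin 2 →₀ ℕ} (he : e ∈ expPow w₁ w₂ n) : h.chi e ∈ maximalIdeal Q.toSubring ^ n := by
  classical
  induction n generalizing e with
  | zero => simp
  | succ n ih =>
    obtain ⟨d, hd, hd0, c, hc, rfl⟩ := he
    rw [h.chi_add hd (expPow_subset n hc), pow_succ']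
    refine Ideal.mul_mem_mul ?_ (ih hc)
    rw [← h.mem_maximal_iff, mem_toricMaximalIdeal, h.hom_chi hd, ← MvPowerSeries.coeff_zero_eq_constantCoeff_apply,
      MvPowerSeries.coeff_monomial, if_neg (Ne.symm hd0)]

lemma chi_zero : h.chi 0 = 1 := by
  apply h.hom_injective
  apply Subtype.ext
  rw [h.hom_chi (zero_mem _)]
  exact (congrArg Subtype.val (map_one h.hom)).symm

/-- A linear combination of monomials, as an element of `Q`. -/
def lin (c : (Fin 2 →₀ ℕ) →₀ ℂ) : Q.toSubring := c.sum fun e z => constHom h.base z * h.chi e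

lemma lin_add (c d : (Fin 2 →₀ ℕ) →₀ ℂ) : h.lin (c + d) = h.lin c + h.lin d :=
  Finsupp.sum_add_index' (by simp) (by intros; rw [map_add, add_mul])

lemma lin_single (e : Fin 2 →₀ ℕ) (z : ℂ) : h.lin (Finsupp.single e z) = constHom h.base z * h.chi e :=
  Finsupp.sum_single_index (by simp)

lemma exists_lin_mul_chi {c : (Fin 2 →₀ ℕ) →₀ ℂ} (hc : ∀ e, c e ≠ 0 → e ∈ toricMonoid w₁ w₂)
    {d : Fin 2 →₀ ℕ} (hd : d ∈ toricMonoid w₁ w₂) : ∃ c' : (Fin 2 →₀ ℕ) →₀ ℂ,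
      (∀ e, c' e ≠ 0 → e ∈ toricMonoid w₁ w₂) ∧ h.lin c' = h.lin c * h.chi d := by
  classical
  refine ⟨c.mapDomain (· + d), fun e he => ?_, ?_⟩
  · obtain ⟨e', he', rfl⟩ := Finset.mem_image.1 (Finsupp.mapDomain_support (Finsupp.mem_support_iff.2 he))
    exact add_mem (hc _ (Finsupp.mem_support_iff.1 he')) hd
  · rw [lin, Finsupp.sum_mapDomain_index (by simp) (by intros; rw [map_add, add_mul]), lin, Finsupp.sum, Finsupp.sum,
      Finset.sum_mul]
    refine Finset.sum_congr rfl fun e he => ?_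
    rw [h.chi_add (hc _ (Finsupp.mem_support_iff.1 he)) hd, mul_assoc]

lemma coeff_hom_lin {c : (Fin 2 →₀ ℕ) →₀ ℂ} (hc : ∀ e, c e ≠ 0 → e ∈ toricMonoid w₁ w₂) (e : Fin 2 →₀ ℕ) :
    coeff e (h.hom (h.lin c) : R) = c e := by
  classical
  have h1 : (h.hom (h.lin c) : R) = c.sum fun d z => monomial d z := by
    rw [lin, Finsupp.sum, map_sum, Finsupp.sum]
    push_cast
    refine Finset.sum_congr rfl fun d hd => ?_
    rw [map_mul, Subring.coe_mul, h.hom_chi (hc _ (Finsupp.mem_support_iff.1 hd))]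
    have : (h.hom (constHom h.base (c d)) : R) = MvPowerSeries.C (c d) := h.hom_const (c d) _
    rw [this, ← MvPowerSeries.monomial_zero_eq_C_apply, MvPowerSeries.monomial_mul_monomial, zero_add, mul_one]
  rw [h1, Finsupp.sum, map_sum]
  simp only [MvPowerSeries.coeff_monomial]
  rw [Finset.sum_ite_eq]
  split_ifs with h2
  · rfl
  · exact (Finsupp.notMem_support_iff.1 h2).symm

/-- Every element of `Q` is, modulo any power of the maximal ideal, a linear combination of monomials. -/
lemma exists_approx (n : ℕ) (x : Q.toSubring) :
    ∃ c : (Fin 2 →₀ ℕ) →₀ ℂ, (∀ e, c e ≠ 0 → e ∈ toricMonoid w₁ w₂) ∧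
      x - h.lin c ∈ maximalIdeal Q.toSubring ^ n := by
  classical
  induction n generalizing x with
  | zero => exact ⟨0, by simp, by simp⟩
  | succ n ih =>
    let T : Set (Q.toSubring) := {x | ∃ c : (Fin 2 →₀ ℕ) →₀ ℂ, (∀ e, c e ≠ 0 → e ∈ toricMonoid w₁ w₂) ∧
      x - h.lin c ∈ maximalIdeal Q.toSubring ^ (n + 1)}
    have hadd : ∀ x ∈ T, ∀ y ∈ T, x + y ∈ T := by
      rintro x ⟨c, hc, hx⟩ y ⟨d, hd, hy⟩
      refine ⟨c + d, fun e he => ?_, ?_⟩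
      · by_cases h0 : c e = 0
        · exact hd e (by intro h1; exact he (by simp [h0, h1]))
        · exact hc e h0
      · rw [h.lin_add, add_sub_add_comm]; exact add_mem hx hy
    have hmax : ∀ x ∈ maximalIdeal Q.toSubring, ∀ r, r * x ∈ T := by
      intro x hx
      have := h.gen hx
      clear hx
      induction this using Submodule.span_induction with
      | mem y hy =>
        intro r
        obtain ⟨e, he, he0, hy⟩ := hy
        obtain ⟨c, hc, hrc⟩ := ih r
        obtain ⟨c', hc', hcc⟩ := h.exists_lin_mul_chi hc he
        refine ⟨c', hc', ?_⟩
        have hy' : y = h.chi e := Subtype.ext (h.eq_chi he hy)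
        rw [hcc, hy', ← sub_mul, pow_succ]
        refine Ideal.mul_mem_mul hrc ?_
        have : h.chi e ∈ maximalIdeal Q.toSubring ^ 1 :=
          h.chi_mem_pow (n := 1) ⟨e, he, he0, 0, zero_mem _, by simp⟩
        simpa using this
      | zero => intro r; exact ⟨0, by simp, by simp [lin]⟩
      | add x y _ _ ihx ihy => intro r; rw [mul_add]; exact hadd _ (ihx r) _ (ihy r)
      | smul s y _ ihy => intro r; rw [smul_eq_mul, ← mul_assoc]; exact ihy _
    obtain ⟨c, hc⟩ := constHom_res h.base h.res x
    have h1 : constHom h.base c ∈ T := by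
      refine ⟨Finsupp.single 0 c, fun d hd => ?_, ?_⟩
      · rw [Finsupp.single_apply] at hd
        split_ifs at hd with h1
        · rw [← h1]; exact zero_mem _
        · exact absurd rfl hd
      · rw [h.lin_single, h.chi_zero, mul_one, sub_self]
        exact zero_mem _
    have := hadd _ (hmax _ hc 1) _ h1
    rwa [one_mul, sub_add_cancel] at this

/-- An ideal generated by monomials is closed: it is determined by the exponents of the
expansions. -/
lemma mem_span_chi {I : Set (Fin 2 →₀ ℕ)} {x : Q.toSubring}
    (hx : ∀ e, coeff e (h.hom x : R) ≠ 0 → e ∈ I) : x ∈ span (h.chi '' I) := by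
  have := h.noeth
  refine mem_of_forall_mem_sup_pow _ fun n => ?_
  obtain ⟨c, hc, hxc⟩ := h.exists_approx n x
  have h1 : h.lin c ∈ span (h.chi '' I) ⊔ maximalIdeal Q.toSubring ^ n := by
    rw [lin]
    refine sum_mem fun e he => Ideal.mul_mem_left _ _ ?_
    by_cases hI : e ∈ I
    · exact Ideal.mem_sup_left (Ideal.subset_span ⟨e, hI, rfl⟩)
    · refine Ideal.mem_sup_right (h.chi_mem_pow ?_)
      have h2 := coeff_mem_expPow (h.hom_mem_pow hxc) e
      rw [map_sub, AddSubgroupClass.coe_sub, map_sub, h.coeff_hom_lin hc] at h2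
      apply h2
      have h3 : coeff e (h.hom x : R) = 0 := by
        by_contra hcon; exact hI (hx e hcon)
      rw [h3, zero_sub, neg_ne_zero]
      exact Finsupp.mem_support_iff.1 he
  have := Ideal.add_mem _ (Ideal.mem_sup_right hxc) h1
  rwa [sub_add_cancel] at this

lemma hom_mem_pow_iff (n : ℕ) (x : Q.toSubring) :
    h.hom x ∈ toricMaximalIdeal w₁ w₂ ^ n ↔ x ∈ maximalIdeal Q.toSubring ^ n := by
  refine ⟨fun hx => ?_, h.hom_mem_pow⟩
  have h1 := h.mem_span_chi fun e he => coeff_mem_expPow hx e he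
  refine (Ideal.span_le.2 ?_) h1
  rintro _ ⟨e, he, rfl⟩
  exact h.chi_mem_pow he

lemma exists_sub_hom_mem (n : ℕ) (y : toricRing w₁ w₂) : ∃ x, y - h.hom x ∈ toricMaximalIdeal w₁ w₂ ^ n := by
  classical
  induction n generalizing y with
  | zero => exact ⟨0, by simp⟩
  | succ n ih =>
    let T : Set (toricRing w₁ w₂) := {y | ∃ x, y - h.hom x ∈ toricMaximalIdeal w₁ w₂ ^ (n + 1)}
    have hadd : ∀ x ∈ T, ∀ y ∈ T, x + y ∈ T := by
      rintro x ⟨c, hx⟩ y ⟨d, hy⟩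
      exact ⟨c + d, by rw [map_add, add_sub_add_comm]; exact add_mem hx hy⟩
    have hspan : ∀ y ∈ span (tmonSet w₁ w₂ {e | e ∈ toricMonoid w₁ w₂ ∧ e ≠ 0}), ∀ r, r * y ∈ T := by
      intro y hy
      induction hy using Submodule.span_induction with
      | mem y hy =>
        intro r
        obtain ⟨e, ⟨he, he0⟩, hy⟩ := hy
        obtain ⟨x, hx⟩ := ih r
        refine ⟨x * h.chi e, ?_⟩
        have hy' : y = h.hom (h.chi e) := Subtype.ext (by rw [hy, h.hom_chi he])
        rw [map_mul, hy', ← sub_mul, pow_succ]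
        refine Ideal.mul_mem_mul hx ?_
        have : h.chi e ∈ maximalIdeal Q.toSubring ^ 1 :=
          h.chi_mem_pow (n := 1) ⟨e, he, he0, 0, zero_mem _, by simp⟩
        rw [pow_one] at this
        exact (h.mem_maximal_iff _).2 this
      | zero => intro r; exact ⟨0, by simp⟩
      | add x y _ _ ihx ihy => intro r; rw [mul_add]; exact hadd _ (ihx r) _ (ihy r)
      | smul s y _ ihy => intro r; rw [smul_eq_mul, ← mul_assoc]; exact ihy _
    set c := constantCoeff (y : R)
    let k : toricRing w₁ w₂ := h.hom (constHom h.base c)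
    have hk : (k : R) = MvPowerSeries.C c := h.hom_const c _
    have h1 : y - k ∈ T := by
      have := hspan (y - k) (mem_span_tmonSet (fun e he => he.1) fun e he => ⟨(y - k).2 e he, ?_⟩) 1
      · rwa [one_mul] at this
      · rintro rfl
        apply he
        rw [MvPowerSeries.coeff_zero_eq_constantCoeff_apply, AddSubgroupClass.coe_sub, hk, map_sub, MvPowerSeries.constantCoeff_C,
          sub_self]
    have := hadd _ h1 k ⟨constHom h.base c, by simp [k]⟩
    rwa [sub_add_cancel] at this

/-- The elements of `K` with a formal power series as expansion belong to `Q`. -/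
lemma mem_of_psi (h : ToricAt Q w₁ w₂ ψ) {x : K} {g : R} (hx : ψ x = algebraMap R K g) : x ∈ Q.toSubring := by
  have := h.noeth
  obtain ⟨s, hs, t, ht, rfl⟩ := exists_frac x
  have hs := h.base hs
  have ht := h.base ht
  by_cases ht0 : t = 0
  · rw [ht0]; simp [zero_mem]
  rw [map_mul, map_inv₀] at hx
  have hψt : ψ t ≠ 0 := (map_ne_zero ψ).2 ht0
  have h1 : (h.hom ⟨t, ht⟩ : R) * g = h.hom ⟨s, hs⟩ := by
    apply algebraMap_injective
    rw [map_mul, h.hom_spec, h.hom_spec, ← hx]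
    field_simp
  have hg : g ∈ toricRing w₁ w₂ := by
    refine mem_toricRing_of_mul (h.hom ⟨t, ht⟩).2 ?_ (h1 ▸ (h.hom ⟨s, hs⟩).2)
    intro h0
    apply hψt
    have := h.hom_spec ⟨t, ht⟩
    rw [h0, map_zero] at this
    exact this.symm
  have h2 : (⟨s, hs⟩ : Q.toSubring) ∈ span {(⟨t, ht⟩ : Q.toSubring)} := by
    refine mem_of_forall_mem_sup_pow _ fun n => ?_
    obtain ⟨r, hr⟩ := h.exists_sub_hom_mem n ⟨g, hg⟩
    have h3 : (⟨s, hs⟩ - ⟨t, ht⟩ * r : Q.toSubring) ∈ maximalIdeal Q.toSubring ^ n := by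
      rw [← h.hom_mem_pow_iff]
      have : h.hom (⟨s, hs⟩ - ⟨t, ht⟩ * r) = h.hom ⟨t, ht⟩ * (⟨g, hg⟩ - h.hom r) := by
        rw [map_sub, map_mul, mul_sub]
        congr 1
        exact Subtype.ext h1.symm
      rw [this]
      exact Ideal.mul_mem_left _ _ hr
    have := Ideal.add_mem _ (Ideal.mem_sup_right h3) (Ideal.mem_sup_left (T := maximalIdeal Q.toSubring ^ n)
      (Ideal.mul_mem_right r _ (mem_span_singleton_self (⟨t, ht⟩ : Q.toSubring))))
    rwa [sub_add_cancel] at this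
  obtain ⟨r, hr⟩ := mem_span_singleton.1 h2
  have h3 : s = t * r := congrArg Subtype.val hr
  have : s * t⁻¹ = r := by rw [h3]; field_simp
  rw [this]; exact r.2

lemma isIntegrallyClosed (h : ToricAt Q w₁ w₂ ψ) : IsIntegrallyClosed Q.toSubring := by
  have := isFractionRing_of_base h.base
  rw [isIntegrallyClosed_iff K]
  intro x hx
  obtain ⟨p, hp, hpx⟩ := hx
  have h1 : IsIntegral R (ψ x) := by
    let f : Q.toSubring →+* R := (toricRing w₁ w₂).subtype.comp h.hom
    refine ⟨p.map f, hp.map f, ?_⟩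
    have h2 : (algebraMap R K).comp f = ψ.comp (algebraMap Q.toSubring K) := by
      ext y; exact h.hom_spec y
    rw [Polynomial.eval₂_map, h2, ← Polynomial.hom_eval₂, hpx, map_zero]
  obtain ⟨g, hg⟩ := IsIntegrallyClosed.isIntegral_iff.1 h1
  exact ⟨⟨x, h.mem_of_psi hg.symm⟩, rfl⟩

/-- A toric point, with the boundary the ideal of which is given by the vanishing of some of
the coordinates, has a toric chart. -/
lemma hasToricChart {D : Set (LocalSubring K)} {J : Set (Fin 2)} (hw₁ : IsCoprime w₁.1 w₁.2)
    (hw₂ : IsCoprime w₂.1 w₂.2) (hd : det w₁ w₂ ≠ 0) (hJ : J = Set.univ ∨ (det w₁ w₂).natAbs = 1)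
    (hD : ∀ x : Q.toSubring, x ∈ idealAt Q D ↔ ∀ j ∈ J, MvPowerSeries.X j ∣ (h.hom x : R)) : HasToricChart Q D := by
  classical
  refine ⟨w₁, w₂, J, h.hom, hw₁, hw₂, hd, hJ, fun c x hx => ?_, h.hom_mem_pow_iff, h.exists_sub_hom_mem, ?_⟩
  · apply h.hom_eq
    rw [hx, h.const, algebraMap_eq_C]
  have hb : ∀ g : toricRing w₁ w₂, g ∈ toricBoundaryIdeal w₁ w₂ J ↔ ∀ j ∈ J, MvPowerSeries.X j ∣ (g : R) := by
    intro g
    unfold toricBoundaryIdeal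
    rw [Ideal.mem_comap]
    simp only [Ideal.mem_iInf, mem_span_singleton]
    rfl
  apply le_antisymm
  · rw [Ideal.map_le_iff_le_comap]
    intro x hx
    rw [Ideal.mem_comap, hb]
    exact (hD x).1 hx
  · intro g hg
    rw [hb] at hg
    have h1 : ∀ e, coeff e (g : R) ≠ 0 → e ∈ {e | e ∈ toricMonoid w₁ w₂ ∧ ∀ j ∈ J, e j ≠ 0} := by
      intro e he
      refine ⟨g.2 e he, fun j hj h0 => he ?_⟩
      exact MvPowerSeries.X_dvd_iff.1 (hg j hj) e h0
    refine (Ideal.span_le.2 ?_) (mem_span_tmonSet (fun e he => he.1) h1)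
    rintro y ⟨e, ⟨he, hej⟩, hy⟩
    have hy' : y = h.hom (h.chi e) := Subtype.ext (by rw [hy, h.hom_chi he])
    rw [hy']
    refine Ideal.mem_map_of_mem _ ((hD _).2 fun j hj => ?_)
    rw [h.hom_chi he, MvPowerSeries.X_dvd_iff]
    intro m hm
    rw [MvPowerSeries.coeff_monomial, if_neg]
    rintro rfl
    exact hej j hj hm

end ToricAt

/-! ### Expansions in local coordinates and monomial changes of variables -/

/-- The Laurent monomial `a ^ m₁ * b ^ m₂`. -/
def mon (a b : K) (m : ℤ × ℤ) : K := a ^ m.1 * b ^ m.2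

lemma mon_add {a b : K} (ha : a ≠ 0) (hb : b ≠ 0) (m n : ℤ × ℤ) : mon a b (m + n) = mon a b m * mon a b n := by
  simp only [mon, Prod.fst_add, Prod.snd_add, zpow_add₀ ha, zpow_add₀ hb]; ring

lemma mon_zero (a b : K) : mon a b 0 = 1 := by simp [mon]

lemma mon_neg (a b : K) (m : ℤ × ℤ) : mon a b (-m) = (mon a b m)⁻¹ := by
  simp [mon, zpow_neg, mul_comm]

lemma mon_ne_zero {a b : K} (ha : a ≠ 0) (hb : b ≠ 0) (m : ℤ × ℤ) : mon a b m ≠ 0 :=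
  mul_ne_zero (zpow_ne_zero _ ha) (zpow_ne_zero _ hb)

/-- The value of the linear form `w` at `m`. -/
def wdot (w m : ℤ × ℤ) : ℤ := w.1 * m.1 + w.2 * m.2

lemma wdot_add (w m n : ℤ × ℤ) : wdot w (m + n) = wdot w m + wdot w n := by simp [wdot]; ring
lemma wdot_neg (w m : ℤ × ℤ) : wdot w (-m) = - wdot w m := by simp [wdot]; ring

/-- The weights `w₁`, `w₂` generate a two-dimensional cone of the quadrant, and are positively
ordered. -/
structure IsCone (w₁ w₂ : ℤ × ℤ) : Prop where
  n11 : 0 ≤ w₁.1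
  n12 : 0 ≤ w₁.2
  n21 : 0 ≤ w₂.1
  n22 : 0 ≤ w₂.2
  det_pos : 0 < det w₁ w₂

lemma IsCone.wdot_ext {w₁ w₂ : ℤ × ℤ} (h : IsCone w₁ w₂) {m n : ℤ × ℤ} (h1 : wdot w₁ m = wdot w₁ n)
    (h2 : wdot w₂ m = wdot w₂ n) : m = n := by
  have hd := h.det_pos
  unfold det at hd
  simp only [wdot] at h1 h2
  have e1 : (w₁.1 * w₂.2 - w₁.2 * w₂.1) * (m.1 - n.1) = 0 := by linear_combination w₂.2 * h1 - w₁.2 * h2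
  have e2 : (w₁.1 * w₂.2 - w₁.2 * w₂.1) * (m.2 - n.2) = 0 := by linear_combination w₁.1 * h2 - w₂.1 * h1
  have := (mul_eq_zero.1 e1).resolve_left hd.ne'
  have := (mul_eq_zero.1 e2).resolve_left hd.ne'
  ext <;> omega

/-- The exponent `d`, as an integral vector. -/
def toInt (d : Fin 2 →₀ ℕ) : ℤ × ℤ := (d 0, d 1)

/-- The map `m ↦ (w₁ ⬝ m, w₂ ⬝ m)` on nonnegative exponents. -/
def conv (w₁ w₂ : ℤ × ℤ) (d : Fin 2 →₀ ℕ) : Fin 2 →₀ ℕ :=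
  ex (wdot w₁ (toInt d)).toNat (wdot w₂ (toInt d)).toNat

section Cone
variable {w₁ w₂ : ℤ × ℤ}

lemma IsCone.conv_zero (h : IsCone w₁ w₂) (d : Fin 2 →₀ ℕ) : ((conv w₁ w₂ d) 0 : ℤ) = wdot w₁ (toInt d) := by
  have h1 := h.n11; have h2 := h.n12
  rw [conv, ex_zero]; apply Int.toNat_of_nonneg
  simp only [wdot, toInt]; positivity

lemma IsCone.conv_one (h : IsCone w₁ w₂) (d : Fin 2 →₀ ℕ) : ((conv w₁ w₂ d) 1 : ℤ) = wdot w₂ (toInt d) := by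
  have h1 := h.n21; have h2 := h.n22
  rw [conv, ex_one]; apply Int.toNat_of_nonneg
  simp only [wdot, toInt]; positivity

lemma IsCone.conv_injective (h : IsCone w₁ w₂) : Function.Injective (conv w₁ w₂) := by
  intro d e hde
  have h1 := h.conv_zero d; have h2 := h.conv_one d
  rw [hde, h.conv_zero] at h1
  rw [hde, h.conv_one] at h2
  have := h.wdot_ext h1 h2
  simp only [toInt, Prod.mk.injEq, Nat.cast_inj] at this
  ext i; fin_cases i
  · exact this.1.symm
  · exact this.2.symm

lemma IsCone.conv_mem (h : IsCone w₁ w₂) (d : Fin 2 →₀ ℕ) : conv w₁ w₂ d ∈ toricMonoid w₁ w₂ :=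
  ⟨toInt d, h.conv_zero d, h.conv_one d⟩

/-- The images of the variables by the monomial substitution defined by a cone. -/
def subVars (w₁ w₂ : ℤ × ℤ) (i : Fin 2) : R := monomial (conv w₁ w₂ (Finsupp.single i 1)) 1

lemma IsCone.hasSubst (h : IsCone w₁ w₂) : MvPowerSeries.HasSubst (subVars w₁ w₂) := by
  classical
  refine MvPowerSeries.hasSubst_of_constantCoeff_zero fun i => ?_
  rw [subVars, ← MvPowerSeries.coeff_zero_eq_constantCoeff_apply, MvPowerSeries.coeff_monomial, if_neg]
  intro h0
  have h1 : conv w₁ w₂ 0 = 0 := by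
    ext j
    fin_cases j
    · have := h.conv_zero 0; simp [toInt, wdot] at this; simpa using this
    · have := h.conv_one 0; simp [toInt, wdot] at this; simpa using this
  have h2 := h.conv_injective (h1.trans h0)
  have := DFunLike.congr_fun h2 i
  simp at this

/-- The monomial substitution defined by a cone. -/
def monHom (h : IsCone w₁ w₂) : R →+* R := (MvPowerSeries.substAlgHom (R := ℂ) h.hasSubst).toRingHom

lemma monHom_apply (h : IsCone w₁ w₂) (f : R) : monHom h f = MvPowerSeries.subst (subVars w₁ w₂) f := by
  rw [monHom]
  exact MvPowerSeries.substAlgHom_apply h.hasSubst f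

lemma prod_subVars (h : IsCone w₁ w₂) (d : Fin 2 →₀ ℕ) :
    (d.prod fun s e => subVars w₁ w₂ s ^ e) = monomial (conv w₁ w₂ d) 1 := by
  rw [Finsupp.prod_fintype _ _ (by simp), Fin.prod_univ_two]
  simp only [subVars, MvPowerSeries.monomial_pow, MvPowerSeries.monomial_mul_monomial, one_pow, mul_one]
  have hext : ∀ x y : Fin 2 →₀ ℕ, (x 0 : ℤ) = y 0 → (x 1 : ℤ) = y 1 → x = y := fun x y h0 h1 => by
    ext i; fin_cases i
    · exact_mod_cast h0
    · exact_mod_cast h1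
  congr 1
  have e0 : toInt (Finsupp.single 0 1) = (1, 0) := by simp [toInt]
  have e1 : toInt (Finsupp.single 1 1) = (0, 1) := by simp [toInt]
  refine congrArg _ (hext _ _ ?_ ?_)
  · simp only [Finsupp.add_apply, Finsupp.smul_apply, Nat.cast_add, smul_eq_mul, Nat.cast_mul, h.conv_zero, e0, e1]
    simp [wdot, toInt]; ring
  · simp only [Finsupp.add_apply, Finsupp.smul_apply, Nat.cast_add, smul_eq_mul, Nat.cast_mul, h.conv_one, e0, e1]
    simp [wdot, toInt]; ring

lemma coeff_monHom_conv (h : IsCone w₁ w₂) (f : R) (d : Fin 2 →₀ ℕ) :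
    coeff (conv w₁ w₂ d) (monHom h f) = coeff d f := by
  classical
  rw [monHom_apply, MvPowerSeries.coeff_subst h.hasSubst, finsum_eq_single _ d]
  · rw [prod_subVars h, MvPowerSeries.coeff_monomial, if_pos rfl]; simp
  · intro e he
    rw [prod_subVars h, MvPowerSeries.coeff_monomial, if_neg, smul_zero]
    exact fun hc => he (h.conv_injective hc).symm

lemma coeff_monHom_ne_zero (h : IsCone w₁ w₂) {f : R} {e : Fin 2 →₀ ℕ}
    (he : coeff e (monHom h f) ≠ 0) : ∃ d, e = conv w₁ w₂ d ∧ coeff d f ≠ 0 := by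
  classical
  by_contra! hc
  apply he
  rw [monHom_apply, MvPowerSeries.coeff_subst h.hasSubst]
  refine finsum_eq_zero_of_forall_eq_zero fun d => ?_
  rw [prod_subVars h, MvPowerSeries.coeff_monomial]
  split_ifs with h1
  · rw [hc d h1, zero_smul]
  · rw [smul_zero]

lemma monHom_injective (h : IsCone w₁ w₂) : Function.Injective (monHom h) := by
  rw [injective_iff_map_eq_zero]
  intro f hf
  ext d
  rw [← coeff_monHom_conv h, hf]; simp

lemma monHom_X (h : IsCone w₁ w₂) (i : Fin 2) : monHom h (MvPowerSeries.X i) = subVars w₁ w₂ i := by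
  rw [monHom_apply, MvPowerSeries.subst_X h.hasSubst]

lemma monHom_C (h : IsCone w₁ w₂) (c : ℂ) : monHom h (MvPowerSeries.C c) = MvPowerSeries.C c :=
  (MvPowerSeries.substAlgHom (R := ℂ) h.hasSubst).commutes c

lemma monHom_mem (h : IsCone w₁ w₂) (f : R) : monHom h f ∈ toricRing w₁ w₂ := by
  intro e he
  obtain ⟨d, rfl, -⟩ := coeff_monHom_ne_zero h he
  exact h.conv_mem d

/-- The extension of the monomial substitution to the field of fractions. -/
def monHomK (h : IsCone w₁ w₂) : K →+* K :=
  IsFractionRing.lift (g := (algebraMap R K).comp (monHom h)) (algebraMap_injective.comp (monHom_injective h))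

lemma monHomK_algebraMap (h : IsCone w₁ w₂) (f : R) : monHomK h (algebraMap R K f) = algebraMap R K (monHom h f) :=
  IsFractionRing.lift_algebraMap _ f

end Cone

/-- The monomial of exponent `e`, in the field of fractions. -/
lemma algebraMap_monomial (e : Fin 2 →₀ ℕ) : algebraMap R K (monomial e 1) =
    mon (algebraMap R K (MvPowerSeries.X 0)) (algebraMap R K (MvPowerSeries.X 1)) (toInt e) := by
  have : (monomial e 1 : R) = MvPowerSeries.X 0 ^ e 0 * MvPowerSeries.X 1 ^ e 1 := by
    rw [MvPowerSeries.X, MvPowerSeries.X, MvPowerSeries.monomial_pow, MvPowerSeries.monomial_pow,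
      MvPowerSeries.monomial_mul_monomial]
    have he : (fun₀ | 0 => e 0) + (fun₀ | 1 => e 1) = e := ex_eta e
    simp [he]
  rw [this]
  simp [mon, toInt]

lemma X_ne_zero' (i : Fin 2) : algebraMap R K (MvPowerSeries.X i) ≠ 0 := by
  intro h
  have h1 := algebraMap_injective (h.trans (map_zero _).symm)
  have := congrArg (coeff (Finsupp.single i 1)) h1
  rw [MvPowerSeries.coeff_index_single_self_X, map_zero] at this
  exact one_ne_zero this

namespace SmoothAt
variable {P : LocalSubring K} {a b : P.toSubring} (h : SmoothAt P a b)

/-- The expansion of the elements of the local ring of a smooth point in local coordinates. -/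
def exp : P.toSubring →+* R := RegPair.expandHom (constHom h.base) h.reg (constHom_res h.base h.res)

lemma exp_injective : Function.Injective h.exp := by
  have := h.noeth
  exact RegPair.expandHom_injective _ _ _

/-- The extension of the expansion homomorphism to the field of fractions. -/
def phi : K →+* K :=
  have := isFractionRing_of_base h.base
  IsFractionRing.lift (A := P.toSubring) (g := (algebraMap R K).comp h.exp) (algebraMap_injective.comp h.exp_injective)

lemma phi_coe (x : P.toSubring) : h.phi x = algebraMap R K (h.exp x) := by
  have := isFractionRing_of_base h.base
  exact IsFractionRing.lift_algebraMap (A := P.toSubring) (g := (algebraMap R K).comp h.exp)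
    (algebraMap_injective.comp h.exp_injective) x

lemma phi_left : h.phi a = algebraMap R K (MvPowerSeries.X 0) := by
  rw [h.phi_coe, exp, RegPair.expandHom_left]

lemma phi_right : h.phi b = algebraMap R K (MvPowerSeries.X 1) := by
  rw [h.phi_coe, exp, RegPair.expandHom_right]

lemma exp_const (c : ℂ) : h.exp (constHom h.base c) = MvPowerSeries.C c := RegPair.expandHom_const _ _ _ c

lemma phi_const (c : ℂ) : h.phi (algebraMap ℂ K c) = algebraMap ℂ K c := by
  have := h.phi_coe (constHom h.base c)
  rw [exp_const, ← algebraMap_eq_C] at this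
  exact this

lemma left_ne_zero (h : SmoothAt P a b) : (a : K) ≠ 0 := fun hc => h.reg.prime.ne_zero (Subtype.ext hc)

lemma right_ne_zero (h : SmoothAt P a b) : (b : K) ≠ 0 := fun hc => h.reg.not_dvd (by
  have : b = 0 := Subtype.ext hc
  rw [this]; exact dvd_zero _)

lemma constantCoeff_exp {x : P.toSubring} : constantCoeff (h.exp x) = 0 ↔ x ∈ maximalIdeal P.toSubring := by
  constructor
  · intro hx
    have := RegPair.mem_pow_of_coeff (constHom h.base) h.reg (constHom_res h.base h.res) (x := x) (n := 1) ?_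
    · simpa using this
    · intro e he
      have : e = 0 := by
        rw [← Finsupp.degree_eq_zero_iff]; omega
      rw [this]; exact hx
  · intro hx
    exact RegPair.coeff_of_mem_pow (constHom h.base) h.reg (constHom_res h.base h.res) (n := 1)
      (by simpa using hx) 0 (by simp)

variable {w₁ w₂ : ℤ × ℤ} (hc : IsCone w₁ w₂)

/-- The expansion in the toric coordinates defined by a cone. -/
def psi : K →+* K := (monHomK hc).comp h.phi

lemma psi_coe (x : P.toSubring) : h.psi hc x = algebraMap R K (monHom hc (h.exp x)) := by
  rw [psi, RingHom.comp_apply, h.phi_coe, monHomK_algebraMap]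

lemma psi_const (c : ℂ) : h.psi hc (algebraMap ℂ K c) = algebraMap ℂ K c := by
  rw [psi, RingHom.comp_apply, h.phi_const, algebraMap_eq_C, monHomK_algebraMap, monHom_C]

lemma psi_mon (m : ℤ × ℤ) : h.psi hc (mon a b m) =
    mon (algebraMap R K (MvPowerSeries.X 0)) (algebraMap R K (MvPowerSeries.X 1)) (wdot w₁ m, wdot w₂ m) := by
  have e0 : toInt (Finsupp.single 0 1) = (1, 0) := by simp [toInt]
  have e1 : toInt (Finsupp.single 1 1) = (0, 1) := by simp [toInt]
  have ha : h.psi hc a = mon (algebraMap R K (MvPowerSeries.X 0)) (algebraMap R K (MvPowerSeries.X 1)) (w₁.1, w₂.1) := by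
    rw [psi, RingHom.comp_apply, h.phi_left, monHomK_algebraMap, monHom_X, subVars, algebraMap_monomial]
    simp only [toInt, hc.conv_zero, hc.conv_one]
    simp [wdot]
  have hb : h.psi hc b = mon (algebraMap R K (MvPowerSeries.X 0)) (algebraMap R K (MvPowerSeries.X 1)) (w₁.2, w₂.2) := by
    rw [psi, RingHom.comp_apply, h.phi_right, monHomK_algebraMap, monHom_X, subVars, algebraMap_monomial]
    simp only [toInt, hc.conv_zero, hc.conv_one]
    simp [wdot]
  rw [mon, map_mul, map_zpow₀, map_zpow₀, ha, hb]
  simp only [mon, mul_zpow, ← zpow_mul, wdot, zpow_add₀ (X_ne_zero' 0), zpow_add₀ (X_ne_zero' 1)]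
  ring

/-- The power series of an expansion is unique. -/
lemma eq_exp_of_isExpansion {f : P.toSubring} {F : R} (hF : IsExpansion P a b f F) : F = h.exp f := by
  classical
  ext e
  obtain ⟨r, hr, hf⟩ := hF (e.degree + 1)
  set n := e.degree + 1
  let p : MvPolynomial (Fin 2) ℂ := ∑ i ∈ Finset.range n, ∑ j ∈ Finset.range n,
    MvPolynomial.monomial (ex i j) (coeff (ex i j) F)
  have hp : RegPair.ev (constHom h.base) a b p = f - r := by
    apply Subtype.ext
    rw [AddSubgroupClass.coe_sub, hf, add_sub_cancel_right]
    simp only [p, map_sum]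
    push_cast
    refine Finset.sum_congr rfl fun i _ => Finset.sum_congr rfl fun j _ => ?_
    simp only [RegPair.ev, MvPolynomial.eval₂Hom_monomial, Subring.coe_mul]
    rw [Finsupp.prod_fintype _ _ (by simp), Fin.prod_univ_two]
    simp only [ex_zero, ex_one, Matrix.cons_val_zero, Matrix.cons_val_one]
    push_cast
    rw [← mul_assoc]; rfl
  have h1 := RegPair.coeff_expandHom (constHom h.base) h.reg (constHom_res h.base h.res) (x := f) (n := n) (p := p)
    (by rw [hp, sub_sub_cancel]; exact hr) (e := e) (Nat.lt_succ_self _)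
  rw [exp, h1]
  simp only [p, MvPolynomial.coeff_sum, MvPolynomial.coeff_monomial]
  have hd : e.degree = e 0 + e 1 := degree_eq e
  rw [Finset.sum_eq_single (e 0), Finset.sum_eq_single (e 1), if_pos (ex_eta e), ex_eta]
  · intro j _ hj
    rw [if_neg]
    intro hc; apply hj; rw [← hc, ex_one]
  · intro hn; exact absurd (Finset.mem_range.2 (by omega)) hn
  · intro i _ hi
    refine Finset.sum_eq_zero fun j _ => ?_
    rw [if_neg]
    intro hc; apply hi; rw [← hc, ex_zero]
  · intro hn; exact absurd (Finset.mem_range.2 (by omega)) hn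

lemma isExpansion_exp (f : P.toSubring) : IsExpansion P a b f (h.exp f) := by
  classical
  intro n
  let p : MvPolynomial (Fin 2) ℂ := ∑ i ∈ Finset.range n, ∑ j ∈ Finset.range n,
    MvPolynomial.monomial (ex i j) (coeff (ex i j) (h.exp f))
  have hp : (RegPair.ev (constHom h.base) a b p : K) = ∑ i ∈ Finset.range n, ∑ j ∈ Finset.range n,
      algebraMap ℂ K (coeff (Finsupp.single 0 i + Finsupp.single 1 j) (h.exp f))
        * (a : K) ^ i * (b : K) ^ j := by
    simp only [p, map_sum]
    push_cast
    refine Finset.sum_congr rfl fun i _ => Finset.sum_congr rfl fun j _ => ?_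
    simp only [RegPair.ev, MvPolynomial.eval₂Hom_monomial, Subring.coe_mul]
    rw [Finsupp.prod_fintype _ _ (by simp), Fin.prod_univ_two]
    simp only [ex_zero, ex_one, Matrix.cons_val_zero, Matrix.cons_val_one]
    push_cast
    rw [← mul_assoc]; rfl
  refine ⟨f - RegPair.ev (constHom h.base) a b p, ?_, by rw [← hp]; simp⟩
  refine RegPair.mem_pow_of_coeff (constHom h.base) h.reg (constHom_res h.base h.res) fun e he => ?_
  rw [map_sub, RegPair.expandHom_ev, map_sub, sub_eq_zero, MvPolynomial.coeff_coe]
  simp only [p, MvPolynomial.coeff_sum, MvPolynomial.coeff_monomial]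
  have hd : e.degree = e 0 + e 1 := degree_eq e
  rw [Finset.sum_eq_single (e 0), Finset.sum_eq_single (e 1), if_pos (ex_eta e), ex_eta]
  · rfl
  · intro j _ hj
    rw [if_neg]
    intro hc; apply hj; rw [← hc, ex_one]
  · intro hn; exact absurd (Finset.mem_range.2 (by omega)) hn
  · intro i _ hi
    refine Finset.sum_eq_zero fun j _ => ?_
    rw [if_neg]
    intro hc; apply hi; rw [← hc, ex_zero]
  · intro hn; exact absurd (Finset.mem_range.2 (by omega)) hn

end SmoothAt

/-! ### Rings generated by monomials -/

/-- The dual cone of the cone generated by `w₁` and `w₂`. -/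
def dualCone (w₁ w₂ : ℤ × ℤ) : AddSubmonoid (ℤ × ℤ) where
  carrier := {m | 0 ≤ wdot w₁ m ∧ 0 ≤ wdot w₂ m}
  zero_mem' := by simp [wdot]
  add_mem' := by
    rintro m n ⟨h1, h2⟩ ⟨k1, k2⟩
    exact ⟨by rw [wdot_add]; omega, by rw [wdot_add]; omega⟩

lemma mem_dualCone {w₁ w₂ m : ℤ × ℤ} : m ∈ dualCone w₁ w₂ ↔ 0 ≤ wdot w₁ m ∧ 0 ≤ wdot w₂ m := Iff.rfl

/-- The ring generated over `A` by the monomials with exponents in the dual of a cone. -/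
def monRing (A : Subring K) (a b : K) (w₁ w₂ : ℤ × ℤ) : Subring K :=
  Subring.closure ((A : Set K) ∪ mon a b '' dualCone w₁ w₂)

lemma chartRing_eq (P : LocalSubring K) (a b : P.toSubring) (w₁ w₂ : ℤ × ℤ) :
    chartRing P a b w₁ w₂ = monRing P.toSubring a b w₁ w₂ := by
  unfold chartRing monRing
  congr 2
  ext z
  constructor
  · rintro ⟨m, h1, h2, rfl⟩
    exact ⟨m, ⟨h1, h2⟩, rfl⟩
  · rintro ⟨m, ⟨h1, h2⟩, rfl⟩
    exact ⟨m, h1, h2, rfl⟩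

section MonRing
variable {A B : Subring K} {a b : K} {w₁ w₂ : ℤ × ℤ}

lemma le_monRing : A ≤ monRing A a b w₁ w₂ := fun _ hx => Subring.subset_closure (Or.inl hx)

lemma mon_mem_monRing {m : ℤ × ℤ} (hm : m ∈ dualCone w₁ w₂) : mon a b m ∈ monRing A a b w₁ w₂ :=
  Subring.subset_closure (Or.inr ⟨m, hm, rfl⟩)

lemma monRing_le (hA : A ≤ B) (hm : ∀ m ∈ dualCone w₁ w₂, mon a b m ∈ B) : monRing A a b w₁ w₂ ≤ B := by
  unfold monRing
  rw [Subring.closure_le]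
  rintro x (hx | ⟨m, hm', rfl⟩)
  · exact hA hx
  · exact hm m hm'

lemma monRing_mono (hA : A ≤ B) : monRing A a b w₁ w₂ ≤ monRing B a b w₁ w₂ :=
  monRing_le (hA.trans le_monRing) fun _ hm => mon_mem_monRing hm

/-- The exponent of the coordinates of a point of the dual cone. -/
lemma exists_exponent {m : ℤ × ℤ} (hm : m ∈ dualCone w₁ w₂) :
    ∃ e ∈ toricMonoid w₁ w₂, (e 0 : ℤ) = wdot w₁ m ∧ (e 1 : ℤ) = wdot w₂ m := by
  have h1 := Int.toNat_of_nonneg hm.1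
  have h2 := Int.toNat_of_nonneg hm.2
  exact ⟨ex (wdot w₁ m).toNat (wdot w₂ m).toNat, ⟨m, by rw [ex_zero, h1]; rfl, by rw [ex_one, h2]; rfl⟩,
    by rw [ex_zero, h1], by rw [ex_one, h2]⟩

/-- Gordan's lemma, for cones of the plane. -/
lemma IsCone.exists_generators (h : IsCone w₁ w₂) :
    ∃ G : Set (ℤ × ℤ), G.Finite ∧ AddSubmonoid.closure G = dualCone w₁ w₂ := by
  obtain ⟨I₀, hfin, hsub, hmin⟩ := exists_finite_minimal {e | e ∈ toricMonoid w₁ w₂ ∧ e ≠ 0}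
  let G : Set (ℤ × ℤ) := {m | ∃ e ∈ I₀, (e 0 : ℤ) = wdot w₁ m ∧ (e 1 : ℤ) = wdot w₂ m}
  refine ⟨G, ?_, le_antisymm ?_ ?_⟩
  · refine Set.Finite.of_finite_image (f := fun m : ℤ × ℤ => (wdot w₁ m, wdot w₂ m))
      ((hfin.image (fun e : Fin 2 →₀ ℕ => ((e 0 : ℤ), (e 1 : ℤ)))).subset ?_) ?_
    · rintro _ ⟨m, ⟨e, he, h1, h2⟩, rfl⟩
      exact ⟨e, he, by simp [h1, h2]⟩
    · intro m _ n _ hmn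
      simp only [Prod.mk.injEq] at hmn
      exact h.wdot_ext hmn.1 hmn.2
  · rw [AddSubmonoid.closure_le]
    rintro m ⟨e, _, h1, h2⟩
    exact ⟨h1 ▸ Int.natCast_nonneg _, h2 ▸ Int.natCast_nonneg _⟩
  · have key : ∀ n : ℕ, ∀ m ∈ dualCone w₁ w₂, wdot w₁ m + wdot w₂ m < n → m ∈ AddSubmonoid.closure G := by
      intro n
      induction n with
      | zero => intro m hm hlt; have := hm.1; have := hm.2; push_cast at hlt; omega
      | succ n ih =>
        intro m hm hlt
        obtain ⟨e, he, h1, h2⟩ := exists_exponent hm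
        by_cases h0 : e = 0
        · have : m = 0 := h.wdot_ext (by rw [← h1, h0]; simp [wdot]) (by rw [← h2, h0]; simp [wdot])
          rw [this]; exact zero_mem _
        obtain ⟨d, hd, hde⟩ := hmin e ⟨he, h0⟩
        obtain ⟨⟨m', k1, k2⟩, hd0⟩ := hsub hd
        have hm' : m' ∈ G := ⟨d, hd, k1, k2⟩
        have k1' : (d 0 : ℤ) = wdot w₁ m' := k1
        have k2' : (d 1 : ℤ) = wdot w₂ m' := k2
        have l0 := hde 0
        have l1 := hde 1
        have hpos : 0 < d 0 + d 1 := by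
          by_contra! hc
          apply hd0
          ext i; fin_cases i
          · simp; omega
          · simp; omega
        have e1 : m = (m + -m') + m' := by abel
        rw [e1]
        refine add_mem (ih _ ⟨?_, ?_⟩ ?_) (AddSubmonoid.subset_closure hm')
        · rw [wdot_add, wdot_neg]; omega
        · rw [wdot_add, wdot_neg]; omega
        · rw [wdot_add, wdot_neg, wdot_add, wdot_neg]; push_cast at hlt; omega
    intro m hm
    refine key ((wdot w₁ m + wdot w₂ m).toNat + 1) m hm ?_
    have := hm.1; have := hm.2; push_cast; omega

lemma IsCone.exists_monRing_eq (h : IsCone w₁ w₂) (ha : a ≠ 0) (hb : b ≠ 0) :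
    ∃ G : Set K, G.Finite ∧ ∀ A : Subring K, monRing A a b w₁ w₂ = Subring.closure ((A : Set K) ∪ G) := by
  obtain ⟨G, hG, hcl⟩ := h.exists_generators
  refine ⟨mon a b '' G, hG.image _, fun A => le_antisymm (monRing_le (fun x hx => Subring.subset_closure (Or.inl hx)) ?_) ?_⟩
  · intro m hm
    rw [← hcl] at hm
    induction hm using AddSubmonoid.closure_induction with
    | mem m hm => exact Subring.subset_closure (Or.inr ⟨m, hm, rfl⟩)
    | zero => rw [mon_zero]; exact one_mem _
    | add m n _ _ h1 h2 => rw [mon_add ha hb]; exact mul_mem h1 h2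
  · unfold monRing
    refine Subring.closure_mono (Set.union_subset_union_right _ (Set.image_mono ?_))
    rw [← hcl]; exact AddSubmonoid.subset_closure

lemma IsCone.monRing_noetherian (h : IsCone w₁ w₂) (ha : a ≠ 0) (hb : b ≠ 0) [IsNoetherianRing A] :
    IsNoetherianRing (monRing A a b w₁ w₂) := by
  obtain ⟨G, hG, hA⟩ := h.exists_monRing_eq ha hb
  let B : Subalgebra A K := Algebra.adjoin A G
  have h1 : B.FG := ⟨hG.toFinset, by simp [B]⟩
  have h2 : IsNoetherianRing B := by
    have : Algebra.FiniteType A B := B.fg_iff_finiteType.1 h1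
    exact Algebra.FiniteType.isNoetherianRing A B
  have h3 : monRing A a b w₁ w₂ = B.toSubring := by
    rw [hA, Algebra.adjoin_eq_ring_closure]
    congr 2
    exact Subtype.range_coe.symm
  rw [h3]; exact h2

lemma IsCone.exists_fg (h : IsCone w₁ w₂) (ha : a ≠ 0) (hb : b ≠ 0) {A : Subalgebra R K} (hA : A.FG) :
    ∃ B : Subalgebra R K, B.FG ∧ B.toSubring = monRing A.toSubring a b w₁ w₂ := by
  obtain ⟨G, hG, h1⟩ := h.exists_monRing_eq ha hb
  refine ⟨A ⊔ Algebra.adjoin R G, hA.sup ⟨hG.toFinset, by simp⟩, ?_⟩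
  rw [h1]
  apply le_antisymm
  · have : A ⊔ Algebra.adjoin R G = Algebra.adjoin R ((A : Set K) ∪ G) := by
      rw [Algebra.adjoin_union, Algebra.adjoin_eq]
    rw [this, Algebra.adjoin_eq_ring_closure, Subring.closure_le]
    rintro x (⟨r, rfl⟩ | hx)
    · exact Subring.subset_closure (Or.inl (A.algebraMap_mem r))
    · exact Subring.subset_closure hx
  · rw [Subring.closure_le]
    rintro x (hx | hx)
    · exact (le_sup_left : A ≤ _) hx
    · exact (le_sup_right : Algebra.adjoin R G ≤ _) (Algebra.subset_adjoin hx)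

/-- Clearing the denominators of the elements of `B`, when `B` is a localization of `A`. -/
lemma exists_mul_mem_monRing {P : LocalSubring K} (hP : IsLocAt A P) {x : K} (hx : x ∈ monRing P.toSubring a b w₁ w₂) :
    ∃ d ∈ A, d ≠ 0 ∧ d⁻¹ ∈ P.toSubring ∧ d * x ∈ monRing A a b w₁ w₂ := by
  have hunit : ∀ {d d' : K}, d ≠ 0 → d' ≠ 0 → d⁻¹ ∈ P.toSubring → d'⁻¹ ∈ P.toSubring → d * d' ≠ 0 ∧ (d * d')⁻¹ ∈ P.toSubring :=
    fun h0 h0' hi hi' => ⟨mul_ne_zero h0 h0', by rw [mul_inv]; exact mul_mem hi hi'⟩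
  induction hx using Subring.closure_induction with
  | mem x hx =>
    rcases hx with hx | ⟨m, hm, rfl⟩
    · obtain ⟨s, hs, t, ht, h0, hi, rfl⟩ := hP.2 x hx
      exact ⟨t, ht, h0, hi, by rw [mul_comm, inv_mul_cancel_right₀ h0]; exact le_monRing hs⟩
    · exact ⟨1, one_mem _, one_ne_zero, by simp [one_mem], by rw [one_mul]; exact mon_mem_monRing hm⟩
  | zero => exact ⟨1, one_mem _, one_ne_zero, by simp [one_mem], by simp [zero_mem]⟩
  | one => exact ⟨1, one_mem _, one_ne_zero, by simp [one_mem], by simp [one_mem]⟩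
  | add x y _ _ h1 h2 =>
    obtain ⟨d, hd, h0, hi, hx⟩ := h1
    obtain ⟨d', hd', h0', hi', hy⟩ := h2
    refine ⟨d * d', mul_mem hd hd', (hunit h0 h0' hi hi').1, (hunit h0 h0' hi hi').2, ?_⟩
    have : d * d' * (x + y) = d' * (d * x) + d * (d' * y) := by ring
    rw [this]
    exact add_mem (mul_mem (le_monRing hd') hx) (mul_mem (le_monRing hd) hy)
  | neg x _ h1 =>
    obtain ⟨d, hd, h0, hi, hx⟩ := h1
    exact ⟨d, hd, h0, hi, by rw [mul_neg]; exact neg_mem hx⟩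
  | mul x y _ _ h1 h2 =>
    obtain ⟨d, hd, h0, hi, hx⟩ := h1
    obtain ⟨d', hd', h0', hi', hy⟩ := h2
    refine ⟨d * d', mul_mem hd hd', (hunit h0 h0' hi hi').1, (hunit h0 h0' hi hi').2, ?_⟩
    have : d * d' * (x * y) = (d * x) * (d' * y) := by ring
    rw [this]
    exact mul_mem hx hy

/-- The points above `P` can be computed with any ring of which `P` is a localization. -/
lemma isLocAt_monRing_iff {P Q : LocalSubring K} (hP : IsLocAt A P) (hPQ : P ≤ Q) :
    IsLocAt (monRing P.toSubring a b w₁ w₂) Q ↔ IsLocAt (monRing A a b w₁ w₂) Q := by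
  have hPQ' := (le_iff_mI.1 hPQ).1
  constructor
  · intro h
    refine ⟨(monRing_mono hP.1).trans h.1, fun x hx => ?_⟩
    obtain ⟨s, hs, t, ht, h0, hi, rfl⟩ := h.2 x hx
    obtain ⟨d, hd, hd0, hdi, hs'⟩ := exists_mul_mem_monRing hP hs
    obtain ⟨c, hc, hc0, hci, ht'⟩ := exists_mul_mem_monRing hP ht
    refine ⟨c * (d * s), mul_mem (le_monRing hc) hs', d * (c * t), mul_mem (le_monRing hd) ht',
      mul_ne_zero hd0 (mul_ne_zero hc0 h0), ?_, ?_⟩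
    · rw [mul_inv, mul_inv]
      exact mul_mem (hPQ' hdi) (mul_mem (hPQ' hci) hi)
    · field_simp
  · intro h
    refine h.mono (monRing_mono hP.1) (monRing_le hPQ' fun m hm => h.1 (mon_mem_monRing hm))

end MonRing

/-! ### Points of a toric modification -/

section Charts
variable {P Q : LocalSubring K} {a b : P.toSubring} {w₁ w₂ : ℤ × ℤ}

lemma IsCone.left_mem (hc : IsCone w₁ w₂) : ((1, 0) : ℤ × ℤ) ∈ dualCone w₁ w₂ :=
  ⟨by simpa [wdot] using hc.n11, by simpa [wdot] using hc.n21⟩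

lemma IsCone.right_mem (hc : IsCone w₁ w₂) : ((0, 1) : ℤ × ℤ) ∈ dualCone w₁ w₂ :=
  ⟨by simpa [wdot] using hc.n12, by simpa [wdot] using hc.n22⟩

lemma mon_left (x y : K) : mon x y (1, 0) = x := by simp [mon]
lemma mon_right (x y : K) : mon x y (0, 1) = y := by simp [mon]

lemma mon_nsmul (x y : K) (k : ℕ) (m : ℤ × ℤ) : mon x y (k • m) = mon x y m ^ k := by
  rw [mon, mon, Prod.smul_fst, Prod.smul_snd, nsmul_eq_mul, nsmul_eq_mul, mul_comm (k : ℤ), mul_comm (k : ℤ), zpow_mul,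
    zpow_mul, zpow_natCast, zpow_natCast, mul_pow]

lemma wdot_nsmul (w : ℤ × ℤ) (k : ℕ) (m : ℤ × ℤ) : wdot w (k • m) = k * wdot w m := by
  rw [wdot, wdot, Prod.smul_fst, Prod.smul_snd, nsmul_eq_mul, nsmul_eq_mul]; ring

lemma RK_le_monRing {A : Subring K} (hA : RK ≤ A) (x y : K) : RK ≤ monRing A x y w₁ w₂ := hA.trans le_monRing

/-- Residues can be computed before localizing. -/
lemma res_of_isLocAt {A : Subring K} (hQ : IsLocAt A Q) (hR : RK ≤ A)
    (hres : ∀ x ∈ A, ∃ c : ℂ, x - algebraMap ℂ K c ∈ mI Q) :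
    ∀ x ∈ Q.toSubring, ∃ c : ℂ, x - algebraMap ℂ K c ∈ mI Q := by
  have hc : ∀ c, algebraMap ℂ K c ∈ Q.toSubring := fun c => hQ.1 (hR (algebraMap_C_mem c))
  intro x hx
  obtain ⟨s, hs, t, ht, h0, hi, rfl⟩ := hQ.2 x hx
  obtain ⟨c, hcs⟩ := hres s hs
  obtain ⟨d, hdt⟩ := hres t ht
  have hd : d ≠ 0 := by
    rintro rfl
    exact notMem_mI_of_inv h0 hi (by simpa using hdt)
  refine ⟨c / d, ?_⟩
  have hd' : algebraMap ℂ K d ≠ 0 := by simpa using hd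
  have : s * t⁻¹ - algebraMap ℂ K (c / d) =
      t⁻¹ * ((s - algebraMap ℂ K c) - algebraMap ℂ K (c / d) * (t - algebraMap ℂ K d)) := by
    rw [map_div₀]; field_simp; ring
  rw [this]
  exact mul_mem_mI hi (sub_mem_mI hcs (mul_mem_mI (hc _) hdt))

/-- An element of the ring of a chart is the sum of a constant and of a combination of nonconstant
monomials. -/
lemma SmoothAt.monRing_decomp (h : SmoothAt P a b) (hc : IsCone w₁ w₂) {x : K}
    (hx : x ∈ monRing P.toSubring a b w₁ w₂) : ∃ c : ℂ, ∃ y ∈ span {y : monRing P.toSubring (a : K) b w₁ w₂ |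
      ∃ m ∈ dualCone w₁ w₂, m ≠ 0 ∧ (y : K) = mon (a : K) b m}, x = algebraMap ℂ K c + y := by
  set J := span {y : monRing P.toSubring (a : K) b w₁ w₂ | ∃ m ∈ dualCone w₁ w₂, m ≠ 0 ∧ (y : K) = mon (a : K) b m} with hJ
  have hC : ∀ c : ℂ, algebraMap ℂ K c ∈ monRing P.toSubring (a : K) b w₁ w₂ := fun c => le_monRing (h.base (algebraMap_C_mem c))
  have hmon : ∀ (m : ℤ × ℤ) (hm : m ∈ dualCone w₁ w₂), m ≠ 0 →
      (⟨mon (a : K) b m, mon_mem_monRing hm⟩ : monRing P.toSubring (a : K) b w₁ w₂) ∈ J :=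
    fun m hm h0 => Ideal.subset_span ⟨m, hm, h0, rfl⟩
  induction hx using Subring.closure_induction with
  | mem x hx =>
    rcases hx with hx | ⟨m, hm, rfl⟩
    · obtain ⟨c, hc'⟩ := h.res x hx
      obtain ⟨r, hr, s, hs, e⟩ := (mem_mI_span h.reg.span).1 hc'
      refine ⟨c, ⟨r, le_monRing hr⟩ * ⟨mon (a : K) b (1, 0), mon_mem_monRing hc.left_mem⟩ +
        ⟨s, le_monRing hs⟩ * ⟨mon (a : K) b (0, 1), mon_mem_monRing hc.right_mem⟩,
        add_mem (Ideal.mul_mem_left _ _ (hmon _ hc.left_mem (by simp))) (Ideal.mul_mem_left _ _ (hmon _ hc.right_mem (by simp))), ?_⟩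
      push_cast
      rw [mon_left, mon_right, ← e]; ring
    · by_cases h0 : m = 0
      · exact ⟨1, 0, zero_mem _, by simp [h0, mon_zero]⟩
      · exact ⟨0, _, hmon m hm h0, by simp⟩
  | zero => exact ⟨0, 0, zero_mem _, by simp⟩
  | one => exact ⟨1, 0, zero_mem _, by simp⟩
  | add x y _ _ h1 h2 =>
    obtain ⟨c, x', hx', rfl⟩ := h1
    obtain ⟨d, y', hy', rfl⟩ := h2
    exact ⟨c + d, x' + y', add_mem hx' hy', by rw [map_add]; push_cast; ring⟩
  | neg x _ h1 =>
    obtain ⟨c, x', hx', rfl⟩ := h1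
    exact ⟨-c, -x', neg_mem hx', by rw [map_neg]; push_cast; ring⟩
  | mul x y _ _ h1 h2 =>
    obtain ⟨c, x', hx', rfl⟩ := h1
    obtain ⟨d, y', hy', rfl⟩ := h2
    refine ⟨c * d, ⟨_, hC c⟩ * y' + ⟨_, hC d⟩ * x' + x' * y', add_mem (add_mem (Ideal.mul_mem_left _ _ hy')
      (Ideal.mul_mem_left _ _ hx')) (Ideal.mul_mem_left _ _ hy'), ?_⟩
    rw [map_mul]; push_cast; ring

/-- The monomials of the field of fractions which are monomials of the ring of power series. -/
lemma mon_X_eq {m : ℤ × ℤ} {e : Fin 2 →₀ ℕ} (h0 : (e 0 : ℤ) = wdot w₁ m) (h1 : (e 1 : ℤ) = wdot w₂ m) :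
    mon (algebraMap R K (MvPowerSeries.X 0)) (algebraMap R K (MvPowerSeries.X 1)) (wdot w₁ m, wdot w₂ m) =
      algebraMap R K (monomial e 1) := by
  rw [algebraMap_monomial, toInt, h0, h1]

lemma SmoothAt.psi_mon_eq (h : SmoothAt P a b) (hc : IsCone w₁ w₂) {m : ℤ × ℤ} {e : Fin 2 →₀ ℕ}
    (h0 : (e 0 : ℤ) = wdot w₁ m) (h1 : (e 1 : ℤ) = wdot w₂ m) :
    h.psi hc (mon (a : K) b m) = algebraMap R K (monomial e 1) := by
  rw [h.psi_mon, mon_X_eq h0 h1]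

lemma SmoothAt.psi_monRing (h : SmoothAt P a b) (hc : IsCone w₁ w₂) {x : K}
    (hx : x ∈ monRing P.toSubring a b w₁ w₂) : ∃ g ∈ toricRing w₁ w₂, algebraMap R K g = h.psi hc x := by
  have : monRing P.toSubring a b w₁ w₂ ≤ ((toricRing w₁ w₂).map (algebraMap R K)).comap (h.psi hc) := by
    refine monRing_le (fun x hx => ⟨_, monHom_mem hc (h.exp ⟨x, hx⟩), (h.psi_coe hc ⟨x, hx⟩).symm⟩) fun m hm => ?_
    obtain ⟨e, he, h0, h1⟩ := exists_exponent hm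
    exact ⟨_, monomial_mem_toricRing he 1, (h.psi_mon_eq hc h0 h1).symm⟩
  exact this hx

/-- The fixed points of toric charts are toric points. -/
lemma SmoothAt.toricAt (h : SmoothAt P a b) (hc : IsCone w₁ w₂) (hQ : IsLocAt (monRing P.toSubring a b w₁ w₂) Q)
    (hfix : ∀ m ∈ dualCone w₁ w₂, m ≠ 0 → mon (a : K) b m ∈ mI Q) : ToricAt Q w₁ w₂ (h.psi hc) := by
  classical
  have hnoeth : IsNoetherianRing Q.toSubring := by
    have := h.noeth
    have := hc.monRing_noetherian (A := P.toSubring) h.left_ne_zero h.right_ne_zero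
    exact isNoetherianRing_of_isLocAt hQ
  have hbase : RK ≤ Q.toSubring := (RK_le_monRing h.base _ _).trans hQ.1
  have hJ : ∀ y ∈ span {y : monRing P.toSubring (a : K) b w₁ w₂ | ∃ m ∈ dualCone w₁ w₂, m ≠ 0 ∧ (y : K) = mon (a : K) b m},
      (∃ hy : (y : K) ∈ Q.toSubring, (⟨y, hy⟩ : Q.toSubring) ∈ span {y : Q.toSubring | ∃ e ∈ toricMonoid w₁ w₂, e ≠ 0 ∧
        h.psi hc (y : K) = algebraMap R K (monomial e 1)}) ∧
      (y : K) ∈ mI Q ∧ ∃ g : R, constantCoeff g = 0 ∧ algebraMap R K g = h.psi hc y := by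
    intro y hy
    induction hy using Submodule.span_induction with
    | mem y hy =>
      obtain ⟨m, hm, h0, e⟩ := hy
      obtain ⟨d, hd, d0, d1⟩ := exists_exponent hm
      have hdne : d ≠ 0 := by
        rintro rfl
        apply h0
        exact hc.wdot_ext (by rw [← d0]; simp [wdot]) (by rw [← d1]; simp [wdot])
      have hψ := h.psi_mon_eq hc d0 d1
      refine ⟨⟨hQ.1 y.2, Ideal.subset_span ⟨d, hd, hdne, by rw [e]; exact hψ⟩⟩, e ▸ hfix m hm h0,
        _, ?_, by rw [e]; exact hψ.symm⟩
      rw [← MvPowerSeries.coeff_zero_eq_constantCoeff_apply, MvPowerSeries.coeff_monomial, if_neg (Ne.symm hdne)]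
    | zero => exact ⟨⟨zero_mem _, zero_mem _⟩, zero_mem_mI Q, 0, by simp, by simp⟩
    | add x y _ _ hx hy =>
      obtain ⟨⟨hx1, hx2⟩, hx3, g, hg, hxg⟩ := hx
      obtain ⟨⟨hy1, hy2⟩, hy3, g', hg', hyg⟩ := hy
      exact ⟨⟨add_mem hx1 hy1, add_mem hx2 hy2⟩, add_mem_mI hx3 hy3, g + g', by rw [map_add, hg, hg', add_zero],
        by rw [map_add, hxg, hyg, Subring.coe_add, map_add]⟩
    | smul r x _ hx =>
      obtain ⟨⟨hx1, hx2⟩, hx3, g, hg, hxg⟩ := hx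
      obtain ⟨g', -, hg'⟩ := h.psi_monRing hc r.2
      exact ⟨⟨mul_mem (hQ.1 r.2) hx1, Ideal.mul_mem_left _ ⟨r, hQ.1 r.2⟩ hx2⟩, mul_mem_mI (hQ.1 r.2) hx3, g' * g,
        by rw [map_mul, hg, mul_zero], by rw [map_mul, hxg, hg', smul_eq_mul, Subring.coe_mul, map_mul]⟩
  have hresA : ∀ x ∈ monRing P.toSubring (a : K) b w₁ w₂, ∃ c : ℂ, x - algebraMap ℂ K c ∈ mI Q := by
    intro x hx
    obtain ⟨c, y, hy, rfl⟩ := h.monRing_decomp hc hx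
    exact ⟨c, by simpa using (hJ y hy).2.1⟩
  refine ⟨hbase, hnoeth, res_of_isLocAt hQ (RK_le_monRing h.base _ _) hresA, h.psi_const hc, fun x hx => ?_, fun e he => ?_, ?_⟩
  · obtain ⟨s, hs, t, ht, h0, hi, rfl⟩ := hQ.2 x hx
    obtain ⟨g, hg, hgs⟩ := h.psi_monRing hc hs
    obtain ⟨k, hk, hkt⟩ := h.psi_monRing hc ht
    obtain ⟨c, y, hy, e⟩ := h.monRing_decomp hc ht
    obtain ⟨-, hym, g', hg', hyg⟩ := hJ y hy
    have hc0 : c ≠ 0 := by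
      rintro rfl
      rw [map_zero, zero_add] at e
      exact notMem_mI_of_inv h0 hi (e ▸ hym)
    have hkc : constantCoeff k = c := by
      have : k = MvPowerSeries.C c + g' := algebraMap_injective (by
        rw [hkt, e, map_add, map_add, h.psi_const, ← algebraMap_eq_C, hyg])
      rw [this, map_add, hg', add_zero, MvPowerSeries.constantCoeff_C]
    have hu : IsUnit k := by
      rw [MvPowerSeries.isUnit_iff_constantCoeff, hkc]; exact isUnit_iff_ne_zero.2 hc0
    obtain ⟨k', hk'⟩ := hu.exists_right_inv
    refine ⟨g * k', mul_mem hg (mem_toricRing_of_mul hk hu.ne_zero (hk' ▸ one_mem _)), ?_⟩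
    rw [map_mul, map_mul, map_inv₀, hgs, ← hkt]
    congr 1
    refine eq_inv_of_mul_eq_one_right ?_
    rw [← map_mul, hk', map_one]
  · obtain ⟨m, h0, h1⟩ := he
    exact ⟨_, hQ.1 (mon_mem_monRing ⟨by rw [wdot, ← h0]; exact Int.natCast_nonneg _,
      by rw [wdot, ← h1]; exact Int.natCast_nonneg _⟩), h.psi_mon_eq hc h0 h1⟩
  · intro x hx
    have hx' := coe_mem_mI.2 hx
    obtain ⟨s, hs, t, ht, h0, hi, e⟩ := hQ.2 x x.2
    have hsm : s ∈ mI Q := by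
      have : s = t * x := by rw [e]; field_simp
      rw [this]; exact mul_mem_mI (hQ.1 ht) hx'
    obtain ⟨c, y, hy, e'⟩ := h.monRing_decomp hc hs
    obtain ⟨⟨hy1, hy2⟩, hym, -⟩ := hJ y hy
    have hc0 : c = 0 := by
      by_contra hc0
      have h1 : algebraMap ℂ K c ∈ mI Q := by
        have : algebraMap ℂ K c = s - y := by rw [e']; ring
        rw [this]; exact sub_mem_mI hsm hym
      refine notMem_mI_of_inv (by simpa using hc0) ?_ h1
      rw [← map_inv₀]; exact hbase (algebraMap_C_mem _)
    have : x = ⟨t⁻¹, hi⟩ * ⟨y, hy1⟩ := Subtype.ext (by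
      rw [e, e', hc0, map_zero, zero_add, mul_comm]; rfl)
    rw [this]
    exact Ideal.mul_mem_left _ _ hy2

/-- A point above `P` in a toric chart is either the fixed point of the chart, or it lies in the chart
associated with an edge of the cone. -/
lemma isLocAt_edge (h : SmoothAt P a b) (hc : IsCone w₁ w₂) (hQ : IsLocAt (monRing P.toSubring a b w₁ w₂) Q) (hPQ : P ≤ Q) :
    (∀ m ∈ dualCone w₁ w₂, m ≠ 0 → mon (a : K) b m ∈ mI Q) ∨
      (0 < w₁.1 ∧ 0 < w₁.2 ∧ IsLocAt (monRing P.toSubring a b w₁ w₁) Q) ∨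
      (0 < w₂.1 ∧ 0 < w₂.2 ∧ IsLocAt (monRing P.toSubring a b w₂ w₂) Q) := by
  have ha0 := h.left_ne_zero
  have hb0 := h.right_ne_zero
  have haQ : (a : K) ∈ mI Q := (le_iff_mI.1 hPQ).2 _ (coe_mem_mI.2 h.reg.mem_left)
  have hbQ : (b : K) ∈ mI Q := (le_iff_mI.1 hPQ).2 _ (coe_mem_mI.2 h.reg.mem_right)
  by_cases hfix : ∀ m ∈ dualCone w₁ w₂, m ≠ 0 → mon (a : K) b m ∈ mI Q
  · exact Or.inl hfix
  right
  push Not at hfix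
  obtain ⟨m, hm, hm0, hmQ⟩ := hfix
  have hmem : ∀ n ∈ dualCone w₁ w₂, mon (a : K) b n ∈ Q.toSubring := fun n hn => hQ.1 (mon_mem_monRing hn)
  have hinv := (unit_of_notMem_mI (hmem m hm) hmQ).2
  -- no vector of the dual cone divides a multiple of `m` if its monomial is not a unit
  have key : ∀ n ∈ dualCone w₁ w₂, mon (a : K) b n ∈ mI Q → ∀ k : ℕ, k • m - n ∉ dualCone w₁ w₂ := by
    intro n hn hnQ k hk
    have h1 : mon (a : K) b m ^ k = mon (a : K) b (k • m - n) * mon (a : K) b n := by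
      rw [← mon_add ha0 hb0, sub_add_cancel, mon_nsmul]
    have h2 : mon (a : K) b m ^ k ∈ mI Q := h1 ▸ mul_mem_mI (hmem _ hk) hnQ
    have hk0 : k ≠ 0 := by
      rintro rfl
      exact one_notMem_mI Q (by simpa using h2)
    exact hmQ ((mI_pow_iff (hmem m hm) hk0).1 h2)
  have hsub : ∀ (w : ℤ × ℤ) (k : ℕ) (n : ℤ × ℤ), wdot w (k • m - n) = k * wdot w m - wdot w n := by
    intro w k n; rw [sub_eq_add_neg, wdot_add, wdot_neg, wdot_nsmul]; ring
  have hnat : ∀ z : ℤ, z ≤ z.toNat := Int.self_le_toNat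
  have hpos := hm
  have hedge : wdot w₁ m = 0 ∨ wdot w₂ m = 0 := by
    by_contra! hcon
    have h1 : 1 ≤ wdot w₁ m := by have := hm.1; omega
    have h2 : 1 ≤ wdot w₂ m := by have := hm.2; omega
    refine key _ hc.left_mem (by rwa [mon_left]) ((wdot w₁ (1, 0)).toNat + (wdot w₂ (1, 0)).toNat) ⟨?_, ?_⟩
    · rw [hsub]; push_cast; nlinarith [hnat (wdot w₁ (1, 0)), hnat (wdot w₂ (1, 0)), Int.natCast_nonneg (wdot w₁ (1, 0)).toNat, Int.natCast_nonneg (wdot w₂ (1, 0)).toNat]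
    · rw [hsub]; push_cast; nlinarith [hnat (wdot w₁ (1, 0)), hnat (wdot w₂ (1, 0)), Int.natCast_nonneg (wdot w₁ (1, 0)).toNat, Int.natCast_nonneg (wdot w₂ (1, 0)).toNat]
  have general : ∀ w w' : ℤ × ℤ, (∀ n, n ∈ dualCone w₁ w₂ ↔ 0 ≤ wdot w n ∧ 0 ≤ wdot w' n) → 0 ≤ w.1 → 0 ≤ w.2 →
      0 ≤ w'.1 → 0 ≤ w'.2 → (w ≠ 0) → wdot w m = 0 → wdot w' m ≠ 0 →
      0 < w.1 ∧ 0 < w.2 ∧ IsLocAt (monRing P.toSubring a b w w) Q := by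
    intro w w' hd hw1 hw2 hw1' hw2' hw0 e0 e1
    have e1' : 1 ≤ wdot w' m := by have := ((hd m).1 hm).2; omega
    have hk : ∀ n, 0 ≤ wdot w n → ∃ k : ℕ, k • m + n ∈ dualCone w₁ w₂ := by
      intro n hn
      refine ⟨(-wdot w' n).toNat, (hd _).2 ⟨?_, ?_⟩⟩
      · rw [wdot_add, wdot_nsmul, e0]; simpa using hn
      · rw [wdot_add, wdot_nsmul]; nlinarith [hnat (-wdot w' n), Int.natCast_nonneg (-wdot w' n).toNat]
    have key' : ∀ n ∈ dualCone w₁ w₂, mon (a : K) b n ∈ mI Q → 0 < wdot w n := by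
      intro n hn hnQ
      by_contra! hcon
      obtain ⟨k, hk⟩ := hk (-n) (by rw [wdot_neg]; omega)
      exact key n hn hnQ k (by simpa [sub_eq_add_neg] using hk)
    have p1 := key' _ hc.left_mem (by rwa [mon_left])
    have p2 := key' _ hc.right_mem (by rwa [mon_right])
    refine ⟨by simpa [wdot] using p1, by simpa [wdot] using p2, hQ.mono (monRing_le le_monRing fun n hn =>
      mon_mem_monRing ⟨((hd n).1 hn).1, ((hd n).1 hn).1⟩) (monRing_le (le_monRing.trans hQ.1) fun n hn => ?_)⟩
    obtain ⟨k, hk⟩ := hk n hn.1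
    have : mon (a : K) b n = (mon (a : K) b m)⁻¹ ^ k * mon (a : K) b (k • m + n) := by
      rw [mon_add ha0 hb0, mon_nsmul, inv_pow, inv_mul_cancel_left₀ (pow_ne_zero _ (mon_ne_zero ha0 hb0 m))]
    rw [this]
    exact mul_mem (pow_mem hinv k) (hmem _ hk)
  have hne : ¬ (wdot w₁ m = 0 ∧ wdot w₂ m = 0) := fun hcon =>
    hm0 (hc.wdot_ext (by rw [hcon.1]; simp [wdot]) (by rw [hcon.2]; simp [wdot]))
  have hd := hc.det_pos
  rcases hedge with e | e
  · left
    exact general w₁ w₂ (fun n => Iff.rfl) hc.n11 hc.n12 hc.n21 hc.n22 (by rintro rfl; simp [det] at hd) e (fun e' => hne ⟨e, e'⟩)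
  · right
    exact general w₂ w₁ (fun n => and_comm) hc.n21 hc.n22 hc.n11 hc.n12 (by rintro rfl; simp [det] at hd) e (fun e' => hne ⟨e', e⟩)

end Charts

/-! ### Points of the exceptional divisors -/

/-- A basis of the lattice of exponents adapted to a weight `w` in the interior of the quadrant: `v` is
orthogonal to `w`, and `w₂` completes `w` into a basis dual to `(n, v)`. -/
structure EdgeBasis (w w₂ n v : ℤ × ℤ) : Prop where
  cone : IsCone w w₂
  wn : wdot w n = 1
  wn₂ : wdot w₂ n = 0
  wv : wdot w v = 0
  wv₂ : wdot w₂ v = 1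
  pos₁ : 0 < w.1
  pos₂ : 0 < w.2

lemma exists_edgeBasis {w : ℤ × ℤ} (h1 : 0 < w.1) (h2 : 0 < w.2) (hw : IsCoprime w.1 w.2) :
    ∃ r s : ℤ, EdgeBasis w (s, r) (r, -s) (-w.2, w.1) := by
  obtain ⟨x, y, hxy⟩ := hw
  -- the solutions of `r * w.1 - s * w.2 = 1` are shifted by multiples of `w` in order to be nonnegative
  refine ⟨x + w.2 * (|x| + |y|), -y + w.1 * (|x| + |y|), ⟨?_, ?_, ?_, ?_, ?_⟩, ?_, ?_, ?_, ?_, h1, h2⟩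
  · exact h1.le
  · exact h2.le
  · simp only; nlinarith [abs_nonneg x, le_abs_self y, abs_nonneg y]
  · simp only; nlinarith [abs_nonneg x, neg_abs_le x, abs_nonneg y]
  · simp only [det]; have : w.1 * (x + w.2 * (|x| + |y|)) - w.2 * (-y + w.1 * (|x| + |y|)) = 1 := by
      linear_combination hxy
    rw [this]; exact one_pos
  · simp only [wdot]; linear_combination hxy
  · simp only [wdot]; ring
  · simp only [wdot]; ring
  · simp only [wdot]; linear_combination hxy

/-- A Noetherian local ring whose maximal ideal is generated by a nonzero element is a discrete valuation ring. -/
lemma dvr_of_principal {F : Type*} [Field F] {Q : LocalSubring F} [IsNoetherianRing Q.toSubring] {u : F}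
    (hu : u ∈ mI Q) (hu0 : u ≠ 0) (h : ∀ x ∈ mI Q, ∃ y ∈ Q.toSubring, x = u * y) : IsDiscreteValuationRing Q.toSubring := by
  have hm : maximalIdeal Q.toSubring = span {⟨u, hu.1⟩} := by
    refine le_antisymm (fun x hx => ?_) ((Ideal.span_singleton_le_iff_mem _).2 (coe_mem_mI.1 hu))
    obtain ⟨y, hy, hxy⟩ := h x (coe_mem_mI.2 hx)
    rw [mem_span_singleton]
    exact ⟨⟨y, hy⟩, Subtype.ext hxy⟩
  have hnf : ¬ IsField Q.toSubring := by
    rw [IsLocalRing.isField_iff_maximalIdeal_eq, hm]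
    intro hc
    rw [Ideal.span_singleton_eq_bot] at hc
    exact hu0 (congrArg Subtype.val hc)
  refine ((IsDiscreteValuationRing.TFAE Q.toSubring hnf).out 0 4).2 ?_
  rw [hm]
  exact ⟨_, rfl⟩

section Edge
variable {P Q : LocalSubring K} {a b : P.toSubring} {w w₂ n v : ℤ × ℤ}

lemma mon_zsmul (x y : K) (k : ℤ) (m : ℤ × ℤ) : mon x y (k • m) = mon x y m ^ k := by
  rw [mon, mon, Prod.smul_fst, Prod.smul_snd, smul_eq_mul, smul_eq_mul, mul_comm k, mul_comm k, zpow_mul,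
    zpow_mul, mul_zpow]

lemma wdot_zsmul (w : ℤ × ℤ) (k : ℤ) (m : ℤ × ℤ) : wdot w (k • m) = k * wdot w m := by
  rw [wdot, wdot, Prod.smul_fst, Prod.smul_snd, smul_eq_mul, smul_eq_mul]; ring

lemma wdot_sub (w m n : ℤ × ℤ) : wdot w (m - n) = wdot w m - wdot w n := by
  rw [sub_eq_add_neg, wdot_add, wdot_neg]; rfl

lemma EdgeBasis.eq_smul (e : EdgeBasis w w₂ n v) {m : ℤ × ℤ} (hm : wdot w m = 0) : m = wdot w₂ m • v :=
  e.cone.wdot_ext (by rw [wdot_zsmul, e.wv, hm, mul_zero]) (by rw [wdot_zsmul, e.wv₂, mul_one])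

lemma EdgeBasis.n_mem (e : EdgeBasis w w₂ n v) : n ∈ dualCone w w := ⟨by rw [e.wn]; decide, by rw [e.wn]; decide⟩
lemma EdgeBasis.v_mem (e : EdgeBasis w w₂ n v) : v ∈ dualCone w w := ⟨by rw [e.wv], by rw [e.wv]⟩
lemma EdgeBasis.neg_v_mem (e : EdgeBasis w w₂ n v) : -v ∈ dualCone w w := by
  constructor <;> rw [wdot_neg, e.wv, neg_zero]

lemma EdgeBasis.inv_mem (e : EdgeBasis w w₂ n v) :
    (mon (a : K) b v)⁻¹ ∈ monRing P.toSubring a b w w := by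
  rw [← mon_neg]; exact mon_mem_monRing e.neg_v_mem

lemma EdgeBasis.le_sub_mem (e : EdgeBasis w w₂ n v) {m : ℤ × ℤ} (hm : 1 ≤ wdot w m) : m - n ∈ dualCone w w := by
  constructor <;> rw [wdot_sub, e.wn] <;> omega

lemma EdgeBasis.mon_eq (h : SmoothAt P a b) (n m : ℤ × ℤ) : mon (a : K) b m = mon (a : K) b n * mon (a : K) b (m - n) := by
  rw [← mon_add h.left_ne_zero h.right_ne_zero, add_sub_cancel]

open Polynomial in
/-- Modulo the equation of the exceptional divisor, the elements of the ring of its chart are Laurent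
polynomials. -/
lemma EdgeBasis.decomp (e : EdgeBasis w w₂ n v) (h : SmoothAt P a b) {x : K} (hx : x ∈ monRing P.toSubring a b w w) :
    ∃ (N : ℕ) (L : ℂ[X]), ∃ y ∈ monRing P.toSubring (a : K) b w w,
      mon (a : K) b v ^ N * x = aeval (mon (a : K) b v) L + mon (a : K) b n * y := by
  set A := monRing P.toSubring (a : K) b w w with hA
  set z := mon (a : K) b v with hz
  set u := mon (a : K) b n with hu
  have hzA : z ∈ A := mon_mem_monRing e.v_mem
  have huA : u ∈ A := mon_mem_monRing e.n_mem
  have hLA : ∀ L : ℂ[X], aeval z L ∈ A := by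
    intro L
    induction L using Polynomial.induction_on' with
    | add p q hp hq => rw [map_add]; exact add_mem hp hq
    | monomial k c => rw [aeval_monomial]; exact mul_mem (le_monRing (h.base (algebraMap_C_mem c))) (pow_mem hzA k)
  induction hx using Subring.closure_induction with
  | mem x hx =>
    rcases hx with hx | ⟨m, hm, rfl⟩
    · obtain ⟨c, hc'⟩ := h.res x hx
      obtain ⟨r, hr, s, hs, e'⟩ := (mem_mI_span h.reg.span).1 hc'
      refine ⟨0, C c, r * mon (a : K) b ((1, 0) - n) + s * mon (a : K) b ((0, 1) - n),
        add_mem (mul_mem (le_monRing hr) (mon_mem_monRing (e.le_sub_mem ?_)))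
          (mul_mem (le_monRing hs) (mon_mem_monRing (e.le_sub_mem ?_))), ?_⟩
      · have := e.pos₁; simp [wdot]; omega
      · have := e.pos₂; simp [wdot]; omega
      · have h1 := mon_eq h n (1, 0)
        have h2 := mon_eq h n (0, 1)
        rw [mon_left] at h1
        rw [mon_right] at h2
        rw [aeval_C, pow_zero, one_mul]
        linear_combination e' + r * h1 + s * h2
    · rcases eq_or_lt_of_le hm.1 with h0 | h0
      · rw [e.eq_smul h0.symm, mon_zsmul]
        obtain ⟨k, hk | hk⟩ := (wdot w₂ m).eq_nat_or_neg
        · exact ⟨0, X ^ k, 0, zero_mem _, by rw [hk]; simp [hz]⟩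
        · refine ⟨k, 1, 0, zero_mem _, ?_⟩
          rw [hk, zpow_neg, zpow_natCast, mul_inv_cancel₀ (pow_ne_zero _ (mon_ne_zero h.left_ne_zero h.right_ne_zero _))]
          simp
      · exact ⟨0, 0, _, mon_mem_monRing (e.le_sub_mem h0), by rw [map_zero, pow_zero, one_mul, zero_add]; exact mon_eq h n m⟩
  | zero => exact ⟨0, 0, 0, zero_mem _, by simp⟩
  | one => exact ⟨0, 1, 0, zero_mem _, by simp⟩
  | add x y _ _ h1 h2 =>
    obtain ⟨N, L, x', hx', h1⟩ := h1
    obtain ⟨M, L', y', hy', h2⟩ := h2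
    refine ⟨N + M, X ^ M * L + X ^ N * L', z ^ M * x' + z ^ N * y', add_mem (mul_mem (pow_mem hzA _) hx')
      (mul_mem (pow_mem hzA _) hy'), ?_⟩
    simp only [map_add, map_mul, map_pow, aeval_X]
    rw [pow_add]
    linear_combination z ^ M * h1 + z ^ N * h2
  | neg x _ h1 =>
    obtain ⟨N, L, x', hx', h1⟩ := h1
    exact ⟨N, -L, -x', neg_mem hx', by rw [map_neg]; linear_combination -h1⟩
  | mul x y _ _ h1 h2 =>
    obtain ⟨N, L, x', hx', h1⟩ := h1
    obtain ⟨M, L', y', hy', h2⟩ := h2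
    refine ⟨N + M, L * L', aeval z L * y' + aeval z L' * x' + u * x' * y', add_mem (add_mem (mul_mem (hLA _) hy')
      (mul_mem (hLA _) hx')) (mul_mem (mul_mem huA hx') hy'), ?_⟩
    rw [map_mul, pow_add]
    linear_combination (z ^ M * y) * h1 + (aeval z L + u * x') * h2

lemma EdgeBasis.exists_pow_mul_mem (e : EdgeBasis w w₂ n v) (h : SmoothAt P a b) {x : K} (hx : x ∈ monRing P.toSubring a b w w) :
    ∃ N : ℕ, mon (a : K) b v ^ N * x ∈ monRing P.toSubring (a : K) b w w₂ := by
  have hz : mon (a : K) b v ∈ monRing P.toSubring (a : K) b w w₂ :=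
    mon_mem_monRing ⟨by rw [e.wv], by rw [e.wv₂]; decide⟩
  induction hx using Subring.closure_induction with
  | mem x hx =>
    rcases hx with hx | ⟨m, hm, rfl⟩
    · exact ⟨0, by rw [pow_zero, one_mul]; exact le_monRing hx⟩
    · refine ⟨(-wdot w₂ m).toNat, ?_⟩
      rw [← mon_nsmul, ← mon_add h.left_ne_zero h.right_ne_zero]
      refine mon_mem_monRing ⟨?_, ?_⟩
      · rw [wdot_add, wdot_nsmul, e.wv, mul_zero, zero_add]; exact hm.1
      · rw [wdot_add, wdot_nsmul, e.wv₂]; omega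
  | zero => exact ⟨0, by simp [zero_mem]⟩
  | one => exact ⟨0, by simp [one_mem]⟩
  | add x y _ _ h1 h2 =>
    obtain ⟨N, h1⟩ := h1
    obtain ⟨M, h2⟩ := h2
    refine ⟨N + M, ?_⟩
    have : mon (a : K) b v ^ (N + M) * (x + y) = mon (a : K) b v ^ M * (mon (a : K) b v ^ N * x) +
      mon (a : K) b v ^ N * (mon (a : K) b v ^ M * y) := by rw [pow_add]; ring
    rw [this]
    exact add_mem (mul_mem (pow_mem hz _) h1) (mul_mem (pow_mem hz _) h2)
  | neg x _ h1 =>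
    obtain ⟨N, h1⟩ := h1
    exact ⟨N, by rw [mul_neg]; exact neg_mem h1⟩
  | mul x y _ _ h1 h2 =>
    obtain ⟨N, h1⟩ := h1
    obtain ⟨M, h2⟩ := h2
    refine ⟨N + M, ?_⟩
    have : mon (a : K) b v ^ (N + M) * (x * y) = (mon (a : K) b v ^ N * x) * (mon (a : K) b v ^ M * y) := by
      rw [pow_add]; ring
    rw [this]
    exact mul_mem h1 h2

open Polynomial in
lemma coeff_aeval_X_one (L : ℂ[X]) (k : ℕ) : coeff (ex 0 k) (aeval (MvPowerSeries.X 1 : R) L) = L.coeff k := by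
  classical
  have hX : ∀ j : ℕ, (MvPowerSeries.X 1 : R) ^ j = monomial (ex 0 j) 1 := fun j => by
    rw [MvPowerSeries.X, MvPowerSeries.monomial_pow, one_pow]; congr 2; simp [ex]
  induction L using Polynomial.induction_on' with
  | add p q hp hq => rw [map_add, map_add, hp, hq, coeff_add]
  | monomial j c =>
    rw [aeval_monomial, coeff_monomial, hX, ← Algebra.smul_def, MvPowerSeries.coeff_smul, MvPowerSeries.coeff_monomial]
    have : (ex 0 k = ex 0 j) ↔ j = k := ⟨fun h => by simpa using (DFunLike.congr_fun h 1).symm, fun h => by rw [h]⟩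
    simp [this]

open Polynomial in
/-- The Laurent polynomials inject into the ring of the exceptional divisor. -/
lemma EdgeBasis.eq_zero (e : EdgeBasis w w₂ n v) (h : SmoothAt P a b) {L : ℂ[X]} {y : K}
    (hy : y ∈ monRing P.toSubring (a : K) b w w) (hL : aeval (mon (a : K) b v) L = mon (a : K) b n * y) : L = 0 := by
  classical
  obtain ⟨N, hN⟩ := e.exists_pow_mul_mem h hy
  obtain ⟨g, -, hg⟩ := h.psi_monRing e.cone hN
  have hz : h.psi e.cone (mon (a : K) b v) = algebraMap R K (MvPowerSeries.X 1) := by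
    rw [h.psi_mon, e.wv, e.wv₂, mon_right]
  have hu : h.psi e.cone (mon (a : K) b n) = algebraMap R K (MvPowerSeries.X 0) := by
    rw [h.psi_mon, e.wn, e.wn₂, mon_left]
  have hψL : ∀ M : ℂ[X], h.psi e.cone (aeval (mon (a : K) b v) M) = algebraMap R K (aeval (MvPowerSeries.X 1 : R) M) := by
    intro M
    induction M using Polynomial.induction_on' with
    | add p q hp hq => simp only [map_add, hp, hq]
    | monomial k c =>
      rw [aeval_monomial, aeval_monomial, map_mul, map_mul, map_pow, map_pow, hz, h.psi_const, ← IsScalarTower.algebraMap_apply]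
  have h1 : aeval (mon (a : K) b v) (X ^ N * L) = mon (a : K) b n * (mon (a : K) b v ^ N * y) := by
    rw [map_mul, map_pow, aeval_X, hL]; ring
  have h2 := congrArg (h.psi e.cone) h1
  rw [hψL, map_mul (h.psi e.cone), hu, ← hg, ← map_mul] at h2
  have h3 := algebraMap_injective h2
  have h4 : X ^ N * L = 0 := by
    ext k
    rw [← coeff_aeval_X_one, h3, coeff_zero, MvPowerSeries.X, MvPowerSeries.coeff_monomial_mul, if_neg]
    intro hle
    have := hle 0
    simp at this
  exact (mul_eq_zero.1 h4).resolve_left (pow_ne_zero _ X_ne_zero)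

open Polynomial in
lemma EdgeBasis.prime (e : EdgeBasis w w₂ n v) (h : SmoothAt P a b) {x y t : K}
    (hx : x ∈ monRing P.toSubring (a : K) b w w) (hy : y ∈ monRing P.toSubring (a : K) b w w)
    (ht : t ∈ monRing P.toSubring (a : K) b w w) (hxy : x * y = mon (a : K) b n * t) :
    (∃ s ∈ monRing P.toSubring (a : K) b w w, x = mon (a : K) b n * s) ∨
      ∃ s ∈ monRing P.toSubring (a : K) b w w, y = mon (a : K) b n * s := by
  have hz0 : mon (a : K) b v ≠ 0 := mon_ne_zero h.left_ne_zero h.right_ne_zero _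
  have hzA : mon (a : K) b v ∈ monRing P.toSubring (a : K) b w w := mon_mem_monRing e.v_mem
  have huA : mon (a : K) b n ∈ monRing P.toSubring (a : K) b w w := mon_mem_monRing e.n_mem
  have hzi : (mon (a : K) b v)⁻¹ ∈ monRing P.toSubring (a : K) b w w := e.inv_mem
  obtain ⟨N, L, x', hx', h1⟩ := e.decomp h hx
  obtain ⟨M, L', y', hy', h2⟩ := e.decomp h hy
  have hLA : ∀ L : ℂ[X], aeval (mon (a : K) b v) L ∈ monRing P.toSubring (a : K) b w w := by
    intro L
    induction L using Polynomial.induction_on' with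
    | add p q hp hq => rw [map_add]; exact add_mem hp hq
    | monomial k c => rw [aeval_monomial]; exact mul_mem (le_monRing (h.base (algebraMap_C_mem c))) (pow_mem hzA k)
  have h3 : L * L' = 0 := by
    refine e.eq_zero h (y := mon (a : K) b v ^ (N + M) * t - (aeval (mon (a : K) b v) L * y' +
      aeval (mon (a : K) b v) L' * x' + mon (a : K) b n * x' * y'))
      (sub_mem (mul_mem (pow_mem hzA _) ht) (add_mem (add_mem (mul_mem (hLA _) hy') (mul_mem (hLA _) hx'))
        (mul_mem (mul_mem huA hx') hy'))) ?_
    rw [map_mul, pow_add]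
    linear_combination (-(mon (a : K) b v ^ M * y)) * h1 - (aeval (mon (a : K) b v) L + mon (a : K) b n * x') * h2 +
      mon (a : K) b v ^ N * mon (a : K) b v ^ M * hxy
  have fin : ∀ {N : ℕ} {x x' : K}, x' ∈ monRing P.toSubring (a : K) b w w →
      mon (a : K) b v ^ N * x = mon (a : K) b n * x' → ∃ s ∈ monRing P.toSubring (a : K) b w w, x = mon (a : K) b n * s := by
    intro N x x' hx' h1
    refine ⟨(mon (a : K) b v)⁻¹ ^ N * x', mul_mem (pow_mem hzi _) hx', ?_⟩
    have : x = (mon (a : K) b v)⁻¹ ^ N * (mon (a : K) b v ^ N * x) := by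
      rw [← mul_assoc, ← mul_pow, inv_mul_cancel₀ hz0, one_pow, one_mul]
    rw [this, h1]; ring
  rcases mul_eq_zero.1 h3 with rfl | rfl
  · left; exact fin hx' (by simpa using h1)
  · right; exact fin hy' (by simpa using h2)

lemma EdgeBasis.u_mem (e : EdgeBasis w w₂ n v) (h : SmoothAt P a b) (hPQ : P ≤ Q)
    (hQ : IsLocAt (monRing P.toSubring a b w w) Q) : mon (a : K) b n ∈ mI Q := by
  have haQ : (a : K) ∈ mI Q := (le_iff_mI.1 hPQ).2 _ (coe_mem_mI.2 h.reg.mem_left)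
  have huQ : mon (a : K) b n ∈ Q.toSubring := hQ.1 (mon_mem_monRing e.n_mem)
  by_contra hc
  have hui := (unit_of_notMem_mI huQ hc).2
  -- `a` is the product of a power of `u` and of a power of `z`, both units
  have h1 : ((1, 0) : ℤ × ℤ) = wdot w (1, 0) • n + wdot w₂ (1, 0) • v :=
    e.cone.wdot_ext (by rw [wdot_add, wdot_zsmul, wdot_zsmul, e.wn, e.wv]; ring)
      (by rw [wdot_add, wdot_zsmul, wdot_zsmul, e.wn₂, e.wv₂]; ring)
  have h2 : (a : K) = mon (a : K) b n ^ wdot w (1, 0) * mon (a : K) b v ^ wdot w₂ (1, 0) := by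
    conv_lhs => rw [← mon_left (a : K) b, h1]
    rw [mon_add h.left_ne_zero h.right_ne_zero, mon_zsmul, mon_zsmul]
  have hz : ∀ k : ℤ, mon (a : K) b v ^ k ∈ Q.toSubring := fun k => by
    rw [← mon_zsmul]
    exact hQ.1 (mon_mem_monRing ⟨by rw [wdot_zsmul, e.wv, mul_zero], by rw [wdot_zsmul, e.wv, mul_zero]⟩)
  have hu : ∀ k : ℤ, mon (a : K) b n ^ k ∈ Q.toSubring := fun k => by
    obtain ⟨j, rfl | rfl⟩ := k.eq_nat_or_neg
    · rw [zpow_natCast]; exact pow_mem huQ _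
    · rw [zpow_neg, zpow_natCast, ← inv_pow]; exact pow_mem hui _
  refine notMem_mI_of_inv h.left_ne_zero ?_ haQ
  rw [h2, mul_inv, ← zpow_neg, ← zpow_neg]
  exact mul_mem (hu _) (hz _)

lemma EdgeBasis.noetherian (e : EdgeBasis w w₂ n v) (h : SmoothAt P a b) (hQ : IsLocAt (monRing P.toSubring a b w w) Q) :
    IsNoetherianRing Q.toSubring := by
  have := h.noeth
  have := e.cone.monRing_noetherian (A := P.toSubring) h.left_ne_zero h.right_ne_zero
  have hz : mon (a : K) b v ∈ monRing P.toSubring (a : K) b w w₂ :=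
    mon_mem_monRing ⟨by rw [e.wv], by rw [e.wv₂]; decide⟩
  have hz0 : mon (a : K) b v ≠ 0 := mon_ne_zero h.left_ne_zero h.right_ne_zero _
  have hle : monRing P.toSubring (a : K) b w w₂ ≤ monRing P.toSubring (a : K) b w w :=
    monRing_le le_monRing fun m hm => mon_mem_monRing ⟨hm.1, hm.1⟩
  have hloc : IsLocAt (monRing P.toSubring (a : K) b w w₂) Q := by
    refine ⟨hle.trans hQ.1, fun x hx => ?_⟩
    obtain ⟨s, hs, t, ht, h0, hi, rfl⟩ := hQ.2 x hx
    obtain ⟨N, hN⟩ := e.exists_pow_mul_mem h hs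
    obtain ⟨M, hM⟩ := e.exists_pow_mul_mem h ht
    refine ⟨_, mul_mem (pow_mem hz M) hN, _, mul_mem (pow_mem hz N) hM, ?_, ?_, ?_⟩
    · exact mul_ne_zero (pow_ne_zero _ hz0) (mul_ne_zero (pow_ne_zero _ hz0) h0)
    · rw [mul_inv, mul_inv, ← inv_pow, ← inv_pow]
      exact mul_mem (pow_mem (hQ.1 (e.inv_mem)) _) (mul_mem (pow_mem (hQ.1 (e.inv_mem)) _) hi)
    · field_simp
  exact isNoetherianRing_of_isLocAt hloc

lemma EdgeBasis.z_unit (e : EdgeBasis w w₂ n v) (h : SmoothAt P a b) (hQ : IsLocAt (monRing P.toSubring a b w w) Q) :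
    mon (a : K) b v ∈ Q.toSubring ∧ (mon (a : K) b v)⁻¹ ∈ Q.toSubring ∧ mon (a : K) b v ∉ mI Q :=
  ⟨hQ.1 (mon_mem_monRing e.v_mem), hQ.1 (e.inv_mem),
    notMem_mI_of_inv (mon_ne_zero h.left_ne_zero h.right_ne_zero _) (hQ.1 (e.inv_mem))⟩

open Polynomial in
/-- The points of the chart of an exceptional divisor above `P` are its generic point, and closed points
parametrized by the nonzero values of the coordinate `z`. -/
lemma EdgeBasis.cases (e : EdgeBasis w w₂ n v) (h : SmoothAt P a b) (hPQ : P ≤ Q)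
    (hQ : IsLocAt (monRing P.toSubring a b w w) Q) :
    (∃ c : ℂ, c ≠ 0 ∧ mon (a : K) b v - algebraMap ℂ K c ∈ mI Q) ∨
    ∀ x ∈ monRing P.toSubring a b w w, x ∈ mI Q ↔ ∃ y ∈ monRing P.toSubring (a : K) b w w, x = mon (a : K) b n * y := by
  have hu := e.u_mem h hPQ hQ
  obtain ⟨hz, hzi, hzm⟩ := e.z_unit h hQ
  by_cases hall : ∀ x ∈ monRing P.toSubring a b w w, x ∈ mI Q → ∃ y ∈ monRing P.toSubring (a : K) b w w, x = mon (a : K) b n * y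
  · refine Or.inr fun x hx => ⟨hall x hx, ?_⟩
    rintro ⟨y, hy, rfl⟩
    exact mul_mem_mI' hu (hQ.1 hy)
  left
  push Not at hall
  obtain ⟨x, hx, hxm, hne⟩ := hall
  obtain ⟨N, L, y, hy, h1⟩ := e.decomp h hx
  have hLm : aeval (mon (a : K) b v) L ∈ mI Q := by
    have : aeval (mon (a : K) b v) L = mon (a : K) b v ^ N * x - mon (a : K) b n * y := by rw [h1]; ring
    rw [this]
    exact sub_mem_mI (mul_mem_mI (pow_mem hz _) hxm) (mul_mem_mI' hu (hQ.1 hy))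
  have hL0 : L ≠ 0 := by
    rintro rfl
    refine hne ((mon (a : K) b v)⁻¹ ^ N * y) (mul_mem (pow_mem (e.inv_mem) _) hy) ?_
    have hz0 : mon (a : K) b v ≠ 0 := mon_ne_zero h.left_ne_zero h.right_ne_zero _
    have : x = (mon (a : K) b v)⁻¹ ^ N * (mon (a : K) b v ^ N * x) := by
      rw [← mul_assoc, ← mul_pow, inv_mul_cancel₀ hz0, one_pow, one_mul]
    rw [this, h1, map_zero]; ring
  have hbase : ∀ c : ℂ, algebraMap ℂ K c ∈ Q.toSubring := fun c => hQ.1 (le_monRing (h.base (algebraMap_C_mem c)))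
  have key : ∀ (d : ℕ) (L : ℂ[X]), L.natDegree = d → L ≠ 0 → aeval (mon (a : K) b v) L ∈ mI Q →
      ∃ c : ℂ, mon (a : K) b v - algebraMap ℂ K c ∈ mI Q := by
    intro d
    induction d with
    | zero =>
      intro L hd hL0 hLm
      rw [eq_C_of_natDegree_eq_zero hd, aeval_C] at hLm
      have hc0 : L.coeff 0 ≠ 0 := by
        intro hc
        apply hL0
        rw [eq_C_of_natDegree_eq_zero hd, hc, C_0]
      refine absurd hLm (notMem_mI_of_inv (by simpa using hc0) ?_)
      rw [← map_inv₀]; exact hbase _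
    | succ d ih =>
      intro L hd hL0 hLm
      obtain ⟨c, hc⟩ := IsAlgClosed.exists_root L (by rw [degree_eq_natDegree hL0, hd]; exact_mod_cast Nat.succ_ne_zero d)
      obtain ⟨M, rfl⟩ := dvd_iff_isRoot.2 hc
      have hM0 : M ≠ 0 := right_ne_zero_of_mul hL0
      rw [map_mul, map_sub, aeval_X, aeval_C] at hLm
      have hMQ : aeval (mon (a : K) b v) M ∈ Q.toSubring := by
        clear * - hz hbase
        induction M using Polynomial.induction_on' with
        | add p q hp hq => rw [map_add]; exact add_mem hp hq
        | monomial k c => rw [aeval_monomial]; exact mul_mem (hbase _) (pow_mem hz k)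
      rcases (mI_mul_iff (sub_mem hz (hbase c)) hMQ).1 hLm with h1 | h1
      · exact ⟨c, h1⟩
      · refine ih M ?_ hM0 h1
        rw [natDegree_mul (X_sub_C_ne_zero c) hM0, natDegree_X_sub_C] at hd
        omega
  obtain ⟨c, hc⟩ := key _ L rfl hL0 hLm
  refine ⟨c, ?_, hc⟩
  rintro rfl
  exact hzm (by simpa using hc)

open Polynomial in
/-- The closed points of the exceptional divisors are smooth, the exceptional divisor being part of a local
coordinate system. -/
lemma EdgeBasis.smoothAt (e : EdgeBasis w w₂ n v) (h : SmoothAt P a b) (hPQ : P ≤ Q)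
    (hQ : IsLocAt (monRing P.toSubring a b w w) Q) {c : ℂ} (hc : c ≠ 0)
    (hzc : mon (a : K) b v - algebraMap ℂ K c ∈ mI Q) :
    SmoothAt Q ⟨mon (a : K) b n, (e.u_mem h hPQ hQ).1⟩ ⟨mon (a : K) b v - algebraMap ℂ K c, hzc.1⟩ := by
  have hu := e.u_mem h hPQ hQ
  obtain ⟨hz, hzi, hzm⟩ := e.z_unit h hQ
  have hz0 : mon (a : K) b v ≠ 0 := mon_ne_zero h.left_ne_zero h.right_ne_zero _
  have hzA : mon (a : K) b v ∈ monRing P.toSubring (a : K) b w w := mon_mem_monRing e.v_mem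
  have hCA : ∀ c : ℂ, algebraMap ℂ K c ∈ monRing P.toSubring (a : K) b w w := fun c => le_monRing (h.base (algebraMap_C_mem c))
  have hbase : ∀ c : ℂ, algebraMap ℂ K c ∈ Q.toSubring := fun c => hQ.1 (hCA c)
  have hMA : ∀ M : ℂ[X], aeval (mon (a : K) b v) M ∈ monRing P.toSubring (a : K) b w w := by
    intro M
    induction M using Polynomial.induction_on' with
    | add p q hp hq => rw [map_add]; exact add_mem hp hq
    | monomial k c => rw [aeval_monomial]; exact mul_mem (hCA _) (pow_mem hzA k)
  -- the elements of the ring of the chart, modulo the two coordinates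
  have hdec : ∀ x ∈ monRing P.toSubring (a : K) b w w, ∃ d : ℂ, ∃ r ∈ Q.toSubring, ∃ s ∈ Q.toSubring,
      x = algebraMap ℂ K d + r * mon (a : K) b n + s * (mon (a : K) b v - algebraMap ℂ K c) := by
    intro x hx
    obtain ⟨N, L, y, hy, h1⟩ := e.decomp h hx
    obtain ⟨M, hM⟩ := X_sub_C_dvd_sub_C_eval (p := L) (a := c)
    obtain ⟨M', hM'⟩ := X_sub_C_dvd_sub_C_eval (p := (X ^ N : ℂ[X])) (a := c)
    have e1 : aeval (mon (a : K) b v) L = algebraMap ℂ K (L.eval c) +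
        (mon (a : K) b v - algebraMap ℂ K c) * aeval (mon (a : K) b v) M := by
      have := congrArg (aeval (mon (a : K) b v)) hM
      simp only [map_sub, map_mul, aeval_X, aeval_C] at this
      linear_combination this
    have e2 : mon (a : K) b v ^ N = algebraMap ℂ K c ^ N +
        (mon (a : K) b v - algebraMap ℂ K c) * aeval (mon (a : K) b v) M' := by
      have := congrArg (aeval (mon (a : K) b v)) hM'
      simp only [map_sub, map_mul, aeval_X, aeval_C, map_pow, eval_pow, eval_X] at this
      linear_combination this
    have hci : algebraMap ℂ K (c⁻¹ ^ N) ∈ Q.toSubring := hbase _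
    refine ⟨c⁻¹ ^ N * L.eval c, algebraMap ℂ K (c⁻¹ ^ N) * y, mul_mem hci (hQ.1 hy),
      algebraMap ℂ K (c⁻¹ ^ N) * (aeval (mon (a : K) b v) M - aeval (mon (a : K) b v) M' * x), 
      mul_mem hci (sub_mem (hQ.1 (hMA _)) (mul_mem (hQ.1 (hMA _)) (hQ.1 hx))), ?_⟩
    have hcc : algebraMap ℂ K (c⁻¹ ^ N) * algebraMap ℂ K c ^ N = 1 := by
      rw [← map_pow, ← map_mul, ← mul_pow, inv_mul_cancel₀ hc, one_pow, map_one]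
    rw [map_mul]
    linear_combination (-x) * hcc + algebraMap ℂ K (c⁻¹ ^ N) * (h1 + e1 - x * e2)
  have hnoeth := e.noetherian h hQ
  have hden : ∀ x ∈ Q.toSubring, ∃ s ∈ monRing P.toSubring (a : K) b w w, ∃ t ∈ monRing P.toSubring (a : K) b w w,
      t ≠ 0 ∧ t⁻¹ ∈ Q.toSubring ∧ t * x = s := by
    intro x hx
    obtain ⟨s, hs, t, ht, h0, hi, rfl⟩ := hQ.2 x hx
    exact ⟨s, hs, t, ht, h0, hi, by field_simp⟩
  have hun : ∀ t ∈ monRing P.toSubring (a : K) b w w, t ≠ 0 → t⁻¹ ∈ Q.toSubring →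
      ¬ ∃ s ∈ monRing P.toSubring (a : K) b w w, t = mon (a : K) b n * s := by
    rintro t ht h0 hi ⟨s, hs, rfl⟩
    exact notMem_mI_of_inv h0 hi (mul_mem_mI' hu (hQ.1 hs))
  -- divisibility by `u` in `Q` and in the ring of the chart
  have hdvd : ∀ x ∈ monRing P.toSubring (a : K) b w w, (∃ r ∈ Q.toSubring, x = mon (a : K) b n * r) →
      ∃ s ∈ monRing P.toSubring (a : K) b w w, x = mon (a : K) b n * s := by
    rintro x hx ⟨r, hr, hxr⟩
    obtain ⟨s, hs, t, ht, h0, hi, hts⟩ := hden r hr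
    rcases e.prime h ht hx hs (by rw [hxr, ← hts]; ring) with h1 | h1
    · exact absurd h1 (hun t ht h0 hi)
    · exact h1
  refine ⟨(RK_le_monRing h.base _ _).trans hQ.1, hnoeth, ⟨?_, ⟨?_, ?_, ?_⟩, ?_⟩, ?_⟩
  · refine le_antisymm (fun x hx => ?_) ?_
    · obtain ⟨s, hs, t, ht, h0, hi, hts⟩ := hden x x.2
      obtain ⟨d, r, hr, r', hr', hd⟩ := hdec s hs
      have hd0 : d = 0 := by
        by_contra hd0
        have h1 : algebraMap ℂ K d ∈ mI Q := by
          have : algebraMap ℂ K d = t * x - r * mon (a : K) b n - r' * (mon (a : K) b v - algebraMap ℂ K c) := by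
            rw [hts, hd]; ring
          rw [this]
          exact sub_mem_mI (sub_mem_mI (mul_mem_mI (hQ.1 ht) (coe_mem_mI.2 hx)) (mul_mem_mI hr hu)) (mul_mem_mI hr' hzc)
        refine notMem_mI_of_inv (by simpa using hd0) ?_ h1
        rw [← map_inv₀]; exact hbase _
      rw [Ideal.mem_span_pair]
      refine ⟨⟨t⁻¹ * r, mul_mem hi hr⟩, ⟨t⁻¹ * r', mul_mem hi hr'⟩, Subtype.ext ?_⟩
      push_cast
      have : (x : K) = t⁻¹ * s := by rw [← hts]; field_simp
      rw [this, hd, hd0, map_zero]; ring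
    · rw [Ideal.span_le]
      rintro x (rfl | rfl)
      · exact coe_mem_mI.1 hu
      · exact coe_mem_mI.1 hzc
  · intro hc0
    exact mon_ne_zero h.left_ne_zero h.right_ne_zero n (congrArg Subtype.val hc0)
  · intro hc0
    exact (mem_maximalIdeal _).1 (coe_mem_mI.1 hu) hc0
  · rintro x y ⟨k, hk⟩
    obtain ⟨s, hs, t, ht, h0, hi, hts⟩ := hden x x.2
    obtain ⟨s', hs', t', ht', h0', hi', hts'⟩ := hden y y.2
    have hk' : (x : K) * y = mon (a : K) b n * k := congrArg Subtype.val hk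
    obtain ⟨q, hq, hsq⟩ := hdvd (s * s') (mul_mem hs hs') ⟨t * t' * k, mul_mem (mul_mem (hQ.1 ht) (hQ.1 ht')) k.2,
      by rw [← hts, ← hts']; linear_combination t * t' * hk'⟩
    rcases e.prime h hs hs' hq hsq with ⟨j, hj, h1⟩ | ⟨j, hj, h1⟩
    · left
      exact ⟨⟨t⁻¹ * j, mul_mem hi (hQ.1 hj)⟩, Subtype.ext (by
        push_cast
        have : (x : K) = t⁻¹ * s := by rw [← hts]; field_simp
        rw [this, h1]; ring)⟩
    · right
      exact ⟨⟨t'⁻¹ * j, mul_mem hi' (hQ.1 hj)⟩, Subtype.ext (by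
        push_cast
        have : (y : K) = t'⁻¹ * s' := by rw [← hts']; field_simp
        rw [this, h1]; ring)⟩
  · rintro ⟨k, hk⟩
    obtain ⟨s, hs, hs'⟩ := hdvd (mon (a : K) b v - algebraMap ℂ K c) (sub_mem hzA (hCA c)) ⟨k, k.2, congrArg Subtype.val hk⟩
    have := e.eq_zero h (L := X - C c) hs (by rw [map_sub, aeval_X, aeval_C, hs'])
    exact X_sub_C_ne_zero c this
  · refine res_of_isLocAt hQ (RK_le_monRing h.base _ _) fun x hx => ?_
    obtain ⟨d, r, hr, s, hs, rfl⟩ := hdec x hx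
    refine ⟨d, ?_⟩
    have : algebraMap ℂ K d + r * mon (a : K) b n + s * (mon (a : K) b v - algebraMap ℂ K c) - algebraMap ℂ K d =
      r * mon (a : K) b n + s * (mon (a : K) b v - algebraMap ℂ K c) := by ring
    rw [this]
    exact add_mem_mI (mul_mem_mI hr hu) (mul_mem_mI hs hzc)

/-- The generic point of an exceptional divisor is a discrete valuation ring. -/
lemma EdgeBasis.dvr (e : EdgeBasis w w₂ n v) (h : SmoothAt P a b) 
    (hQ : IsLocAt (monRing P.toSubring a b w w) Q)
    (hE : ∀ x ∈ monRing P.toSubring a b w w, x ∈ mI Q ↔ ∃ y ∈ monRing P.toSubring (a : K) b w w, x = mon (a : K) b n * y) :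
    IsDiscreteValuationRing Q.toSubring := by
  have := e.noetherian h hQ
  have huA : mon (a : K) b n ∈ monRing P.toSubring (a : K) b w w := mon_mem_monRing e.n_mem
  have hu : mon (a : K) b n ∈ mI Q := (hE _ huA).2 ⟨1, one_mem _, by rw [mul_one]⟩
  have hu0 : mon (a : K) b n ≠ 0 := mon_ne_zero h.left_ne_zero h.right_ne_zero n
  refine dvr_of_principal hu hu0 fun x hx => ?_
  obtain ⟨s, hs, t, ht, h0, hi, rfl⟩ := hQ.2 x hx.1
  have hsm : s ∈ mI Q := by
    have : s = t * (s * t⁻¹) := by field_simp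
    rw [this]; exact mul_mem_mI (hQ.1 ht) hx
  obtain ⟨y, hy, rfl⟩ := (hE s hs).1 hsm
  exact ⟨y * t⁻¹, mul_mem (hQ.1 hy) hi, by ring⟩

open Polynomial in
/-- The generic point of an exceptional divisor is not closed. -/
lemma EdgeBasis.exists_lt (e : EdgeBasis w w₂ n v) (h : SmoothAt P a b)
    (hQ : IsLocAt (monRing P.toSubring a b w w) Q)
    (hE : ∀ x ∈ monRing P.toSubring a b w w, x ∈ mI Q ↔ ∃ y ∈ monRing P.toSubring (a : K) b w w, x = mon (a : K) b n * y) :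
    ∃ T, P ≤ T ∧ IsLocAt (monRing P.toSubring a b w w) T ∧ T.toSubring ≤ Q.toSubring ∧ T ≠ Q := by
  have huA : mon (a : K) b n ∈ monRing P.toSubring (a : K) b w w := mon_mem_monRing e.n_mem
  have hzA : mon (a : K) b v ∈ monRing P.toSubring (a : K) b w w := mon_mem_monRing e.v_mem
  let I : Ideal (monRing P.toSubring (a : K) b w w) := span {⟨_, huA⟩, ⟨_, hzA⟩ - 1}
  have hI : I ≠ ⊤ := by
    rw [Ne, Ideal.eq_top_iff_one, Ideal.mem_span_pair]
    rintro ⟨r, s, hrs⟩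
    have h1 : (r : K) * mon (a : K) b n + s * (mon (a : K) b v - 1) = 1 := congrArg Subtype.val hrs
    obtain ⟨N, L, y, hy, h2⟩ := e.decomp h s.2
    have h3 := e.eq_zero h (L := X ^ N - (X - 1) * L) (y := mon (a : K) b v ^ N * r + y * (mon (a : K) b v - 1))
      (add_mem (mul_mem (pow_mem hzA _) r.2) (mul_mem hy (sub_mem hzA (one_mem _)))) (by
        simp only [map_sub, map_mul, map_pow, aeval_X, map_one]
        linear_combination (-mon (a : K) b v ^ N) * h1 + (mon (a : K) b v - 1) * h2)
    have h4 := congrArg (eval 1) h3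
    simp at h4
  obtain ⟨M, hM, hIM⟩ := Ideal.exists_le_maximal I hI
  have := hM.isPrime
  have huM : (⟨_, huA⟩ : monRing P.toSubring (a : K) b w w) ∈ M := hIM (Ideal.subset_span (by simp))
  have hzM : (⟨_, hzA⟩ - 1 : monRing P.toSubring (a : K) b w w) ∈ M := hIM (Ideal.subset_span (by simp))
  have hT := isLocAt_ofPrime (monRing P.toSubring (a : K) b w w) M
  have huT : mon (a : K) b n ∈ mI (ofPrime (monRing P.toSubring (a : K) b w w) M) := (mem_mI_ofPrime huA).2 huM
  refine ⟨_, ?_, hT, ?_, ?_⟩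
  · have hmem : ∀ m : ℤ × ℤ, 1 ≤ wdot w m → mon (a : K) b m ∈ mI (ofPrime (monRing P.toSubring (a : K) b w w) M) := by
      intro m hm
      rw [mon_eq h n m]
      exact mul_mem_mI' huT (hT.1 (mon_mem_monRing (e.le_sub_mem hm)))
    refine le_iff_mI.2 ⟨le_monRing.trans hT.1, fun x hx => ?_⟩
    obtain ⟨r, hr, s, hs, rfl⟩ := (mem_mI_span h.reg.span).1 hx
    refine add_mem_mI (mul_mem_mI (hT.1 (le_monRing hr)) ?_) (mul_mem_mI (hT.1 (le_monRing hs)) ?_)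
    · have := hmem (1, 0) (by have := e.pos₁; simp [wdot]; omega)
      rwa [mon_left] at this
    · have := hmem (0, 1) (by have := e.pos₂; simp [wdot]; omega)
      rwa [mon_right] at this
  · intro x hx
    obtain ⟨s, t, ht, rfl⟩ := mem_ofPrime.1 hx
    refine mul_mem (hQ.1 s.2) (unit_of_notMem_mI (hQ.1 t.2) fun hc => ht ?_).2
    obtain ⟨y, hy, hty⟩ := (hE t t.2).1 hc
    have : t = ⟨_, huA⟩ * ⟨y, hy⟩ := Subtype.ext hty
    rw [this]; exact Ideal.mul_mem_right _ _ huM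
  · intro hTQ
    have h1 : mon (a : K) b v - 1 ∈ mI Q := by
      rw [← hTQ]; exact (mem_mI_ofPrime (sub_mem hzA (one_mem _))).2 hzM
    obtain ⟨y, hy, hy'⟩ := (hE _ (sub_mem hzA (one_mem _))).1 h1
    have := e.eq_zero h (L := X - C 1) hy (by rw [map_sub, aeval_X, aeval_C, map_one, hy'])
    exact X_sub_C_ne_zero 1 this

end Edge

/-! ### Prime ideals of toric points -/

lemma X_prime_R (i : Fin 2) : Prime (MvPowerSeries.X i : R) := by
  have hs : RegPair (MvPowerSeries.X 1 : R) (MvPowerSeries.X 0) := by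
    have hirr : Irreducible (MvPowerSeries.X 1 : R) := by
      refine ⟨fun hu => ?_, fun x y hxy => ?_⟩
      · exact (mem_maximalIdeal _).1 regPair_X.mem_right hu
      · by_contra! hc
        have h2 : (MvPowerSeries.X 1 : R) ∈ maximalIdeal R ^ 2 := by
          rw [hxy, pow_two]
          exact Ideal.mul_mem_mul ((mem_maximalIdeal x).2 hc.1) ((mem_maximalIdeal y).2 hc.2)
        obtain ⟨r, hr, s, hrs⟩ := regPair_X.mem_pow_succ 1 h2
        have h3 := congrArg (coeff (ex 0 1)) hrs
        rw [map_add, MvPowerSeries.X_pow_eq, MvPowerSeries.X, MvPowerSeries.X, MvPowerSeries.coeff_monomial_mul,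
          MvPowerSeries.coeff_monomial_mul, if_neg, if_neg, MvPowerSeries.coeff_monomial, if_pos] at h3
        · simp at h3
        · ext i; fin_cases i <;> simp
        · intro hle; have := hle 1; simp at this
        · intro hle; have := hle 0; simp at this
    refine ⟨by rw [regPair_X.span, Set.pair_comm], hirr.prime, fun hd => ?_⟩
    obtain ⟨k, hk⟩ := hd
    exact regPair_X.not_principal (MvPowerSeries.X 1) (by
      rw [regPair_X.span]
      refine le_antisymm (Ideal.span_le.2 ?_) (Ideal.span_mono (by simp))
      rintro x (rfl | rfl)
      · exact mem_span_singleton.2 ⟨k, hk⟩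
      · exact mem_span_singleton_self _)
  fin_cases i
  · exact X_zero_prime
  · exact hs.prime

namespace ToricAt
variable {Q : LocalSubring K} {w₁ w₂ : ℤ × ℤ} {ψ : K →+* K} (h : ToricAt Q w₁ w₂ ψ)

lemma chi_nsmul {e : Fin 2 →₀ ℕ} (he : e ∈ toricMonoid w₁ w₂) (k : ℕ) : h.chi (k • e) = h.chi e ^ k := by
  induction k with
  | zero => rw [zero_smul, h.chi_zero, pow_zero]
  | succ k ih => rw [succ_nsmul, h.chi_add (nsmul_mem he k) he, ih, pow_succ]

/-- The ideal of one of the two branches of the toric boundary. -/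
def boundaryPrime (i : Fin 2) : Ideal Q.toSubring :=
  (span {(MvPowerSeries.X i : R)}).comap ((toricRing w₁ w₂).subtype.comp h.hom)

lemma mem_boundaryPrime {i : Fin 2} {x : Q.toSubring} : x ∈ h.boundaryPrime i ↔ MvPowerSeries.X i ∣ (h.hom x : R) := by
  unfold boundaryPrime
  rw [Ideal.mem_comap, mem_span_singleton]; rfl

lemma mem_boundaryPrime_iff {i : Fin 2} {x : Q.toSubring} :
    x ∈ h.boundaryPrime i ↔ ∀ e, coeff e (h.hom x : R) ≠ 0 → e i ≠ 0 := by
  rw [mem_boundaryPrime, MvPowerSeries.X_dvd_iff]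
  exact forall_congr' fun e => ⟨fun k h1 h2 => h1 (k h2), fun k h1 => by by_contra h2; exact k h2 h1⟩

instance isPrime_boundaryPrime (i : Fin 2) : (h.boundaryPrime i).IsPrime := by
  have : (span {(MvPowerSeries.X i : R)}).IsPrime :=
    (Ideal.span_singleton_prime (X_prime_R i).ne_zero).2 (X_prime_R i)
  unfold boundaryPrime; infer_instance

lemma chi_mem_boundaryPrime {i : Fin 2} {e : Fin 2 →₀ ℕ} (he : e ∈ toricMonoid w₁ w₂) :
    h.chi e ∈ h.boundaryPrime i ↔ e i ≠ 0 := by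
  classical
  rw [mem_boundaryPrime_iff, h.hom_chi he]
  constructor
  · intro k
    exact k e (by rw [MvPowerSeries.coeff_monomial, if_pos rfl]; exact one_ne_zero)
  · intro k d hd
    rw [MvPowerSeries.coeff_monomial] at hd
    split_ifs at hd with h1
    · rwa [h1]
    · exact absurd rfl hd

lemma boundaryPrime_le_span (i : Fin 2) :
    h.boundaryPrime i ≤ span (h.chi '' {e | e ∈ toricMonoid w₁ w₂ ∧ e i ≠ 0}) := by
  intro x hx
  rw [mem_boundaryPrime_iff] at hx
  exact h.mem_span_chi fun e he => ⟨(h.hom x).2 e he, hx e he⟩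

lemma eq_zero_of_apply {i k : Fin 2} (hk : k ≠ i) {d : Fin 2 →₀ ℕ} (h0 : d i = 0) (h1 : d k = 0) : d = 0 := by
  ext j
  rcases (by omega : j = i ∨ j = k) with rfl | rfl <;> assumption

lemma smul_eq_smul {i k : Fin 2} (hk : k ≠ i) {d e : Fin 2 →₀ ℕ} (h0 : d i = 0) (h1 : e i = 0) : d k • e = e k • d := by
  ext j
  rcases (by omega : j = i ∨ j = k) with rfl | rfl
  · simp [h0, h1]
  · simp [mul_comm]

lemma exists_other (i : Fin 2) : ∃ k, k ≠ i := ⟨i + 1, by fin_cases i <;> decide⟩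

lemma eq_boundaryPrime_of_notMem (p : Ideal Q.toSubring) [p.IsPrime] {i : Fin 2} {d e : Fin 2 →₀ ℕ}
    (hd : d ∈ toricMonoid w₁ w₂) (hd0 : d ≠ 0) (hdi : d i = 0) (hdp : h.chi d ∉ p)
    (he : e ∈ toricMonoid w₁ w₂) (hep : h.chi e ∈ p) : p = h.boundaryPrime i := by
  obtain ⟨k, hk⟩ := exists_other i
  have hdk : d k ≠ 0 := fun hc => hd0 (eq_zero_of_apply hk hdi hc)
  have hmono : ∀ f ∈ toricMonoid w₁ w₂, f i ≠ 0 → h.chi f ∈ p := by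
    intro f hf hfi
    have hle : e ≤ (e i + 1) • f + e k • d := by
      intro j
      rcases (by omega : j = i ∨ j = k) with rfl | rfl
      · simp only [Finsupp.add_apply, Finsupp.smul_apply, smul_eq_mul]
        nlinarith [Nat.pos_of_ne_zero hfi]
      · simp only [Finsupp.add_apply, Finsupp.smul_apply, smul_eq_mul]
        nlinarith [Nat.pos_of_ne_zero hdk]
    have hmem := add_mem (nsmul_mem hf (e i + 1)) (nsmul_mem hd (e k))
    have h1 : h.chi ((e i + 1) • f + e k • d) ∈ p := by
      rw [← add_tsub_cancel_of_le hle, h.chi_add he (sub_mem_toricMonoid hmem he hle)]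
      exact Ideal.mul_mem_right _ _ hep
    rw [h.chi_add (nsmul_mem hf _) (nsmul_mem hd _), h.chi_nsmul hf, h.chi_nsmul hd] at h1
    rcases Ideal.IsPrime.mem_or_mem ‹_› h1 with h2 | h2
    · exact Ideal.IsPrime.mem_of_pow_mem ‹_› _ h2
    · exact absurd (Ideal.IsPrime.mem_of_pow_mem ‹_› _ h2) hdp
  have hsub : h.boundaryPrime i ≤ p := by
    refine (h.boundaryPrime_le_span i).trans (Ideal.span_le.2 ?_)
    rintro _ ⟨f, ⟨hf, hfi⟩, rfl⟩
    exact hmono f hf hfi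
  refine le_antisymm (fun x hx => ?_) hsub
  by_contra hc
  rw [mem_boundaryPrime_iff] at hc
  push Not at hc
  -- a term of `x` without the variable of index `i`, of least degree
  obtain ⟨f, hf⟩ := exists_minimal_of_wellFoundedLT (fun f : Fin 2 →₀ ℕ =>
    coeff f (h.hom x : R) ≠ 0 ∧ f i = 0) (by obtain ⟨e, h1, h2⟩ := hc; exact ⟨e, h1, h2⟩)
  obtain ⟨⟨hf1, hf2⟩, hmin⟩ := hf
  have hfΓ := (h.hom x).2 f hf1
  have hxs : x ∈ span (h.chi '' ({e | e ∈ toricMonoid w₁ w₂ ∧ e i ≠ 0} ∪ {g | ∃ c ∈ toricMonoid w₁ w₂, g = f + c})) := by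
    refine h.mem_span_chi fun g hg => ?_
    have hgΓ := (h.hom x).2 g hg
    by_cases hgi : g i = 0
    · right
      have hle : f ≤ g := by
        rcases le_total (g k) (f k) with h1 | h1
        · refine hmin ⟨hg, hgi⟩ fun j => ?_
          rcases (by omega : j = i ∨ j = k) with rfl | rfl
          · rw [hgi]; exact Nat.zero_le _
          · exact h1
        · intro j
          rcases (by omega : j = i ∨ j = k) with rfl | rfl
          · rw [hf2]; exact Nat.zero_le _
          · exact h1
      exact ⟨g - f, sub_mem_toricMonoid hgΓ hfΓ hle, (add_tsub_cancel_of_le hle).symm⟩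
    · exact Or.inl ⟨hgΓ, hgi⟩
  rw [Set.image_union, Ideal.span_union, Submodule.mem_sup] at hxs
  obtain ⟨y, hy, z, hz, hyz⟩ := hxs
  have hyb : y ∈ h.boundaryPrime i := by
    refine (Ideal.span_le.2 ?_) hy
    rintro _ ⟨g, ⟨hg, hgi⟩, rfl⟩
    exact (h.chi_mem_boundaryPrime hg).2 hgi
  have hzf : z ∈ span {h.chi f} := by
    refine (Ideal.span_le.2 ?_) hz
    rintro _ ⟨_, ⟨c, hc, rfl⟩, rfl⟩
    rw [h.chi_add hfΓ hc]
    exact Ideal.mul_mem_right _ _ (mem_span_singleton_self _)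
  obtain ⟨t, rfl⟩ := mem_span_singleton.1 hzf
  have hcoef : coeff f (h.hom x : R) = constantCoeff (h.hom t : R) := by
    have h1 : coeff f (h.hom y : R) = 0 := by
      by_contra h2
      exact (h.mem_boundaryPrime_iff.1 hyb) f h2 hf2
    rw [← hyz, map_add, Subring.coe_add, map_add, h1, zero_add, map_mul, Subring.coe_mul, h.hom_chi hfΓ,
      MvPowerSeries.coeff_monomial_mul, if_pos le_rfl, tsub_self, one_mul, MvPowerSeries.coeff_zero_eq_constantCoeff_apply]
  have htu : IsUnit t := by
    by_contra h1
    have h2 := (h.mem_maximal_iff t).2 ((mem_maximalIdeal t).2 h1)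
    rw [mem_toricMaximalIdeal] at h2
    exact hf1 (hcoef.trans h2)
  have hfp : h.chi f ∈ p := by
    have h1 : h.chi f * t ∈ p := by
      have : h.chi f * t = x - y := by rw [← hyz]; ring
      rw [this]; exact sub_mem hx (hsub hyb)
    exact (Ideal.IsPrime.mem_or_mem ‹_› h1).resolve_right fun h2 =>
      Ideal.IsPrime.ne_top ‹p.IsPrime› (Ideal.eq_top_of_isUnit_mem _ h2 htu)
  have h1 := congrArg h.chi (smul_eq_smul hk hdi hf2)
  rw [h.chi_nsmul hfΓ, h.chi_nsmul hd] at h1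
  exact hdp (Ideal.IsPrime.mem_of_pow_mem ‹_› _ (h1 ▸ Ideal.pow_mem_of_mem _ hfp _ (Nat.pos_of_ne_zero hdk)))

/-- A prime ideal which contains a monomial, and is not maximal, is the ideal of one of the branches of
the toric boundary. -/
lemma eq_boundaryPrime (p : Ideal Q.toSubring) [p.IsPrime] (hp : p ≠ maximalIdeal Q.toSubring) {e : Fin 2 →₀ ℕ}
    (he : e ∈ toricMonoid w₁ w₂) (hep : h.chi e ∈ p) : ∃ i, p = h.boundaryPrime i := by
  obtain ⟨d, hd, hd0, hdp⟩ : ∃ d ∈ toricMonoid w₁ w₂, d ≠ 0 ∧ h.chi d ∉ p := by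
    by_contra! hc
    refine hp (le_antisymm (le_maximalIdeal (Ideal.IsPrime.ne_top ‹_›)) (h.gen.trans (Ideal.span_le.2 ?_)))
    rintro y ⟨d, hd, hd0, hy⟩
    have : y = h.chi d := Subtype.ext (h.eq_chi hd hy)
    rw [this]; exact hc d hd hd0
  by_cases h0 : ∃ i, d i = 0
  · obtain ⟨i, hi⟩ := h0
    exact ⟨i, h.eq_boundaryPrime_of_notMem p hd hd0 hi hdp he hep⟩
  push Not at h0
  exfalso
  have hle : e ≤ (e 0 + e 1) • d := by
    intro j
    have h1 := Nat.pos_of_ne_zero (h0 j)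
    simp only [Finsupp.smul_apply, smul_eq_mul]
    fin_cases j
    · simp only [Fin.zero_eta] at *; nlinarith
    · simp only [Fin.mk_one] at *; nlinarith
  have h1 : h.chi ((e 0 + e 1) • d) ∈ p := by
    rw [← add_tsub_cancel_of_le hle, h.chi_add he (sub_mem_toricMonoid (nsmul_mem hd _) he hle)]
    exact Ideal.mul_mem_right _ _ hep
  rw [h.chi_nsmul hd] at h1
  exact hdp (Ideal.IsPrime.mem_of_pow_mem ‹_› _ h1)

lemma dvr_boundaryPrime {i : Fin 2} {d e : Fin 2 →₀ ℕ} (hd : d ∈ toricMonoid w₁ w₂) (hd0 : d ≠ 0) (hdi : d i = 0)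
    (he : e ∈ toricMonoid w₁ w₂) (hei : e i = 1) :
    IsDiscreteValuationRing (ofPrime Q.toSubring (h.boundaryPrime i)).toSubring := by
  obtain ⟨k, hk⟩ := exists_other i
  have hdk : d k ≠ 0 := fun hc => hd0 (eq_zero_of_apply hk hdi hc)
  have := h.noeth
  set V := ofPrime Q.toSubring (h.boundaryPrime i)
  have hV := isLocAt_ofPrime Q.toSubring (h.boundaryPrime i)
  have := isNoetherianRing_of_isLocAt hV
  have hm : ∀ {x : Q.toSubring}, (x : K) ∈ mI V ↔ x ∈ h.boundaryPrime i := fun {x} => mem_mI_ofPrime x.2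
  have hchi0 : ∀ {c : Fin 2 →₀ ℕ}, c ∈ toricMonoid w₁ w₂ → (h.chi c : K) ≠ 0 := by
    intro c hc h0
    have h1 : h.chi c = 0 := Subtype.ext h0
    have h2 := h.hom_chi hc
    rw [h1, map_zero] at h2
    have h3 := congrArg (coeff c) h2
    classical
    rw [MvPowerSeries.coeff_monomial, if_pos rfl] at h3
    simp at h3
  have hdV : (h.chi d : K)⁻¹ ∈ V.toSubring :=
    (unit_of_notMem_mI (hV.1 (h.chi d).2) fun hc => (h.chi_mem_boundaryPrime hd).1 (hm.1 hc) hdi).2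
  refine dvr_of_principal (u := h.chi e) (hm.2 ((h.chi_mem_boundaryPrime he).2 (by rw [hei]; exact one_ne_zero)))
    (hchi0 he) fun x hx => ?_
  have hgen : ∀ y ∈ h.boundaryPrime i, ∃ z ∈ V.toSubring, (y : K) = h.chi e * z := by
    intro y hy
    have := h.boundaryPrime_le_span i hy
    clear hy
    induction this using Submodule.span_induction with
    | mem y hy =>
      obtain ⟨f, ⟨hf, hfi⟩, rfl⟩ := hy
      have hle : e ≤ f + e k • d := by
        intro j
        rcases (by omega : j = i ∨ j = k) with rfl | rfl
        · simp only [Finsupp.add_apply]; omega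
        · simp only [Finsupp.add_apply, Finsupp.smul_apply, smul_eq_mul]; nlinarith [Nat.pos_of_ne_zero hdk]
      have hs := sub_mem_toricMonoid (add_mem hf (nsmul_mem hd (e k))) he hle
      refine ⟨h.chi (f + e k • d - e) * (h.chi d : K)⁻¹ ^ e k, mul_mem (hV.1 (h.chi _).2) (pow_mem hdV _), ?_⟩
      have h1 : h.chi f * h.chi d ^ e k = h.chi e * h.chi (f + e k • d - e) := by
        rw [← h.chi_add he hs, add_tsub_cancel_of_le hle, h.chi_add hf (nsmul_mem hd _), h.chi_nsmul hd]
      have h2 : (h.chi f : K) * (h.chi d : K) ^ e k = h.chi e * h.chi (f + e k • d - e) := by exact_mod_cast congrArg Subtype.val h1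
      rw [← mul_assoc, ← h2, mul_assoc, ← mul_pow, mul_inv_cancel₀ (hchi0 hd), one_pow, mul_one]
    | zero => exact ⟨0, zero_mem _, by simp⟩
    | add x y _ _ ihx ihy =>
      obtain ⟨z, hz, h1⟩ := ihx
      obtain ⟨z', hz', h2⟩ := ihy
      exact ⟨z + z', add_mem hz hz', by rw [Subring.coe_add, h1, h2]; ring⟩
    | smul r x _ ihx =>
      obtain ⟨z, hz, h1⟩ := ihx
      exact ⟨r * z, mul_mem (hV.1 r.2) hz, by rw [smul_eq_mul, Subring.coe_mul, h1]; ring⟩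
  obtain ⟨s, hs, t, ht, h0, hi, rfl⟩ := hV.2 x hx.1
  have hsm : s ∈ mI V := by
    have : s = t * (s * t⁻¹) := by field_simp
    rw [this]; exact mul_mem_mI (hV.1 ht) hx
  obtain ⟨z, hz, h1⟩ := hgen ⟨s, hs⟩ (hm.1 hsm)
  exact ⟨z * t⁻¹, mul_mem hz hi, by rw [← mul_assoc, ← h1]⟩

end ToricAt

/-- The monoid of a cone with primitive edges contains elements of the shape `(0, d)`, `(1, k)`, and
the symmetric ones. -/
lemma IsCone.exists_exponents {w₁ w₂ : ℤ × ℤ} (hc : IsCone w₁ w₂) (h1 : IsCoprime w₁.1 w₁.2) (h2 : IsCoprime w₂.1 w₂.2)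
    (i : Fin 2) : (∃ d ∈ toricMonoid w₁ w₂, d ≠ 0 ∧ d i = 0) ∧ ∃ e ∈ toricMonoid w₁ w₂, e i = 1 := by
  have hd := hc.det_pos
  have key : ∀ m : ℤ × ℤ, m ∈ dualCone w₁ w₂ → ∃ d ∈ toricMonoid w₁ w₂, (d 0 : ℤ) = wdot w₁ m ∧ (d 1 : ℤ) = wdot w₂ m :=
    fun m hm => exists_exponent hm
  have m1 : wdot w₁ (-w₁.2, w₁.1) = 0 := by simp only [wdot]; ring
  have m2 : wdot w₂ (-w₁.2, w₁.1) = det w₁ w₂ := by simp only [wdot, det]; ring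
  have n1 : wdot w₁ (w₂.2, -w₂.1) = det w₁ w₂ := by simp only [wdot, det]; ring
  have n2 : wdot w₂ (w₂.2, -w₂.1) = 0 := by simp only [wdot]; ring
  fin_cases i
  · constructor
    · obtain ⟨d, hdm, d0, d1⟩ := key _ ⟨by rw [m1], by rw [m2]; exact hd.le⟩
      refine ⟨d, hdm, ?_, by rw [m1] at d0; simpa using d0⟩
      rintro rfl
      rw [m2] at d1; simp at d1; omega
    · obtain ⟨x, y, hxy⟩ := h1
      have e1 : wdot w₁ ((x, y) + |wdot w₂ (x, y)| • (-w₁.2, w₁.1)) = 1 := by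
        rw [wdot_add, wdot_zsmul, m1]; simp only [wdot]; linear_combination hxy
      obtain ⟨d, hdm, d0, d1⟩ := key ((x, y) + |wdot w₂ (x, y)| • (-w₁.2, w₁.1)) ⟨by rw [e1]; decide, by
        rw [wdot_add, wdot_zsmul, m2]; nlinarith [neg_abs_le (wdot w₂ (x, y)), abs_nonneg (wdot w₂ (x, y))]⟩
      exact ⟨d, hdm, by rw [e1] at d0; exact_mod_cast d0⟩
  · constructor
    · obtain ⟨d, hdm, d0, d1⟩ := key _ ⟨by rw [n1]; exact hd.le, by rw [n2]⟩
      refine ⟨d, hdm, ?_, by rw [n2] at d1; simpa using d1⟩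
      rintro rfl
      rw [n1] at d0; simp at d0; omega
    · obtain ⟨x, y, hxy⟩ := h2
      have e1 : wdot w₂ ((x, y) + |wdot w₁ (x, y)| • (w₂.2, -w₂.1)) = 1 := by
        rw [wdot_add, wdot_zsmul, n2]; simp only [wdot]; linear_combination hxy
      obtain ⟨d, hdm, d0, d1⟩ := key ((x, y) + |wdot w₁ (x, y)| • (w₂.2, -w₂.1)) ⟨by
        rw [wdot_add, wdot_zsmul, n1]; nlinarith [neg_abs_le (wdot w₁ (x, y)), abs_nonneg (wdot w₁ (x, y))], by rw [e1]; decide⟩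
      exact ⟨d, hdm, by rw [e1] at d1; exact_mod_cast d1⟩

/-! ### Newton fans -/

/-- The exponents occurring in a series. -/
def supp (F : R) : Set (Fin 2 →₀ ℕ) := {e | coeff e F ≠ 0}

/-- The exponents of `F` at which the weight `w` is minimal. -/
def IsMinAt (F : R) (w : ℤ × ℤ) (e : Fin 2 →₀ ℕ) : Prop :=
  e ∈ supp F ∧ ∀ d ∈ supp F, wdot w (toInt e) ≤ wdot w (toInt d)

lemma supp_nonempty {F : R} (hF : F ≠ 0) : (supp F).Nonempty := by
  by_contra hc
  apply hF
  ext e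
  by_contra he
  exact hc ⟨e, he⟩

lemma wdot_mono {w : ℤ × ℤ} (h1 : 0 ≤ w.1) (h2 : 0 ≤ w.2) {d e : Fin 2 →₀ ℕ} (h : d ≤ e) :
    wdot w (toInt d) ≤ wdot w (toInt e) := by
  have h3 : (d 0 : ℤ) ≤ e 0 := by exact_mod_cast h 0
  have h4 : (d 1 : ℤ) ≤ e 1 := by exact_mod_cast h 1
  simp only [wdot, toInt]
  nlinarith

lemma wdot_nonneg {w : ℤ × ℤ} (h1 : 0 ≤ w.1) (h2 : 0 ≤ w.2) (d : Fin 2 →₀ ℕ) : 0 ≤ wdot w (toInt d) := by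
  simp only [wdot, toInt]; positivity

lemma exists_isMinAt {F : R} (hF : F ≠ 0) {w : ℤ × ℤ} (h1 : 0 ≤ w.1) (h2 : 0 ≤ w.2) : ∃ e, IsMinAt F w e := by
  obtain ⟨e, he, hmin⟩ := exists_minimalFor_of_wellFoundedLT (· ∈ supp F) (fun e => (wdot w (toInt e)).toNat) (supp_nonempty hF)
  refine ⟨e, he, fun d hd => ?_⟩
  by_contra! hc
  have hd0 := wdot_nonneg h1 h2 d
  have h3 : (wdot w (toInt e)).toNat ≤ (wdot w (toInt d)).toNat :=
    hmin hd (show (wdot w (toInt d)).toNat ≤ (wdot w (toInt e)).toNat by omega)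
  omega

/-- The linear form `w` on the plane of the Newton polygon. -/
def wreal (w : ℤ × ℤ) (p : ℝ × ℝ) : ℝ := (w.1 : ℝ) * p.1 + (w.2 : ℝ) * p.2

lemma wreal_comb (w : ℤ × ℤ) (p q : ℝ × ℝ) (s t : ℝ) : wreal w (s • p + t • q) = s * wreal w p + t * wreal w q := by
  simp [wreal]; ring

lemma wreal_toInt (w : ℤ × ℤ) (e : Fin 2 →₀ ℕ) : wreal w ((e 0 : ℝ), (e 1 : ℝ)) = (wdot w (toInt e) : ℝ) := by
  simp [wreal, wdot, toInt]

/-- The compact edges of the Newton polygon correspond to the weights which are minimal at several exponents. -/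
lemma newtonFace_nontrivial_iff {F : R} (hF : F ≠ 0) {w : ℤ × ℤ} (h1 : 0 < w.1) (h2 : 0 < w.2) :
    (newtonFace F w).Nontrivial ↔ ∃ e d, e ≠ d ∧ IsMinAt F w e ∧ IsMinAt F w d := by
  have h1' : (0 : ℝ) < w.1 := by exact_mod_cast h1
  have h2' : (0 : ℝ) < w.2 := by exact_mod_cast h2
  constructor
  · intro hnt
    by_contra! hc
    obtain ⟨e, he⟩ := exists_isMinAt hF h1.le h2.le
    have hpoly : newtonPolygon F ⊆ {p | p = ((e 0 : ℝ), (e 1 : ℝ)) ∨ (wdot w (toInt e) : ℝ) < wreal w p} := by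
      refine convexHull_min ?_ ?_
      · rintro _ ⟨d, hd, i, j, rfl⟩
        have h3 : wreal w ((d 0 : ℝ) + i, (d 1 : ℝ) + j) = (wdot w (toInt d) : ℝ) + w.1 * i + w.2 * j := by
          simp [wreal, wdot, toInt]; ring
        have h4 : (wdot w (toInt e) : ℝ) ≤ wdot w (toInt d) := by exact_mod_cast he.2 d hd
        have hi : (0 : ℝ) ≤ i := Nat.cast_nonneg i
        have hj : (0 : ℝ) ≤ j := Nat.cast_nonneg j
        by_cases hde : d = e
        · subst hde
          by_cases hij : i = 0 ∧ j = 0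
          · left; simp [hij.1, hij.2]
          · right
            show _ < wreal w _
            rw [h3]
            have : 0 < w.1 * (i : ℝ) + w.2 * j := by
              rcases not_and_or.1 hij with h5 | h5
              · have : (0 : ℝ) < i := by exact_mod_cast Nat.pos_of_ne_zero h5
                positivity
              · have : (0 : ℝ) < j := by exact_mod_cast Nat.pos_of_ne_zero h5
                positivity
            linarith
        · right
          show _ < wreal w _
          rw [h3]
          have h5 : wdot w (toInt e) < wdot w (toInt d) := by
            refine lt_of_le_of_ne (he.2 d hd) fun h6 => ?_
            exact hc e d (Ne.symm hde) he ⟨hd, fun c hc' => h6 ▸ he.2 c hc'⟩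
          have h6 : (wdot w (toInt e) : ℝ) < wdot w (toInt d) := by exact_mod_cast h5
          have : 0 ≤ w.1 * (i : ℝ) + w.2 * j := by positivity
          linarith
      · have hwe := wreal_toInt w e
        intro p hp q hq s t hs ht hst
        have hp' : (wdot w (toInt e) : ℝ) ≤ wreal w p := by
          rcases hp with rfl | hp
          · rw [hwe]
          · exact le_of_lt hp
        have hq' : (wdot w (toInt e) : ℝ) ≤ wreal w q := by
          rcases hq with rfl | hq
          · rw [hwe]
          · exact le_of_lt hq
        by_cases hs0 : s = 0
        · have ht1 : t = 1 := by linarith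
          rw [hs0, ht1, zero_smul, one_smul, zero_add]; exact hq
        by_cases ht0 : t = 0
        · have hs1 : s = 1 := by linarith
          rw [hs1, ht0, zero_smul, one_smul, add_zero]; exact hp
        have hs' : 0 < s := lt_of_le_of_ne hs (Ne.symm hs0)
        have ht' : 0 < t := lt_of_le_of_ne ht (Ne.symm ht0)
        rcases hp with rfl | hp
        · rcases hq with rfl | hq
          · left; rw [← add_smul, hst, one_smul]
          · right
            show _ < wreal w _
            rw [wreal_comb, hwe]
            have hX : s * (wdot w (toInt e) : ℝ) + t * (wdot w (toInt e) : ℝ) = wdot w (toInt e) := by rw [← add_mul, hst, one_mul]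
            linarith [mul_lt_mul_of_pos_left (show (wdot w (toInt e) : ℝ) < wreal w q from hq) ht']
        · right
          show _ < wreal w _
          rw [wreal_comb]
          have hX : s * (wdot w (toInt e) : ℝ) + t * (wdot w (toInt e) : ℝ) = wdot w (toInt e) := by rw [← add_mul, hst, one_mul]
          linarith [mul_lt_mul_of_pos_left (show (wdot w (toInt e) : ℝ) < wreal w p from hp) hs', mul_le_mul_of_nonneg_left hq' ht]
    obtain ⟨p, hp, q, hq, hpq⟩ := hnt
    have hself : ∀ p ∈ newtonFace F w, p = ((e 0 : ℝ), (e 1 : ℝ)) := by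
      intro p hp
      rcases hpoly hp.1 with h3 | h3
      · exact h3
      · have h4 := hp.2 ((e 0 : ℝ), (e 1 : ℝ)) (subset_convexHull ℝ _ ⟨e, he.1, 0, 0, by simp⟩)
        have h5 := wreal_toInt w e
        have h6 : (wdot w (toInt e) : ℝ) < wreal w p := h3
        simp only [wreal] at h5 h6
        linarith
    exact hpq ((hself p hp).trans (hself q hq).symm)
  · rintro ⟨e, d, hed, he, hd⟩
    have hmem : ∀ c, IsMinAt F w c → ((c 0 : ℝ), (c 1 : ℝ)) ∈ newtonFace F w := by
      intro c hc
      refine ⟨subset_convexHull ℝ _ ⟨c, hc.1, 0, 0, by simp⟩, ?_⟩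
      have hpoly : newtonPolygon F ⊆ {p | (wdot w (toInt c) : ℝ) ≤ wreal w p} := by
        refine convexHull_min ?_ ?_
        · rintro _ ⟨g, hg, i, j, rfl⟩
          have h3 : wreal w ((g 0 : ℝ) + i, (g 1 : ℝ) + j) = (wdot w (toInt g) : ℝ) + w.1 * i + w.2 * j := by
            simp [wreal, wdot, toInt]; ring
          have h4 : (wdot w (toInt c) : ℝ) ≤ wdot w (toInt g) := by exact_mod_cast hc.2 g hg
          show _ ≤ wreal w _
          rw [h3]
          have : 0 ≤ w.1 * (i : ℝ) + w.2 * j := by positivity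
          linarith
        · intro p hp q hq s t hs ht hst
          show _ ≤ wreal w _
          rw [wreal_comb]
          have hX : s * (wdot w (toInt c) : ℝ) + t * (wdot w (toInt c) : ℝ) = wdot w (toInt c) := by rw [← add_mul, hst, one_mul]
          linarith [mul_le_mul_of_nonneg_left (show (wdot w (toInt c) : ℝ) ≤ wreal w p from hp) hs,
            mul_le_mul_of_nonneg_left (show (wdot w (toInt c) : ℝ) ≤ wreal w q from hq) ht]
      intro q hq
      have h3 := wreal_toInt w c
      have h4 : (wdot w (toInt c) : ℝ) ≤ wreal w q := hpoly hq
      simp only [wreal] at h3 h4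
      linarith
    refine ⟨_, hmem e he, _, hmem d hd, fun hc => hed ?_⟩
    simp only [Prod.mk.injEq, Nat.cast_inj] at hc
    ext i; fin_cases i
    · exact hc.1
    · exact hc.2

lemma newtonFanRays_nonneg {F : R} {w : ℤ × ℤ} (h : w ∈ newtonFanRays F) : 0 ≤ w.1 ∧ 0 ≤ w.2 ∧ IsCoprime w.1 w.2 := by
  rcases h with (rfl | rfl) | ⟨h1, h2, h3, -⟩
  · exact ⟨by simp, by simp, isCoprime_one_left⟩
  · exact ⟨by simp, by simp, isCoprime_one_right⟩
  · exact ⟨h1.le, h2.le, h3⟩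

/-- A primitive vector of the quadrant is determined by an orthogonal line. -/
lemma eq_of_det_eq_zero {w w' : ℤ × ℤ} (h1 : 0 ≤ w.1) (h2 : 0 ≤ w.2) (h1' : 0 ≤ w'.1) (h2' : 0 ≤ w'.2)
    (h : IsCoprime w.1 w.2) (h' : IsCoprime w'.1 w'.2) (hd : det w w' = 0) : w = w' := by
  unfold det at hd
  have e1 : w.1 ∣ w'.1 := h.dvd_of_dvd_mul_left (⟨w'.2, by linarith⟩ : w.1 ∣ w.2 * w'.1)
  have e2 : w'.1 ∣ w.1 := h'.dvd_of_dvd_mul_left (⟨w.2, by linarith⟩ : w'.1 ∣ w'.2 * w.1)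
  have e3 : w.2 ∣ w'.2 := h.symm.dvd_of_dvd_mul_left (⟨w'.1, by linarith⟩ : w.2 ∣ w.1 * w'.2)
  have e4 : w'.2 ∣ w.2 := h'.symm.dvd_of_dvd_mul_left (⟨w.1, by linarith⟩ : w'.2 ∣ w'.1 * w.2)
  ext
  · exact Int.dvd_antisymm h1 h1' e1 e2
  · exact Int.dvd_antisymm h2 h2' e3 e4

lemma finite_newtonFanRays {F : R} (hF : F ≠ 0) : (newtonFanRays F).Finite := by
  obtain ⟨I₀, hfin, hsub, hmin⟩ := exists_finite_minimal (supp F)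
  have key : ∀ w : ℤ × ℤ, 0 < w.1 → 0 < w.2 → ∀ e, IsMinAt F w e → e ∈ I₀ := by
    intro w h1 h2 e he
    obtain ⟨d, hd, hde⟩ := hmin e he.1
    have h3 := he.2 d (hsub hd)
    have h4 : (d 0 : ℤ) ≤ e 0 := by exact_mod_cast hde 0
    have h5 : (d 1 : ℤ) ≤ e 1 := by exact_mod_cast hde 1
    simp only [wdot, toInt] at h3
    have h6 : (d 0 : ℤ) = e 0 := by nlinarith
    have h7 : (d 1 : ℤ) = e 1 := by nlinarith
    have : d = e := by
      ext i; fin_cases i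
      · exact_mod_cast h6
      · exact_mod_cast h7
    rwa [← this]
  refine Set.Finite.union (Set.toFinite _) ?_
  have hex : ∀ w ∈ {w : ℤ × ℤ | 0 < w.1 ∧ 0 < w.2 ∧ IsCoprime w.1 w.2 ∧ (newtonFace F w).Nontrivial},
      ∃ p : (Fin 2 →₀ ℕ) × (Fin 2 →₀ ℕ), p.1 ≠ p.2 ∧ p ∈ I₀ ×ˢ I₀ ∧ wdot w (toInt p.1) = wdot w (toInt p.2) := by
    rintro w ⟨h1, h2, -, h4⟩
    obtain ⟨e, d, hed, he, hd⟩ := (newtonFace_nontrivial_iff hF h1 h2).1 h4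
    exact ⟨(e, d), hed, ⟨key w h1 h2 e he, key w h1 h2 d hd⟩, le_antisymm (he.2 d hd.1) (hd.2 e he.1)⟩
  choose! p hp1 hp2 hp3 using hex
  refine Set.Finite.of_finite_image (f := p) ((hfin.prod hfin).subset ?_) ?_
  · rintro _ ⟨w, hw, rfl⟩
    exact hp2 w hw
  · intro w hw w' hw' hpw
    refine eq_of_det_eq_zero hw.1.le hw.2.1.le hw'.1.le hw'.2.1.le hw.2.2.1 hw'.2.2.1 ?_
    have h1 := hp3 w hw
    have h2 := hp3 w' hw'
    have h3 := hp1 w hw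
    rw [← hpw] at h2
    simp only [wdot, toInt] at h1 h2
    set e := (p w).1
    set d := (p w).2
    have h4 : ¬ ((e 0 : ℤ) - d 0 = 0 ∧ (e 1 : ℤ) - d 1 = 0) := by
      rintro ⟨h5, h6⟩
      apply h3
      ext i; fin_cases i
      · show e 0 = d 0; omega
      · show e 1 = d 1; omega
    have h5 : det w w' * ((e 0 : ℤ) - d 0) = 0 := by unfold det; linear_combination w'.2 * h1 - w.2 * h2
    have h6 : det w w' * ((e 1 : ℤ) - d 1) = 0 := by unfold det; linear_combination w.1 * h2 - w'.1 * h1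
    by_contra hdet
    exact h4 ⟨(mul_eq_zero.1 h5).resolve_left hdet, (mul_eq_zero.1 h6).resolve_left hdet⟩

/-- If a weight `u + v` is minimal at `e`, but not `u`, then there is a ray of the Newton fan strictly
between `u` and `v`. -/
lemma exists_ray {F : R} (hF : F ≠ 0) {u v : ℤ × ℤ} (hu1 : 0 ≤ u.1) (hu2 : 0 ≤ u.2) (hv1 : 0 ≤ v.1) (hv2 : 0 ≤ v.2)
    (h1 : 0 < u.1 + v.1) (h2 : 0 < u.2 + v.2) {e : Fin 2 →₀ ℕ} (he : IsMinAt F (u + v) e)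
    (hne : ∃ d ∈ supp F, wdot u (toInt d) < wdot u (toInt e)) :
    ∃ w ∈ newtonFanRays F, ∃ A B g : ℤ, 0 < A ∧ 0 < B ∧ 0 < g ∧ g * w.1 = B * u.1 + A * v.1 ∧ g * w.2 = B * u.2 + A * v.2 := by
  obtain ⟨I₀, hfin, hsub, hmin⟩ := exists_finite_minimal (supp F)
  have hsum : ∀ d : Fin 2 →₀ ℕ, wdot (u + v) (toInt d) = wdot u (toInt d) + wdot v (toInt d) := by
    intro d; simp [wdot]; ring
  -- the numerator and the denominator of the slope at which `d` becomes better than `e`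
  let T : Set (Fin 2 →₀ ℕ) := {d ∈ I₀ | wdot u (toInt d) < wdot u (toInt e)}
  have hTfin : T.Finite := hfin.subset (Set.sep_subset _ _)
  have hTne : T.Nonempty := by
    obtain ⟨d, hd, hlt⟩ := hne
    obtain ⟨d', hd', hle⟩ := hmin d hd
    exact ⟨d', hd', lt_of_le_of_lt (wdot_mono hu1 hu2 hle) hlt⟩
  have hT : ∀ d ∈ T, 0 < wdot u (toInt e) - wdot u (toInt d) ∧
      wdot u (toInt e) - wdot u (toInt d) ≤ wdot v (toInt d) - wdot v (toInt e) := by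
    rintro d ⟨hd, hlt⟩
    have := he.2 d (hsub hd)
    rw [hsum, hsum] at this
    omega
  obtain ⟨d, hdT, hmax⟩ := hTfin.exists_maximalFor (fun d =>
    ((wdot u (toInt e) - wdot u (toInt d) : ℤ) : ℚ) / ((wdot v (toInt d) - wdot v (toInt e) : ℤ) : ℚ)) T hTne
  set A := wdot u (toInt e) - wdot u (toInt d) with hA
  set B := wdot v (toInt d) - wdot v (toInt e) with hB
  obtain ⟨hA0, hAB⟩ := hT d hdT
  have hB0 : 0 < B := lt_of_lt_of_le hA0 hAB
  have hcross : ∀ c ∈ T, (wdot u (toInt e) - wdot u (toInt c)) * B ≤ A * (wdot v (toInt c) - wdot v (toInt e)) := by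
    intro c hc
    obtain ⟨hc0, hcB⟩ := hT c hc
    have hcB0 : 0 < wdot v (toInt c) - wdot v (toInt e) := lt_of_lt_of_le hc0 hcB
    have h3 : ((wdot u (toInt e) - wdot u (toInt c) : ℤ) : ℚ) / ((wdot v (toInt c) - wdot v (toInt e) : ℤ) : ℚ) ≤ (A : ℚ) / B := by
      by_contra! h4
      exact absurd (hmax hc h4.le) (not_le.2 h4)
    rw [div_le_div_iff₀ (by exact_mod_cast hcB0) (by exact_mod_cast hB0)] at h3
    exact_mod_cast h3
  have hW : ∀ c : Fin 2 →₀ ℕ, wdot (B * u.1 + A * v.1, B * u.2 + A * v.2) (toInt c) = B * wdot u (toInt c) + A * wdot v (toInt c) := by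
    intro c; simp [wdot]; ring
  have p1 : 0 < B * u.1 + A * v.1 := by
    rcases eq_or_lt_of_le hu1 with h3 | h3
    · have : 0 < v.1 := by omega
      rw [← h3]; positivity
    · positivity
  have p2 : 0 < B * u.2 + A * v.2 := by
    rcases eq_or_lt_of_le hu2 with h3 | h3
    · have : 0 < v.2 := by omega
      rw [← h3]; positivity
    · positivity
  have hmin0 : ∀ c ∈ supp F, B * wdot u (toInt e) + A * wdot v (toInt e) ≤ B * wdot u (toInt c) + A * wdot v (toInt c) := by
    intro c hc
    obtain ⟨c', hc', hle⟩ := hmin c hc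
    have m1 := wdot_mono hu1 hu2 hle
    have m2 := wdot_mono hv1 hv2 hle
    have h3 : B * wdot u (toInt e) + A * wdot v (toInt e) ≤ B * wdot u (toInt c') + A * wdot v (toInt c') := by
      by_cases hcT : wdot u (toInt c') < wdot u (toInt e)
      · have := hcross c' ⟨hc', hcT⟩
        linarith
      · push Not at hcT
        by_cases hcv : wdot v (toInt e) ≤ wdot v (toInt c')
        · nlinarith
        · have h5 := he.2 c' (hsub hc')
          rw [hsum, hsum] at h5
          nlinarith
    nlinarith
  set W : ℤ × ℤ := (B * u.1 + A * v.1, B * u.2 + A * v.2)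
  have heW : IsMinAt F W e := ⟨he.1, fun c hc => by rw [hW, hW]; exact hmin0 c hc⟩
  have hdW : IsMinAt F W d := ⟨hsub hdT.1, fun c hc => by
    rw [hW, hW]
    refine le_trans (le_of_eq ?_) (hmin0 c hc)
    rw [hA, hB]; ring⟩
  have hed : e ≠ d := by
    rintro rfl
    exact absurd hdT.2 (lt_irrefl _)
  set g : ℤ := (Int.gcd W.1 W.2 : ℤ)
  have hg0 : 0 < g := by
    have : Int.gcd W.1 W.2 ≠ 0 := fun h => by
      rw [Int.gcd_eq_zero_iff] at h; exact p1.ne' h.1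
    exact Int.natCast_pos.2 (Nat.pos_of_ne_zero this)
  obtain ⟨x, hx⟩ : g ∣ W.1 := Int.gcd_dvd_left ..
  obtain ⟨y, hy⟩ : g ∣ W.2 := Int.gcd_dvd_right ..
  have hx0 : 0 < x := by
    have : 0 < g * x := hx ▸ p1
    exact (pos_iff_pos_of_mul_pos this).1 hg0
  have hy0 : 0 < y := by
    have : 0 < g * y := hy ▸ p2
    exact (pos_iff_pos_of_mul_pos this).1 hg0
  have hcop : IsCoprime x y := by
    refine ⟨Int.gcdA W.1 W.2, Int.gcdB W.1 W.2, ?_⟩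
    have h3 : g = W.1 * Int.gcdA W.1 W.2 + W.2 * Int.gcdB W.1 W.2 := Int.gcd_eq_gcd_ab _ _
    have h4 : g * (Int.gcdA W.1 W.2 * x + Int.gcdB W.1 W.2 * y) = g * 1 := by
      linear_combination -h3 - Int.gcdA W.1 W.2 * hx - Int.gcdB W.1 W.2 * hy
    exact mul_left_cancel₀ hg0.ne' h4
  have hxy : ∀ c : Fin 2 →₀ ℕ, wdot W (toInt c) = g * wdot (x, y) (toInt c) := by
    intro c; simp only [wdot]; rw [hx, hy]; ring
  have hscale : ∀ c, IsMinAt F W c → IsMinAt F (x, y) c := by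
    intro c hc
    refine ⟨hc.1, fun c' hc' => ?_⟩
    have := hc.2 c' hc'
    rw [hxy, hxy] at this
    exact le_of_mul_le_mul_left this hg0
  exact ⟨(x, y), Or.inr ⟨hx0, hy0, hcop, (newtonFace_nontrivial_iff hF hx0 hy0).2 ⟨e, d, hed, hscale e heW, hscale d hdW⟩⟩,
    A, B, g, hA0, hB0, hg0, hx.symm, hy.symm⟩

lemma IsNewtonCone.isCone {F : R} {w₁ w₂ : ℤ × ℤ} (h : IsNewtonCone F w₁ w₂) : IsCone w₁ w₂ :=
  ⟨(newtonFanRays_nonneg h.1).1, (newtonFanRays_nonneg h.1).2.1, (newtonFanRays_nonneg h.2.1).1,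
    (newtonFanRays_nonneg h.2.1).2.1, h.2.2.1⟩

/-- The two edges of a cone of the Newton fan of `F` are minimal at a common exponent of `F`. -/
lemma IsNewtonCone.exists_vertex {F : R} (hF : F ≠ 0) {w₁ w₂ : ℤ × ℤ} (h : IsNewtonCone F w₁ w₂) :
    ∃ e, IsMinAt F w₁ e ∧ IsMinAt F w₂ e := by
  have hc := h.isCone
  have hd := hc.det_pos
  have hdet := hd
  unfold det at hd
  have n11 := hc.n11
  have n12 := hc.n12
  have n21 := hc.n21
  have n22 := hc.n22
  have q1 : 0 < w₁.1 := by
    rcases eq_or_lt_of_le n11 with h0 | h0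
    · rw [← h0] at hd; nlinarith
    · exact h0
  have q2 : 0 < w₂.2 := by
    rcases eq_or_lt_of_le n22 with h0 | h0
    · rw [← h0] at hd; nlinarith
    · exact h0
  have p1 : 0 < w₁.1 + w₂.1 := by omega
  have p2 : 0 < w₁.2 + w₂.2 := by omega
  obtain ⟨e, he⟩ := exists_isMinAt hF (w := w₁ + w₂) p1.le p2.le
  refine ⟨e, ⟨he.1, ?_⟩, ⟨he.1, ?_⟩⟩
  · by_contra! hcon
    obtain ⟨w, hw, A, B, g, hA, hB, hg, e1, e2⟩ := exists_ray hF n11 n12 n21 n22 p1 p2 he hcon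
    refine h.2.2.2 w hw ⟨?_, ?_⟩
    · have : g * det w₁ w = A * det w₁ w₂ := by unfold det; linear_combination w₁.1 * e2 - w₁.2 * e1
      exact (pos_iff_pos_of_mul_pos (by rw [this]; positivity)).1 hg
    · have : g * det w w₂ = B * det w₁ w₂ := by unfold det; linear_combination w₂.2 * e1 - w₂.1 * e2
      exact (pos_iff_pos_of_mul_pos (by rw [this]; positivity)).1 hg
  · by_contra! hcon
    obtain ⟨w, hw, A, B, g, hA, hB, hg, e1, e2⟩ := exists_ray hF n21 n22 n11 n12 (by omega) (by omega)
      (by rwa [add_comm w₂ w₁]) hcon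
    refine h.2.2.2 w hw ⟨?_, ?_⟩
    · have : g * det w₁ w = B * det w₁ w₂ := by unfold det; linear_combination w₁.1 * e2 - w₁.2 * e1
      exact (pos_iff_pos_of_mul_pos (by rw [this]; positivity)).1 hg
    · have : g * det w w₂ = A * det w₁ w₂ := by unfold det; linear_combination w₂.2 * e1 - w₂.1 * e2
      exact (pos_iff_pos_of_mul_pos (by rw [this]; positivity)).1 hg

/-- At the fixed points of the charts of the Newton fan of `f`, the total transform of `Z(f)` is
contained in the toric boundary. -/
lemma SmoothAt.eq_chi_mul_unit {P Q : LocalSubring K} {a b : P.toSubring} (h : SmoothAt P a b) {w₁ w₂ : ℤ × ℤ}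
    {f : P.toSubring} (hf : f ≠ 0) (hN : IsNewtonCone (h.exp f) w₁ w₂) (hQ : ToricAt Q w₁ w₂ (h.psi hN.isCone))
    (hfQ : (f : K) ∈ Q.toSubring) :
    ∃ e ∈ toricMonoid w₁ w₂, ∃ y, IsUnit y ∧ (⟨f, hfQ⟩ : Q.toSubring) = hQ.chi e * y := by
  have hc := hN.isCone
  have hF : h.exp f ≠ 0 := fun h0 => hf (h.exp_injective (by rw [h0, map_zero]))
  obtain ⟨e, he1, he2⟩ := hN.exists_vertex hF
  have hψ : (hQ.hom ⟨f, hfQ⟩ : R) = monHom hc (h.exp f) := hQ.hom_eq (h.psi_coe hc f)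
  have hΓ := hc.conv_mem e
  have hsp : (⟨f, hfQ⟩ : Q.toSubring) ∈ span {hQ.chi (conv w₁ w₂ e)} := by
    refine (Ideal.span_le.2 ?_) (hQ.mem_span_chi (x := ⟨f, hfQ⟩) (I := {d | ∃ c ∈ toricMonoid w₁ w₂, d = conv w₁ w₂ e + c}) fun d hd => ?_)
    · rintro _ ⟨_, ⟨c, hc', rfl⟩, rfl⟩
      rw [hQ.chi_add hΓ hc']
      exact Ideal.mul_mem_right _ _ (mem_span_singleton_self _)
    · rw [hψ] at hd
      obtain ⟨d, rfl, hd'⟩ := coeff_monHom_ne_zero hc hd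
      have hle : conv w₁ w₂ e ≤ conv w₁ w₂ d := by
        intro i
        have k0 := he1.2 d hd'
        have k1 := he2.2 d hd'
        rw [← hc.conv_zero, ← hc.conv_zero] at k0
        rw [← hc.conv_one, ← hc.conv_one] at k1
        fin_cases i
        · exact_mod_cast k0
        · exact_mod_cast k1
      exact ⟨_, sub_mem_toricMonoid (hc.conv_mem d) hΓ hle, (add_tsub_cancel_of_le hle).symm⟩
  obtain ⟨y, hy⟩ := mem_span_singleton.1 hsp
  refine ⟨_, hΓ, y, ?_, hy⟩
  by_contra hu
  have h2 := (hQ.mem_maximal_iff y).2 ((mem_maximalIdeal y).2 hu)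
  rw [mem_toricMaximalIdeal] at h2
  have h3 : coeff (conv w₁ w₂ e) (hQ.hom ⟨f, hfQ⟩ : R) =
      coeff (conv w₁ w₂ e) (hQ.hom (hQ.chi (conv w₁ w₂ e) * y) : R) := by rw [hy]
  rw [hψ, coeff_monHom_conv, map_mul, Subring.coe_mul, hQ.hom_chi hΓ, MvPowerSeries.coeff_monomial_mul, if_pos le_rfl,
    tsub_self, one_mul, MvPowerSeries.coeff_zero_eq_constantCoeff_apply, h2] at h3
  exact he1.1 h3

/-! ### Newton modifications are modifications -/

/-- Finite unions of affine models of finite type. -/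
def IsFiniteType (U : Set (LocalSubring K)) : Prop :=
  ∃ 𝒜 : Set (Subalgebra R K), 𝒜.Finite ∧ (∀ A ∈ 𝒜, A.FG) ∧ U = ⋃ A ∈ 𝒜, affinePoints A.toSubring

lemma isFiniteType_affine {A : Subalgebra R K} (hA : A.FG) : IsFiniteType (affinePoints A.toSubring) :=
  ⟨{A}, Set.finite_singleton A, by rintro _ rfl; exact hA, by simp⟩

lemma isFiniteType_biUnion {ι : Type*} {s : Set ι} (hs : s.Finite) {U : ι → Set (LocalSubring K)}
    (hU : ∀ i ∈ s, IsFiniteType (U i)) : IsFiniteType (⋃ i ∈ s, U i) := by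
  choose! 𝒜 h1 h2 h3 using hU
  refine ⟨⋃ i ∈ s, 𝒜 i, hs.biUnion h1, fun A hA => ?_, ?_⟩
  · simp only [Set.mem_iUnion] at hA
    obtain ⟨i, hi, hA⟩ := hA
    exact h2 i hi A hA
  · ext P
    simp only [Set.mem_iUnion]
    constructor
    · rintro ⟨i, hi, hP⟩
      rw [h3 i hi] at hP
      simp only [Set.mem_iUnion] at hP
      obtain ⟨A, hA, hP⟩ := hP
      exact ⟨A, ⟨i, hi, hA⟩, hP⟩
    · rintro ⟨A, ⟨i, hi, hA⟩, hP⟩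
      refine ⟨i, hi, ?_⟩
      rw [h3 i hi]
      simp only [Set.mem_iUnion]
      exact ⟨A, hA, hP⟩

lemma isFiniteType_union {U V : Set (LocalSubring K)} (hU : IsFiniteType U) (hV : IsFiniteType V) : IsFiniteType (U ∪ V) := by
  have := isFiniteType_biUnion (s := Set.univ) (Set.finite_univ) (U := fun i : Bool => if i then U else V)
    (by intro i _; cases i <;> simpa)
  have h2 : (⋃ i ∈ Set.univ, (if i = true then U else V)) = U ∪ V := by
    ext P; simp [or_comm]
  rwa [h2] at this

/-- The ring of fractions of `A` with denominators the powers of `f`. -/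
def away (A : Subalgebra R K) (f : K) : Subalgebra R K := A ⊔ Algebra.adjoin R {f⁻¹}

lemma away_fg {A : Subalgebra R K} (hA : A.FG) (f : K) : (away A f).FG :=
  hA.sup ⟨{f⁻¹}, by simp⟩

lemma le_away (A : Subalgebra R K) (f : K) : A ≤ away A f := le_sup_left

lemma inv_mem_away (A : Subalgebra R K) (f : K) : f⁻¹ ∈ away A f :=
  (le_sup_right : Algebra.adjoin R {f⁻¹} ≤ _) (Algebra.subset_adjoin rfl)

lemma exists_mul_mem_of_mem_away {A : Subalgebra R K} {f : K} (hf : f ∈ A) (h0 : f ≠ 0) {x : K} (hx : x ∈ away A f) :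
    ∃ n : ℕ, f ^ n * x ∈ A := by
  have h1 : away A f = Algebra.adjoin R ((A : Set K) ∪ {f⁻¹}) := by
    rw [away, Algebra.adjoin_union, Algebra.adjoin_eq]
  rw [h1] at hx
  induction hx using Algebra.adjoin_induction with
  | mem x hx =>
    rcases hx with hx | rfl
    · exact ⟨0, by rwa [pow_zero, one_mul]⟩
    · exact ⟨1, by rw [pow_one, mul_inv_cancel₀ h0]; exact one_mem _⟩
  | algebraMap r => exact ⟨0, by rw [pow_zero, one_mul]; exact A.algebraMap_mem r⟩
  | add x y _ _ h1 h2 =>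
    obtain ⟨n, h1⟩ := h1
    obtain ⟨m, h2⟩ := h2
    refine ⟨n + m, ?_⟩
    have : f ^ (n + m) * (x + y) = f ^ m * (f ^ n * x) + f ^ n * (f ^ m * y) := by rw [pow_add]; ring
    rw [this]
    exact add_mem (mul_mem (pow_mem hf _) h1) (mul_mem (pow_mem hf _) h2)
  | mul x y _ _ h1 h2 =>
    obtain ⟨n, h1⟩ := h1
    obtain ⟨m, h2⟩ := h2
    refine ⟨n + m, ?_⟩
    have : f ^ (n + m) * (x * y) = (f ^ n * x) * (f ^ m * y) := by rw [pow_add]; ring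
    rw [this]
    exact mul_mem h1 h2

lemma away_le {A : Subalgebra R K} {f : K} {B : Subring K} (hA : A.toSubring ≤ B) (hf : f⁻¹ ∈ B) :
    (away A f).toSubring ≤ B := by
  have h1 : away A f = Algebra.adjoin R ((A : Set K) ∪ {f⁻¹}) := by
    rw [away, Algebra.adjoin_union, Algebra.adjoin_eq]
  rw [h1, Algebra.adjoin_eq_ring_closure, Subring.closure_le]
  rintro x (⟨r, rfl⟩ | hx | rfl)
  · exact hA (A.algebraMap_mem r)
  · exact hA hx
  · exact hf

/-- The points of the ring of fractions `away A f` are the points of `A` at which `f` is a unit. -/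
lemma isLocAt_away {A : Subalgebra R K} {f : K} (hf : f ∈ A) (h0 : f ≠ 0) {Q : LocalSubring K} :
    IsLocAt (away A f).toSubring Q ↔ IsLocAt A.toSubring Q ∧ f⁻¹ ∈ Q.toSubring := by
  constructor
  · intro h
    have hfi : f⁻¹ ∈ Q.toSubring := h.1 (inv_mem_away A f)
    refine ⟨⟨(show A.toSubring ≤ (away A f).toSubring from le_away A f).trans h.1, fun x hx => ?_⟩, hfi⟩
    obtain ⟨s, hs, t, ht, ht0, hi, rfl⟩ := h.2 x hx
    obtain ⟨n, hn⟩ := exists_mul_mem_of_mem_away hf h0 hs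
    obtain ⟨m, hm⟩ := exists_mul_mem_of_mem_away hf h0 ht
    refine ⟨f ^ m * (f ^ n * s), mul_mem (pow_mem hf m) hn, f ^ n * (f ^ m * t), mul_mem (pow_mem hf n) hm, ?_, ?_, ?_⟩
    · exact mul_ne_zero (pow_ne_zero _ h0) (mul_ne_zero (pow_ne_zero _ h0) ht0)
    · rw [mul_inv, mul_inv, ← inv_pow, ← inv_pow]
      exact mul_mem (pow_mem hfi _) (mul_mem (pow_mem hfi _) hi)
    · field_simp
  · rintro ⟨h, hfi⟩
    exact h.mono (le_away A f) (away_le h.1 hfi)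

/-- Closed points can be removed. -/
lemma isFiniteType_diff_singleton {X U : Set (LocalSubring K)} (hU : IsFiniteType U) (hUX : U ⊆ X) {P : LocalSubring K}
    (hP : IsClosedPoint X P) : IsFiniteType (U \ {P}) := by
  obtain ⟨𝒜, hfin, hFG, rfl⟩ := hU
  have h1 : (⋃ A ∈ 𝒜, affinePoints A.toSubring) \ {P} = ⋃ A ∈ 𝒜, (affinePoints A.toSubring \ {P}) := by
    ext Q; simp only [Set.mem_sdiff, Set.mem_iUnion, Set.mem_singleton_iff]; tauto
  rw [h1]
  refine isFiniteType_biUnion hfin fun A hA => ?_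
  have hAX : affinePoints A.toSubring ⊆ X :=
    (Set.subset_biUnion_of_mem (u := fun A : Subalgebra R K => affinePoints A.toSubring) hA).trans hUX
  by_cases hPA : P ∈ affinePoints A.toSubring
  swap
  · rw [Set.sdiff_singleton_eq_self hPA]
    exact isFiniteType_affine (hFG A hA)
  have hl := mem_affinePoints.1 hPA
  have := noetherian_of_FG (hFG A hA)
  obtain ⟨s, hs⟩ := (isNoetherianRing_iff_ideal_fg _).1 this (contr hl.1)
  have h2 : affinePoints A.toSubring \ {P} = ⋃ f ∈ {f : A.toSubring | f ∈ s ∧ f ≠ 0}, affinePoints (away A (f : K)).toSubring := by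
    ext Q
    simp only [Set.mem_sdiff, Set.mem_iUnion, Set.mem_singleton_iff, Set.mem_ofPred_eq, mem_affinePoints, exists_prop]
    constructor
    · rintro ⟨hQ, hQP⟩
      by_contra! hc
      refine hQP (hP.2 Q (hAX (mem_affinePoints.2 hQ)) fun x hx => ?_)
      have hle : contr hl.1 ≤ contr hQ.1 := by
        rw [← hs]
        refine Ideal.span_le.2 fun f hf => ?_
        by_cases h0 : f = 0
        · rw [h0]; exact zero_mem _
        rw [SetLike.mem_coe, mem_contr]
        by_contra hfQ
        have h0' : (f : K) ≠ 0 := fun h => h0 (Subtype.ext h)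
        exact hc f ⟨hf, h0⟩ ((isLocAt_away f.2 h0').2 ⟨hQ, (unit_of_notMem_mI (hQ.1 f.2) hfQ).2⟩)
      obtain ⟨u, hu, t, ht, h0, hi, rfl⟩ := hQ.2 x hx
      refine mul_mem (hl.1 hu) (unit_of_notMem_mI (hl.1 ht) fun hm => ?_).2
      have : (⟨t, ht⟩ : A.toSubring) ∈ contr hQ.1 := hle (mem_contr hl.1 |>.2 hm)
      exact notMem_mI_of_inv h0 hi ((mem_contr hQ.1).1 this)
    · rintro ⟨f, ⟨hf, h0⟩, hQ⟩
      have h0' : (f : K) ≠ 0 := fun h => h0 (Subtype.ext h)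
      obtain ⟨hQ1, hQ2⟩ := (isLocAt_away f.2 h0').1 hQ
      refine ⟨hQ1, ?_⟩
      rintro rfl
      have : f ∈ contr hl.1 := hs ▸ Ideal.subset_span hf
      exact notMem_mI_of_inv h0' hQ2 ((mem_contr hl.1).1 this)
  rw [h2]
  exact isFiniteType_biUnion (s.finite_toSet.subset fun f hf => hf.1) fun f _ => isFiniteType_affine (away_fg (hFG A hA) _)

lemma isFiniteType_diff {X : Set (LocalSubring K)} (hX : IsFiniteType X) {Z : Set (LocalSubring K)} (hZ : Z.Finite)
    (hcl : ∀ P ∈ Z, IsClosedPoint X P) : IsFiniteType (X \ Z) := by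
  induction Z, hZ using Set.Finite.induction_on with
  | empty => simpa using hX
  | @insert P Z _ _ ih =>
    have h1 : X \ insert P Z = (X \ Z) \ {P} := by ext; simp; tauto
    rw [h1]
    exact isFiniteType_diff_singleton (ih fun P hP => hcl P (Set.mem_insert_of_mem _ hP)) Set.sdiff_subset
      (hcl P (Set.mem_insert _ _))

/-- A neighbourhood of a point on which given elements of its local ring are defined. -/
lemma exists_chart_containing {A : Subalgebra R K} (hA : A.FG) {P : LocalSubring K} (hP : IsLocAt A.toSubring P)
    {G : Set K} (hG : G.Finite) (hGP : ∀ g ∈ G, g ∈ P.toSubring) :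
    ∃ B : Subalgebra R K, B.FG ∧ A ≤ B ∧ G ⊆ B ∧ IsLocAt B.toSubring P ∧
      affinePoints B.toSubring ⊆ affinePoints A.toSubring := by
  induction G, hG using Set.Finite.induction_on with
  | empty => exact ⟨A, hA, le_rfl, by simp, hP, le_rfl⟩
  | @insert g G _ _ ih =>
    obtain ⟨B, hB, hAB, hGB, hBP, hsub⟩ := ih fun g hg => hGP g (Set.mem_insert_of_mem _ hg)
    obtain ⟨s, hs, t, ht, h0, hi, rfl⟩ := hBP.2 g (hGP g (Set.mem_insert _ _))
    refine ⟨away B t, away_fg hB t, hAB.trans (le_away B t), ?_, (isLocAt_away ht h0).2 ⟨hBP, hi⟩, ?_⟩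
    · rintro x (rfl | hx)
      · exact mul_mem (le_away B t hs) (inv_mem_away B t)
      · exact le_away B t (hGB hx)
    · intro Q hQ
      exact hsub (mem_affinePoints.2 ((isLocAt_away ht h0).1 (mem_affinePoints.1 hQ)).1)

/-- A neighbourhood of a closed smooth point in which it is the only common zero of the
coordinates. -/
lemma exists_chart_coordinates {X U : Set (LocalSubring K)} (hU : IsFiniteType U) (hUX : U ⊆ X) {P : LocalSubring K}
    (hP : IsClosedPoint X P) (hPU : P ∈ U) {a b : P.toSubring} (h : SmoothAt P a b) :
    ∃ A : Subalgebra R K, A.FG ∧ affinePoints A.toSubring ⊆ U ∧ IsLocAt A.toSubring P ∧ (a : K) ∈ A ∧ (b : K) ∈ A ∧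
      ∀ T ∈ affinePoints A.toSubring, (a : K) ∈ mI T → (b : K) ∈ mI T → T = P := by
  obtain ⟨𝒜, hfin, hFG, rfl⟩ := hU
  simp only [Set.mem_iUnion] at hPU
  obtain ⟨A, hA, hPA⟩ := hPU
  have hAU := Set.subset_biUnion_of_mem (u := fun A : Subalgebra R K => affinePoints A.toSubring) hA
  obtain ⟨B, hB, hAB, hGB, hBP, hBA⟩ := exists_chart_containing (hFG A hA) (mem_affinePoints.1 hPA)
    (G := {(a : K), (b : K)}) (by simp) (by rintro _ (rfl | rfl) <;> simp)
  have := noetherian_of_FG hB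
  obtain ⟨s, hs⟩ := (isNoetherianRing_iff_ideal_fg _).1 this (contr hBP.1)
  have hex : ∀ g ∈ s, ∃ r ∈ P.toSubring, ∃ r' ∈ P.toSubring, (g : K) = r * a + r' * b := by
    intro g hg
    refine (mem_mI_span h.reg.span).1 ((mem_contr hBP.1).1 ?_)
    rw [← hs]; exact Ideal.subset_span hg
  choose! r hr r' hr' hrr using hex
  obtain ⟨D, hD, hBD, hGD, hDP, hDB⟩ := exists_chart_containing hB hBP (G := r '' s ∪ r' '' s)
    ((s.finite_toSet.image _).union (s.finite_toSet.image _)) (by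
      rintro _ (⟨g, hg, rfl⟩ | ⟨g, hg, rfl⟩)
      · exact hr g hg
      · exact hr' g hg)
  refine ⟨D, hD, (hDB.trans hBA).trans hAU, hDP, hBD (hGB (by simp)), hBD (hGB (by simp)), fun T hT haT hbT => ?_⟩
  have hTD := mem_affinePoints.1 hT
  refine hP.2 T (hUX (hAU (hBA (hDB hT)))) fun x hx => ?_
  have hTB := mem_affinePoints.1 (hDB hT)
  obtain ⟨u, hu, t, ht, h0, hi, rfl⟩ := hTB.2 x hx
  refine mul_mem (hBP.1 hu) (unit_of_notMem_mI (hBP.1 ht) fun hm => notMem_mI_of_inv h0 hi ?_).2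
  have h1 : (⟨t, ht⟩ : B.toSubring) ∈ contr hBP.1 := (mem_contr hBP.1).2 hm
  rw [← hs] at h1
  have h2 : span (s : Set B.toSubring) ≤ contr hTB.1 := by
    refine Ideal.span_le.2 fun g hg => ?_
    rw [SetLike.mem_coe, mem_contr, hrr g hg]
    exact add_mem_mI (mul_mem_mI (hTD.1 (hGD (Or.inl ⟨g, hg, rfl⟩))) haT) (mul_mem_mI (hTD.1 (hGD (Or.inr ⟨g, hg, rfl⟩))) hbT)
  exact (mem_contr hTB.1).1 (h2 h1)

/-- The slope of a vector of the quadrant. -/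
def slope (w : ℤ × ℤ) : ℚ := w.2 / (w.1 + w.2 : ℤ)

lemma sum_pos_of_coprime {w : ℤ × ℤ} (h : 0 ≤ w.1 ∧ 0 ≤ w.2 ∧ IsCoprime w.1 w.2) : 0 < w.1 + w.2 := by
  obtain ⟨h1, h2, h3⟩ := h
  rcases eq_or_lt_of_le h1 with h0 | h0
  · rcases eq_or_lt_of_le h2 with h0' | h0'
    · rw [← h0, ← h0'] at h3
      exact absurd h3 not_isCoprime_zero_zero
    · omega
  · omega

lemma slope_lt_iff {w w' : ℤ × ℤ} (h : 0 ≤ w.1 ∧ 0 ≤ w.2 ∧ IsCoprime w.1 w.2) (h' : 0 ≤ w'.1 ∧ 0 ≤ w'.2 ∧ IsCoprime w'.1 w'.2) :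
    slope w < slope w' ↔ 0 < det w w' := by
  unfold slope det
  rw [div_lt_div_iff₀ (by exact_mod_cast sum_pos_of_coprime h) (by exact_mod_cast sum_pos_of_coprime h')]
  norm_cast
  constructor <;> intro k <;> nlinarith

lemma slope_inj {w w' : ℤ × ℤ} (h : 0 ≤ w.1 ∧ 0 ≤ w.2 ∧ IsCoprime w.1 w.2) (h' : 0 ≤ w'.1 ∧ 0 ≤ w'.2 ∧ IsCoprime w'.1 w'.2)
    (he : slope w = slope w') : w = w' := by
  refine eq_of_det_eq_zero h.1 h.2.1 h'.1 h'.2.1 h.2.2 h'.2.2 ?_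
  have h1 := (slope_lt_iff h h').not.1 (by rw [he]; exact lt_irrefl _)
  have h2 := (slope_lt_iff h' h).not.1 (by rw [he]; exact lt_irrefl _)
  have h3 : det w' w = - det w w' := by unfold det; ring
  omega

section Valuative
variable {a b : K} {w₁ w₂ : ℤ × ℤ}

/-- A cone is recognized on the two edges of its dual. -/
lemma monRing_le_valuation (ha : a ≠ 0) (hb : b ≠ 0) (hc : IsCone w₁ w₂) {A : Subring K} {W : ValuationSubring K}
    (hA : A ≤ W.toSubring) (h1 : mon a b (-w₁.2, w₁.1) ∈ W) (h2 : mon a b (w₂.2, -w₂.1) ∈ W) :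
    monRing A a b w₁ w₂ ≤ W.toSubring := by
  refine monRing_le hA fun m hm => ?_
  have hd := hc.det_pos
  have e : det w₁ w₂ • m = wdot w₂ m • (-w₁.2, w₁.1) + wdot w₁ m • (w₂.2, -w₂.1) := by
    simp only [det, wdot]
    ext
    · simp only [Prod.smul_fst, Prod.fst_add, smul_eq_mul]; ring
    · simp only [Prod.smul_snd, Prod.snd_add, smul_eq_mul]; ring
  have h3 : mon a b m ^ (det w₁ w₂).toNat ∈ W := by
    have : mon a b m ^ (det w₁ w₂).toNat = mon a b (det w₁ w₂ • m) := by
      rw [mon_zsmul, ← zpow_natCast, Int.toNat_of_nonneg hd.le]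
    rw [this, e, mon_add ha hb, mon_zsmul, mon_zsmul, ← Int.toNat_of_nonneg hm.1, ← Int.toNat_of_nonneg hm.2, zpow_natCast, zpow_natCast]
    exact mul_mem (pow_mem h1 _) (pow_mem h2 _)
  rcases W.mem_or_inv_mem (mon a b m) with h4 | h4
  · exact h4
  · have h5 : mon a b m = mon a b m ^ (det w₁ w₂).toNat * (mon a b m)⁻¹ ^ ((det w₁ w₂).toNat - 1) := by
      have h0 := mon_ne_zero ha hb m
      have h6 : (det w₁ w₂).toNat = (det w₁ w₂).toNat - 1 + 1 := by omega
      conv_rhs => rw [h6, pow_succ]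
      rw [Nat.add_sub_cancel, mul_right_comm, ← mul_pow, mul_inv_cancel₀ h0, one_pow, one_mul]
    rw [h5]
    exact mul_mem h3 (pow_mem h4 _)

lemma isLocAt_right_edge (ha : a ≠ 0) (hb : b ≠ 0) (hc : IsCone w₁ w₂) {A : Subring K} {Q : LocalSubring K}
    (hQ : IsLocAt (monRing A a b w₁ w₂) Q) (h : mon a b (-w₂.2, w₂.1) ∈ Q.toSubring) : IsLocAt (monRing A a b w₂ w₂) Q := by
  have hd := hc.det_pos
  refine hQ.mono (monRing_le le_monRing fun m hm => mon_mem_monRing ⟨hm.2, hm.2⟩)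
    (monRing_le (le_monRing.trans hQ.1) fun m hm => ?_)
  have e : m = (|wdot w₁ m|).toNat • (-w₂.2, w₂.1) + (m + (|wdot w₁ m|).toNat • (w₂.2, -w₂.1)) := by
    ext
    · simp
    · simp
  rw [e, mon_add ha hb, mon_nsmul]
  refine mul_mem (pow_mem h _) (hQ.1 (mon_mem_monRing ⟨?_, ?_⟩))
  · rw [wdot_add, wdot_nsmul]
    have e1 : wdot w₁ (w₂.2, -w₂.1) = det w₁ w₂ := by simp only [wdot, det]; ring
    rw [e1, Int.toNat_of_nonneg (abs_nonneg _)]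
    nlinarith [neg_abs_le (wdot w₁ m), abs_nonneg (wdot w₁ m)]
  · rw [wdot_add, wdot_nsmul]
    have e1 : wdot w₂ (w₂.2, -w₂.1) = 0 := by simp only [wdot]; ring
    rw [e1, mul_zero, add_zero]
    exact hm.1

lemma isLocAt_left_edge (ha : a ≠ 0) (hb : b ≠ 0) (hc : IsCone w₁ w₂) {A : Subring K} {Q : LocalSubring K}
    (hQ : IsLocAt (monRing A a b w₁ w₂) Q) (h : mon a b (w₁.2, -w₁.1) ∈ Q.toSubring) : IsLocAt (monRing A a b w₁ w₁) Q := by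
  have hd := hc.det_pos
  refine hQ.mono (monRing_le le_monRing fun m hm => mon_mem_monRing ⟨hm.1, hm.1⟩)
    (monRing_le (le_monRing.trans hQ.1) fun m hm => ?_)
  have e : m = (|wdot w₂ m|).toNat • (w₁.2, -w₁.1) + (m + (|wdot w₂ m|).toNat • (-w₁.2, w₁.1)) := by
    ext
    · simp
    · simp
  rw [e, mon_add ha hb, mon_nsmul]
  refine mul_mem (pow_mem h _) (hQ.1 (mon_mem_monRing ⟨?_, ?_⟩))
  · rw [wdot_add, wdot_nsmul]
    have e1 : wdot w₁ (-w₁.2, w₁.1) = 0 := by simp only [wdot]; ring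
    rw [e1, mul_zero, add_zero]
    exact hm.1
  · rw [wdot_add, wdot_nsmul]
    have e1 : wdot w₂ (-w₁.2, w₁.1) = det w₁ w₂ := by simp only [wdot, det]; ring
    rw [e1, Int.toNat_of_nonneg (abs_nonneg _)]
    nlinarith [neg_abs_le (wdot w₂ m), abs_nonneg (wdot w₂ m)]

/-- The slopes of the edges of the cones containing a valuation are ordered. -/
lemma det_nonpos (ha : a ≠ 0) (hb : b ≠ 0) {W : ValuationSubring K} (haW : a ∈ mI W.toLocalSubring)
    {u v : ℤ × ℤ} (hu : 0 ≤ u.1 ∧ 0 ≤ u.2) (hv : 0 ≤ v.1 ∧ 0 ≤ v.2) (h1 : mon a b (-u.2, u.1) ∈ W) (h2 : mon a b (v.2, -v.1) ∈ W) :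
    det v u ≤ 0 := by
  by_contra! hd
  -- one of the coordinates would be invertible
  have key : ∀ (x : K) (d : ℤ), x ∈ mI W.toLocalSubring → x ≠ 0 → 0 < d → x ^ (-d) ∈ W → False := by
    intro x d hx hx0 hd hxd
    obtain ⟨k, rfl⟩ := Int.eq_ofNat_of_zero_le hd.le
    have hk : k ≠ 0 := by rintro rfl; simp at hd
    rw [zpow_neg, zpow_natCast] at hxd
    exact notMem_mI_of_inv (P := W.toLocalSubring) (pow_ne_zero k hx0) hxd ((mI_pow_iff hx.1 hk).2 hx)
  have e1 : mon a b (-u.2, u.1) ^ v.1.toNat * mon a b (v.2, -v.1) ^ u.1.toNat = a ^ (-det v u) := by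
    rw [← mon_nsmul, ← mon_nsmul, ← mon_add ha hb]
    have : v.1.toNat • (-u.2, u.1) + u.1.toNat • (v.2, -v.1) = (-det v u, 0) := by
      have k1 := Int.toNat_of_nonneg hv.1
      have k2 := Int.toNat_of_nonneg hu.1
      ext
      · rw [Prod.fst_add, Prod.smul_fst, Prod.smul_fst, nsmul_eq_mul, nsmul_eq_mul, k1, k2]
        simp only [det]; ring
      · rw [Prod.snd_add, Prod.smul_snd, Prod.smul_snd, nsmul_eq_mul, nsmul_eq_mul, k1, k2]
        ring
    rw [this]; simp [mon]
  exact key a (det v u) haW ha hd (e1 ▸ mul_mem (pow_mem h1 _) (pow_mem h2 _))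

end Valuative

/-- Above a smooth point, the center of a valuation exists and is unique. -/
lemma existsUnique_center_newtonFiber {P : LocalSubring K} {a b : P.toSubring} (h : SmoothAt P a b) {F : R} (hF : F ≠ 0)
    {W : ValuationSubring K} (hPW : P ≤ W.toLocalSubring) : ∃! Q, Q ∈ newtonFiber P a b F ∧ Q ≤ W.toLocalSubring := by
  have ha0 := h.left_ne_zero
  have hb0 := h.right_ne_zero
  have haW : (a : K) ∈ mI W.toLocalSubring := (le_iff_mI.1 hPW).2 _ (coe_mem_mI.2 h.reg.mem_left)
  have hbW : (b : K) ∈ mI W.toLocalSubring := (le_iff_mI.1 hPW).2 _ (coe_mem_mI.2 h.reg.mem_right)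
  have hPW' : P.toSubring ≤ W.toSubring := (le_iff_mI.1 hPW).1
  have hneg : ∀ w : ℤ × ℤ, mon (a : K) b (w.2, -w.1) = (mon (a : K) b (-w.2, w.1))⁻¹ := by
    intro w; rw [← mon_neg]; simp
  refine existsUnique_of_exists_of_unique ?_ ?_
  · obtain ⟨w₁, ⟨hw₁, hp₁⟩, hmax⟩ := ((finite_newtonFanRays hF).subset
      (Set.sep_subset _ (fun w => mon (a : K) b (-w.2, w.1) ∈ W))).exists_maximalFor slope _
      ⟨(1, 0), Or.inl (by simp), by
        have h : (b : K) ∈ W := hbW.1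
        simpa [mon] using h⟩
    have hn₁ := newtonFanRays_nonneg hw₁
    have h01 : ((0, 1) : ℤ × ℤ) ∈ newtonFanRays F := Or.inl (by simp)
    have hnot : mon (a : K) b (-1, 0) ∉ W := by
      intro hc
      refine notMem_mI_of_inv (P := W.toLocalSubring) ha0 ?_ haW
      have h : (a : K)⁻¹ ∈ W := by simpa [mon] using hc
      exact h
    have hlt : 0 < det w₁ (0, 1) := by
      have : w₁.1 ≠ 0 := by
        intro h0
        have : w₁ = (0, 1) := slope_inj hn₁ (newtonFanRays_nonneg h01) (by
          unfold slope
          have := sum_pos_of_coprime hn₁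
          rw [h0, zero_add] at *
          rw [div_self (by exact_mod_cast this.ne')]; simp)
        rw [this] at hp₁
        exact hnot hp₁
      have := hn₁.1
      simp only [det]; omega
    obtain ⟨w₂, ⟨hw₂, hd₂⟩, hmin⟩ := ((finite_newtonFanRays hF).subset
      (Set.sep_subset _ (fun w => 0 < det w₁ w))).exists_minimalFor slope _ ⟨(0, 1), h01, hlt⟩
    have hn₂ := newtonFanRays_nonneg hw₂
    have hcone : IsNewtonCone F w₁ w₂ := by
      refine ⟨hw₁, hw₂, hd₂, fun w hw hcon => ?_⟩
      have hn := newtonFanRays_nonneg hw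
      have h1 := (slope_lt_iff hn hn₂).2 hcon.2
      exact absurd (hmin ⟨hw, hcon.1⟩ h1.le) (not_le.2 h1)
    have hp₂ : mon (a : K) b (w₂.2, -w₂.1) ∈ W := by
      rw [hneg]
      refine (W.mem_or_inv_mem _).resolve_left fun hc => ?_
      have h1 := (slope_lt_iff hn₁ hn₂).2 hd₂
      exact absurd (hmax ⟨hw₂, hc⟩ h1.le) (not_le.2 h1)
    have hle := monRing_le_valuation ha0 hb0 hcone.isCone hPW' hp₁ hp₂
    have hle' : monRing P.toSubring (a : K) b w₁ w₂ ≤ W.toLocalSubring.toSubring := hle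
    refine ⟨ofPrime _ (contr hle'), ⟨?_, w₁, w₂, hcone, ?_⟩, ofPrime_contr_le hle'⟩
    · have hQ := ofPrime_contr_le hle'
      refine le_iff_mI.2 ⟨le_monRing.trans (le_ofPrime _ _), fun x hx => ?_⟩
      exact (mem_mI_of_le hQ (le_ofPrime _ _ (le_monRing hx.1))).1 ((le_iff_mI.1 hPW).2 x hx)
    · rw [chartRing_eq]
      exact ⟨_, inferInstance, rfl⟩
  · rintro Q Q' ⟨⟨hPQ, w₁, w₂, hN, hQ⟩, hQW⟩ ⟨⟨hPQ', w₃, w₄, hN', hQ'⟩, hQW'⟩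
    rw [chartRing_eq, mem_affinePoints] at hQ hQ'
    have hc := hN.isCone
    have hc' := hN'.isCone
    have n1 := newtonFanRays_nonneg hN.1
    have n2 := newtonFanRays_nonneg hN.2.1
    have n3 := newtonFanRays_nonneg hN'.1
    have n4 := newtonFanRays_nonneg hN'.2.1
    have hQs := (le_iff_mI.1 hQW).1
    have hQs' := (le_iff_mI.1 hQW').1
    have hm : ∀ w w' : ℤ × ℤ, 0 < det w w' → (-w.2, w.1) ∈ dualCone w w' ∧ (w'.2, -w'.1) ∈ dualCone w w' := by
      intro w w' hd
      refine ⟨⟨?_, ?_⟩, ⟨?_, ?_⟩⟩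
      · simp only [wdot]; apply le_of_eq; ring
      · have : wdot w' (-w.2, w.1) = det w w' := by simp only [wdot, det]; ring
        rw [this]; exact hd.le
      · have : wdot w (w'.2, -w'.1) = det w w' := by simp only [wdot, det]; ring
        rw [this]; exact hd.le
      · simp only [wdot]; apply le_of_eq; ring
    have q1 := hQ.1 (mon_mem_monRing (hm _ _ hc.det_pos).1)
    have q2 := hQ.1 (mon_mem_monRing (hm _ _ hc.det_pos).2)
    have q3 := hQ'.1 (mon_mem_monRing (hm _ _ hc'.det_pos).1)
    have q4 := hQ'.1 (mon_mem_monRing (hm _ _ hc'.det_pos).2)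
    have d23 := det_nonpos ha0 hb0 haW ⟨n3.1, n3.2.1⟩ ⟨n2.1, n2.2.1⟩ (hQs' q3) (hQs q2)
    have d41 := det_nonpos ha0 hb0 haW ⟨n1.1, n1.2.1⟩ ⟨n4.1, n4.2.1⟩ (hQs q1) (hQs' q4)
    -- an element of `Q` invertible in `W` is invertible in `Q`
    have hunit : ∀ {T : LocalSubring K} {x : K}, T ≤ W.toLocalSubring → x ∈ T.toSubring → x ≠ 0 → x⁻¹ ∈ W → x⁻¹ ∈ T.toSubring := by
      intro T x hT hx h0 hi
      refine (unit_of_notMem_mI hx fun hcon => ?_).2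
      exact notMem_mI_of_inv (P := W.toLocalSubring) h0 hi ((le_iff_mI.1 hT).2 x hcon)
    have hninv : ∀ w : ℤ × ℤ, mon (a : K) b (-w.2, w.1) = (mon (a : K) b (w.2, -w.1))⁻¹ := by
      intro w; rw [← mon_neg]; simp
    by_cases e23 : w₂ = w₃
    · subst e23
      have r1 : mon (a : K) b (-w₂.2, w₂.1) ∈ Q.toSubring := by
        rw [hninv]
        exact hunit hQW q2 (mon_ne_zero ha0 hb0 _) (by rw [← hninv]; exact hQs' q3)
      have r2 : mon (a : K) b (w₂.2, -w₂.1) ∈ Q'.toSubring := by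
        rw [hneg]
        exact hunit hQW' q3 (mon_ne_zero ha0 hb0 _) (by rw [← hneg]; exact hQs q2)
      exact (isLocAt_right_edge ha0 hb0 hc hQ r1).eq_of_le (isLocAt_left_edge ha0 hb0 hc' hQ' r2) hQW hQW'
    by_cases e41 : w₄ = w₁
    · subst e41
      have r1 : mon (a : K) b (-w₄.2, w₄.1) ∈ Q'.toSubring := by
        rw [hninv]
        exact hunit hQW' q4 (mon_ne_zero ha0 hb0 _) (by rw [← hninv]; exact hQs q1)
      have r2 : mon (a : K) b (w₄.2, -w₄.1) ∈ Q.toSubring := by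
        rw [hneg]
        exact hunit hQW q1 (mon_ne_zero ha0 hb0 _) (by rw [← hneg]; exact hQs' q4)
      exact (isLocAt_left_edge ha0 hb0 hc hQ r2).eq_of_le (isLocAt_right_edge ha0 hb0 hc' hQ' r1) hQW hQW'
    have s12 := (slope_lt_iff n1 n2).2 hc.det_pos
    have s34 := (slope_lt_iff n3 n4).2 hc'.det_pos
    have s23 : slope w₃ < slope w₂ := lt_of_le_of_ne (not_lt.1 fun hcon => by
      have := (slope_lt_iff n2 n3).1 hcon; omega) fun hcon => e23 (slope_inj n2 n3 hcon.symm)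
    have s41 : slope w₁ < slope w₄ := lt_of_le_of_ne (not_lt.1 fun hcon => by
      have := (slope_lt_iff n4 n1).1 hcon; omega) fun hcon => e41 (slope_inj n4 n1 hcon.symm)
    have e13 : w₁ = w₃ := by
      rcases lt_trichotomy (slope w₁) (slope w₃) with hlt | heq | hlt
      · exact absurd ⟨(slope_lt_iff n1 n3).1 hlt, (slope_lt_iff n3 n2).1 s23⟩ (hN.2.2.2 w₃ hN'.1)
      · exact slope_inj n1 n3 heq
      · exact absurd ⟨(slope_lt_iff n3 n1).1 hlt, (slope_lt_iff n1 n4).1 s41⟩ (hN'.2.2.2 w₁ hN.1)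
    have e24 : w₂ = w₄ := by
      rcases lt_trichotomy (slope w₂) (slope w₄) with hlt | heq | hlt
      · exact absurd ⟨(slope_lt_iff n3 n2).1 s23, (slope_lt_iff n2 n4).1 hlt⟩ (hN'.2.2.2 w₂ hN.2.1)
      · exact slope_inj n2 n4 heq
      · exact absurd ⟨(slope_lt_iff n1 n4).1 s41, (slope_lt_iff n4 n2).1 hlt⟩ (hN.2.2.2 w₄ hN'.2.1)
    subst e13 e24
    exact hQ.eq_of_le hQ' hQW hQW'

/-- The Newton modifications at finitely many closed smooth points of a modification of `S` define
a modification of `S`. -/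
lemma isModification_newton {X : Set (LocalSubring K)} (hX : IsModification X) {Z : Set (LocalSubring K)} (hZ : Z.Finite)
    (hcl : ∀ P ∈ Z, IsClosedPoint X P) {a b : ∀ P : LocalSubring K, P.toSubring} {F : LocalSubring K → R}
    (hs : ∀ P ∈ Z, SmoothAt P (a P) (b P)) (hF : ∀ P ∈ Z, F P ≠ 0) :
    IsModification ((X \ Z) ∪ ⋃ P ∈ Z, newtonFiber P (a P) (b P) (F P)) := by
  set X' := (X \ Z) ∪ ⋃ P ∈ Z, newtonFiber P (a P) (b P) (F P) with hX'
  have hmem : ∀ {Q}, Q ∈ X' ↔ (Q ∈ X ∧ Q ∉ Z) ∨ ∃ P ∈ Z, Q ∈ newtonFiber P (a P) (b P) (F P) := by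
    intro Q; simp only [hX', Set.mem_union, Set.mem_sdiff, Set.mem_iUnion, exists_prop]
  constructor
  · have hXf : IsFiniteType X := hX.finite_type
    have hchart : ∀ P ∈ Z, ∃ A : Subalgebra R K, A.FG ∧ affinePoints A.toSubring ⊆ X \ (Z \ {P}) ∧ IsLocAt A.toSubring P ∧
        (a P : K) ∈ A ∧ (b P : K) ∈ A ∧ ∀ T ∈ affinePoints A.toSubring, (a P : K) ∈ mI T → (b P : K) ∈ mI T → T = P := by
      intro P hP
      exact exists_chart_coordinates (isFiniteType_diff hXf (hZ.subset Set.sdiff_subset) fun P hP => hcl P hP.1) Set.sdiff_subset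
        (hcl P hP) ⟨(hcl P hP).1, by simp⟩ (hs P hP)
    choose! A hAFG hAX hAP haA hbA hAT using hchart
    have hB : ∀ P ∈ Z, ∀ p ∈ {p : (ℤ × ℤ) × (ℤ × ℤ) | IsNewtonCone (F P) p.1 p.2}, ∃ B : Subalgebra R K, B.FG ∧
        B.toSubring = monRing (A P).toSubring (a P : K) (b P) p.1 p.2 := fun P hP p hp =>
      hp.isCone.exists_fg (hs P hP).left_ne_zero (hs P hP).right_ne_zero (hAFG P hP)
    choose! B hBFG hBeq using hB
    have hfinal : X' = (X \ Z) ∪ ⋃ P ∈ Z, ⋃ p ∈ {p : (ℤ × ℤ) × (ℤ × ℤ) | IsNewtonCone (F P) p.1 p.2}, affinePoints (B P p).toSubring := by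
      ext Q
      simp only [hmem, Set.mem_union, Set.mem_sdiff, Set.mem_iUnion, exists_prop]
      constructor
      · rintro (h | ⟨P, hP, hPQ, w₁, w₂, hN, hQ⟩)
        · exact Or.inl h
        · refine Or.inr ⟨P, hP, (w₁, w₂), hN, ?_⟩
          rw [hBeq P hP _ hN, mem_affinePoints, ← isLocAt_monRing_iff (hAP P hP) hPQ, ← chartRing_eq]
          exact mem_affinePoints.1 hQ
      · rintro (h | ⟨P, hP, ⟨w₁, w₂⟩, hN, hQ⟩)
        · exact Or.inl h
        rw [hBeq P hP _ hN, mem_affinePoints] at hQ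
        simp only at hQ
        have hAQ : (A P).toSubring ≤ Q.toSubring := le_monRing.trans hQ.1
        have hTQ := ofPrime_contr_le hAQ
        have hTA := isLocAt_ofPrime (A P).toSubring (contr hAQ)
        set T := ofPrime (A P).toSubring (contr hAQ)
        by_cases hTP : T = P
        · rw [hTP] at hTQ
          refine Or.inr ⟨P, hP, hTQ, w₁, w₂, hN, ?_⟩
          rw [chartRing_eq, mem_affinePoints, isLocAt_monRing_iff (hAP P hP) hTQ]
          exact hQ
        · left
          have hTX := hAX P hP (mem_affinePoints.2 hTA)
          have ha0 := (hs P hP).left_ne_zero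
          have hb0 := (hs P hP).right_ne_zero
          have haT := hTA.1 (haA P hP)
          have hbT := hTA.1 (hbA P hP)
          have hzp : ∀ {x : K}, x ∈ T.toSubring → x ≠ 0 → x ∉ mI T → ∀ k : ℤ, x ^ k ∈ T.toSubring := by
            intro x hx h0 hxm k
            obtain ⟨j, rfl | rfl⟩ := k.eq_nat_or_neg
            · rw [zpow_natCast]; exact pow_mem hx _
            · rw [zpow_neg, zpow_natCast, ← inv_pow]; exact pow_mem (unit_of_notMem_mI hx hxm).2 _
          -- in a product of integral powers lying in `Q`, the exponent of a nonunit is nonnegative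
          have hexp : ∀ {x y : K}, x ∈ T.toSubring → y ∈ T.toSubring → x ≠ 0 → y ≠ 0 → x ∉ mI T → y ∈ mI T →
              ∀ k l : ℤ, x ^ k * y ^ l ∈ Q.toSubring → x ^ k * y ^ l ∈ T.toSubring := by
            intro x y hx hy hx0 hy0 hxm hym k l hxy
            rcases le_or_gt 0 l with hl | hl
            · obtain ⟨j, rfl⟩ := Int.eq_ofNat_of_zero_le hl
              exact mul_mem (hzp hx hx0 hxm k) (by rw [zpow_natCast]; exact pow_mem hy _)
            · exfalso
              have hyQ : y ∈ mI Q := (le_iff_mI.1 hTQ).2 y hym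
              have e1 : x ^ k * y ^ l * y ^ (-l).toNat = x ^ k := by
                rw [← zpow_natCast, Int.toNat_of_nonneg (by omega), mul_assoc, ← zpow_add₀ hy0, add_neg_cancel, zpow_zero, mul_one]
              have e2 : x ^ k ∈ mI Q := e1 ▸ mul_mem_mI hxy ((mI_pow_iff hyQ.1 (by omega)).2 hyQ)
              have e3 := (le_iff_mI.1 hTQ).1 (hzp hx hx0 hxm (-k))
              rw [zpow_neg] at e3
              exact notMem_mI_of_inv (zpow_ne_zero k hx0) e3 e2
          have hBT : monRing (A P).toSubring (a P : K) (b P) w₁ w₂ ≤ T.toSubring := by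
            refine monRing_le hTA.1 fun m hm => ?_
            have hmQ := hQ.1 (mon_mem_monRing hm)
            by_cases hau : (a P : K) ∈ mI T
            · by_cases hbu : (b P : K) ∈ mI T
              · exact absurd (hAT P hP T (mem_affinePoints.2 hTA) hau hbu) hTP
              · rw [mon, mul_comm] at hmQ ⊢
                exact hexp hbT haT hb0 ha0 hbu hau _ _ hmQ
            · by_cases hbu : (b P : K) ∈ mI T
              · exact hexp haT hbT ha0 hb0 hau hbu _ _ hmQ
              · exact mul_mem (hzp haT ha0 hau _) (hzp hbT hb0 hbu _)
          have hTB := hTA.mono le_monRing hBT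
          rw [← hTB.eq_of_le hQ hTQ le_rfl]
          exact ⟨hTX.1, fun hc => hTX.2 ⟨hc, hTP⟩⟩
    show IsFiniteType X'
    rw [hfinal]
    refine isFiniteType_union (isFiniteType_diff hXf hZ hcl) (isFiniteType_biUnion hZ fun P hP => isFiniteType_biUnion ?_ fun p hp =>
      isFiniteType_affine (hBFG P hP p hp))
    exact ((finite_newtonFanRays (hF P hP)).prod (finite_newtonFanRays (hF P hP))).subset fun p hp => ⟨hp.1, hp.2.1⟩
  · intro W hW
    obtain ⟨P, ⟨hPX, hPW⟩, huniq⟩ := hX.valuative W hW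
    by_cases hPZ : P ∈ Z
    · obtain ⟨Q, ⟨hQ, hQW⟩, hQu⟩ := existsUnique_center_newtonFiber (hs P hPZ) (hF P hPZ) hPW
      refine ⟨Q, ⟨hmem.2 (Or.inr ⟨P, hPZ, hQ⟩), hQW⟩, ?_⟩
      rintro Q' ⟨hQ', hQW'⟩
      rcases hmem.1 hQ' with ⟨hX1, hZ1⟩ | ⟨P', hP', hQP'⟩
      · exact absurd (huniq Q' ⟨hX1, hQW'⟩ ▸ hPZ) hZ1
      · obtain rfl : P' = P := huniq P' ⟨(hcl P' hP').1, hQP'.1.trans hQW'⟩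
        exact hQu Q' ⟨hQP', hQW'⟩
    · refine ⟨P, ⟨hmem.2 (Or.inl ⟨hPX, hPZ⟩), hPW⟩, ?_⟩
      rintro Q' ⟨hQ', hQW'⟩
      rcases hmem.1 hQ' with ⟨hX1, hZ1⟩ | ⟨P', hP', hQP'⟩
      · exact huniq Q' ⟨hX1, hQW'⟩
      · obtain rfl : P' = P := huniq P' ⟨(hcl P' hP').1, hQP'.1.trans hQW'⟩
        exact absurd hP' hPZ

/-! ### Branches have one place -/

lemma mI_le_valuation {L : Type*} [Field L] {V : LocalSubring L} {W : ValuationSubring L} (h : W.toSubring ≤ V.toSubring)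
    {x : L} (hx : x ∈ mI V) : x ∈ mI W.toLocalSubring := by
  by_cases h0 : x = 0
  · rw [h0]; exact zero_mem_mI _
  refine mI_le_of_le (W := W.toLocalSubring) h ?_ hx
  rcases W.mem_or_inv_mem x with h1 | h1
  · exact h1
  · exact absurd hx (notMem_mI_of_inv h0 (h h1))

section Weierstrass
open Polynomial
variable {O : Type*} [CommRing O] [IsLocalRing O] [IsAdicComplete (maximalIdeal O) O]

/-- Weierstrass preparation of a polynomial. -/
lemma exists_distinguished_mul [IsDomain O] (p : O[X]) (hp : p.map (residue O) ≠ 0) :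
    ∃ P q : O[X], p = P * q ∧ P.IsDistinguishedAt (maximalIdeal O) ∧ IsUnit (q.coeff 0) := by
  have h0 : (p : PowerSeries O).map (residue O) ≠ 0 := by
    rw [← Polynomial.polynomial_map_coe]
    exact_mod_cast hp
  obtain ⟨P, h, H⟩ := PowerSeries.exists_isWeierstrassFactorization h0
  have h1 : Ideal.Quotient.mk (span {P}) p = 0 := by
    apply H.isDistinguishedAt.algEquivQuotient.injective
    rw [map_zero, Polynomial.IsDistinguishedAt.algEquivQuotient_apply]
    refine Ideal.Quotient.eq_zero_iff_mem.2 (mem_span_singleton.2 ⟨h, ?_⟩)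
    exact H.eq_mul
  rw [Ideal.Quotient.eq_zero_iff_mem, mem_span_singleton] at h1
  obtain ⟨q, hq⟩ := h1
  refine ⟨P, q, hq, H.isDistinguishedAt, ?_⟩
  have h2 : (P : PowerSeries O) * q = P * h := by rw [← H.eq_mul, hq, Polynomial.coe_mul]
  have h3 : (q : PowerSeries O) = h := mul_left_cancel₀ (by exact_mod_cast H.isDistinguishedAt.monic.ne_zero) h2
  have h4 := PowerSeries.isUnit_iff_constantCoeff.1 H.isUnit
  rw [← h3] at h4
  simpa using h4

/-- A root modulo `mI V` of a polynomial over a complete local ring which is a nonunit of one valuation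
ring contained in `V` is a nonunit of all of them. -/
lemma mem_mI_of_root [IsDomain O] {L : Type*} [Field L] (φ : O →+* L) {V : LocalSubring L} {W₁ W₂ : ValuationSubring L}
    (h1 : W₁.toSubring ≤ V.toSubring) (h2 : W₂.toSubring ≤ V.toSubring)
    (hφ₁' : ∀ x ∈ maximalIdeal O, φ x ∈ mI W₁.toLocalSubring)
    (hφ₂ : ∀ x, φ x ∈ W₂) {p : O[X]} (hp : p.map (residue O) ≠ 0) {z : L} (hz : z ∈ mI W₂.toLocalSubring)
    (hpz : p.eval₂ φ z ∈ mI V) : z ∈ mI W₁.toLocalSubring := by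
  obtain ⟨P, q, rfl, hP, hq⟩ := exists_distinguished_mul p hp
  have hzW : z ∈ W₂ := hz.1
  have hq2 : q.eval₂ φ z ∈ W₂ := by
    rw [eval₂_eq_sum_range]
    exact sum_mem fun i _ => mul_mem (hφ₂ _) (pow_mem hzW _)
  obtain ⟨hq0, hqi⟩ : q.eval₂ φ z ≠ 0 ∧ (q.eval₂ φ z)⁻¹ ∈ W₂ := by
    refine unit_of_notMem_mI (P := W₂.toLocalSubring) hq2 fun hc => ?_
    have e : q.eval₂ φ z = q.divX.eval₂ φ z * z + φ (q.coeff 0) := by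
      conv_lhs => rw [← q.divX_mul_X_add]
      rw [eval₂_add, eval₂_mul, eval₂_X, eval₂_C]
    have h3 : q.divX.eval₂ φ z ∈ W₂ := by
      rw [eval₂_eq_sum_range]
      exact sum_mem fun i _ => mul_mem (hφ₂ _) (pow_mem hzW _)
    have h4 : φ (q.coeff 0) ∈ mI W₂.toLocalSubring := by
      rw [eq_sub_of_add_eq' e.symm]
      exact sub_mem_mI hc (mul_mem_mI h3 hz)
    obtain ⟨u, hu⟩ := hq
    refine notMem_mI_of_inv (P := W₂.toLocalSubring) ?_ ?_ h4
    · rw [← hu]; exact (φ.isUnit_map u.isUnit).ne_zero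
    · have : (φ (q.coeff 0))⁻¹ = φ ↑u⁻¹ := by
        rw [← hu]
        exact inv_eq_of_mul_eq_one_right (by rw [← map_mul, Units.mul_inv, map_one])
      rw [this]; exact hφ₂ _
  have hPV : P.eval₂ φ z ∈ mI V := by
    have := mul_mem_mI' hpz (h2 hqi)
    rwa [eval₂_mul, mul_assoc, mul_inv_cancel₀ hq0, mul_one] at this
  have hPz := mI_le_valuation h1 hPV
  by_contra hz1
  have hzi : z⁻¹ ∈ W₁ := by
    rcases W₁.mem_or_inv_mem z with h | h
    · exact (unit_of_notMem_mI (P := W₁.toLocalSubring) h hz1).2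
    · exact h
  have hz0 : z ≠ 0 := by rintro rfl; exact hz1 (zero_mem_mI _)
  have e : (1 : L) = P.eval₂ φ z * z⁻¹ ^ P.natDegree - ∑ i ∈ Finset.range P.natDegree, φ (P.coeff i) * z⁻¹ ^ (P.natDegree - i) := by
    rw [eval₂_eq_sum_range, Finset.sum_range_succ, add_mul, Finset.sum_mul]
    have e1 : ∀ i ∈ Finset.range P.natDegree, φ (P.coeff i) * z ^ i * z⁻¹ ^ P.natDegree = φ (P.coeff i) * z⁻¹ ^ (P.natDegree - i) := by
      intro i hi
      have hi' := Finset.mem_range.1 hi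
      have : z⁻¹ ^ P.natDegree = z⁻¹ ^ i * z⁻¹ ^ (P.natDegree - i) := by rw [← pow_add]; congr 1; omega
      rw [this, mul_assoc, ← mul_assoc (z ^ i), ← mul_pow, mul_inv_cancel₀ hz0, one_pow, one_mul]
    rw [Finset.sum_congr rfl e1, coeff_natDegree, hP.monic.leadingCoeff, map_one, one_mul, ← mul_pow, mul_inv_cancel₀ hz0, one_pow]
    ring
  refine one_notMem_mI (P := W₁.toLocalSubring) ?_
  rw [e]
  refine sub_mem_mI (mul_mem_mI' hPz (pow_mem hzi _)) ?_
  have : ∀ s : Finset ℕ, s ⊆ Finset.range P.natDegree → ∑ i ∈ s, φ (P.coeff i) * z⁻¹ ^ (P.natDegree - i) ∈ mI W₁.toLocalSubring := by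
    intro s hs
    refine Finset.sum_induction _ (· ∈ mI W₁.toLocalSubring) (fun _ _ => add_mem_mI) (zero_mem_mI _) fun i hi => ?_
    exact mul_mem_mI' (hφ₁' _ (hP.mem (Finset.mem_range.1 (hs hi)))) (pow_mem hzi _)
  exact this _ le_rfl

/-- A power series with nonzero reduction has an integral quotient. -/
lemma exists_monic_dvd {g : PowerSeries O} (hg : g.map (residue O) ≠ 0) (x : PowerSeries O) :
    ∃ p : O[X], p.Monic ∧ g ∣ p.eval₂ PowerSeries.C x := by
  obtain ⟨P, h, H⟩ := PowerSeries.exists_isWeierstrassFactorization hg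
  have hfin : Module.Finite O (O[X] ⧸ span {P}) := H.isDistinguishedAt.monic.finite_quotient
  have hfin2 : Module.Finite O (PowerSeries O ⧸ span {g}) := Module.Finite.equiv H.algEquivQuotient.toLinearEquiv
  obtain ⟨p, hp, hpx⟩ := Algebra.IsIntegral.isIntegral (R := O) (Ideal.Quotient.mk (span {g}) x)
  refine ⟨p, hp, ?_⟩
  rw [← mem_span_singleton, ← Ideal.Quotient.eq_zero_iff_mem, hom_eval₂]
  exact hpx

end Weierstrass

/-- The coefficient ring of Weierstrass preparation. -/
abbrev R₁ : Type := MvPowerSeries (Fin 1) ℂ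

lemma maximalIdeal_R₁ : maximalIdeal R₁ = span (Set.range MvPowerSeries.X) := by
  rw [Set.range_unique]
  ext f
  rw [mem_maximalIdeal, mem_nonunits_iff, MvPowerSeries.isUnit_iff_constantCoeff, isUnit_iff_ne_zero, not_not,
    mem_span_singleton, MvPowerSeries.X_dvd_iff]
  constructor
  · intro h m hm
    have : m = 0 := by ext; exact hm
    rw [this]; exact h
  · intro h; exact h 0 rfl

instance : IsAdicComplete (maximalIdeal R₁) R₁ := maximalIdeal_R₁ ▸ inferInstance

lemma X_prime_R₁ : Prime (MvPowerSeries.X 0 : R₁) := by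
  rw [← MulEquiv.prime_iff (MvPowerSeries.finSuccEquiv ℂ 0).toMulEquiv]
  simpa using PowerSeries.X_prime

lemma mem_maximalIdeal_R₁ {x : R₁} : x ∈ maximalIdeal R₁ ↔ MvPowerSeries.X 0 ∣ x := by
  rw [maximalIdeal_R₁, Set.range_unique, mem_span_singleton]; rfl

lemma map_residue_eq_zero {s : PowerSeries R₁} (hs : s.map (residue R₁) = 0) : PowerSeries.C (MvPowerSeries.X 0) ∣ s := by
  have : ∀ n, ∃ c, PowerSeries.coeff n s = MvPowerSeries.X 0 * c := by
    intro n
    refine mem_maximalIdeal_R₁.1 ((residue_eq_zero_iff _).1 ?_)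
    rw [← PowerSeries.coeff_map, hs, map_zero]
  choose c hc using this
  refine ⟨PowerSeries.mk c, ?_⟩
  ext1 n
  rw [PowerSeries.coeff_C_mul, PowerSeries.coeff_mk, hc]

/-- Coordinates in which a given prime series is regular. -/
lemma exists_equiv_regular {g : R} (hg : Prime g) :
    ∃ e : R ≃+* PowerSeries R₁, (e g).map (residue R₁) ≠ 0 := by
  by_cases h : MvPowerSeries.X 1 ∣ g
  · refine ⟨((MvPowerSeries.renameEquiv ℂ (Equiv.swap (0 : Fin 2) 1)).trans (MvPowerSeries.finSuccEquiv ℂ 1)).toRingEquiv, fun hc => ?_⟩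
    have h1 := (((X_prime_R 1).associated_of_dvd hg h).symm.dvd)
    have h2 := (map_residue_eq_zero hc).trans (map_dvd _ h1)
    have h3 : ((MvPowerSeries.renameEquiv ℂ (Equiv.swap (0 : Fin 2) 1)).trans (MvPowerSeries.finSuccEquiv ℂ 1)).toRingEquiv
        (MvPowerSeries.X 1 : R) = PowerSeries.X := by
      show MvPowerSeries.finSuccEquiv ℂ 1 (MvPowerSeries.rename (Equiv.swap (0 : Fin 2) 1) (MvPowerSeries.X 1)) = _
      rw [MvPowerSeries.rename_X, Equiv.swap_apply_right, MvPowerSeries.finSuccEquiv_X_zero]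
    rw [h3] at h2
    obtain ⟨c, hc⟩ := h2
    have h4 := congrArg (PowerSeries.coeff 1) hc
    rw [PowerSeries.coeff_one_X, PowerSeries.coeff_C_mul] at h4
    exact X_prime_R₁.not_dvd_one ⟨_, h4⟩
  · refine ⟨(MvPowerSeries.finSuccEquiv ℂ 1).toRingEquiv, fun hc => h ?_⟩
    have h1 := map_residue_eq_zero hc
    rw [← MvPowerSeries.finSuccEquiv_X_succ] at h1
    exact (map_dvd_iff (MvPowerSeries.finSuccEquiv ℂ 1)).1 h1

/-- A prime divisor of `S` is the zero locus of a prime series. -/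
lemma IsPrimeDivisor.exists_prime {V : LocalSubring K} (hV : IsPrimeDivisor S V) :
    ∃ g : R, Prime g ∧ ∀ r : R, algebraMap R K r ∈ mI V ↔ g ∣ r := by
  have hl := mem_affinePoints.1 hV.1
  have := hV.2
  have hmem : ∀ r : R, algebraMap R K r ∈ V.toSubring := fun r => hl.1 ⟨r, rfl⟩
  let φ : R →+* V.toSubring := (algebraMap R K).codRestrict V.toSubring hmem
  have hp : ∀ r, r ∈ (maximalIdeal V.toSubring).comap φ ↔ algebraMap R K r ∈ mI V := fun r => by
    rw [Ideal.mem_comap]; exact coe_mem_mI.symm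
  obtain ⟨ϖ, hϖ⟩ := IsDiscreteValuationRing.exists_irreducible V.toSubring
  have hmax := hϖ.maximalIdeal_eq
  obtain ⟨g, hg, hgp⟩ := regPair_X.exists_prime_generator ((maximalIdeal V.toSubring).comap φ) (by
    intro h0
    obtain ⟨s, ⟨s, rfl⟩, t, ⟨t, rfl⟩, ht0, hi, hst⟩ := hl.2 ϖ ϖ.2
    have h1 : s ∈ (maximalIdeal V.toSubring).comap φ := by
      rw [hp]
      have : algebraMap R K s = ϖ * algebraMap R K t := by rw [hst]; field_simp
      rw [this]
      exact mul_mem_mI' (coe_mem_mI.2 (hmax ▸ mem_span_singleton_self ϖ)) (hmem t)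
    rw [h0, Ideal.mem_bot] at h1
    rw [h1, map_zero] at hst
    exact hϖ.ne_zero (Subtype.ext (hst.trans (zero_mul _)))) (by
    intro h0
    -- every element of `V` is then the image of a series
    have hsurj : ∀ x ∈ V.toSubring, ∃ r, algebraMap R K r = x := by
      intro x hx
      obtain ⟨s, ⟨s, rfl⟩, t, ⟨t, rfl⟩, ht0, hi, rfl⟩ := hl.2 x hx
      have ht : IsUnit t := by
        by_contra hc
        have := (hp t).1 (h0 ▸ (mem_maximalIdeal t).2 hc)
        exact notMem_mI_of_inv ht0 hi this
      obtain ⟨u, rfl⟩ := ht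
      refine ⟨s * ↑u⁻¹, ?_⟩
      rw [map_mul]
      show _ = _ * _
      congr 1
      exact (inv_eq_of_mul_eq_one_right (by rw [← map_mul, Units.mul_inv, map_one])).symm
    obtain ⟨w, hw⟩ := hsurj ϖ ϖ.2
    refine regPair_X.not_principal w ?_
    ext r
    rw [← h0, hp, mem_span_singleton]
    constructor
    · intro hr
      have h1 : (⟨_, hmem r⟩ : V.toSubring) ∈ maximalIdeal V.toSubring := coe_mem_mI.1 hr
      rw [hmax, mem_span_singleton] at h1
      obtain ⟨c, hc⟩ := h1
      obtain ⟨d, hd⟩ := hsurj c c.2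
      refine ⟨d, algebraMap_injective ?_⟩
      rw [map_mul, hw, hd]
      exact congrArg Subtype.val hc
    · rintro ⟨c, rfl⟩
      rw [map_mul, hw]
      exact mul_mem_mI' (coe_mem_mI.2 (hmax ▸ mem_span_singleton_self ϖ)) (hmem c))
  refine ⟨g, hg, fun r => ?_⟩
  rw [← hp, hgp, mem_span_singleton]

/-- A formal branch has only one place: there is only one valuation ring of `K` dominating `R` which
is composed with the discrete valuation ring of a prime divisor of `S`. -/
lemma valuation_unique {V : LocalSubring K} (hV : IsPrimeDivisor S V) {W₁ W₂ : ValuationSubring K}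
    (h1 : W₁.toSubring ≤ V.toSubring) (h2 : W₂.toSubring ≤ V.toSubring)
    (d1 : origin ≤ W₁.toLocalSubring) (d2 : origin ≤ W₂.toLocalSubring) : W₁ = W₂ := by
  obtain ⟨g, hg, hgV⟩ := hV.exists_prime
  obtain ⟨e, he⟩ := exists_equiv_regular hg
  have hl := mem_affinePoints.1 hV.1
  have hmem : ∀ r : R, algebraMap R K r ∈ V.toSubring := fun r => hl.1 ⟨r, rfl⟩
  let φ : R₁ →+* K := (algebraMap R K).comp ((e.symm : PowerSeries R₁ →+* R).comp PowerSeries.C)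
  have hφ : ∀ x, φ x = algebraMap R K (e.symm (PowerSeries.C x)) := fun _ => rfl
  have hφm : ∀ x ∈ maximalIdeal R₁, e.symm (PowerSeries.C x) ∈ maximalIdeal R := by
    intro x hx
    rw [mem_maximalIdeal, mem_nonunits_iff] at hx ⊢
    intro hu
    have := (hu.map e)
    rw [e.apply_symm_apply, PowerSeries.isUnit_iff_constantCoeff, PowerSeries.constantCoeff_C] at this
    exact hx this
  have hφV : ∀ x, φ x ∈ V.toSubring := fun x => hmem _
  let ρ : R₁ →+* ResidueField V.toSubring := (residue V.toSubring).comp (φ.codRestrict V.toSubring hφV)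
  let := ρ.toAlgebra
  have hmemres : ∀ (x : K) (hx : x ∈ V.toSubring), residue V.toSubring ⟨x, hx⟩ = 0 ↔ x ∈ mI V := by
    intro x hx
    rw [residue_eq_zero_iff]; exact coe_mem_mI.symm
  have hint : ∀ r : R, IsIntegral R₁ (residue V.toSubring ⟨_, hmem r⟩) := by
    intro r
    obtain ⟨p, hp, c, hc⟩ := exists_monic_dvd he (e r)
    refine ⟨p, hp, ?_⟩
    have h3 : p.eval₂ φ (algebraMap R K r) ∈ mI V := by
      have : p.eval₂ φ (algebraMap R K r) = algebraMap R K (g * e.symm c) := by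
        have h4 : e.symm (p.eval₂ PowerSeries.C (e r)) = g * e.symm c := by rw [hc, map_mul, e.symm_apply_apply]
        rw [← h4]
        have h5 := Polynomial.hom_eval₂ p PowerSeries.C ((algebraMap R K).comp (e.symm : PowerSeries R₁ →+* R)) (e r)
        simp only [RingHom.comp_apply, RingHom.coe_coe, e.symm_apply_apply] at h5
        rw [h5]; rfl
      rw [this, hgV]
      exact ⟨_, rfl⟩
    have h6 := Polynomial.hom_eval₂ p (φ.codRestrict V.toSubring hφV) V.toSubring.subtype ⟨_, hmem r⟩
    have h7 := Polynomial.hom_eval₂ p (φ.codRestrict V.toSubring hφV) (residue V.toSubring) ⟨_, hmem r⟩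
    show p.eval₂ ρ _ = 0
    rw [← h7, residue_eq_zero_iff, ← coe_mem_mI]
    show V.toSubring.subtype _ ∈ _
    rw [h6]
    exact h3
  have halg : ∀ (z : K) (hz : z ∈ V.toSubring), ∃ p : Polynomial R₁, p.map (residue R₁) ≠ 0 ∧ p.eval₂ φ z ∈ mI V := by
    intro z hz
    have hinj : Function.Injective (algebraMap R₁ (ResidueField V.toSubring)) := by
      rw [injective_iff_map_eq_zero]
      intro x hx
      by_contra hx0
      have h3 : φ x ∈ mI V := (hmemres _ (hφV x)).1 hx
      rw [hφ, hgV] at h3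
      have h4 : e g ∣ PowerSeries.C x := by simpa using map_dvd e h3
      have hge : Prime (e g) := (MulEquiv.prime_iff e.toMulEquiv).2 hg
      obtain ⟨n, u, hu, rfl⟩ := WfDvdMonoid.max_power_factor hx0 X_prime_R₁.irreducible
      have huu : IsUnit u := by
        by_contra hc
        exact hu (mem_maximalIdeal_R₁.1 ((mem_maximalIdeal u).2 hc))
      rw [map_mul, map_pow] at h4
      rcases hge.dvd_or_dvd h4 with h5 | h5
      · obtain ⟨c, hc⟩ := hge.dvd_of_dvd_pow h5
        have h6 := congrArg (PowerSeries.map (residue R₁)) hc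
        rw [map_mul, PowerSeries.map_C, (residue_eq_zero_iff _).2 (mem_maximalIdeal_R₁.2 dvd_rfl), map_zero] at h6
        obtain ⟨d, rfl⟩ := map_residue_eq_zero ((mul_eq_zero.1 h6.symm).resolve_left he)
        have h7 : (PowerSeries.C (MvPowerSeries.X 0 : R₁)) ≠ 0 := by
          rw [Ne, map_eq_zero_iff _ PowerSeries.C_injective]; exact X_prime_R₁.ne_zero
        refine hge.not_dvd_one ⟨d, mul_left_cancel₀ h7 ?_⟩
        rw [mul_one]
        exact hc.trans (mul_left_comm _ _ _)
      · exact hge.not_isUnit (isUnit_of_dvd_unit h5 (huu.map _))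
    have hza : IsAlgebraic R₁ (residue V.toSubring ⟨z, hz⟩) := by
      obtain ⟨s, ⟨s, rfl⟩, t, ⟨t, rfl⟩, ht0, hi, hzst⟩ := hl.2 z hz
      have h3 : residue V.toSubring ⟨z, hz⟩ = residue V.toSubring ⟨_, hmem s⟩ * (residue V.toSubring ⟨_, hmem t⟩)⁻¹ := by
        rw [eq_mul_inv_iff_mul_eq₀, ← map_mul]
        · congr 1
          refine Subtype.ext ?_
          show z * algebraMap R K t = algebraMap R K s
          rw [hzst]
          exact inv_mul_cancel_right₀ ht0 _
        · rw [Ne, hmemres]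
          exact notMem_mI_of_inv ht0 hi
      rw [h3]
      exact ((hint s).isAlgebraic).mul ((hint t).isAlgebraic).inv
    obtain ⟨p, hp0, hpz⟩ := hza
    have hCp : Prime (Polynomial.C (MvPowerSeries.X 0 : R₁)) := Polynomial.prime_C_iff.2 X_prime_R₁
    obtain ⟨n, q, hq, rfl⟩ := WfDvdMonoid.max_power_factor hp0 hCp.irreducible
    refine ⟨q, fun hc => hq ?_, ?_⟩
    · rw [Polynomial.C_dvd_iff_dvd_coeff]
      intro i
      refine mem_maximalIdeal_R₁.1 ((residue_eq_zero_iff _).1 ?_)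
      rw [← Polynomial.coeff_map, hc, Polynomial.coeff_zero]
    · rw [map_mul, map_pow, Polynomial.aeval_C, mul_eq_zero] at hpz
      have h3 := hpz.resolve_left (pow_ne_zero _ ((map_ne_zero_iff _ hinj).2 X_prime_R₁.ne_zero))
      have h6 := Polynomial.hom_eval₂ q (φ.codRestrict V.toSubring hφV) V.toSubring.subtype ⟨_, hz⟩
      have h7 := Polynomial.hom_eval₂ q (φ.codRestrict V.toSubring hφV) (residue V.toSubring) ⟨_, hz⟩
      have h8 : q.eval₂ ρ (residue V.toSubring ⟨z, hz⟩) = 0 := h3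
      rw [← h7, residue_eq_zero_iff, ← coe_mem_mI] at h8
      have h9 : V.toSubring.subtype _ ∈ mI V := h8
      rw [h6] at h9
      exact h9
  have key : ∀ W₁ W₂ : ValuationSubring K, W₁.toSubring ≤ V.toSubring → W₂.toSubring ≤ V.toSubring → 
      origin ≤ W₁.toLocalSubring → origin ≤ W₂.toLocalSubring → ∀ z ∈ mI W₂.toLocalSubring, z ∈ mI W₁.toLocalSubring := by
    intro W₁ W₂ h1 h2 d1 d2 z hz
    obtain ⟨p, hp, hpz⟩ := halg z (h2 hz.1)
    have d1' := le_iff_mI.1 d1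
    have d2' := le_iff_mI.1 d2
    exact mem_mI_of_root φ h1 h2 (fun x hx => d1'.2 _ (mem_mI_origin.2 (hφm x hx)))
      (fun x => d2'.1 ⟨_, rfl⟩) hp hz hpz
  have key2 : ∀ W₁ W₂ : ValuationSubring K, (∀ z ∈ mI W₂.toLocalSubring, z ∈ mI W₁.toLocalSubring) → ∀ x ∈ W₁, x ∈ W₂ := by
    intro W₁ W₂ h x hx
    rcases W₂.mem_or_inv_mem x with h3 | h3
    · exact h3
    by_contra h4
    have hx0 : x ≠ 0 := by rintro rfl; exact h4 W₂.zero_mem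
    have h5 : x⁻¹ ∈ mI W₂.toLocalSubring := by
      by_contra h6
      have := (unit_of_notMem_mI (P := W₂.toLocalSubring) h3 h6).2
      rw [inv_inv] at this
      exact h4 this
    exact notMem_mI_of_inv (P := W₁.toLocalSubring) (inv_ne_zero hx0) (by rw [inv_inv]; exact hx) (h _ h5)
  ext x
  exact ⟨key2 _ _ (key W₁ W₂ h1 h2 d1 d2) x, key2 _ _ (key W₂ W₁ h2 h1 d2 d1) x⟩

/-! ### Intersection numbers with the boundary -/

/-- In coordinates `(a, b)`, the intersection number of the curves `a = 0` and `x = 0` is `k`. -/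
def HasOrder {A : Type*} [CommRing A] (a b x : A) (k : ℕ) : Prop := ∃ e, IsUnit e ∧ a ∣ x - e * b ^ k

section Strict
open Polynomial
variable {P Q : LocalSubring K} {a b : P.toSubring} {w w₂ n : ℤ × ℤ}

lemma exists_eq_pow_mul_of_mem_pow {u : K} (huQ : u ∈ Q.toSubring) (hPQ : P.toSubring ≤ Q.toSubring)
    (hu : ∀ x ∈ mI P, ∃ y ∈ Q.toSubring, x = u * y) (k : ℕ) {r : P.toSubring} (hr : r ∈ maximalIdeal P.toSubring ^ k) :
    ∃ y ∈ Q.toSubring, (r : K) = u ^ k * y := by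
  have h1 : maximalIdeal P.toSubring ≤ (span {(⟨u, huQ⟩ : Q.toSubring)}).comap (Subring.inclusion hPQ) := by
    intro x hx
    obtain ⟨y, hy, hxy⟩ := hu x (coe_mem_mI.2 hx)
    rw [Ideal.mem_comap, mem_span_singleton]
    exact ⟨⟨y, hy⟩, Subtype.ext hxy⟩
  have h2 : Subring.inclusion hPQ r ∈ span {(⟨u, huQ⟩ : Q.toSubring)} ^ k :=
    (Ideal.le_comap_pow _ k) (Ideal.pow_right_mono h1 k hr)
  rw [Ideal.span_singleton_pow, mem_span_singleton] at h2
  obtain ⟨y, hy⟩ := h2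
  exact ⟨y, y.2, congrArg Subtype.val hy⟩

lemma SmoothAt.coeff_exp_ne_zero (h : SmoothAt P a b) {f : P.toSubring} {k : ℕ} (hf : HasOrder a b f k) :
    coeff (ex 0 k) (h.exp f) ≠ 0 := by
  classical
  obtain ⟨e, he, g, hg⟩ := hf
  have h1 : h.exp f = h.exp e * MvPowerSeries.X 1 ^ k + MvPowerSeries.X 0 * h.exp g := by
    have h2 : f = e * b ^ k + a * g := by rw [← hg]; ring
    conv_lhs => rw [h2]
    have hb : h.exp b = MvPowerSeries.X 1 := RegPair.expandHom_right _ _ _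
    have ha : h.exp a = MvPowerSeries.X 0 := RegPair.expandHom_left _ _ _
    rw [map_add, map_mul, map_mul, map_pow, hb, ha]
  have h3 : coeff (ex 0 k) (MvPowerSeries.X 0 * h.exp g) = 0 :=
    MvPowerSeries.X_dvd_iff.1 (dvd_mul_right _ _) _ (by simp)
  have hX : (MvPowerSeries.X 1 : R) ^ k = monomial (ex 0 k) 1 := by
    rw [MvPowerSeries.X, MvPowerSeries.monomial_pow, one_pow]; congr 2; simp [ex]
  rw [h1, map_add, h3, add_zero, hX]
  have h4 := MvPowerSeries.coeff_add_mul_monomial (m := (0 : Fin 2 →₀ ℕ)) (ex 0 k) (h.exp e) (1 : ℂ)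
  rw [zero_add, mul_one] at h4
  rw [h4]
  intro h5
  exact (mem_maximalIdeal e).1 (h.constantCoeff_exp.1 h5) he

/-- The strict transform of a curve at a point of the interior of an exceptional component. Its
intersection number with the exceptional divisor does not exceed that with the initial boundary, and
in the case of equality the order of the exceptional divisor is as large as possible. -/
lemma EdgeBasis.exists_strict (e : EdgeBasis w w₂ n (-w.2, w.1)) (h : SmoothAt P a b) (hPQ : P ≤ Q)
    (hQ : IsLocAt (monRing P.toSubring a b w w) Q) {c : ℂ}
    (hzc : mon (a : K) b (-w.2, w.1) - algebraMap ℂ K c ∈ mI Q) {f : P.toSubring} {k : ℕ} (hf : HasOrder a b f k) :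
    ∃ (t k' : ℕ) (f' : Q.toSubring), (f : K) = mon (a : K) b n ^ t * f' ∧
      HasOrder (⟨mon (a : K) b n, (e.u_mem h hPQ hQ).1⟩ : Q.toSubring) ⟨mon (a : K) b (-w.2, w.1) - algebraMap ℂ K c, hzc.1⟩ f' k' ∧
      k' ≤ k ∧ (k' = k → 0 < k → w.1 = 1 ∧ (t : ℤ) = k * w.2) := by
  classical
  have hp₁ := e.pos₁
  have hp₂ := e.pos₂
  have huQ := e.u_mem h hPQ hQ
  obtain ⟨hz, hzi, hzm⟩ := e.z_unit h hQ
  have hPQ' := (le_iff_mI.1 hPQ).1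
  have ha0 := h.left_ne_zero
  have hb0 := h.right_ne_zero
  set z := mon (a : K) b (-w.2, w.1) with hzdef
  set u := mon (a : K) b n with hudef
  have hz0 : z ≠ 0 := mon_ne_zero ha0 hb0 _
  have hu0 : u ≠ 0 := mon_ne_zero ha0 hb0 _
  set F := h.exp f
  let W : ℕ × ℕ → ℕ := fun p => w.1.toNat * p.1 + w.2.toNat * p.2
  let T : ℕ × ℕ → ℕ := fun p => w₂.1.toNat * p.1 + w₂.2.toNat * p.2
  have hW : ∀ p, (W p : ℤ) = wdot w (p.1, p.2) := fun p => by
    simp only [W, wdot]; push_cast; rw [Int.toNat_of_nonneg hp₁.le, Int.toNat_of_nonneg hp₂.le]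
  have hT : ∀ p, (T p : ℤ) = wdot w₂ (p.1, p.2) := fun p => by
    simp only [T, wdot]; push_cast; rw [Int.toNat_of_nonneg e.cone.n21, Int.toNat_of_nonneg e.cone.n22]
  have hmon : ∀ p : ℕ × ℕ, (a : K) ^ p.1 * (b : K) ^ p.2 = u ^ W p * z ^ T p := by
    intro p
    have h1 : (((p.1 : ℤ), (p.2 : ℤ)) : ℤ × ℤ) = (W p : ℤ) • n + (T p : ℤ) • (-w.2, w.1) := by
      refine e.cone.wdot_ext ?_ ?_
      · rw [wdot_add, wdot_zsmul, wdot_zsmul, e.wn, e.wv, hW]; ring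
      · rw [wdot_add, wdot_zsmul, wdot_zsmul, e.wn₂, e.wv₂, hT]; ring
    have h2 : (a : K) ^ p.1 * (b : K) ^ p.2 = mon a b (p.1, p.2) := by simp [mon]
    rw [h2, h1, mon_add ha0 hb0, mon_zsmul, mon_zsmul, zpow_natCast, zpow_natCast]
  -- two exponents of the same weight
  have hdiff : ∀ p q, W p = W q → (p.2 : ℤ) - q.2 = ((T p : ℤ) - T q) * w.1 ∧ (p.1 : ℤ) - q.1 = -((T p : ℤ) - T q) * w.2 := by
    intro p q hpq
    have h1 : wdot w (((p.1 : ℤ), (p.2 : ℤ)) - ((q.1 : ℤ), (q.2 : ℤ))) = 0 := by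
      rw [wdot_sub, ← hW, ← hW, hpq, sub_self]
    have h2 := e.eq_smul h1
    rw [wdot_sub, ← hT, ← hT] at h2
    have h3 := congrArg Prod.fst h2
    have h4 := congrArg Prod.snd h2
    simp only [Prod.fst_sub, Prod.snd_sub, Prod.smul_fst, Prod.smul_snd, smul_eq_mul] at h3 h4
    exact ⟨h4, by rw [h3]; ring⟩
  have hk : coeff (ex 0 k) F ≠ 0 := h.coeff_exp_ne_zero hf
  have hex : ∃ t, ∃ p : ℕ × ℕ, coeff (ex p.1 p.2) F ≠ 0 ∧ W p = t := ⟨_, (0, k), hk, rfl⟩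
  obtain ⟨t, ht, htmin⟩ : ∃ t, (∃ p : ℕ × ℕ, coeff (ex p.1 p.2) F ≠ 0 ∧ W p = t) ∧
      ∀ p : ℕ × ℕ, coeff (ex p.1 p.2) F ≠ 0 → t ≤ W p :=
    ⟨Nat.find hex, Nat.find_spec hex, fun p hp => Nat.find_min' hex ⟨p, hp, rfl⟩⟩
  have htk : (t : ℤ) ≤ k * w.2 := by
    have := htmin (0, k) hk
    have h2 := hW (0, k)
    simp only [wdot] at h2
    have h3 : (t : ℤ) ≤ W (0, k) := by exact_mod_cast this
    rw [h2] at h3; push_cast at h3; linarith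
  let E : Finset (ℕ × ℕ) := (Finset.range (t + 1) ×ˢ Finset.range (t + 1)).filter
    fun p => coeff (ex p.1 p.2) F ≠ 0 ∧ W p = t
  have hE : ∀ p, p ∈ E ↔ coeff (ex p.1 p.2) F ≠ 0 ∧ W p = t := by
    intro p
    simp only [E, Finset.mem_filter, Finset.mem_product, Finset.mem_range]
    refine ⟨fun h => h.2, fun h => ⟨?_, h⟩⟩
    have h1 := h.2
    have e1 : 1 ≤ w.1.toNat := by omega
    have e2 : 1 ≤ w.2.toNat := by omega
    simp only [W] at h1
    constructor <;> nlinarith [Nat.zero_le p.1, Nat.zero_le p.2]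
  have hEne : E.Nonempty := by
    obtain ⟨p, hp⟩ := ht
    exact ⟨p, (hE p).2 hp⟩
  obtain ⟨p₀, hp₀, hmin⟩ := E.exists_min_image T hEne
  let L : ℂ[X] := ∑ p ∈ E, monomial (T p - T p₀) (coeff (ex p.1 p.2) F)
  have hLc : ∀ p ∈ E, L.coeff (T p - T p₀) = coeff (ex p.1 p.2) F := by
    intro p hp
    simp only [L, finsetSum_coeff, coeff_monomial]
    rw [Finset.sum_eq_single p]
    · rw [if_pos rfl]
    · intro q hq hqp
      rw [if_neg]
      intro hc
      apply hqp
      have h1 := hmin p hp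
      have h2 := hmin q hq
      have h3 : T q = T p := by omega
      have h4 := hdiff q p (((hE q).1 hq).2.trans ((hE p).1 hp).2.symm)
      rw [h3, sub_self] at h4
      ext
      · have := h4.2; simp at this; omega
      · have := h4.1; simp at this; omega
    · intro hc; exact absurd hp hc
  have hL0 : L ≠ 0 := by
    intro hc
    have := hLc p₀ hp₀
    rw [hc, coeff_zero] at this
    exact ((hE p₀).1 hp₀).1 this.symm
  -- the heights of the exponents of the face
  have hheight : ∀ p ∈ E, ((T p - T p₀ : ℕ) : ℤ) * w.1 = p.2 - p₀.2 ∧ (p.2 : ℤ) ≤ k ∧ 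
      (t : ℤ) = w.1 * p.1 + w.2 * p.2 := by
    intro p hp
    have h1 := hmin p hp
    have h2 := (hdiff p p₀ (((hE p).1 hp).2.trans ((hE p₀).1 hp₀).2.symm)).1
    have h3 := hW p
    rw [((hE p).1 hp).2] at h3
    simp only [wdot] at h3
    refine ⟨by rw [Nat.cast_sub h1, h2], ?_, h3⟩
    nlinarith [Int.natCast_nonneg p.1]
  have hdeg : L.natDegree ≤ k := by
    refine natDegree_sum_le_of_forall_le _ _ fun p hp => (natDegree_monomial_le _).trans ?_
    obtain ⟨h1, h2, h3⟩ := hheight p hp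
    have : ((T p - T p₀ : ℕ) : ℤ) ≤ k := by nlinarith [Int.natCast_nonneg (T p - T p₀), Int.natCast_nonneg p₀.2]
    exact_mod_cast this
  have hLQ : ∀ L : ℂ[X], aeval z L ∈ Q.toSubring := by
    intro L
    induction L using Polynomial.induction_on' with
    | add p q hp hq => rw [map_add]; exact add_mem hp hq
    | monomial k c => rw [aeval_monomial]; exact mul_mem (hPQ' (h.base (algebraMap_C_mem c))) (pow_mem hz k)
  have hres : ∃ y ∈ Q.toSubring, (f : K) = u ^ t * (z ^ T p₀ * aeval z L + u * y) := by
    have hmP : ∀ x ∈ mI P, ∃ y ∈ Q.toSubring, x = u * y := by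
      intro x hx
      obtain ⟨r, hr, s, hs, rfl⟩ := (mem_mI_span h.reg.span).1 hx
      have h1 := hmon (1, 0)
      have h2 := hmon (0, 1)
      have h3 : W (1, 0) = W (1, 0) - 1 + 1 := by simp only [W]; omega
      have h4 : W (0, 1) = W (0, 1) - 1 + 1 := by simp only [W]; omega
      rw [pow_one, pow_zero, mul_one, h3, pow_succ] at h1
      rw [pow_one, pow_zero, one_mul, h4, pow_succ] at h2
      refine ⟨r * (u ^ (W (1, 0) - 1) * z ^ T (1, 0)) + s * (u ^ (W (0, 1) - 1) * z ^ T (0, 1)), add_mem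
        (mul_mem (hPQ' hr) (mul_mem (pow_mem huQ.1 _) (pow_mem hz _))) (mul_mem (hPQ' hs) (mul_mem (pow_mem huQ.1 _) (pow_mem hz _))), ?_⟩
      rw [h1, h2]; ring
    obtain ⟨r, hr, hfr⟩ := h.isExpansion_exp f (t + 1)
    obtain ⟨y₀, hy₀, hry⟩ := exists_eq_pow_mul_of_mem_pow huQ.1 hPQ' hmP (t + 1) hr
    let g : ℕ × ℕ → K := fun p => algebraMap ℂ K (coeff (ex p.1 p.2) F) * (u ^ W p * z ^ T p)
    have hfg : (f : K) = ∑ p ∈ Finset.range (t + 1) ×ˢ Finset.range (t + 1), g p + r := by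
      rw [hfr, Finset.sum_product]
      congr 1
      refine Finset.sum_congr rfl fun i _ => Finset.sum_congr rfl fun j _ => ?_
      simp only [g]
      rw [← hmon, mul_assoc]
    rw [← Finset.sum_filter_add_sum_filter_not _ (fun p => coeff (ex p.1 p.2) F ≠ 0 ∧ W p = t)] at hfg
    have h1 : ∑ p ∈ E, g p = u ^ t * (z ^ T p₀ * aeval z L) := by
      simp only [L, map_sum, aeval_monomial, Finset.mul_sum]
      refine Finset.sum_congr rfl fun p hp => ?_
      have h3 : z ^ T p = z ^ T p₀ * z ^ (T p - T p₀) := by rw [← pow_add, Nat.add_sub_cancel' (hmin p hp)]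
      simp only [g]
      rw [((hE p).1 hp).2, h3]
      ring
    have h2 : ∀ s : Finset (ℕ × ℕ), (∀ p ∈ s, ¬ (coeff (ex p.1 p.2) F ≠ 0 ∧ W p = t)) →
        ∃ y ∈ Q.toSubring, ∑ p ∈ s, g p = u ^ (t + 1) * y := by
      intro s hs
      refine Finset.sum_induction g (fun x => ∃ y ∈ Q.toSubring, x = u ^ (t + 1) * y) ?_ ⟨0, zero_mem _, by simp⟩ fun p hp => ?_
      · rintro _ _ ⟨y, hy, rfl⟩ ⟨y', hy', rfl⟩
        exact ⟨y + y', add_mem hy hy', by ring⟩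
      · by_cases h0 : coeff (ex p.1 p.2) F = 0
        · exact ⟨0, zero_mem _, by simp only [g]; rw [h0]; simp⟩
        · have h3 := htmin p h0
          have h4 : W p ≠ t := fun hc => hs p hp ⟨h0, hc⟩
          have h5 : W p = t + 1 + (W p - (t + 1)) := by omega
          refine ⟨algebraMap ℂ K (coeff (ex p.1 p.2) F) * (u ^ (W p - (t + 1)) * z ^ T p),
            mul_mem (hPQ' (h.base (algebraMap_C_mem _))) (mul_mem (pow_mem huQ.1 _) (pow_mem hz _)), ?_⟩
          simp only [g]
          conv_lhs => rw [h5, pow_add]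
          ring
    obtain ⟨y₁, hy₁, h3⟩ := h2 _ fun p hp => (Finset.mem_filter.1 hp).2
    refine ⟨y₁ + y₀, add_mem hy₁ hy₀, ?_⟩
    have h4 := hfg
    rw [h3, hry] at h4
    rw [h4]
    have h5 : ∑ p ∈ Finset.range (t + 1) ×ˢ Finset.range (t + 1) with coeff (ex p.1 p.2) F ≠ 0 ∧ W p = t, g p
      = ∑ p ∈ E, g p := rfl
    rw [h5, h1, pow_succ]
    ring
  obtain ⟨y, hy, hfy⟩ := hres
  obtain ⟨L₁, hL₁, hroot⟩ := exists_eq_pow_rootMultiplicity_mul_and_not_dvd L hL0 c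
  have hmd : L.rootMultiplicity c ≤ L.natDegree := by
    rw [← count_roots]
    exact (Multiset.count_le_card _ _).trans (card_roots' L)
  generalize L.rootMultiplicity c = k' at hL₁ hmd
  have hL₁u : aeval z L₁ ∉ mI Q := by
    obtain ⟨q, hq⟩ := X_sub_C_dvd_sub_C_eval (a := c) (p := L₁)
    have h1 : aeval z L₁ = algebraMap ℂ K (L₁.eval c) + (z - algebraMap ℂ K c) * aeval z q := by
      have := congrArg (aeval z) hq
      simp only [map_sub, map_mul, aeval_X, aeval_C] at this
      linear_combination this
    intro hc
    have h2 : algebraMap ℂ K (L₁.eval c) ∈ mI Q := by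
      rw [eq_sub_of_add_eq h1.symm]
      exact sub_mem_mI hc (mul_mem_mI' hzc (hLQ q))
    have h3 : L₁.eval c ≠ 0 := fun h0 => hroot (dvd_iff_isRoot.2 h0)
    refine notMem_mI_of_inv ?_ ?_ h2
    · rwa [Ne, map_eq_zero]
    · rw [← map_inv₀]; exact hPQ' (h.base (algebraMap_C_mem _))
  refine ⟨t, k', ⟨z ^ T p₀ * aeval z L + u * y, add_mem (mul_mem (pow_mem hz _) (hLQ _)) (mul_mem huQ.1 hy)⟩, hfy, 
    ⟨⟨z ^ T p₀ * aeval z L₁, mul_mem (pow_mem hz _) (hLQ _)⟩, ?_, ⟨y, hy⟩, ?_⟩, hmd.trans hdeg, ?_⟩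
  · by_contra hc
    have h1 : z ^ T p₀ * aeval z L₁ ∈ mI Q := coe_mem_mI.2 ((mem_maximalIdeal (⟨z ^ T p₀ * aeval z L₁, _⟩ : Q.toSubring)).2 hc)
    rcases (mI_mul_iff (pow_mem hz _) (hLQ _)).1 h1 with h2 | h2
    · refine notMem_mI_of_inv (pow_ne_zero _ hz0) ?_ h2
      rw [← inv_pow]; exact pow_mem hzi _
    · exact hL₁u h2
  · refine Subtype.ext ?_
    show z ^ T p₀ * aeval z L + u * y - z ^ T p₀ * aeval z L₁ * (z - algebraMap ℂ K c) ^ _ = u * y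
    conv_lhs => rw [hL₁]
    simp only [map_mul, map_pow, map_sub, aeval_X, aeval_C]
    ring
  · intro hkk hk0
    have hd : L.natDegree = k := le_antisymm hdeg (hkk ▸ hmd)
    have hLk : L.coeff k ≠ 0 := by
      rw [← hd, coeff_natDegree]; exact leadingCoeff_ne_zero.2 hL0
    obtain ⟨p, hp, hpk⟩ : ∃ p ∈ E, T p - T p₀ = k := by
      by_contra! hc
      apply hLk
      simp only [L, finsetSum_coeff, coeff_monomial]
      exact Finset.sum_eq_zero fun p hp => if_neg (hc p hp)
    obtain ⟨h1, h2, h3⟩ := hheight p hp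
    rw [hpk] at h1
    have hw1 : w.1 = 1 := by nlinarith [Int.natCast_nonneg p₀.2]
    refine ⟨hw1, ?_⟩
    rw [hw1] at h1 h3
    have h4 : (p.2 : ℤ) = k := by linarith [Int.natCast_nonneg p₀.2]
    rw [h4] at h3
    linarith [Int.natCast_nonneg p.1]

end Strict

/-! ### A derivation tangent to the initial boundary -/

/-- A derivation of a domain extends to its field of fractions. -/
lemma exists_extension {A F : Type*} [CommRing A] [IsDomain A] [Field F] [Algebra A F] [IsFractionRing A F]
    [Algebra ℤ A] [iF : Algebra ℤ F] (d : Derivation ℤ A A) : ∃ D : Derivation ℤ F F, ∀ r, D (algebraMap A F r) = algebraMap A F (d r) := by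
  obtain rfl : iF = Ring.toIntAlgebra F := Subsingleton.elim _ _
  -- derivations are homomorphisms to the dual numbers
  let φ : A →+* TrivSqZeroExt F F :=
    { toFun := fun r => TrivSqZeroExt.inl (algebraMap A F r) + TrivSqZeroExt.inr (algebraMap A F (d r))
      map_one' := by simp
      map_mul' := fun x y => by
        ext
        · simp
        · simp only [TrivSqZeroExt.snd_mul, TrivSqZeroExt.snd_add, TrivSqZeroExt.snd_inl, TrivSqZeroExt.snd_inr,
            TrivSqZeroExt.fst_add, TrivSqZeroExt.fst_inl, TrivSqZeroExt.fst_inr, smul_eq_mul,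
            MulOpposite.smul_eq_mul_unop, MulOpposite.unop_op, zero_add, add_zero, map_mul, Derivation.leibniz, map_add]
          ring
      map_zero' := by simp
      map_add' := fun x y => by
        ext
        · simp
        · simp [Algebra.smul_def] }
  have hφ : ∀ y : nonZeroDivisors A, IsUnit (φ y) := by
    intro y
    rw [TrivSqZeroExt.isUnit_iff_isUnit_fst]
    have : (φ y).fst = algebraMap A F y := by simp [φ]
    rw [this]
    exact IsLocalization.map_units F y
  let Φ : F →+* TrivSqZeroExt F F := IsLocalization.lift hφ
  have hΦ : ∀ r, Φ (algebraMap A F r) = φ r := fun r => IsLocalization.lift_eq hφ r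
  have hfst : ∀ x, (Φ x).fst = x := by
    have : ((TrivSqZeroExt.fstHom F F F).toRingHom.comp Φ) = RingHom.id F := by
      refine IsLocalization.ringHom_ext (nonZeroDivisors A) (RingHom.ext fun r => ?_)
      show (Φ (algebraMap A F r)).fst = _
      rw [hΦ]; simp [φ]
    exact fun x => RingHom.congr_fun this x
  let L : F →+ F :=
    { toFun := fun x => (Φ x).snd
      map_zero' := by simp
      map_add' := fun x y => by simp }
  refine ⟨Derivation.mk' L.toIntLinearMap fun x y => ?_, fun r => ?_⟩
  · show (Φ (x * y)).snd = x • (Φ y).snd + y • (Φ x).snd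
    rw [map_mul, TrivSqZeroExt.snd_mul, hfst, hfst]
    simp [mul_comm]
  · show (Φ (algebraMap A F r)).snd = _
    rw [hΦ]
    exact (TrivSqZeroExt.snd_add _ _).trans (zero_add _)

open MvPowerSeries in
/-- The derivation tangent to the levels of `l`: its only invariant branch is the zero locus of `l`. -/
lemma exists_tangent {l : R} (hl : l ∈ maximalIdeal R) (hl' : l ∉ maximalIdeal R ^ 2) :
    ∃ d : Derivation ℤ R R, d l = 0 ∧ ∀ g, Prime g → g ∣ d g → Associated g l := by
  obtain ⟨i, j, hij, hreg, r, s, hr, hrs⟩ := exists_regPair hl hl'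
  let d : Derivation ℂ R R := (pderiv ℂ i l) • pderiv ℂ j - (pderiv ℂ j l) • pderiv ℂ i
  have hd : ∀ x, d x = pderiv ℂ i l * pderiv ℂ j x - pderiv ℂ j l * pderiv ℂ i x := fun x => rfl
  have hdl : d l = 0 := by rw [hd]; ring
  have hdm : IsUnit (d (X j)) := by
    have h1 : d (X j) = r + (X i * pderiv ℂ i r + X j * pderiv ℂ i s) := by
      rw [hd, pderiv_X_self, pderiv_X_of_ne hij.symm]
      conv_lhs => rw [hrs]
      rw [map_add, Derivation.leibniz, Derivation.leibniz, pderiv_X_self, pderiv_X_of_ne hij.symm]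
      simp only [smul_eq_mul]
      ring
    rw [h1, isUnit_iff_constantCoeff]
    rw [isUnit_iff_constantCoeff] at hr
    simpa using hr
  refine ⟨d.restrictScalars ℤ, hdl, fun g hg hgd => ?_⟩
  by_contra hne
  have hlg : ¬ l ∣ g := fun hc => hne (hreg.prime.associated_of_dvd hg hc).symm
  obtain ⟨k, e, he, t, ht⟩ := hreg.exists_order hlg
  have hg' : g = e * X j ^ k + l * t := by rw [← ht]; ring
  obtain ⟨q, hq⟩ : g ∣ d g := hgd
  have hk : k ≠ 0 := by
    rintro rfl
    refine hg.not_isUnit ?_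
    rw [hg', pow_zero, mul_one]
    rw [isUnit_iff_constantCoeff] at he ⊢
    rw [map_add, map_mul, mem_maximalIdeal_R.1 hl, zero_mul, add_zero]
    exact he
  obtain ⟨k, rfl⟩ := Nat.exists_eq_succ_of_ne_zero hk
  have hdg : d g = X j ^ k * (X j * d e + ((k + 1 : ℕ) : R) * e * d (X j)) + l * d t := by
    conv_lhs => rw [hg']
    rw [map_add, Derivation.leibniz, Derivation.leibniz, Derivation.leibniz_pow, hdl]
    simp only [smul_eq_mul, nsmul_eq_mul, Nat.succ_eq_add_one, Nat.add_sub_cancel]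
    ring
  have h1 : l ∣ X j ^ k * (X j * d e + ((k + 1 : ℕ) : R) * e * d (X j) - q * e * X j) := by
    refine ⟨q * t - d t, ?_⟩
    rw [hdg] at hq
    have hg'' : g = e * X j ^ (k + 1) + l * t := hg'
    linear_combination hq + q * hg''
  rcases hreg.prime.dvd_or_dvd h1 with h2 | h2
  · exact hreg.not_dvd (hreg.prime.dvd_of_dvd_pow h2)
  · obtain ⟨v, hv⟩ := h2
    have h3 := congrArg constantCoeff hv
    rw [map_mul, mem_maximalIdeal_R.1 hl, zero_mul] at h3
    rw [isUnit_iff_constantCoeff] at he hdm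
    simp only [map_sub, map_add, map_mul, constantCoeff_X, mul_zero, zero_mul, zero_add, sub_zero, map_natCast] at h3
    have h4 := he.ne_zero
    have h5 := hdm.ne_zero
    have h6 : ((k + 1 : ℕ) : ℂ) ≠ 0 := by exact_mod_cast Nat.succ_ne_zero k
    exact mul_ne_zero (mul_ne_zero h6 h4) h5 h3

/-- A reduced curve which does not contain `l = 0` is tangent to the levels of `l` at most at the
origin. -/
lemma exists_pow_mem {f l : R} (hf : Squarefree f) (hlf : ¬ l ∣ f) (hl : l ∈ maximalIdeal R) {d : Derivation ℤ R R}
    (hd : ∀ g, Prime g → g ∣ d g → Associated g l) : ∃ (N : ℕ) (A B : R), l ^ N = A * f + B * d f := by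
  have h1 : l ∈ (span {f, d f}).radical := by
    rw [Ideal.radical_eq_sInf, Submodule.mem_sInf]
    rintro q ⟨hq, hqp⟩
    by_cases hm : q = maximalIdeal R
    · rw [hm]; exact hl
    exfalso
    have hfq : f ∈ q := hq (Ideal.subset_span (by simp))
    have hdq : d f ∈ q := hq (Ideal.subset_span (by simp))
    have hf0 : f ≠ 0 := hf.ne_zero
    obtain ⟨g, hg, rfl⟩ := regPair_X.exists_prime_generator q (by rintro rfl; exact hf0 (by simpa using hfq)) hm
    rw [mem_span_singleton] at hfq hdq
    obtain ⟨k, rfl⟩ := hfq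
    have hgk : ¬ g ∣ k := by
      rintro ⟨k', rfl⟩
      exact hg.not_isUnit (hf g ⟨k', by ring⟩)
    have h2 : g ∣ d g := by
      rw [Derivation.leibniz, smul_eq_mul, smul_eq_mul] at hdq
      rw [dvd_add_right (dvd_mul_right _ _)] at hdq
      exact (hg.dvd_or_dvd hdq).resolve_left hgk
    exact hlf ((hd g hg h2).symm.dvd.trans (dvd_mul_right _ _))
  obtain ⟨N, hN⟩ := h1
  obtain ⟨A, B, h⟩ := Ideal.mem_span_pair.1 hN
  exact ⟨N, A, B, h.symm⟩

section Order
variable {A : Type*} [CommRing A] [IsLocalRing A] {a b a' b' x y : A} {k : ℕ}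

lemma HasOrder.not_dvd (h : RegPair a b) (hx : HasOrder a b x k) : ¬ a ∣ x := by
  intro hc
  obtain ⟨e, he, hk⟩ := hx
  have h1 := (dvd_sub_right hc).1 hk
  rcases h.prime.dvd_or_dvd h1 with h2 | h2
  · exact h.prime.not_isUnit (isUnit_of_dvd_unit h2 he)
  · exact h.not_dvd (h.prime.dvd_of_dvd_pow h2)

lemma HasOrder.congr [IsNoetherianRing A] (h : RegPair a b) (h' : RegPair a' b') (haa : Associated a a') (hx : HasOrder a b x k) :
    HasOrder a' b' x k := by
  obtain ⟨m, hm⟩ : ∃ m, HasOrder a' b' x m := h'.exists_order fun hc => hx.not_dvd h (haa.dvd.trans hc)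
  have key : ∀ {a b a' b' : A} {k m : ℕ}, RegPair a b → RegPair a' b' → Associated a a' → HasOrder a b x k → HasOrder a' b' x m → k ≤ m := by
    intro a b a' b' k m h h' haa hk hm
    obtain ⟨e, he, hk⟩ := hk
    obtain ⟨e', he', hm⟩ := hm
    obtain ⟨α, β, hb⟩ := h'.mem_iff.1 h.mem_right
    refine h'.order_unique (e' := e * β ^ k) he' hm ?_
    have h1 : a' ∣ b - β * b' := ⟨α, by rw [← hb]; ring⟩
    have h2 : a' ∣ e * (b ^ k - (β * b') ^ k) := (h1.trans (sub_dvd_pow_sub_pow _ _ _)).mul_left _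
    have h3 := dvd_add (haa.symm.dvd.trans hk) h2
    have e1 : x - e * b ^ k + e * (b ^ k - (β * b') ^ k) = x - e * β ^ k * b' ^ k := by rw [mul_pow]; ring
    rwa [e1] at h3
  have h1 := key h h' haa hx hm
  have h2 := key h' h haa.symm hm hx
  rwa [le_antisymm h1 h2]

lemma HasOrder.of_mul [IsNoetherianRing A] (h : RegPair a b) (hxy : HasOrder a b (x * y) k) : ∃ m ≤ k, HasOrder a b x m := by
  have hnd := hxy.not_dvd h
  obtain ⟨m, e, he, hm⟩ := h.exists_order (x := x) fun hc => hnd (hc.mul_right _)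
  obtain ⟨m', e', he', hm'⟩ := h.exists_order (x := y) fun hc => hnd (hc.mul_left _)
  obtain ⟨e'', he'', hk⟩ := hxy
  refine ⟨m, ?_, e, he, hm⟩
  have h1 : a ∣ x * y - (e * e') * b ^ (m + m') := by
    have := dvd_add (hm.mul_right y) (hm'.mul_left (e * b ^ m))
    have e1 : (x - e * b ^ m) * y + e * b ^ m * (y - e' * b ^ m') = x * y - (e * e') * b ^ (m + m') := by rw [pow_add]; ring
    rwa [e1] at this
  have := h.order_unique he'' hk h1
  omega

lemma HasOrder.isUnit (h : RegPair a b) (hx : HasOrder a b x 0) : IsUnit x := by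
  obtain ⟨e, he, t, ht⟩ := hx
  rw [pow_zero, mul_one] at ht
  by_contra hc
  refine (mem_maximalIdeal e).1 ?_ he
  have e1 : e = x - a * t := by rw [← ht]; ring
  rw [e1]
  exact sub_mem ((mem_maximalIdeal x).2 hc) (Ideal.mul_mem_right _ _ h.mem_left)

lemma HasOrder.span_eq (h : RegPair a b) (hx : HasOrder a b x 1) : maximalIdeal A = span {a, x} := by
  obtain ⟨e, he, t, ht⟩ := hx
  rw [pow_one] at ht
  obtain ⟨e, rfl⟩ := he
  have e1 : x = a * t + ↑e * b := by rw [← ht]; ring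
  have e2 : (↑e⁻¹ : A) * ↑e = 1 := e.inv_mul
  refine le_antisymm ?_ ?_
  · rw [h.span, Ideal.span_le]
    rintro y (hy | hy)
    · rw [hy]; exact Ideal.subset_span (by simp)
    · rw [hy, SetLike.mem_coe, Ideal.mem_span_pair]
      refine ⟨-↑e⁻¹ * t, ↑e⁻¹, ?_⟩
      rw [e1]
      linear_combination b * e2
  · rw [Ideal.span_le]
    rintro y (hy | hy)
    · rw [hy]; exact h.mem_left
    · rw [hy, e1]
      exact add_mem (Ideal.mul_mem_right _ _ h.mem_left) (Ideal.mul_mem_left _ _ h.mem_right)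

end Order

/-- Comparison of the germ at `P` with the initial curve `f₀ = 0` and boundary `l₀ = 0`, where `a` and `g` are equations of the
boundary and of the strict transform of the curve: the orders along the boundary of `f₀`, of the poles of the
derivation `D`, and of `l₀`, are at least `h`, at most `M`, and equal to `j`. -/
structure Compares (D : Derivation ℤ K K) (f₀ l₀ : K) {P : LocalSubring K} (a g : P.toSubring) (h M j : ℕ) : Prop where
  curve : ∃ x ∈ P.toSubring, f₀ = (a : K) ^ h * (g * x)
  pole : ∀ x ∈ P.toSubring, (a : K) ^ M * D x ∈ P.toSubring
  tangent : ∃ y ∈ P.toSubring, (a : K) ^ M * D a = a * y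
  boundary : ∃ e ∈ P.toSubring, e⁻¹ ∈ P.toSubring ∧ e ≠ 0 ∧ l₀ = (a : K) ^ j * e

section Compares
variable {D : Derivation ℤ K K} {f₀ l₀ : K} {P Q : LocalSubring K} {a b g : P.toSubring} {h M j : ℕ}

lemma Compares.congr (H : Compares D f₀ l₀ a g h M j) {a' g' : P.toSubring} (ha : Associated a a') (hg : g' ∣ g)  :
    Compares D f₀ l₀ a' g' h M j := by
  obtain ⟨v, hv⟩ := ha
  obtain ⟨s, rfl⟩ := hg
  have hvv : ((v : P.toSubring) : K) * ((v⁻¹ : P.toSubringˣ) : P.toSubring) = 1 := congrArg Subtype.val v.mul_inv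
  have hv0 : ((v : P.toSubring) : K) ≠ 0 := left_ne_zero_of_mul_eq_one hvv
  have hvi : ((v : P.toSubring) : K)⁻¹ ∈ P.toSubring := by
    rw [inv_eq_of_mul_eq_one_right hvv]; exact Subtype.prop _
  have ha' : (a : K) = a' * ((v : P.toSubring) : K)⁻¹ := by
    rw [← hv]; show (a : K) = a * v * _
    rw [mul_assoc, mul_inv_cancel₀ hv0, mul_one]
  have ha'' : (a' : K) = a * v := by rw [← hv]; rfl
  refine ⟨?_, fun x hx => ?_, ?_, ?_⟩
  · obtain ⟨x, hx, e⟩ := H.curve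
    refine ⟨((v : P.toSubring) : K)⁻¹ ^ h * (s * x), mul_mem (pow_mem hvi _) (mul_mem s.2 hx), ?_⟩
    rw [e, ha', mul_pow]
    show _ * (g' * s * x) = _
    ring
  · rw [ha'', mul_pow, mul_right_comm]
    exact mul_mem (H.pole x hx) (pow_mem (Subtype.prop _) _)
  · obtain ⟨y, hy, e⟩ := H.tangent
    refine ⟨((v : P.toSubring) : K) ^ M * y + ((v : P.toSubring) : K) ^ M * ((v : P.toSubring) : K)⁻¹ * ((a : K) ^ M * D v), 
      add_mem (mul_mem (pow_mem (Subtype.prop _) _) hy)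
      (mul_mem (mul_mem (pow_mem (Subtype.prop _) _) hvi) (H.pole _ (Subtype.prop _))), ?_⟩
    rw [ha'', Derivation.leibniz, smul_eq_mul, smul_eq_mul, mul_pow]
    field_simp
    linear_combination ((v : P.toSubring) : K) * e
  · obtain ⟨e, he, hei, he0, hl⟩ := H.boundary
    refine ⟨((v : P.toSubring) : K)⁻¹ ^ j * e, mul_mem (pow_mem hvi _) he, ?_, mul_ne_zero (pow_ne_zero _ (inv_ne_zero hv0)) he0, ?_⟩
    · rw [mul_inv, ← inv_pow, inv_inv]
      exact mul_mem (pow_mem (Subtype.prop _) _) hei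
    · rw [hl, ha', mul_pow]; ring

/-- The order of the curve along the boundary is bounded in terms of those of the poles of `D` and of `l₀`. -/
lemma Compares.le (H : Compares D f₀ l₀ a g h M j) (ha : a ∈ maximalIdeal P.toSubring) (ha0 : (a : K) ≠ 0) {N : ℕ} {A B : K}
    (hA : A ∈ P.toSubring) (hB : B ∈ P.toSubring) (hN : l₀ ^ N = A * f₀ + B * D f₀) : h ≤ N * j + M := by
  by_contra! hc
  obtain ⟨x, hx, hf⟩ := H.curve
  obtain ⟨y, hy, ht⟩ := H.tangent
  obtain ⟨e, he, hei, he0, hl⟩ := H.boundary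
  obtain ⟨d, hd⟩ : ∃ d, h = N * j + M + d + 1 := ⟨h - (N * j + M) - 1, by omega⟩
  have hgx : (g : K) * x ∈ P.toSubring := mul_mem g.2 hx
  have hDf : D f₀ = h • (a : K) ^ (h - 1) * D a * (g * x) + (a : K) ^ h * D (g * x) := by
    rw [hf, Derivation.leibniz, Derivation.leibniz_pow]
    simp only [smul_eq_mul, nsmul_eq_mul]
    ring
  have h1 : (a : K) ^ (N * j + M) * (e ^ N - a * (a ^ d * (a ^ M * (A * (g * x)) + h • B * y * (g * x) + B * (a ^ M * D (g * x))))) = 0 := by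
    have e1 : (a : K) ^ (N * j + M) * e ^ N = a ^ M * l₀ ^ N := by rw [hl, mul_pow, ← pow_mul, mul_comm j, pow_add]; ring
    have e2 : (a : K) ^ h = a ^ (h - 1) * a := by rw [← pow_succ]; congr 1; omega
    have e3 : (a : K) ^ h = a ^ (N * j + M) * (a * a ^ d) := by rw [hd, pow_add, pow_add]; ring
    rw [mul_sub, e1, hN, hDf]
    rw [hf]
    simp only [nsmul_eq_mul]
    have e4 : (a : K) ^ (h - 1) * a = a ^ (N * j + M) * (a * a ^ d) := by rw [← e2, e3]
    rw [e3]
    linear_combination (B * h * (g * x) * (a : K) ^ (h - 1)) * ht + (B * h * (g * x) * y) * e4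
  have h2 := (mul_eq_zero.1 h1).resolve_left (pow_ne_zero _ ha0)
  refine notMem_mI_of_inv (P := P) (pow_ne_zero N he0) (by rw [← inv_pow]; exact pow_mem hei N) ?_
  rw [sub_eq_zero.1 h2]
  refine mul_mem_mI' (coe_mem_mI.2 ha) (mul_mem (pow_mem a.2 _) (add_mem (add_mem ?_ ?_) ?_))
  · exact mul_mem (pow_mem a.2 _) (mul_mem hA hgx)
  · exact mul_mem (mul_mem (nsmul_mem hB _) hy) hgx
  · exact mul_mem hB (H.pole _ hgx)

/-- The comparison is transported to the points above `P` of the interior of an exceptional component. -/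
lemma Compares.strict (H : Compares D f₀ l₀ a g h M j) {w w₂ n : ℤ × ℤ} (e : EdgeBasis w w₂ n (-w.2, w.1)) (hs : SmoothAt P a b)
    (hPQ : P ≤ Q) (hQ : IsLocAt (monRing P.toSubring a b w w) Q) {t : ℕ} {g' u : Q.toSubring}
    (hu : (u : K) = mon (a : K) b n) (hg : (g : K) = mon (a : K) b n ^ t * g') :
    Compares D f₀ l₀ u g' (w.1.toNat * h + t) (w.1.toNat * M + w.2.toNat) (w.1.toNat * j) := by
  obtain ⟨hz, hzi, hzm⟩ := e.z_unit hs hQ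
  have hPQ' := (le_iff_mI.1 hPQ).1
  have ha0 := hs.left_ne_zero
  have hb0 := hs.right_ne_zero
  rw [← hu] at hg
  set z := mon (a : K) b (-w.2, w.1) with hzdef
  have hz0 : z ≠ 0 := mon_ne_zero ha0 hb0 _
  have hu0 : (u : K) ≠ 0 := by rw [hu]; exact mon_ne_zero ha0 hb0 _
  have huQ := u.2
  have hunit : ∀ k : ℤ, z ^ k ∈ Q.toSubring := by
    intro k
    obtain ⟨i, rfl | rfl⟩ := k.eq_nat_or_neg
    · rw [zpow_natCast]; exact pow_mem hz _
    · rw [zpow_neg, zpow_natCast, ← inv_pow]; exact pow_mem hzi _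
  have hexp : ∀ m : ℤ × ℤ, mon (a : K) b m = (u : K) ^ wdot w m * z ^ wdot w₂ m := by
    intro m
    have h1 : m = wdot w m • n + wdot w₂ m • (-w.2, w.1) := by
      refine e.cone.wdot_ext ?_ ?_
      · rw [wdot_add, wdot_zsmul, wdot_zsmul, e.wn, e.wv]; ring
      · rw [wdot_add, wdot_zsmul, wdot_zsmul, e.wn₂, e.wv₂]; ring
    conv_lhs => rw [h1]
    rw [mon_add ha0 hb0, mon_zsmul, mon_zsmul, hu]
  set p := w.1.toNat with hp
  set q := w.2.toNat with hq
  have hau : (a : K) = u ^ p * z ^ w₂.1 := by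
    have := hexp (1, 0)
    rw [mon_left] at this
    rw [this, ← zpow_natCast, hp, Int.toNat_of_nonneg e.pos₁.le]
    simp [wdot]
  have hbu : (b : K) = u ^ q * z ^ w₂.2 := by
    have := hexp (0, 1)
    rw [mon_right] at this
    rw [this, ← zpow_natCast, hq, Int.toNat_of_nonneg e.pos₂.le]
    simp [wdot]
  have hapow : ∀ k : ℕ, (a : K) ^ k = u ^ (p * k) * z ^ (w₂.1 * k) := by
    intro k; rw [hau, mul_pow, ← pow_mul, zpow_mul, zpow_natCast]
  have hzc : ∀ k : ℤ, z ^ (-k) * z ^ k = 1 := fun k => by rw [← zpow_add₀ hz0]; simp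
  -- the poles on the local ring of `P`
  have hpole : ∀ x ∈ P.toSubring, (u : K) ^ (p * M) * D x ∈ Q.toSubring := by
    intro x hx
    have h1 := mul_mem (hunit (-(w₂.1 * M))) (hPQ' (H.pole x hx))
    have h2 : z ^ (-(w₂.1 * M)) * ((a : K) ^ M * D x) = u ^ (p * M) * D x := by
      rw [hapow]; linear_combination (u ^ (p * M) * D x) * hzc (w₂.1 * M)
    rwa [h2] at h1
  have hda : ∃ y ∈ Q.toSubring, (u : K) ^ (p * M + q) * D a = a * y := by
    obtain ⟨y, hy, hay⟩ := H.tangent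
    refine ⟨u ^ q * (z ^ (-(w₂.1 * M)) * y), mul_mem (pow_mem huQ _) (mul_mem (hunit _) (hPQ' hy)), ?_⟩
    rw [hapow] at hay
    rw [pow_add]
    linear_combination (u ^ q * z ^ (-(w₂.1 * M))) * hay - (u ^ q * u ^ (p * M) * D a) * hzc (w₂.1 * M)
  have hdb : ∃ y ∈ Q.toSubring, (u : K) ^ (p * M + q) * D b = b * y := by
    refine ⟨z ^ (-w₂.2) * (u ^ (p * M) * D b), mul_mem (hunit _) (hpole _ b.2), ?_⟩
    generalize D (b : K) = β
    rw [hbu, pow_add]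
    linear_combination -(u ^ q * u ^ (p * M) * β) * hzc w₂.2
  have hdm : ∀ m, ∃ y ∈ Q.toSubring, (u : K) ^ (p * M + q) * D (mon a b m) = mon a b m * y := by
    intro m
    obtain ⟨y, hy, hay⟩ := hda
    obtain ⟨y', hy', hby⟩ := hdb
    refine ⟨m.1 • y + m.2 • y', add_mem (zsmul_mem hy _) (zsmul_mem hy' _), ?_⟩
    rw [mon, Derivation.leibniz, Derivation.leibniz_zpow, Derivation.leibniz_zpow]
    simp only [smul_eq_mul, zsmul_eq_mul, zpow_sub_one₀ ha0, zpow_sub_one₀ hb0]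
    field_simp
    linear_combination (m.2 * a : K) * hby + (m.1 * b : K) * hay
  have hA : ∀ x ∈ monRing P.toSubring (a : K) b w w, (u : K) ^ (p * M + q) * D x ∈ Q.toSubring := by
    intro x hx
    induction hx using Subring.closure_induction with
    | mem x hx =>
      rcases hx with hx | ⟨m, hm, rfl⟩
      · rw [pow_add, mul_right_comm]
        exact mul_mem (hpole x hx) (pow_mem huQ _)
      · obtain ⟨y, hy, hmy⟩ := hdm m
        have h1 : mon (a : K) b m * y ∈ Q.toSubring := mul_mem (hQ.1 (mon_mem_monRing hm)) hy
        rw [← hmy] at h1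
        exact h1
    | zero => rw [map_zero, mul_zero]; exact zero_mem _
    | one => rw [Derivation.map_one_eq_zero, mul_zero]; exact zero_mem _
    | add x y _ _ h1 h2 => rw [map_add, mul_add]; exact add_mem h1 h2
    | neg x _ h1 => rw [map_neg, mul_neg]; exact neg_mem h1
    | mul x y hx hy h1 h2 =>
      have : (u : K) ^ (p * M + q) * D (x * y) = x * ((u : K) ^ (p * M + q) * D y) + y * ((u : K) ^ (p * M + q) * D x) := by
        rw [Derivation.leibniz, smul_eq_mul, smul_eq_mul]; ring
      rw [this]
      exact add_mem (mul_mem (hQ.1 hx) h2) (mul_mem (hQ.1 hy) h1)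
  refine ⟨?_, fun x hx => ?_, ?_, ?_⟩
  · obtain ⟨x, hx, hf⟩ := H.curve
    refine ⟨z ^ (w₂.1 * h) * x, mul_mem (hunit _) (hPQ' hx), ?_⟩
    rw [hf, hapow, hg, pow_add]
    ring
  · obtain ⟨s, hs, t, ht, ht0, hti, rfl⟩ := hQ.2 x hx
    have : (u : K) ^ (p * M + q) * D (s * t⁻¹) = s * (-t⁻¹ ^ 2 * ((u : K) ^ (p * M + q) * D t)) + t⁻¹ * ((u : K) ^ (p * M + q) * D s) := by
      rw [Derivation.leibniz, Derivation.leibniz_inv, smul_eq_mul, smul_eq_mul, smul_eq_mul]; ring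
    rw [this]
    exact add_mem (mul_mem (hQ.1 hs) (mul_mem (neg_mem (pow_mem hti _)) (hA t ht))) (mul_mem hti (hA s hs))
  · rw [hu]; rw [← hu]
    have := hdm n
    rwa [← hu] at this
  · obtain ⟨ε, hε, hεi, hε0, hl⟩ := H.boundary
    refine ⟨z ^ (w₂.1 * j) * ε, mul_mem (hunit _) (hPQ' hε), ?_, mul_ne_zero (zpow_ne_zero _ hz0) hε0, ?_⟩
    · rw [mul_inv, ← zpow_neg]; exact mul_mem (hunit _) (hPQ' hεi)
    · rw [hl, hapow, mul_assoc]

end Compares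

/-! ### Divisors on modifications -/

lemma mem_idealAt {P : LocalSubring K} {D : Set (LocalSubring K)} {x : P.toSubring} :
    x ∈ idealAt P D ↔ ∀ V ∈ D, P.toSubring ≤ V.toSubring → (x : K) ∈ mI V := by
  simp only [idealAt, Submodule.mem_iInf, Ideal.mem_comap]
  exact forall₃_congr fun V _ h => coe_mem_mI.symm

lemma idealAt_congr {P : LocalSubring K} {D D' : Set (LocalSubring K)}
    (h : ∀ V, P.toSubring ≤ V.toSubring → (V ∈ D ↔ V ∈ D')) : idealAt P D = idealAt P D' := by
  ext x
  simp only [mem_idealAt]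
  exact ⟨fun k V hV hPV => k V ((h V hPV).2 hV) hPV, fun k V hV hPV => k V ((h V hPV).1 hV) hPV⟩

lemma hasToricChart_congr {P : LocalSubring K} {D D' : Set (LocalSubring K)} (h : idealAt P D = idealAt P D')
    (hD : HasToricChart P D) : HasToricChart P D' := by
  unfold HasToricChart at hD ⊢
  rwa [← h]

lemma exists_mem_mI (V : LocalSubring K) [IsDiscreteValuationRing V.toSubring] : ∃ x ∈ mI V, x ≠ 0 := by
  obtain ⟨ϖ, hϖ⟩ := IsDiscreteValuationRing.exists_irreducible V.toSubring
  exact ⟨ϖ, coe_mem_mI.2 (hϖ.maximalIdeal_eq ▸ mem_span_singleton_self ϖ), fun h => hϖ.ne_zero (Subtype.ext h)⟩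

lemma eq_of_le_dvr {V T : LocalSubring K} [IsDiscreteValuationRing V.toSubring] [IsDiscreteValuationRing T.toSubring]
    (hR : RK ≤ V.toSubring) (h : V.toSubring ≤ T.toSubring) : T = V := by
  obtain ⟨x, hx, h0⟩ := exists_mem_mI T
  exact dvr_maximal (mem_or_inv_mem hR) h hx h0

/-- A local ring containing `R` and with residue field `ℂ` dominates `R`. -/
lemma origin_le_of_res {Q : LocalSubring K} (h : RK ≤ Q.toSubring)
    (hres : ∀ x ∈ Q.toSubring, ∃ c : ℂ, x - algebraMap ℂ K c ∈ mI Q) : origin ≤ Q := by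
  refine le_iff_mI.2 ⟨h, fun x hx => ?_⟩
  obtain ⟨c, hc⟩ := hres x (h hx.1)
  by_cases hc0 : c = 0
  · rwa [hc0, map_zero, sub_zero] at hc
  exfalso
  have h1 : x - algebraMap ℂ K c ∉ mI origin := by
    intro h2
    have h3 : algebraMap ℂ K c ∈ mI origin := by simpa using sub_mem_mI hx h2
    refine notMem_mI_of_inv ?_ ?_ h3
    · rwa [Ne, map_eq_zero]
    · rw [← map_inv₀]; exact algebraMap_C_mem _
  obtain ⟨h2, h3⟩ := unit_of_notMem_mI (P := origin) (sub_mem hx.1 (algebraMap_C_mem c)) h1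
  exact notMem_mI_of_inv h2 (h h3) hc

lemma exists_valuation (P : LocalSubring K) : ∃ W : ValuationSubring K, P ≤ W.toLocalSubring := by
  obtain ⟨W, hW, -⟩ := exists_dominating_le (V := LocalSubring.range (RingHom.id K)) (Q := P)
    (fun x => Or.inl ⟨x, rfl⟩) (fun x _ => ⟨x, rfl⟩)
  exact ⟨W, hW⟩

variable {X X' : Set (LocalSubring K)} {P Q T V : LocalSubring K} {D : Set (LocalSubring K)}

lemma IsModification.subring_le (hX : IsModification X) (hP : P ∈ X) (hQ : Q ∈ X) (hPT : P ≤ T)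
    (hQT : Q.toSubring ≤ T.toSubring) : Q.toSubring ≤ P.toSubring := by
  have h1 := hX.mem_of_isLocAt hQ (isLocAt_ofPrime _ (contr hQT))
  rw [hX.eq_of_le hP h1 hPT (ofPrime_contr_le hQT)]
  exact le_ofPrime _ _

lemma IsModification.exists_valuation_center (hX : IsModification X) {W : ValuationSubring K} (hW : origin ≤ W.toLocalSubring) :
    ∃ Q ∈ X, Q ≤ W.toLocalSubring := by
  obtain ⟨Q, hQ, -⟩ := hX.valuative W (le_iff_mI.1 hW).1
  exact ⟨Q, hQ⟩

lemma IsClosedPoint.origin_le (hX : IsModification X) (hP : IsClosedPoint X P) : origin ≤ P := by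
  obtain ⟨W₀, hW₀⟩ := exists_valuation P
  have hb := hX.base_le hP.1
  obtain ⟨W, hW, hWW⟩ := exists_dominating_le (V := W₀.toLocalSubring) (Q := origin) W₀.mem_or_inv_mem
    (hb.trans (le_iff_mI.1 hW₀).1)
  obtain ⟨Q, hQ, hQW⟩ := hX.exists_valuation_center hW
  have h1 := hP.2 Q hQ (hX.subring_le hP.1 hQ hW₀ ((le_iff_mI.1 hQW).1.trans hWW))
  rw [h1] at hQW
  refine le_iff_mI.2 ⟨hb, fun x hx => (mem_mI_of_le hQW (hb hx.1)).1 ((le_iff_mI.1 hW).2 x hx)⟩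

lemma IsClosedPoint.of_mem (hX : IsModification X) (hX' : IsModification X') (hQ : IsClosedPoint X' Q) (hQX : Q ∈ X) :
    IsClosedPoint X Q := by
  refine ⟨hQX, fun T hT hTQ => ?_⟩
  obtain ⟨W₀, hW₀⟩ := exists_valuation Q
  obtain ⟨W, hW, hWW⟩ := exists_dominating_le (V := W₀.toLocalSubring) (Q := T) W₀.mem_or_inv_mem
    (hTQ.trans (le_iff_mI.1 hW₀).1)
  obtain ⟨Q', ⟨hQ', hQW⟩, -⟩ := hX'.valuative W ((hX.base_le hT).trans (le_iff_mI.1 hW).1)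
  have h1 := hQ.2 Q' hQ' (hX'.subring_le hQ.1 hQ' hW₀ ((le_iff_mI.1 hQW).1.trans hWW))
  rw [h1] at hQW
  exact hX.eq_of_le hT hQX hW hQW

/-- A branch passes through at most one closed point of a modification. -/
lemma IsModification.closedPoint_unique (hX : IsModification X) (hV : IsPrimeDivisor S V) (hP : IsClosedPoint X P)
    (hQ : IsClosedPoint X Q) (hPV : P.toSubring ≤ V.toSubring) (hQV : Q.toSubring ≤ V.toSubring) : P = Q := by
  have := hV.2
  have hd : ∀ x : K, x ∈ V.toSubring ∨ x⁻¹ ∈ V.toSubring := mem_or_inv_mem ((hX.base_le hP.1).trans hPV)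
  obtain ⟨W, hW, hWV⟩ := exists_dominating_le hd hPV
  obtain ⟨W', hW', hWV'⟩ := exists_dominating_le hd hQV
  have := valuation_unique hV hWV hWV' ((hP.origin_le hX).trans hW) ((hQ.origin_le hX).trans hW')
  subst this
  exact hX.eq_of_le hP.1 hQ.1 hW hW'

lemma mem_support_iff (hX : IsModification X) (hP : P ∈ X) (hD : D.Finite) (hT : T ∈ X)
    (hPT : P.toSubring ≤ T.toSubring) : T ∈ support X D ↔ ∀ x ∈ idealAt P D, (x : K) ∈ mI T := by
  constructor
  · rintro ⟨-, V, hV, hTV⟩ x hx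
    exact mI_le_of_le hTV (hPT x.2) (mem_idealAt.1 hx V hV (hPT.trans hTV))
  · intro h
    classical
    by_contra hc
    have hex : ∀ V ∈ D, ∃ x : P.toSubring, (x : K) ∉ mI T ∧ (P.toSubring ≤ V.toSubring → (x : K) ∈ mI V) := by
      intro V hV
      by_cases hPV : P.toSubring ≤ V.toSubring
      swap
      · exact ⟨1, one_notMem_mI T, fun h => absurd h hPV⟩
      by_contra! hcon
      refine hc ⟨hT, V, hV, fun x hx => ?_⟩
      obtain ⟨s, hs, t, ht, h0, hi, rfl⟩ := (hX.isLocAt_of_le hP hT hPT).2 x hx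
      refine mul_mem (hPV hs) (unit_of_notMem_mI (hPV ht) fun hm => ?_).2
      by_cases htT : t ∈ mI T
      · exact notMem_mI_of_inv h0 hi htT
      · exact (hcon ⟨t, ht⟩ htT).2 hm
    choose! y hy1 hy2 using hex
    have h1 : ∏ V ∈ hD.toFinset, y V ∈ idealAt P D := by
      refine mem_idealAt.2 fun V hV hPV => ?_
      rw [← Finset.mul_prod_erase _ _ (hD.mem_toFinset.2 hV)]
      exact mul_mem_mI' (hy2 V hV hPV) (hPV (Subtype.prop _))
    have h2 : ∏ V ∈ hD.toFinset, y V ∈ contr hPT := (mem_contr hPT).2 (h _ h1)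
    obtain ⟨V, hV, h3⟩ := (Ideal.IsPrime.prod_mem_iff).1 h2
    exact hy1 V (hD.mem_toFinset.1 hV) ((mem_contr hPT).1 h3)

lemma mem_preimage_iff (hX : IsModification X) (hP : P ∈ X) (hD : D.Finite)
    (hPV : P.toSubring ≤ V.toSubring) : V ∈ preimage X' X (support X D) ↔ V ∈ X' ∧ ∀ x ∈ idealAt P D, (x : K) ∈ mI V := by
  have hT := hX.mem_of_isLocAt hP (isLocAt_ofPrime _ (contr hPV))
  have hTV := ofPrime_contr_le hPV
  have hPT := le_ofPrime P.toSubring (contr hPV)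
  have h1 := mem_support_iff hX hP hD hT hPT
  constructor
  · rintro ⟨hV, T, hT', hTV', hTs⟩
    rw [hX.eq_of_le hT' hT hTV' hTV] at hTs
    exact ⟨hV, fun x hx => (le_iff_mI.1 hTV).2 _ (h1.1 hTs x hx)⟩
  · rintro ⟨hV, h⟩
    exact ⟨hV, _, hT, hTV, h1.2 fun x hx => (mem_mI_of_le hTV (hPT x.2)).1 (h x hx)⟩

/-! ### Smooth points -/

section Smooth
variable {a b a' b' : P.toSubring}

lemma RegPair.symm {A : Type*} [CommRing A] [IsLocalRing A] [IsDomain A] [IsNoetherianRing A] {a b : A} (h : RegPair a b) : RegPair b a where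
  span := by rw [h.span, Set.pair_comm]
  prime := by
    have := h.ufd
    have hb0 : b ≠ 0 := fun h0 => h.not_dvd (h0 ▸ dvd_zero a)
    refine Irreducible.prime ⟨fun hu => (mem_maximalIdeal b).1 h.mem_right hu, fun x y hxy => ?_⟩
    by_contra! hc
    obtain ⟨r, s, hx⟩ := h.mem_iff.1 ((mem_maximalIdeal x).2 hc.1)
    obtain ⟨r', s', hy⟩ := h.mem_iff.1 ((mem_maximalIdeal y).2 hc.2)
    -- modulo `a`, the element `b` would be a multiple of its square
    have h1 : a ∣ b * (1 - s * s' * b) := by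
      refine ⟨r * r' * a + r * s' * b + r' * s * b, ?_⟩
      have : b = (r * a + s * b) * (r' * a + s' * b) := by rw [hx, hy, hxy]
      linear_combination this
    rcases h.prime.dvd_or_dvd h1 with h2 | h2
    · exact h.not_dvd h2
    · refine (maximalIdeal.isMaximal A).ne_top ((Ideal.eq_top_iff_one _).2 ?_)
      have : (1 : A) = (1 - s * s' * b) + s * s' * b := by ring
      rw [this]
      exact add_mem (Ideal.mem_of_dvd _ h2 h.mem_left) (Ideal.mul_mem_left _ _ h.mem_right)
  not_dvd := by
    rintro ⟨c, hc⟩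
    refine h.not_principal b ?_
    rw [h.span, hc]
    refine le_antisymm (Ideal.span_le.2 ?_) (Ideal.span_mono (by simp))
    rintro x (hx | hx)
    · rw [hx]; exact Ideal.mul_mem_right _ _ (mem_span_singleton_self b)
    · rw [hx]; exact mem_span_singleton_self b

lemma SmoothAt.of_span (h : SmoothAt P a b) (ha : Associated a a') (hm : maximalIdeal P.toSubring = span {a', b'}) :
    SmoothAt P a' b' := by
  have := h.noeth
  refine ⟨h.base, h.noeth, ⟨hm, ha.prime h.reg.prime, fun hd => h.reg.not_principal a' ?_⟩, h.res⟩
  rw [hm]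
  obtain ⟨c, hc⟩ := hd
  refine le_antisymm (Ideal.span_le.2 ?_) (Ideal.span_mono (by simp))
  rintro x (hx | hx)
  · rw [hx]; exact mem_span_singleton_self a'
  · rw [hx, hc]; exact Ideal.mul_mem_right _ _ (mem_span_singleton_self a')

lemma SmoothAt.symm (h : SmoothAt P a b) : SmoothAt P b a := by
  have := h.noeth
  exact ⟨h.base, h.noeth, h.reg.symm, h.res⟩

lemma SmoothAt.origin_le (h : SmoothAt P a b) : origin ≤ P := origin_le_of_res h.base h.res

/-- The local ring at the generic point of a curve through a smooth point. -/
lemma dvr_ofPrime [IsNoetherianRing P.toSubring] (p : Ideal P.toSubring) [p.IsPrime] {g : P.toSubring} (hg0 : g ≠ 0)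
    (hg : p = span {g}) : IsDiscreteValuationRing (ofPrime P.toSubring p).toSubring := by
  have hl := isLocAt_ofPrime P.toSubring p
  have := isNoetherianRing_of_isLocAt hl
  have hgp : g ∈ p := hg ▸ mem_span_singleton_self g
  refine dvr_of_principal (u := (g : K)) ((mem_mI_ofPrime g.2).2 hgp) (fun h => hg0 (Subtype.ext h)) fun x hx => ?_
  obtain ⟨s, hs, t, ht, h0, hi, rfl⟩ := hl.2 x hx.1
  have h1 : s ∈ mI (ofPrime P.toSubring p) := by
    have := mul_mem_mI' hx (hl.1 ht)
    rwa [inv_mul_cancel_right₀ h0] at this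
  rw [mem_mI_ofPrime hs, hg, mem_span_singleton] at h1
  obtain ⟨c, hc⟩ := h1
  refine ⟨c * t⁻¹, mul_mem (hl.1 c.2) hi, ?_⟩
  have h2 : s = g * c := congrArg Subtype.val hc
  rw [h2, mul_assoc]

lemma SmoothAt.cases (h : SmoothAt P a b) (hT : IsLocAt P.toSubring T) :
    T = P ∨ IsDiscreteValuationRing T.toSubring ∨ ∀ x, x ∈ T.toSubring := by
  have := h.noeth
  have hp := hT.eq_ofPrime
  by_cases hm : contr hT.1 = maximalIdeal P.toSubring
  · left
    refine hT.ext (isLocAt_self P) fun x hx => ?_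
    rw [← mk_mem_maximalIdeal hx, ← hm, mem_contr]
  by_cases h0 : contr hT.1 = ⊥
  · refine Or.inr (Or.inr fun x => ?_)
    obtain ⟨s, hs, t, ht, rfl⟩ := exists_frac x
    by_cases ht0 : t = 0
    · rw [ht0, inv_zero, mul_zero]; exact zero_mem _
    refine mul_mem (hT.1 (h.base hs)) (unit_of_notMem_mI (hT.1 (h.base ht)) fun hc => ht0 ?_).2
    have h1 : (⟨t, h.base ht⟩ : P.toSubring) ∈ contr hT.1 := (mem_contr hT.1).2 hc
    rw [h0, Ideal.mem_bot] at h1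
    exact congrArg Subtype.val h1
  · right; left
    obtain ⟨g, hg, hgp⟩ := h.reg.exists_prime_generator _ h0 hm
    rw [hp]
    exact dvr_ofPrime _ hg.ne_zero hgp

lemma SmoothAt.not_dvr (h : SmoothAt P a b) : ¬ IsDiscreteValuationRing P.toSubring := by
  intro hd
  have := h.noeth
  obtain ⟨ϖ, hϖ⟩ := IsDiscreteValuationRing.exists_irreducible P.toSubring
  exact h.reg.not_principal ϖ hϖ.maximalIdeal_eq

lemma SmoothAt.isIntegrallyClosed (h : SmoothAt P a b) : IsIntegrallyClosed P.toSubring := by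
  have := h.noeth
  have := h.reg.ufd
  infer_instance

lemma SmoothAt.isRegularLocalRing (h : SmoothAt P a b) : IsRegularLocalRing P.toSubring := by
  have := h.noeth
  refine IsRegularLocalRing.of_spanFinrank_maximalIdeal_le (R := P.toSubring) ?_
  have h1 : (maximalIdeal P.toSubring).spanFinrank ≤ 2 := by
    rw [h.reg.span]
    exact (Submodule.spanFinrank_span_le_ncard_of_finite (Set.toFinite _)).trans ((Set.ncard_insert_le _ _).trans (by rw [Set.ncard_singleton]))
  have ha : (span {a}).IsPrime := (Ideal.span_singleton_prime h.reg.prime.ne_zero).2 h.reg.prime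
  have h2 : ((⊥ : PrimeSpectrum P.toSubring)) < ⟨span {a}, ha⟩ := by
    refine lt_of_le_of_ne bot_le fun hb => h.reg.prime.ne_zero ?_
    have h3 : (⊥ : Ideal P.toSubring) = span {a} := congrArg PrimeSpectrum.asIdeal hb
    exact (Ideal.span_singleton_eq_bot).1 h3.symm
  have h4 : (⟨span {a}, ha⟩ : PrimeSpectrum P.toSubring) < ⟨maximalIdeal P.toSubring, inferInstance⟩ := by
    refine lt_of_le_of_ne (PrimeSpectrum.asIdeal_le_asIdeal _ _ |>.1 (le_maximalIdeal ha.ne_top)) fun hb => ?_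
    exact h.reg.not_principal a (congrArg PrimeSpectrum.asIdeal hb).symm
  let c : LTSeries (PrimeSpectrum P.toSubring) :=
    { length := 2
      toFun := ![⊥, ⟨span {a}, ha⟩, ⟨maximalIdeal P.toSubring, inferInstance⟩]
      step := fun i => by fin_cases i; exacts [h2, h4] }
  have h5 : ((2 : ℕ) : WithBot ℕ∞) ≤ ringKrullDim P.toSubring := Order.LTSeries.length_le_krullDim c
  exact (Nat.cast_le.2 h1).trans h5

lemma isRegularLocalRing_dvr (h : IsDiscreteValuationRing T.toSubring) : IsRegularLocalRing T.toSubring := inferInstance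

lemma isRegularLocalRing_of_forall_mem (h : ∀ x, x ∈ T.toSubring) : IsRegularLocalRing T.toSubring := by
  have hf : IsField T.toSubring := ⟨⟨0, 1, zero_ne_one⟩, mul_comm, fun {x} hx => ⟨⟨(x : K)⁻¹, h _⟩, Subtype.ext (mul_inv_cancel₀ fun h0 => hx (Subtype.ext h0))⟩⟩
  let := hf.toField
  infer_instance

end Smooth

/-! ### Curves on the germ `S` -/

lemma mem_S {T : LocalSubring K} : T ∈ S ↔ IsLocAt RK T := mem_affinePoints

lemma origin_mem_S : origin ∈ S := mem_S.2 (isLocAt_self origin)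

lemma isModification_S : IsModification S where
  finite_type := by
    refine ⟨{⊥}, Set.finite_singleton _, by rintro A rfl; exact Subalgebra.fg_bot, ?_⟩
    have h : (⊥ : Subalgebra R K).toSubring = RK := by
      ext x
      simp [Algebra.mem_bot]
    simp [S, h]
  valuative W hW := by
    have h : RK ≤ W.toLocalSubring.toSubring := hW
    exact ⟨_, ⟨mem_S.2 (isLocAt_ofPrime _ (contr h)), ofPrime_contr_le h⟩,
      fun _ hT => (mem_S.1 hT.1).eq_of_le (isLocAt_ofPrime _ _) hT.2 (ofPrime_contr_le h)⟩

lemma smoothAt_X : SmoothAt origin (originEquiv (MvPowerSeries.X 0)) (originEquiv (MvPowerSeries.X 1)) :=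
  smoothAt_origin regPair_X

variable {V : LocalSubring K} {f l : R}

lemma mem_curve : V ∈ curve f ↔ IsPrimeDivisor S V ∧ algebraMap R K f ∈ mI V := by
  refine and_congr_right fun _ => ⟨?_, fun h => ⟨⟨_, h.1⟩, h.2, rfl⟩⟩
  rintro ⟨g, hg, h⟩
  exact h ▸ coe_mem_mI.2 hg

lemma IsPrimeDivisor.origin_le (hV : IsPrimeDivisor S V) : origin.toSubring ≤ V.toSubring := (mem_S.1 hV.1).1

lemma IsPrimeDivisor.ext_mem {V' : LocalSubring K} (hV : IsPrimeDivisor S V) (hV' : IsPrimeDivisor S V')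
    (h : ∀ r : R, algebraMap R K r ∈ mI V ↔ algebraMap R K r ∈ mI V') : V = V' := by
  refine (mem_S.1 hV.1).ext (mem_S.1 hV'.1) ?_
  rintro _ ⟨r, rfl⟩
  exact h r

lemma finite_curve (hf : f ≠ 0) : (curve f).Finite := by
  refine Set.Finite.of_finite_image (f := fun V => {r : R | algebraMap R K r ∈ mI V}) ?_ fun V hV V' hV' h =>
    hV.1.ext_mem hV'.1 fun r => Set.ext_iff.1 h r
  refine ((UniqueFactorizationMonoid.factors f).finite_toSet.image fun g => {r : R | g ∣ r}).subset ?_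
  rintro _ ⟨V, hV, rfl⟩
  obtain ⟨hV, hfV⟩ := mem_curve.1 hV
  obtain ⟨g, hg, hgV⟩ := hV.exists_prime
  obtain ⟨q, hq, hgq⟩ := UniqueFactorizationMonoid.exists_mem_factors_of_dvd hf hg.irreducible ((hgV f).1 hfV)
  exact ⟨q, hq, Set.ext fun r => (hgq.dvd_iff_dvd_left.symm.trans (hgV r).symm)⟩

lemma nonempty_curve (hf : f ∈ maximalIdeal R) (hf0 : f ≠ 0) : (curve f).Nonempty := by
  obtain ⟨g, hg, hgf⟩ := WfDvdMonoid.exists_irreducible_factor (by simpa using hf) hf0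
  have hp : Prime (originEquiv g) := (MulEquiv.prime_iff (originEquiv : R ≃* origin.toSubring)).2 hg.prime
  have := smoothAt_X.noeth
  have h1 : (span {originEquiv g}).IsPrime := (Ideal.span_singleton_prime hp.ne_zero).2 hp
  refine ⟨ofPrime origin.toSubring (span {originEquiv g}), mem_curve.2
    ⟨⟨mem_S.2 (isLocAt_ofPrime origin.toSubring (span {originEquiv g})), dvr_ofPrime _ hp.ne_zero rfl⟩, ?_⟩⟩
  rw [← coe_originEquiv, mem_mI_ofPrime (Subtype.prop _), mem_span_singleton]
  exact map_dvd originEquiv hgf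

lemma idealAt_curve {x : R} (h : RegPair l x) : idealAt origin (curve l) = span {originEquiv l} := by
  ext y
  obtain ⟨r, rfl⟩ := originEquiv.surjective y
  have key : ∀ V ∈ curve l, (algebraMap R K r ∈ mI V ↔ l ∣ r) := by
    intro V hV
    obtain ⟨hV, hlV⟩ := mem_curve.1 hV
    obtain ⟨g, hg, hgV⟩ := hV.exists_prime
    rw [hgV]
    exact ((hg.irreducible.dvd_irreducible_iff_associated h.prime.irreducible).1 ((hgV l).1 hlV)).dvd_iff_dvd_left
  rw [mem_idealAt, mem_span_singleton, map_dvd_iff, coe_originEquiv]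
  obtain ⟨V, hV⟩ := nonempty_curve h.mem_left h.prime.ne_zero
  exact ⟨fun k => (key V hV).1 (k V hV (mem_curve.1 hV).1.origin_le), fun k V hV _ => (key V hV).2 k⟩

variable {X D : Set (LocalSubring K)} {P : LocalSubring K} {a b : P.toSubring}

lemma cases_S {T : LocalSubring K} (hT : T ∈ S) : T = origin ∨ IsDiscreteValuationRing T.toSubring ∨ ∀ x, x ∈ T.toSubring :=
  smoothAt_X.cases (mem_S.1 hT)

lemma IsModification.mem_of_isPrimeDivisor (hX : IsModification X) (hV : IsPrimeDivisor S V) : V ∈ X :=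
  have := hV.2
  hX.dvr_mem (mem_S.1 hV.1)

/-! ### Divisors at smooth points -/

lemma SmoothAt.exists_prime (h : SmoothAt P a b) (hPV : IsLocAt P.toSubring V) (hV : IsDiscreteValuationRing V.toSubring) :
    ∃ g : P.toSubring, Prime g ∧ ∀ x : P.toSubring, (x : K) ∈ mI V ↔ g ∣ x := by
  have := h.noeth
  have h0 : contr hPV.1 ≠ ⊥ := by
    intro h0
    obtain ⟨x, hx, hx0⟩ := exists_mem_mI V
    obtain ⟨s, hs, t, ht, ht0, hi, rfl⟩ := hPV.2 x hx.1
    have h1 : s ∈ mI V := by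
      have := mul_mem_mI' hx (hPV.1 ht)
      rwa [inv_mul_cancel_right₀ ht0] at this
    have h2 : (⟨s, hs⟩ : P.toSubring) ∈ contr hPV.1 := (mem_contr hPV.1).2 h1
    rw [h0, Ideal.mem_bot] at h2
    exact hx0 (by rw [show s = 0 from congrArg Subtype.val h2, zero_mul])
  have hm : contr hPV.1 ≠ maximalIdeal P.toSubring := by
    intro hm
    refine h.not_dvr ?_
    rwa [show P = V from (isLocAt_self P).ext hPV fun x hx => by rw [← mk_mem_maximalIdeal hx, ← hm, mem_contr]]
  obtain ⟨g, hg, hgV⟩ := h.reg.exists_prime_generator (contr hPV.1) h0 hm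
  exact ⟨g, hg, fun x => by rw [← mem_span_singleton, ← hgV, mem_contr]⟩

lemma SmoothAt.exists_idealAt_eq_span (h : SmoothAt P a b) (hD : D.Finite)
    (hDV : ∀ V ∈ D, P.toSubring ≤ V.toSubring → IsLocAt P.toSubring V ∧ IsDiscreteValuationRing V.toSubring) :
    ∃ g, idealAt P D = span {g} := by
  induction D, hD using Set.Finite.induction_on with
  | empty => exact ⟨1, by simp [idealAt]⟩
  | @insert V D _ _ ih =>
    obtain ⟨c, hc⟩ := ih fun W hW => hDV W (Set.mem_insert_of_mem _ hW)
    have hcm : ∀ x, x ∈ idealAt P D ↔ c ∣ x := fun x => by rw [hc, mem_span_singleton]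
    simp only [mem_idealAt] at hcm
    by_cases hPV : P.toSubring ≤ V.toSubring
    · obtain ⟨g, hg, hgV⟩ := h.exists_prime (hDV V (Set.mem_insert _ _) hPV).1 (hDV V (Set.mem_insert _ _) hPV).2
      by_cases hgc : g ∣ c
      · refine ⟨c, ?_⟩
        ext x
        rw [mem_idealAt, Set.forall_mem_insert, mem_span_singleton, hcm]
        exact and_iff_right_of_imp fun k _ => (hgV x).2 (hgc.trans k)
      · refine ⟨g * c, ?_⟩
        ext x
        rw [mem_idealAt, Set.forall_mem_insert, mem_span_singleton, hcm]
        constructor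
        · rintro ⟨k1, d, rfl⟩
          obtain ⟨e, rfl⟩ := (hg.dvd_or_dvd ((hgV _).1 (k1 hPV))).resolve_left hgc
          exact ⟨e, by ring⟩
        · exact fun k => ⟨fun _ => (hgV x).2 ((dvd_mul_right _ _).trans k), (dvd_mul_left _ _).trans k⟩
    · refine ⟨c, ?_⟩
      ext x
      rw [mem_idealAt, Set.forall_mem_insert, mem_span_singleton, hcm]
      exact and_iff_right_of_imp fun k k' => absurd k' hPV

lemma isCone_standard : IsCone (1, 0) (0, 1) := ⟨by decide, by decide, by decide, by decide, by decide⟩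

/-- A smooth point has a toric chart, the boundary consisting of some of the coordinate axes. -/
lemma SmoothAt.hasToricChart (h : SmoothAt P a b) (J : Set (Fin 2))
    (hJ : ∀ x, x ∈ idealAt P D ↔ (0 ∈ J → a ∣ x) ∧ (1 ∈ J → b ∣ x)) : HasToricChart P D := by
  have hmon : ∀ m ∈ dualCone (1, 0) (0, 1), m ≠ 0 → mon (a : K) b m ∈ mI P := by
    rintro ⟨i, j⟩ hm hm0
    have h0 : 0 ≤ i ∧ 0 ≤ j := by simpa [mem_dualCone, wdot] using hm
    lift i to ℕ using h0.1
    lift j to ℕ using h0.2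
    simp only [mon, zpow_natCast]
    by_cases hi : i = 0
    · have hj : j ≠ 0 := by rintro rfl; exact hm0 (by simp [hi])
      exact mul_mem_mI (pow_mem a.2 _) ((mI_pow_iff b.2 hj).2 (coe_mem_mI.2 h.reg.mem_right))
    · exact mul_mem_mI' ((mI_pow_iff a.2 hi).2 (coe_mem_mI.2 h.reg.mem_left)) (pow_mem b.2 _)
  have hring : monRing P.toSubring (a : K) b (1, 0) (0, 1) = P.toSubring := by
    refine le_antisymm (monRing_le le_rfl fun m hm => ?_) le_monRing
    by_cases hm0 : m = 0
    · rw [hm0, mon_zero]; exact one_mem _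
    · exact (hmon m hm hm0).1
  have hT := h.toricAt isCone_standard (Q := P) (by rw [hring]; exact isLocAt_self P) hmon
  have := h.noeth
  have e0 : ex 1 0 ∈ toricMonoid (1, 0) (0, 1) := ⟨(1, 0), by simp, by simp [ex]⟩
  have e1 : ex 0 1 ∈ toricMonoid (1, 0) (0, 1) := ⟨(0, 1), by simp, by simp [ex]⟩
  have ha : a = hT.chi (ex 1 0) := Subtype.ext <| hT.eq_chi e0 <| by
    rw [← mon_left (a : K) b]; exact h.psi_mon_eq _ (by simp [wdot]) (by simp [wdot, ex])
  have hb : b = hT.chi (ex 0 1) := Subtype.ext <| hT.eq_chi e1 <| by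
    rw [← mon_right (a : K) b]; exact h.psi_mon_eq _ (by simp [wdot]) (by simp [wdot, ex])
  have ma : ∀ i, a ∈ hT.boundaryPrime i ↔ ex 1 0 i ≠ 0 := fun i => by
    rw [← hT.chi_mem_boundaryPrime e0, ← ha]
  have mb : ∀ i, b ∈ hT.boundaryPrime i ↔ ex 0 1 i ≠ 0 := fun i => by
    rw [← hT.chi_mem_boundaryPrime e1, ← hb]
  have p0 : hT.boundaryPrime 0 = span {a} :=
    h.reg.eq_of_mem _ ((ma 0).2 (by simp)) fun hm => (mb 0).1 (hm ▸ h.reg.mem_right) (by simp)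
  have p1 : hT.boundaryPrime 1 = span {b} :=
    h.reg.symm.eq_of_mem _ ((mb 1).2 (by simp [ex])) fun hm => (ma 1).1 (hm ▸ h.reg.mem_left) (by simp [ex])
  refine hT.hasToricChart (J := J) isCoprime_one_left isCoprime_one_right (by decide) (Or.inr (by decide)) fun x => ?_
  simp only [← hT.mem_boundaryPrime]
  rw [hJ, Fin.forall_fin_two, p0, p1, mem_span_singleton, mem_span_singleton]

/-! ### The points of the fibres of a Newton modification -/

section Fibre
variable {X X' D : Set (LocalSubring K)} {P Q V : LocalSubring K} {a b f : P.toSubring} {w w₂ n : ℤ × ℤ}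

lemma mem_of_idealAt (hX : IsModification X) (hP : P ∈ X) (hD : D.Finite) (hDX : ∀ V ∈ D, IsPrimeDivisor X V)
    (hV : IsPrimeDivisor X V) (hPV : P.toSubring ≤ V.toSubring) (h : ∀ x ∈ idealAt P D, (x : K) ∈ mI V) : V ∈ D := by
  obtain ⟨-, W, hW, hVW⟩ := (mem_support_iff hX hP hD hV.1 hPV).2 h
  have := hV.2
  have := (hDX W hW).2
  exact eq_of_le_dvr (hX.base_le hV.1) hVW ▸ hW

/-- A point of the fibre is either a fixed point of a chart, or a point of the orbit of dimension one defined by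
a ray in the interior of the quadrant, or the generic point of this orbit. -/
lemma newtonFiber_cases (h : SmoothAt P a b) (hQ : Q ∈ newtonFiber P a b (h.exp f)) :
    (∃ (w₁ w₂ : ℤ × ℤ) (hN : IsNewtonCone (h.exp f) w₁ w₂), ToricAt Q w₁ w₂ (h.psi hN.isCone)) ∨
      ∃ w ∈ newtonFanRays (h.exp f), ∃ w₂ n, EdgeBasis w w₂ n (-w.2, w.1) ∧ IsLocAt (monRing P.toSubring a b w w) Q ∧
        ((∃ c : ℂ, c ≠ 0 ∧ mon (a : K) b (-w.2, w.1) - algebraMap ℂ K c ∈ mI Q) ∨ IsDiscreteValuationRing Q.toSubring) := by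
  obtain ⟨hPQ, w₁, w₂, hN, hQ⟩ := hQ
  rw [mem_affinePoints, chartRing_eq] at hQ
  have key : ∀ w ∈ newtonFanRays (h.exp f), 0 < w.1 ∧ 0 < w.2 ∧ IsLocAt (monRing P.toSubring (a : K) b w w) Q →
      ∃ w₂ n, EdgeBasis w w₂ n (-w.2, w.1) ∧ IsLocAt (monRing P.toSubring a b w w) Q ∧
        ((∃ c : ℂ, c ≠ 0 ∧ mon (a : K) b (-w.2, w.1) - algebraMap ℂ K c ∈ mI Q) ∨ IsDiscreteValuationRing Q.toSubring) := by
    rintro w hw ⟨h1, h2, hl⟩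
    obtain ⟨r, s, e⟩ := exists_edgeBasis h1 h2 (newtonFanRays_nonneg hw).2.2
    exact ⟨_, _, e, hl, (e.cases h hPQ hl).imp_right (e.dvr h hl)⟩
  rcases isLocAt_edge h hN.isCone hQ hPQ with hfix | hw | hw
  · exact Or.inl ⟨w₁, w₂, hN, h.toricAt hN.isCone hQ hfix⟩
  · exact Or.inr ⟨w₁, hN.1, key w₁ hN.1 hw⟩
  · exact Or.inr ⟨w₂, hN.2.1, key w₂ hN.2.1 hw⟩

/-- The exceptional divisors are determined by their rays. -/
lemma EdgeBasis.eq_of_dvr (e : EdgeBasis w w₂ n (-w.2, w.1)) (h : SmoothAt P a b) {Q' : LocalSubring K} (hPQ : P ≤ Q) (hPQ' : P ≤ Q')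
    (hQ : IsLocAt (monRing P.toSubring a b w w) Q) (hQ' : IsLocAt (monRing P.toSubring a b w w) Q')
    (d : IsDiscreteValuationRing Q.toSubring) (d' : IsDiscreteValuationRing Q'.toSubring) : Q = Q' := by
  rcases e.cases h hPQ hQ with ⟨c, hc, hzc⟩ | h1
  · exact absurd d (e.smoothAt h hPQ hQ hc hzc).not_dvr
  rcases e.cases h hPQ' hQ' with ⟨c, hc, hzc⟩ | h2
  · exact absurd d' (e.smoothAt h hPQ' hQ' hc hzc).not_dvr
  exact hQ.ext hQ' fun x hx => (h1 x hx).trans (h2 x hx).symm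

lemma EdgeBasis.not_isClosedPoint (e : EdgeBasis w w₂ n (-w.2, w.1)) (h : SmoothAt P a b) (hPQ : P ≤ Q)
    (hQ : IsLocAt (monRing P.toSubring a b w w) Q) (d : IsDiscreteValuationRing Q.toSubring) (hX : IsModification X) :
    ¬ IsClosedPoint X Q := by
  intro hcl
  rcases e.cases h hPQ hQ with ⟨c, hc, hzc⟩ | h1
  · exact (e.smoothAt h hPQ hQ hc hzc).not_dvr d
  obtain ⟨T, hPT, hT, hTQ, hne⟩ := e.exists_lt h hQ h1
  have hd : ∀ x : K, x ∈ Q.toSubring ∨ x⁻¹ ∈ Q.toSubring := mem_or_inv_mem (hX.base_le hcl.1)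
  obtain ⟨W, hTW, hWQ⟩ := exists_dominating_le hd hTQ
  obtain ⟨Q', ⟨hQ', hQW⟩, -⟩ := hX.valuative W
    ((h.base.trans (le_iff_mI.1 hPT).1).trans (le_iff_mI.1 hTW).1)
  have h2 := hcl.2 Q' hQ' ((le_iff_mI.1 hQW).1.trans hWQ)
  rw [h2] at hQW
  exact hne (hT.eq_of_le hQ hTW hQW)

lemma EdgeBasis.mon_mem_iff (e : EdgeBasis w w₂ n (-w.2, w.1)) (h : SmoothAt P a b)
    (hQ : IsLocAt (monRing P.toSubring a b w w) Q) (hQV : Q.toSubring ≤ V.toSubring) {m : ℤ × ℤ} (hm : 0 < wdot w m) :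
    mon (a : K) b m ∈ mI V ↔ mon (a : K) b n ∈ mI V := by
  have h0 : wdot w (m - wdot w m • n) = 0 := by rw [wdot_sub, wdot_zsmul, e.wn, mul_one, sub_self]
  have h1 : m = wdot w m • n + wdot w₂ (m - wdot w m • n) • (-w.2, w.1) := by
    rw [← e.eq_smul h0, add_sub_cancel]
  obtain ⟨z1, z2, -⟩ := e.z_unit h hQ
  have hz : ∀ k : ℤ, mon (a : K) b (-w.2, w.1) ^ k ∈ Q.toSubring := by
    intro k
    obtain ⟨k, rfl | rfl⟩ := k.eq_nat_or_neg
    · rw [zpow_natCast]; exact pow_mem z1 k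
    · rw [zpow_neg, zpow_natCast, ← inv_pow]; exact pow_mem z2 k
  have hz0 := mon_ne_zero h.left_ne_zero h.right_ne_zero (-w.2, w.1)
  have hu : mon (a : K) b n ∈ V.toSubring := hQV (hQ.1 (mon_mem_monRing e.n_mem))
  obtain ⟨k, hk⟩ := Int.eq_ofNat_of_zero_le hm.le
  have hk0 : k ≠ 0 := by rintro rfl; omega
  rw [h1, mon_add h.left_ne_zero h.right_ne_zero, mon_zsmul, mon_zsmul, hk, zpow_natCast,
    mI_mul_iff (pow_mem hu k) (hQV (hz _)), mI_pow_iff hu hk0, or_iff_left]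
  exact notMem_mI_of_inv (zpow_ne_zero _ hz0) (by rw [← zpow_neg]; exact hQV (hz _))

/-- The germ at `Q` of the divisor `D` of `X` is that of the total transform of the cross `x * y = 0`. -/
def IsBoundaryGerm (X : Set (LocalSubring K)) (x y : K) (Q : LocalSubring K) (D : Set (LocalSubring K)) : Prop :=
  ∀ V, Q.toSubring ≤ V.toSubring → (V ∈ D ↔ IsPrimeDivisor X V ∧ (x ∈ mI V ∨ y ∈ mI V))

lemma EdgeBasis.idealAt_eq (e : EdgeBasis w w₂ n (-w.2, w.1)) (h : SmoothAt P a b) (hPQ : P ≤ Q)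
    (hQ : IsLocAt (monRing P.toSubring a b w w) Q) {c : ℂ} (hc : c ≠ 0)
    (hzc : mon (a : K) b (-w.2, w.1) - algebraMap ℂ K c ∈ mI Q) (hX : IsModification X) (hQX : Q ∈ X) (hD : IsBoundaryGerm X a b Q D) :
    idealAt Q D = span {⟨mon (a : K) b n, (e.u_mem h hPQ hQ).1⟩} ∧ ∃ V ∈ D, Q.toSubring ≤ V.toSubring := by
  have hs := e.smoothAt h hPQ hQ hc hzc
  set u : Q.toSubring := ⟨mon (a : K) b n, (e.u_mem h hPQ hQ).1⟩
  have := hs.noeth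
  have hp : (span {u}).IsPrime := (Ideal.span_singleton_prime hs.reg.prime.ne_zero).2 hs.reg.prime
  have ha : ∀ {V : LocalSubring K}, Q.toSubring ≤ V.toSubring → ((a : K) ∈ mI V ↔ (u : K) ∈ mI V) := fun {V} hQV => by
    have := e.mon_mem_iff h hQ hQV (m := (1, 0)) (by simpa [wdot] using e.pos₁)
    rwa [mon_left] at this
  have hb : ∀ {V : LocalSubring K}, Q.toSubring ≤ V.toSubring → ((b : K) ∈ mI V ↔ (u : K) ∈ mI V) := fun {V} hQV => by
    have := e.mon_mem_iff h hQ hQV (m := (0, 1)) (by simpa [wdot] using e.pos₂)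
    rwa [mon_right] at this
  have hE : ofPrime Q.toSubring (span {u}) ∈ D := by
    have hle := le_ofPrime Q.toSubring (span {u})
    refine (hD _ hle).2 ⟨⟨hX.mem_of_isLocAt hQX (isLocAt_ofPrime _ _), dvr_ofPrime _ hs.reg.prime.ne_zero rfl⟩, Or.inl ?_⟩
    exact (ha hle).2 ((mem_mI_ofPrime u.2).2 (mem_span_singleton_self u))
  refine ⟨?_, _, hE, le_ofPrime _ _⟩
  ext x
  rw [mem_idealAt]
  constructor
  · intro hx
    exact (mem_mI_ofPrime x.2).1 (hx _ hE (le_ofPrime _ _))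
  · intro hx V hV hQV
    obtain ⟨r, rfl⟩ := mem_span_singleton.1 hx
    refine mul_mem_mI' ?_ (hQV r.2)
    rcases ((hD V hQV).1 hV).2 with h1 | h1
    · exact (ha hQV).1 h1
    · exact (hb hQV).1 h1

section Toric
variable {w₁ w₂ : ℤ × ℤ} {hc : IsCone w₁ w₂} {h : SmoothAt P a b}

lemma SmoothAt.left_eq_chi (h : SmoothAt P a b) (hT : ToricAt Q w₁ w₂ (h.psi hc)) : (a : K) = hT.chi (conv w₁ w₂ (ex 1 0)) :=
  hT.eq_chi (hc.conv_mem _) <| by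
    rw [← mon_left (a : K) b]
    exact h.psi_mon_eq _ (by rw [hc.conv_zero]; simp [toInt, ex]) (by rw [hc.conv_one]; simp [toInt, ex])

lemma SmoothAt.right_eq_chi (h : SmoothAt P a b) (hT : ToricAt Q w₁ w₂ (h.psi hc)) : (b : K) = hT.chi (conv w₁ w₂ (ex 0 1)) :=
  hT.eq_chi (hc.conv_mem _) <| by
    rw [← mon_right (a : K) b]
    exact h.psi_mon_eq _ (by rw [hc.conv_zero]; simp [toInt, ex]) (by rw [hc.conv_one]; simp [toInt, ex])

/-- The total transform of the cross contains both edges of the chart. -/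
lemma ToricAt.mem_boundaryPrime_or (hT : ToricAt Q w₁ w₂ (h.psi hc)) (i : Fin 2) :
    (∃ x ∈ hT.boundaryPrime i, (x : K) = a) ∨ ∃ x ∈ hT.boundaryPrime i, (x : K) = b := by
  have h1 : conv w₁ w₂ (ex 1 0) i ≠ 0 ∨ conv w₁ w₂ (ex 0 1) i ≠ 0 := by
    have hd := hc.det_pos
    by_contra! hcon
    obtain ⟨h1, h2⟩ := hcon
    have e1 : ∀ w : ℤ × ℤ, wdot w (toInt (ex 1 0)) = w.1 := fun w => by simp [wdot, toInt, ex]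
    have e2 : ∀ w : ℤ × ℤ, wdot w (toInt (ex 0 1)) = w.2 := fun w => by simp [wdot, toInt, ex]
    obtain rfl | rfl : i = 0 ∨ i = 1 := by fin_cases i <;> simp
    · have h3 := hc.conv_zero (ex 1 0)
      have h4 := hc.conv_zero (ex 0 1)
      rw [e1, h1] at h3
      rw [e2, h2] at h4
      simp [det, ← h3, ← h4] at hd
    · have h3 := hc.conv_one (ex 1 0)
      have h4 := hc.conv_one (ex 0 1)
      rw [e1, h1] at h3
      rw [e2, h2] at h4
      simp [det, ← h3, ← h4] at hd
  refine h1.imp (fun h2 => ⟨_, (hT.chi_mem_boundaryPrime (hc.conv_mem _)).2 h2, (h.left_eq_chi hT).symm⟩) fun h2 =>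
    ⟨_, (hT.chi_mem_boundaryPrime (hc.conv_mem _)).2 h2, (h.right_eq_chi hT).symm⟩

lemma ToricAt.dvr (hT : ToricAt Q w₁ w₂ (h.psi hc)) (h1 : IsCoprime w₁.1 w₁.2) (h2 : IsCoprime w₂.1 w₂.2) (i : Fin 2) :
    IsDiscreteValuationRing (ofPrime Q.toSubring (hT.boundaryPrime i)).toSubring := by
  obtain ⟨⟨d, hd, hd0, hdi⟩, e, he, hei⟩ := hc.exists_exponents h1 h2 i
  exact hT.dvr_boundaryPrime hd hd0 hdi he hei

lemma ToricAt.not_dvr (hT : ToricAt Q w₁ w₂ (h.psi hc)) (h1 : IsCoprime w₁.1 w₁.2) (h2 : IsCoprime w₂.1 w₂.2) :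
    ¬ IsDiscreteValuationRing Q.toSubring := by
  intro hd
  have := hT.dvr h1 h2 0
  have h3 := eq_of_le_dvr hT.base (le_ofPrime Q.toSubring (hT.boundaryPrime 0))
  obtain ⟨⟨d, hd, hd0, hdi⟩, -⟩ := hc.exists_exponents h1 h2 0
  have h4 : (hT.chi d : K) ∈ mI (ofPrime Q.toSubring (hT.boundaryPrime 0)) := by
    rw [h3, coe_mem_mI, ← hT.mem_maximal_iff, mem_toricMaximalIdeal, hT.hom_chi hd]
    classical
    rw [← MvPowerSeries.coeff_zero_eq_constantCoeff_apply, MvPowerSeries.coeff_monomial, if_neg hd0.symm]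
  rw [mem_mI_ofPrime (Subtype.prop _)] at h4
  exact (hT.chi_mem_boundaryPrime hd).1 h4 hdi

/-- The prime divisors through the fixed point of a chart where some monomial vanishes are the two edges. -/
lemma ToricAt.contr_eq (hT : ToricAt Q w₁ w₂ (h.psi hc)) (h1 : IsCoprime w₁.1 w₁.2) (h2 : IsCoprime w₂.1 w₂.2)
    (hV : IsDiscreteValuationRing V.toSubring) (hQV : IsLocAt Q.toSubring V) {e : Fin 2 →₀ ℕ} (he : e ∈ toricMonoid w₁ w₂)
    (heV : (hT.chi e : K) ∈ mI V) : ∃ i, ∀ x : Q.toSubring, (x : K) ∈ mI V ↔ x ∈ hT.boundaryPrime i := by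
  have hm : contr hQV.1 ≠ maximalIdeal Q.toSubring := by
    refine fun hm => hT.not_dvr h1 h2 ?_
    rwa [show Q = V from (isLocAt_self Q).ext hQV fun x hx => by rw [← mk_mem_maximalIdeal hx, ← hm, mem_contr]]
  obtain ⟨i, hi⟩ := hT.eq_boundaryPrime (contr hQV.1) hm he ((mem_contr hQV.1).2 heV)
  exact ⟨i, fun x => by rw [← hi, mem_contr]⟩

lemma ToricAt.mem_or_of_mem (hT : ToricAt Q w₁ w₂ (h.psi hc)) (h1 : IsCoprime w₁.1 w₁.2) (h2 : IsCoprime w₂.1 w₂.2)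
    (hV : IsDiscreteValuationRing V.toSubring) (hQV : IsLocAt Q.toSubring V) {e : Fin 2 →₀ ℕ} (he : e ∈ toricMonoid w₁ w₂)
    (heV : (hT.chi e : K) ∈ mI V) : (a : K) ∈ mI V ∨ (b : K) ∈ mI V := by
  obtain ⟨i, hi⟩ := hT.contr_eq h1 h2 hV hQV he heV
  rcases hT.mem_boundaryPrime_or i with ⟨x, hx, hxa⟩ | ⟨x, hx, hxa⟩
  · exact Or.inl (hxa ▸ (hi x).2 hx)
  · exact Or.inr (hxa ▸ (hi x).2 hx)

lemma ToricAt.chart (hT : ToricAt Q w₁ w₂ (h.psi hc)) (h1 : IsCoprime w₁.1 w₁.2) (h2 : IsCoprime w₂.1 w₂.2)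
    (hX : IsModification X) (hQX : Q ∈ X) (hD : IsBoundaryGerm X a b Q D) :
    HasToricChart Q D ∧ ∃ V ∈ D, Q.toSubring ≤ V.toSubring := by
  have hE : ∀ i, ofPrime Q.toSubring (hT.boundaryPrime i) ∈ D := by
    intro i
    refine (hD _ (le_ofPrime _ _)).2 ⟨⟨hX.mem_of_isLocAt hQX (isLocAt_ofPrime _ _), hT.dvr h1 h2 i⟩, ?_⟩
    refine (hT.mem_boundaryPrime_or i).imp ?_ ?_
    · rintro ⟨x, hx, hxa⟩
      exact hxa ▸ (mem_mI_ofPrime x.2).2 hx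
    · rintro ⟨x, hx, hxa⟩
      exact hxa ▸ (mem_mI_ofPrime x.2).2 hx
  refine ⟨hT.hasToricChart (J := Set.univ) h1 h2 hc.det_pos.ne' (Or.inl rfl) fun x => ?_, _, hE 0, le_ofPrime _ _⟩
  simp only [← hT.mem_boundaryPrime, Set.mem_univ, true_imp_iff]
  rw [mem_idealAt]
  refine ⟨fun hx i => (mem_mI_ofPrime x.2).1 (hx _ (hE i) (le_ofPrime _ _)), fun hx V hV hQV => ?_⟩
  obtain ⟨hVX, hab⟩ := (hD V hQV).1 hV
  have hl := hX.isLocAt_of_le hQX hVX.1 hQV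
  obtain ⟨i, hi⟩ : ∃ i, ∀ x : Q.toSubring, (x : K) ∈ mI V ↔ x ∈ hT.boundaryPrime i := by
    rcases hab with h3 | h3
    · exact hT.contr_eq h1 h2 hVX.2 hl (hc.conv_mem _) (h.left_eq_chi hT ▸ h3)
    · exact hT.contr_eq h1 h2 hVX.2 hl (hc.conv_mem _) (h.right_eq_chi hT ▸ h3)
  exact (hi x).2 (hx i)

end Toric
end Fibre

/-! ### The invariants of the algorithm -/

section
variable {X : Set (LocalSubring K)} {P Q V : LocalSubring K} {a b f : P.toSubring}

lemma finite_dvr_newtonFiber (h : SmoothAt P a b) (hf : f ≠ 0) :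
    {V | V ∈ newtonFiber P a b (h.exp f) ∧ IsDiscreteValuationRing V.toSubring}.Finite := by
  have hF : h.exp f ≠ 0 := fun h0 => hf (h.exp_injective (h0.trans (map_zero _).symm))
  refine ((finite_newtonFanRays hF).biUnion (t := fun w => {Q | P ≤ Q ∧ IsDiscreteValuationRing Q.toSubring ∧
    ∃ w₂ n, EdgeBasis w w₂ n (-w.2, w.1) ∧ IsLocAt (monRing P.toSubring (a : K) b w w) Q}) fun w _ => ?_).subset ?_
  · refine Set.Subsingleton.finite ?_
    rintro Q ⟨hPQ, d, w₂, n, e, hQ⟩ Q' ⟨hPQ', d', -, -, -, hQ'⟩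
    exact e.eq_of_dvr h hPQ hPQ' hQ hQ' d d'
  · rintro Q ⟨hQ, d⟩
    rcases newtonFiber_cases h hQ with ⟨w₁, w₂, hN, hT⟩ | ⟨w, hw, w₂, n, e, hl, -⟩
    · exact absurd d (hT.not_dvr (newtonFanRays_nonneg hN.1).2.2 (newtonFanRays_nonneg hN.2.1).2.2)
    · exact Set.mem_biUnion hw ⟨hQ.1, d, w₂, n, e, hl⟩

end

variable {f₀ : R} {Ch : Set (LocalSubring K)} {s : Stage}

/-- The properties of the stages which are preserved by the steps of the algorithm; `Ch` contains the branches of the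
curve `Z(f₀)` chosen so far. -/
structure Inv (f₀ : R) (Ch : Set (LocalSubring K)) (s : Stage) : Prop where
  modif : IsModification s.surface
  normal : ∀ P ∈ s.surface, IsIntegrallyClosed P.toSubring
  finite : s.boundary.Finite
  divisor : ∀ V ∈ s.boundary, IsPrimeDivisor s.surface V
  closed : ∀ P ∈ s.points, IsClosedPoint s.surface P
  smooth : ∀ P ∈ s.points, ∃ a b, SmoothAt P a b ∧ idealAt P s.boundary = span {a}
  notMem : ∀ P ∈ s.points, ∀ V ∈ s.boundary, P.toSubring ≤ V.toSubring → V ∉ curve f₀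
  pass : ∀ P ∈ s.points, ∃ V ∈ curve f₀, P.toSubring ≤ V.toSubring
  chart : ∀ P, IsClosedPoint s.surface P → P ∉ s.points → HasToricChart P s.boundary
  fibre : ∀ P ∈ s.surface, origin ≤ P → ∃ V ∈ s.boundary, P.toSubring ≤ V.toSubring
  strict : ∀ V ∈ curve f₀, V ∈ s.boundary ∨ ∃ P ∈ s.points, P.toSubring ≤ V.toSubring
  sing : ∀ P ∈ s.surface, IsRegularLocalRing P.toSubring ∨ ∀ V ∈ curve f₀, P.toSubring ≤ V.toSubring → V ∈ Ch

namespace Inv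
variable {P V β : LocalSubring K} {x y : P.toSubring}

lemma finite_points (I : Inv f₀ Ch s) (hf : f₀ ≠ 0) : s.points.Finite := by
  choose! v hv using I.pass
  refine Set.Finite.of_finite_image (f := v) ((finite_curve hf).subset ?_) fun P hP Q hQ h => ?_
  · rintro _ ⟨P, hP, rfl⟩
    exact (hv P hP).1
  · exact I.modif.closedPoint_unique (mem_curve.1 (hv P hP).1).1 (I.closed P hP) (I.closed Q hQ) (hv P hP).2
      (h ▸ (hv Q hQ).2)

/-- The strict transform of the curve has no component in common with the boundary at the current points. -/
lemma left_notMem (I : Inv f₀ Ch s) (hP : P ∈ s.points) (hx : idealAt P s.boundary = span {x}) (hV : V ∈ curve f₀)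
    (hPV : P.toSubring ≤ V.toSubring) : (x : K) ∉ mI V := by
  intro h
  refine I.notMem P hP V (mem_of_idealAt I.modif (I.closed P hP).1 I.finite I.divisor
    ⟨I.modif.mem_of_isPrimeDivisor (mem_curve.1 hV).1, (mem_curve.1 hV).1.2⟩ hPV fun z hz => ?_) hPV hV
  rw [hx] at hz
  obtain ⟨c, rfl⟩ := mem_span_singleton.1 hz
  exact mul_mem_mI' h (hPV c.2)

/-- A smooth branch at a current point which is transversal to the boundary comes from a branch on `S`. -/
lemma branch (I : Inv f₀ Ch s) (hP : P ∈ s.points) (h : SmoothAt P x y) (hx : idealAt P s.boundary = span {x})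
    (hy : idealAt P {β} = span {y}) :
    P.toSubring ≤ β.toSubring ∧ IsPrimeDivisor S β ∧ ∀ z : P.toSubring, (z : K) ∈ mI β ↔ y ∣ z := by
  have hPX := (I.closed P hP).1
  have hyx : ¬ y ∣ x := h.symm.reg.not_dvd
  have hm : ∀ z : P.toSubring, (P.toSubring ≤ β.toSubring → (z : K) ∈ mI β) ↔ y ∣ z := fun z => by
    rw [← mem_span_singleton, ← hy, mem_idealAt]
    simp
  have hPβ : P.toSubring ≤ β.toSubring := by
    by_contra hc
    exact hyx ((hm x).1 fun k => absurd k hc)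
  have hm' : ∀ z : P.toSubring, (z : K) ∈ mI β ↔ y ∣ z := fun z => by rw [← hm]; exact ⟨fun k _ => k, fun k => k hPβ⟩
  have := h.noeth
  have hc : contr hPβ = span {y} := by
    ext z
    rw [mem_contr, hm', mem_span_singleton]
  have d := dvr_ofPrime (contr hPβ) h.symm.reg.prime.ne_zero hc
  have hle := le_ofPrime P.toSubring (contr hPβ)
  have he : β = ofPrime P.toSubring (contr hPβ) := dvr_maximal (mem_or_inv_mem (h.base.trans hle))
    (le_iff_mI.1 (ofPrime_contr_le hPβ)).1 ((hm' y).2 dvd_rfl) h.right_ne_zero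
  have dβ : IsDiscreteValuationRing β.toSubring := he ▸ d
  have hβX : β ∈ s.surface := he ▸ I.modif.mem_of_isLocAt hPX (isLocAt_ofPrime _ _)
  refine ⟨hPβ, ?_, hm'⟩
  obtain ⟨T, hT, hTβ⟩ := isModification_S.exists_center (T := β) ⟨origin, origin_mem_S, h.base.trans hPβ⟩
  rcases cases_S hT with rfl | d' | hall
  · obtain ⟨V, hV, hβV⟩ := I.fibre β hβX hTβ
    have := (I.divisor V hV).2
    have h1 := eq_of_le_dvr (h.base.trans hPβ) hβV
    subst h1
    refine absurd ((hm' x).1 ?_) hyx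
    exact mem_idealAt.1 (hx ▸ mem_span_singleton_self x) V hV hPβ
  · rw [eq_of_le_dvr (isModification_S.base_le hT) (le_iff_mI.1 hTβ).1]
    exact ⟨hT, d'⟩
  · obtain ⟨z, hz, hz0⟩ := exists_mem_mI β
    exact absurd hz (notMem_mI_of_inv hz0 ((le_iff_mI.1 hTβ).1 (hall _)))

lemma right_notMem (I : Inv f₀ Ch s) (hP : P ∈ s.points) (h : SmoothAt P x y) (hx : idealAt P s.boundary = span {x})
    (hy : idealAt P {β} = span {y}) (hV : IsPrimeDivisor S V) (hVβ : V ≠ β)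
    (hPV : P.toSubring ≤ V.toSubring) : (y : K) ∉ mI V := by
  intro hyV
  obtain ⟨-, hβ, -⟩ := I.branch hP h hx hy
  refine hVβ (mem_of_idealAt (D := {β}) I.modif (I.closed P hP).1 (Set.finite_singleton β) ?_
    ⟨I.modif.mem_of_isPrimeDivisor hV, hV.2⟩ hPV fun z hz => ?_)
  · rintro V rfl
    exact ⟨I.modif.mem_of_isPrimeDivisor hβ, hβ.2⟩
  · rw [hy] at hz
    obtain ⟨c, rfl⟩ := mem_span_singleton.1 hz
    exact mul_mem_mI' hyV (hPV c.2)

end Inv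

/-- The data of a step of the algorithm, where the series `F P` are replaced by expansions of equations of the curve. -/
structure StepData (f₀ : R) (s : Stage) (B : LocalSubring K → LocalSubring K) (a b : ∀ P : LocalSubring K, P.toSubring)
    (F : LocalSubring K → R) : Prop where
  cross : ∀ P ∈ s.points, ∃ x y : P.toSubring, SmoothAt P x y ∧ idealAt P s.boundary = span {x} ∧
    idealAt P {B P} = span {y}
  pick : ∀ P ∈ s.points, IsCross P s.boundary (curve f₀) → B P ∈ curve f₀
  left : ∀ P ∈ s.continuing (curve f₀), idealAt P s.boundary = span {a P}
  right : ∀ P ∈ s.continuing (curve f₀), idealAt P {B P} = span {b P}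
  expansion : ∀ P ∈ s.continuing (curve f₀), ∃ (h : SmoothAt P (a P) (b P)) (f : P.toSubring), f ≠ 0 ∧
    idealAt P (curve f₀) = span {f} ∧ F P = h.exp f

lemma algebraMap_mem_idealAt {P : LocalSubring K} (h : RK ≤ P.toSubring) :
    (⟨algebraMap R K f₀, h ⟨f₀, rfl⟩⟩ : P.toSubring) ∈ idealAt P (curve f₀) :=
  mem_idealAt.2 fun _ hV _ => (mem_curve.1 hV).2

lemma Inv.exists_stepData (I : Inv f₀ Ch s) (hf : f₀ ≠ 0) {B : LocalSubring K → LocalSubring K} {s' : Stage}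
    (hs : IsStep (curve f₀) B s s') : ∃ a b F, StepData f₀ s B a b F ∧ s' = s.next (curve f₀) B a b F := by
  have key : ∀ P ∈ s.points, ∀ x y : P.toSubring, idealAt P s.boundary = span {x} →
      maximalIdeal P.toSubring = span {x, y} → SmoothAt P x y := by
    intro P hP x y hx hm
    obtain ⟨a, b, h, ha⟩ := I.smooth P hP
    exact h.of_span (Ideal.span_singleton_eq_span_singleton.1 (ha.symm.trans hx)) hm
  obtain ⟨h1, a, b, F, h2, rfl⟩ := hs
  refine ⟨a, b, F, ⟨fun P hP => ?_, fun P hP => (h1 P hP).2, fun P hP => (h2 P hP).1, fun P hP => (h2 P hP).2.1,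
    fun P hP => ?_⟩, rfl⟩
  · obtain ⟨x, y, hx, hy, hm⟩ := (h1 P hP).1
    exact ⟨x, y, key P hP x y hx hm, hx, hy⟩
  · obtain ⟨hx, hy, hm, f, hfC, hF⟩ := h2 P hP
    have h := key P hP.1 _ _ hx hm
    refine ⟨h, f, ?_, hfC, h.eq_exp_of_isExpansion hF⟩
    rintro rfl
    have h3 := algebraMap_mem_idealAt (f₀ := f₀) h.base
    rw [hfC, mem_span_singleton, zero_dvd_iff] at h3
    exact hf (algebraMap_injective ((congrArg Subtype.val h3).trans (map_zero _).symm))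

/-- The second branch is the curve itself where it forms a cross with the boundary, and elsewhere any coordinate axis. -/
lemma Inv.exists_step (I : Inv f₀ Ch s) (hf : f₀ ≠ 0) : ∃ B s', IsStep (curve f₀) B s s' := by
  classical
  have hloc : ∀ P ∈ s.points, ∀ V ∈ curve f₀, P.toSubring ≤ V.toSubring →
      IsLocAt P.toSubring V ∧ IsDiscreteValuationRing V.toSubring := fun P hP V hV hPV =>
    ⟨I.modif.isLocAt_of_le (I.closed P hP).1 (I.modif.mem_of_isPrimeDivisor (mem_curve.1 hV).1) hPV, (mem_curve.1 hV).1.2⟩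
  have hpt : ∀ P, ∃ (β : LocalSubring K) (x y : P.toSubring) (F : R), P ∈ s.points →
      IsCross P s.boundary {β} ∧ (IsCross P s.boundary (curve f₀) → β ∈ curve f₀) ∧
      (¬ IsCross P s.boundary (curve f₀) → IsNewtonData P s.boundary {β} (curve f₀) x y F) := by
    intro P
    by_cases hP : P ∈ s.points
    swap
    · exact ⟨P, 0, 0, 0, fun h => absurd h hP⟩
    obtain ⟨a, b, h, ha⟩ := I.smooth P hP
    by_cases hX : IsCross P s.boundary (curve f₀)
    · obtain ⟨β, hβ, hPβ⟩ := I.pass P hP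
      refine ⟨β, 0, 0, 0, fun _ => ⟨?_, fun _ => hβ, fun hc => absurd hX hc⟩⟩
      obtain ⟨x, y, hx, hy, hm⟩ := hX
      have hs := h.of_span (Ideal.span_singleton_eq_span_singleton.1 (ha.symm.trans hx)) hm
      refine ⟨x, y, hx, ?_, hm⟩
      obtain ⟨g, hg, hgβ⟩ := hs.exists_prime (hloc P hP β hβ hPβ).1 (hloc P hP β hβ hPβ).2
      have hyg : Associated g y := by
        refine (hg.irreducible.dvd_irreducible_iff_associated hs.symm.reg.prime.irreducible).1 ((hgβ y).1 ?_)
        exact mem_idealAt.1 (hy ▸ mem_span_singleton_self y) β hβ hPβ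
      rw [Ideal.span_singleton_eq_span_singleton.2 hyg.symm]
      ext z
      rw [mem_idealAt, mem_span_singleton, ← hgβ]
      simp [hPβ]
    · obtain ⟨f, hfC⟩ := h.exists_idealAt_eq_span (finite_curve hf) (hloc P hP)
      have hp : (span {b}).IsPrime := (Ideal.span_singleton_prime h.symm.reg.prime.ne_zero).2 h.symm.reg.prime
      have hb : idealAt P {ofPrime P.toSubring (span {b})} = span {b} := by
        ext z
        rw [mem_idealAt]
        simp [le_ofPrime, mem_mI_ofPrime z.2]
      exact ⟨ofPrime P.toSubring (span {b}), a, b, h.exp f, fun _ => ⟨⟨a, b, ha, hb, h.reg.span⟩,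
        fun hc => absurd hc hX, fun _ => ⟨ha, hb, h.reg.span, f, hfC, h.isExpansion_exp f⟩⟩⟩
  choose B a b F hB using hpt
  exact ⟨B, _, fun P hP => ⟨(hB P hP).1, (hB P hP).2.1⟩, a, b, F, fun P hP => (hB P hP.1).2.2 hP.2, rfl⟩

/-! ### The invariants are preserved by the steps -/

namespace StepData
variable {f₀ : R} {Ch : Set (LocalSubring K)} {s : Stage} {B : LocalSubring K → LocalSubring K}
  {a b : ∀ P : LocalSubring K, P.toSubring} {F : LocalSubring K → R} {P Q V : LocalSubring K}

lemma divisor (N : StepData f₀ s B a b F) (I : Inv f₀ Ch s) : ∀ V ∈ s.boundary ∪ B '' s.points, IsPrimeDivisor s.surface V := by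
  rintro V (hV | ⟨P, hP, rfl⟩)
  · exact I.divisor V hV
  · obtain ⟨x, y, h, hx, hy⟩ := N.cross P hP
    obtain ⟨-, hβ, -⟩ := I.branch hP h hx hy
    exact ⟨I.modif.mem_of_isPrimeDivisor hβ, hβ.2⟩

lemma eq_of_le (N : StepData f₀ s B a b F) (I : Inv f₀ Ch s) (hP : P ∈ s.points) (hQ : IsClosedPoint s.surface Q)
    (hQP : Q.toSubring ≤ (B P).toSubring) : Q = P := by
  obtain ⟨x, y, h, hx, hy⟩ := N.cross P hP
  obtain ⟨h1, hβ, -⟩ := I.branch hP h hx hy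
  exact I.modif.closedPoint_unique hβ hQ (I.closed P hP) hQP h1

lemma mem_idealAt (N : StepData f₀ s B a b F) (I : Inv f₀ Ch s) (hP : P ∈ s.points) {x y : P.toSubring}
    (hx : idealAt P s.boundary = span {x}) (hy : idealAt P {B P} = span {y}) (z : P.toSubring) :
    z ∈ idealAt P (s.boundary ∪ B '' s.points) ↔ x ∣ z ∧ y ∣ z := by
  rw [← mem_span_singleton, ← mem_span_singleton, ← hx, ← hy]
  simp only [ToroidalRes.mem_idealAt]
  constructor
  · exact fun k => ⟨fun V hV => k V (Or.inl hV), fun V hV => k V (Or.inr ⟨P, hP, hV.symm⟩)⟩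
  · rintro ⟨k1, k2⟩ V (hV | ⟨P', hP', rfl⟩) hPV
    · exact k1 V hV hPV
    · obtain rfl := N.eq_of_le I hP' (I.closed P hP) hPV
      exact k2 _ rfl hPV

variable (f₀) in
lemma isModification (N : StepData f₀ s B a b F) (I : Inv f₀ Ch s) (hf : f₀ ≠ 0) :
    IsModification (s.nextSurface (curve f₀) a b F) := by
  refine isModification_newton I.modif ((I.finite_points hf).subset fun P hP => hP.1) (fun P hP => I.closed P hP.1)
    (fun P hP => (N.expansion P hP).choose) fun P hP => ?_
  obtain ⟨h, f, hf, -, hF⟩ := N.expansion P hP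
  rw [hF]
  exact fun h0 => hf (h.exp_injective (h0.trans (map_zero _).symm))

lemma mem_surface (N : StepData f₀ s B a b F) (hV : IsPrimeDivisor s.surface V) :
    V ∈ s.nextSurface (curve f₀) a b F := by
  refine Or.inl ⟨hV.1, fun hP => ?_⟩
  obtain ⟨h, -⟩ := N.expansion V hP
  exact h.not_dvr hV.2

lemma subset_boundary (N : StepData f₀ s B a b F) (I : Inv f₀ Ch s) :
    s.boundary ∪ B '' s.points ⊆ (s.next (curve f₀) B a b F).boundary := fun V hV =>
  have h := N.divisor I V hV
  ⟨⟨N.mem_surface h, h.2⟩, N.mem_surface h, V, h.1, le_rfl, h.1, V, hV, le_rfl⟩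

/-- Away from the modified points, the boundary is only completed by the chosen branches. -/
lemma boundary_iff (N : StepData f₀ s B a b F) (I : Inv f₀ Ch s) (hf : f₀ ≠ 0) (hP : P ∈ s.surface)
    (hPZ : P ∉ s.continuing (curve f₀)) (hPV : P.toSubring ≤ V.toSubring) :
    V ∈ (s.next (curve f₀) B a b F).boundary ↔ V ∈ s.boundary ∪ B '' s.points := by
  have hfin : (s.boundary ∪ B '' s.points).Finite := I.finite.union ((I.finite_points hf).image B)
  refine ⟨fun hV => ?_, fun hV => N.subset_boundary I hV⟩
  obtain ⟨hV, hpre⟩ := hV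
  have hl := (N.isModification f₀ I hf).isLocAt_of_le (Or.inl ⟨hP, hPZ⟩) hV.1 hPV
  exact mem_of_idealAt I.modif hP hfin (N.divisor I) ⟨I.modif.mem_of_isLocAt hP hl, hV.2⟩ hPV
    ((mem_preimage_iff I.modif hP hfin hPV).1 hpre).2

lemma isBoundaryGerm (N : StepData f₀ s B a b F) (I : Inv f₀ Ch s) (hf : f₀ ≠ 0) (hP : P ∈ s.continuing (curve f₀)) (hPQ : P ≤ Q) :
    IsBoundaryGerm (s.nextSurface (curve f₀) a b F) (a P) (b P) Q (s.next (curve f₀) B a b F).boundary := by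
  intro V hQV
  have hPV := (le_iff_mI.1 hPQ).1.trans hQV
  have hfin : (s.boundary ∪ B '' s.points).Finite := I.finite.union ((I.finite_points hf).image B)
  have hm := N.mem_idealAt I hP.1 (N.left P hP) (N.right P hP)
  refine and_congr_right fun hV => (mem_preimage_iff I.modif (I.closed P hP.1).1 hfin hPV).trans ⟨fun k => ?_, fun k => ⟨hV.1, fun x hx => ?_⟩⟩
  · exact (mI_mul_iff (hPV (a P).2) (hPV (b P).2)).1 (k.2 (a P * b P) ((hm _).2 ⟨dvd_mul_right _ _, dvd_mul_left _ _⟩))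
  · obtain ⟨⟨c, rfl⟩, ⟨d, hd⟩⟩ := (hm x).1 hx
    rcases k with k | k
    · exact mul_mem_mI' k (hPV c.2)
    · rw [hd]
      exact mul_mem_mI' k (hPV d.2)

/-- A point above a modified point `P` is a fixed point of a chart, through which no branch of the curve other than `B P` passes,
or a closed point in the interior of an exceptional component, or the generic point of such a component. -/
lemma cases (N : StepData f₀ s B a b F) (I : Inv f₀ Ch s) (hf : f₀ ≠ 0) (hQ : Q ∈ s.nextSurface (curve f₀) a b F) :
    (Q ∈ s.surface ∧ Q ∉ s.continuing (curve f₀)) ∨ ∃ P ∈ s.continuing (curve f₀), P ≤ Q ∧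
      ((IsIntegrallyClosed Q.toSubring ∧ HasToricChart Q (s.next (curve f₀) B a b F).boundary ∧
        (∃ V ∈ (s.next (curve f₀) B a b F).boundary, Q.toSubring ≤ V.toSubring) ∧
        (∀ V ∈ curve f₀, Q.toSubring ≤ V.toSubring → V = B P) ∧ ¬ IsDiscreteValuationRing Q.toSubring ∧
        IsClosedPoint (s.nextSurface (curve f₀) a b F) Q) ∨
      (∃ (w w₂ n : ℤ × ℤ) (e : EdgeBasis w w₂ n (-w.2, w.1)) (h : SmoothAt P (a P) (b P)) (hPQ : P ≤ Q)
        (hl : IsLocAt (monRing P.toSubring (a P) (b P) w w) Q) (c : ℂ)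
        (hzc : mon (a P : K) (b P) (-w.2, w.1) - algebraMap ℂ K c ∈ mI Q),
        SmoothAt Q ⟨mon (a P : K) (b P) n, (e.u_mem h hPQ hl).1⟩ ⟨mon (a P : K) (b P) (-w.2, w.1) - algebraMap ℂ K c, hzc.1⟩ ∧
        idealAt Q (s.next (curve f₀) B a b F).boundary = span {⟨mon (a P : K) (b P) n, (e.u_mem h hPQ hl).1⟩} ∧
        (∃ V ∈ (s.next (curve f₀) B a b F).boundary, Q.toSubring ≤ V.toSubring)) ∨
      (IsDiscreteValuationRing Q.toSubring ∧ ¬ IsClosedPoint (s.nextSurface (curve f₀) a b F) Q ∧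
        Q ∈ (s.next (curve f₀) B a b F).boundary)) := by
  have hX := N.isModification f₀ I hf
  rcases id hQ with hQ' | hQ'
  · exact Or.inl hQ'
  simp only [Set.mem_iUnion] at hQ'
  obtain ⟨P, hP, hQP⟩ := hQ'
  obtain ⟨h, f, hf', hfC, hF⟩ := N.expansion P hP
  have hPQ := hQP.1
  have hD := N.isBoundaryGerm I hf hP hPQ
  rw [hF] at hQP
  refine Or.inr ⟨P, hP, hPQ, ?_⟩
  rcases newtonFiber_cases h hQP with ⟨w₁, w₂, hN, hT⟩ | ⟨w, hw, w₂, n, e, hl, ⟨c, hc, hzc⟩ | hd⟩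
  · have c1 := (newtonFanRays_nonneg hN.1).2.2
    have c2 := (newtonFanRays_nonneg hN.2.1).2.2
    obtain ⟨h1, h2⟩ := hT.chart c1 c2 hX hQ hD
    refine Or.inl ⟨hT.isIntegrallyClosed, h1, h2, fun V hV hQV => ?_, hT.not_dvr c1 c2, hX.isClosedPoint hQ hT.res⟩
    -- the strict transforms of the branches avoid the fixed points, since a vertex of the polygon is minimal there
    have hPV := (le_iff_mI.1 hPQ).1.trans hQV
    by_contra hne
    obtain ⟨e, he, y, hy, hfe⟩ := h.eq_chi_mul_unit hf' hN hT ((le_iff_mI.1 hPQ).1 f.2)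
    have hfV : (f : K) ∈ mI V := ToroidalRes.mem_idealAt.1 (hfC ▸ mem_span_singleton_self f) V hV hPV
    have h3 : (f : K) = hT.chi e * y := congrArg Subtype.val hfe
    rw [h3, mI_mul_iff (hQV (Subtype.prop _)) (hQV (Subtype.prop _)), or_iff_left] at hfV
    · have hVS := (mem_curve.1 hV).1
      rcases hT.mem_or_of_mem c1 c2 hVS.2 (hX.isLocAt_of_le hQ (hX.mem_of_isPrimeDivisor hVS) hQV) he hfV with h4 | h4
      · exact I.left_notMem hP.1 (N.left P hP) hV hPV h4
      · exact I.right_notMem hP.1 h (N.left P hP) (N.right P hP) hVS hne hPV h4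
    · obtain ⟨h4, h5⟩ := isUnit_iff_inv_mem.1 hy
      exact notMem_mI_of_inv h4 (hQV h5)
  · exact Or.inr (Or.inl ⟨w, w₂, n, e, h, hPQ, hl, c, hzc, e.smoothAt h hPQ hl hc hzc, e.idealAt_eq h hPQ hl hc hzc hX hQ hD⟩)
  · refine Or.inr (Or.inr ⟨hd, e.not_isClosedPoint h hPQ hl hd hX, (hD Q le_rfl).2 ⟨⟨hQ, hd⟩, Or.inl ?_⟩⟩)
    exact (le_iff_mI.1 hPQ).2 _ (coe_mem_mI.2 h.reg.mem_left)

/-- No branch of the curve is an exceptional component. -/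
lemma not_dvr (N : StepData f₀ s B a b F) (I : Inv f₀ Ch s) (hP : P ∈ s.continuing (curve f₀)) (hPQ : P ≤ Q)
    (hV : V ∈ curve f₀) (hQV : Q.toSubring ≤ V.toSubring) : ¬ IsDiscreteValuationRing Q.toSubring := by
  intro d
  have := (mem_curve.1 hV).1.2
  obtain ⟨h, -⟩ := N.expansion P hP
  have hb := h.base.trans (le_iff_mI.1 hPQ).1
  have hVQ := eq_of_le_dvr hb hQV
  refine I.left_notMem hP.1 (N.left P hP) hV ((le_iff_mI.1 hPQ).1.trans hQV) ?_
  rw [hVQ]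
  exact (le_iff_mI.1 hPQ).2 _ (coe_mem_mI.2 h.reg.mem_left)

/-- The new points are smooth, and the new boundary is there a smooth branch. -/
lemma point (N : StepData f₀ s B a b F) (I : Inv f₀ Ch s) (hf : f₀ ≠ 0) (hQ : Q ∈ (s.next (curve f₀) B a b F).points) :
    ∃ P ∈ s.continuing (curve f₀), ∃ (w w₂ n : ℤ × ℤ) (e : EdgeBasis w w₂ n (-w.2, w.1)) (h : SmoothAt P (a P) (b P)) (hPQ : P ≤ Q)
        (hl : IsLocAt (monRing P.toSubring (a P) (b P) w w) Q) (c : ℂ)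
        (hzc : mon (a P : K) (b P) (-w.2, w.1) - algebraMap ℂ K c ∈ mI Q),
        SmoothAt Q ⟨mon (a P : K) (b P) n, (e.u_mem h hPQ hl).1⟩ ⟨mon (a P : K) (b P) (-w.2, w.1) - algebraMap ℂ K c, hzc.1⟩ ∧
        idealAt Q (s.next (curve f₀) B a b F).boundary = span {⟨mon (a P : K) (b P) n, (e.u_mem h hPQ hl).1⟩} := by
  obtain ⟨hcl, P, hP, hPQ, V, hV, hVP, hQV⟩ := hQ
  have hPX := (I.closed P hP.1).1
  rcases N.cases I hf hcl.1 with ⟨h1, h2⟩ | ⟨P', hP', hPQ', hT | ⟨w, w₂, n, e, h, h1, hl, c, hzc, h2, h3, -⟩ | hd⟩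
  · exact absurd hP (I.modif.eq_of_le hPX h1 hPQ le_rfl ▸ h2)
  · have := I.modif.eq_of_le hPX (I.closed P' hP'.1).1 hPQ hPQ'
    subst this
    exact absurd (hT.2.2.2.1 V hV hQV) hVP
  · exact ⟨P', hP', w, w₂, n, e, h, h1, hl, c, hzc, h2, h3⟩
  · exact absurd hcl hd.2.1

lemma notMem (N : StepData f₀ s B a b F) (I : Inv f₀ Ch s) (hf : f₀ ≠ 0) (hQ : Q ∈ (s.next (curve f₀) B a b F).points)
    (hV : V ∈ (s.next (curve f₀) B a b F).boundary) (hQV : Q.toSubring ≤ V.toSubring) : V ∉ curve f₀ := by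
  intro hVC
  obtain ⟨P, hP, w, w₂, n, e, h, hPQ, hl, -⟩ := N.point I hf hQ
  have h1 := ((N.isBoundaryGerm I hf hP hPQ V hQV).1 hV).2
  refine I.left_notMem hP.1 (N.left P hP) hVC ((le_iff_mI.1 hPQ).1.trans hQV) ?_
  have h2 := e.mon_mem_iff h hl hQV (m := (1, 0)) (by simpa [wdot] using e.pos₁)
  have h3 := e.mon_mem_iff h hl hQV (m := (0, 1)) (by simpa [wdot] using e.pos₂)
  rw [mon_left] at h2
  rw [mon_right] at h3
  exact h1.elim id fun h4 => h2.2 (h3.1 h4)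

lemma inv_next (N : StepData f₀ s B a b F) (I : Inv f₀ Ch s) (hf : f₀ ≠ 0)
    (hCh : ∀ P ∈ s.continuing (curve f₀), B P ∈ curve f₀ → B P ∈ Ch) : Inv f₀ Ch (s.next (curve f₀) B a b F) where
  modif := N.isModification f₀ I hf
  normal Q hQ := by
    rcases N.cases I hf hQ with ⟨h1, -⟩ | ⟨P, -, -, hT | ⟨w, w₂, n, e, h, h1, hl, c, hzc, h2, -⟩ | hd⟩
    · exact I.normal Q h1
    · exact hT.1
    · exact h2.isIntegrallyClosed
    · have := hd.1
      infer_instance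
  finite := by
    have hc : (s.continuing (curve f₀)).Finite := (I.finite_points hf).subset fun P hP => hP.1
    refine ((I.finite.union ((I.finite_points hf).image B)).union (hc.biUnion (t := fun P => {V | V ∈ newtonFiber P (a P) (b P) (F P) ∧ IsDiscreteValuationRing V.toSubring})
      fun P hP => ?_)).subset fun V hV => ?_
    · obtain ⟨h, f, hf', -, hF⟩ := N.expansion P hP
      rw [hF]
      exact finite_dvr_newtonFiber h hf'
    · rcases hV.1.1 with h1 | h1
      · exact Or.inl ((N.boundary_iff I hf h1.1 h1.2 le_rfl).1 hV)
      · simp only [Set.mem_iUnion] at h1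
        obtain ⟨P, hP, h1⟩ := h1
        exact Or.inr (Set.mem_biUnion hP ⟨h1, hV.1.2⟩)
  divisor V hV := hV.1
  closed Q hQ := hQ.1
  smooth Q hQ := by
    obtain ⟨P, hP, w, w₂, n, e, h, hPQ, hl, c, hzc, h1, h2⟩ := N.point I hf hQ
    exact ⟨_, _, h1, h2⟩
  notMem Q hQ V hV hQV := N.notMem I hf hQ hV hQV
  pass Q hQ := by
    obtain ⟨-, P, -, -, V, hV, -, hQV⟩ := hQ
    exact ⟨V, hV, hQV⟩
  chart Q hQ hQp := by
    rcases N.cases I hf hQ.1 with ⟨h1, h2⟩ | ⟨P, -, -, hT | ⟨w, w₂, n, e, h, hPQ, hl, c, hzc, hs, h3, -⟩ | hd⟩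
    · have hcl := hQ.of_mem I.modif (N.isModification f₀ I hf) h1
      by_cases hQs : Q ∈ s.points
      · obtain ⟨x, y, h, hx, hy⟩ := N.cross Q hQs
        refine h.hasToricChart Set.univ fun z => ?_
        rw [idealAt_congr fun V hV => N.boundary_iff I hf h1 h2 hV, N.mem_idealAt I hQs hx hy]
        simp
      · refine hasToricChart_congr (idealAt_congr fun V hQV => ?_) (I.chart Q hcl hQs)
        rw [N.boundary_iff I hf h1 h2 hQV]
        refine ⟨Or.inl, fun hV => hV.resolve_right ?_⟩
        rintro ⟨P, hP, rfl⟩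
        exact hQs (N.eq_of_le I hP hcl hQV ▸ hP)
    · exact hT.2.1
    · refine hs.hasToricChart {0} fun z => ?_
      rw [h3, mem_span_singleton]
      simp
    · exact absurd hQ hd.2.1
  fibre Q hQ hoQ := by
    rcases N.cases I hf hQ with ⟨h1, -⟩ | ⟨P, -, -, hT | ⟨w, w₂, n, e, h, hPQ, hl, c, hzc, hs, -, h3⟩ | hd⟩
    · obtain ⟨V, hV, hQV⟩ := I.fibre Q h1 hoQ
      exact ⟨V, N.subset_boundary I (Or.inl hV), hQV⟩
    · exact hT.2.2.1
    · exact h3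
    · exact ⟨Q, hd.2.2, le_rfl⟩
  strict V hV := by
    have hX := N.isModification f₀ I hf
    have hVS := (mem_curve.1 hV).1
    have := hVS.2
    rcases I.strict V hV with h1 | ⟨P, hP, hPV⟩
    · exact Or.inl (N.subset_boundary I (Or.inl h1))
    by_cases hVB : V = B P
    · exact Or.inl (N.subset_boundary I (Or.inr ⟨P, hP, hVB.symm⟩))
    have hPc : P ∈ s.continuing (curve f₀) := by
      refine ⟨hP, fun hX => hVB ?_⟩
      -- at a point where the curve and the boundary form a cross, only one branch passes
      obtain ⟨x, y, h, hx, hy⟩ := N.cross P hP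
      obtain ⟨hPβ, hβ, hβm⟩ := I.branch hP h hx hy
      obtain ⟨x', y', hx', hy', hm⟩ := id hX
      have hs := h.of_span (Ideal.span_singleton_eq_span_singleton.1 (hx.symm.trans hx')) hm
      have key : ∀ W ∈ curve f₀, P.toSubring ≤ W.toSubring → IsLocAt P.toSubring W ∧ ∀ z : P.toSubring, (z : K) ∈ mI W ↔ y' ∣ z := by
        intro W hW hPW
        have hWS := (mem_curve.1 hW).1
        have hl := I.modif.isLocAt_of_le (I.closed P hP).1 (I.modif.mem_of_isPrimeDivisor hWS) hPW
        obtain ⟨g, hg, hgW⟩ := hs.exists_prime hl hWS.2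
        refine ⟨hl, fun z => ?_⟩
        rw [hgW]
        refine ((hg.irreducible.dvd_irreducible_iff_associated hs.symm.reg.prime.irreducible).1 ((hgW y').1 ?_)).dvd_iff_dvd_left
        exact ToroidalRes.mem_idealAt.1 (hy' ▸ mem_span_singleton_self y') W hW hPW
      have k1 := key V hV hPV
      have k2 := key (B P) (N.pick P hP hX) hPβ
      exact k1.1.ext k2.1 fun z hz => (k1.2 ⟨z, hz⟩).trans (k2.2 ⟨z, hz⟩).symm
    -- the center of the composition of the valuation of `V` with the germ at `P` of the branch
    obtain ⟨W, hPW, hWV⟩ := exists_dominating_le (mem_or_inv_mem (I.modif.base_le (I.closed P hP).1 |>.trans hPV)) hPV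
    obtain ⟨h0, -⟩ := N.expansion P hPc
    obtain ⟨Q, hQ, hQW⟩ := hX.exists_valuation_center (h0.origin_le.trans hPW)
    have hQV := (le_iff_mI.1 hQW).1.trans hWV
    have hPX := (I.closed P hP).1
    rcases N.cases I hf hQ with ⟨h1, h2⟩ | ⟨P', hP', hPQ', h3⟩
    · exact absurd hPc (I.modif.eq_of_le hPX h1 hPW hQW ▸ h2)
    have := I.modif.eq_of_le hPX (I.closed P' hP'.1).1 hPW (hPQ'.trans hQW)
    subst this
    rcases h3 with hT | ⟨w, w₂, n, e, h, hPQ, hl, c, hzc, hs, -⟩ | hd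
    · exact absurd (hT.2.2.2.1 V hV hQV) hVB
    · exact Or.inr ⟨Q, ⟨hX.isClosedPoint hQ hs.res, P, hPc, hPQ', V, hV, hVB, hQV⟩, hQV⟩
    · exact absurd hd.1 (N.not_dvr I hPc hPQ' hV hQV)
  sing Q hQ := by
    rcases N.cases I hf hQ with ⟨h1, -⟩ | ⟨P, hP, -, hT | ⟨w, w₂, n, e, h, hPQ, hl, c, hzc, hs, -⟩ | hd⟩
    · exact I.sing Q h1
    · refine Or.inr fun V hV hQV => ?_
      have hVB := hT.2.2.2.1 V hV hQV
      rw [hVB] at hV ⊢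
      exact hCh P hP hV
    · exact Or.inl hs.isRegularLocalRing
    · exact Or.inl (isRegularLocalRing_dvr hd.1)

end StepData

lemma inv_initial {f₀ l x : R} (hl : RegPair l x) (hf : f₀ ∈ maximalIdeal R) (hf0 : f₀ ≠ 0) (hlf : ¬ l ∣ f₀)
    (Ch : Set (LocalSubring K)) : Inv f₀ Ch (initialStage (curve l)) := by
  have h := smoothAt_origin hl
  have hcl : ∀ P, IsClosedPoint S P → P = origin := fun P hP =>
    (hP.2 origin origin_mem_S (isModification_S.base_le hP.1)).symm
  constructor
  · exact isModification_S
  · exact fun P hP => have := h.isIntegrallyClosed; isIntegrallyClosed_of_isLocAt (A := origin.toSubring) (mem_S.1 hP)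
  · exact finite_curve hl.prime.ne_zero
  · exact fun V hV => (mem_curve.1 hV).1
  · rintro P rfl
    exact isModification_S.isClosedPoint origin_mem_S h.res
  · rintro P rfl
    exact ⟨_, _, h, idealAt_curve hl⟩
  · rintro P rfl V hV - hV'
    obtain ⟨hVS, hlV⟩ := mem_curve.1 hV
    obtain ⟨g, hg, hgV⟩ := hVS.exists_prime
    have hgl := (hg.irreducible.dvd_irreducible_iff_associated hl.prime.irreducible).1 ((hgV l).1 hlV)
    exact hlf (hgl.symm.dvd.trans ((hgV f₀).1 (mem_curve.1 hV').2))
  · rintro P rfl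
    obtain ⟨V, hV⟩ := nonempty_curve hf hf0
    exact ⟨V, hV, (mem_curve.1 hV).1.origin_le⟩
  · exact fun P hP hP' => absurd (hcl P hP) hP'
  · intro P hP hoP
    obtain rfl := isModification_S.eq_of_le origin_mem_S hP hoP le_rfl
    obtain ⟨V, hV⟩ := nonempty_curve hl.mem_left hl.prime.ne_zero
    exact ⟨V, hV, (mem_curve.1 hV).1.origin_le⟩
  · exact fun V hV => Or.inr ⟨origin, rfl, (mem_curve.1 hV).1.origin_le⟩
  · intro P hP
    left
    rcases cases_S hP with rfl | d | hall
    · exact h.isRegularLocalRing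
    · exact isRegularLocalRing_dvr d
    · exact isRegularLocalRing_of_forall_mem hall

/-! ### Decrease of the complexity -/

variable {f₀ : R} {Ch : Set (LocalSubring K)} {s : Stage} {B : LocalSubring K → LocalSubring K}
  {a b : ∀ P : LocalSubring K, P.toSubring} {F : LocalSubring K → R} {P Q : LocalSubring K}

/-- The measure of the complexity of a stage at a point: the intersection number `μ.1` of the boundary with the strict
transform of the curve, and the gap `μ.2` in the inequality `Compares.le`. -/
def HasMeasure (D : Derivation ℤ K K) (f₀ l : R) (N : ℕ) (s : Stage) (P : LocalSubring K) (μ : ℕ × ℕ) : Prop :=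
  ∃ (a b g : P.toSubring) (h M j : ℕ), SmoothAt P a b ∧ idealAt P s.boundary = span {a} ∧
    idealAt P (curve f₀) = span {g} ∧ Compares D (algebraMap R K f₀) (algebraMap R K l) a g h M j ∧
    HasOrder a b g μ.1 ∧ μ.2 + h = N * j + M

lemma exists_curve_eq_span (hf : f₀ ≠ 0) {X : Set (LocalSubring K)} (hX : IsModification X) (hP : P ∈ X) {x y : P.toSubring}
    (h : SmoothAt P x y) : ∃ g, idealAt P (curve f₀) = span {g} :=
  h.exists_idealAt_eq_span (finite_curve hf) fun _ hV hPV =>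
    ⟨hX.isLocAt_of_le hP (hX.mem_of_isPrimeDivisor (mem_curve.1 hV).1) hPV, (mem_curve.1 hV).1.2⟩

/-- The measure decreases, with respect to the lexicographic order: the intersection number does not increase, and when it
stays the same the slope is an integer `w.2` and the order of the curve along the boundary increases by a multiple `t ≥ 2 * w.2`,
whereas its bound increases by `w.2`. -/
lemma StepData.exists_measure_lt (H : StepData f₀ s B a b F) (I : Inv f₀ Ch s) (hf : f₀ ≠ 0) {D : Derivation ℤ K K} {l : R} {N : ℕ}
    {A C : R} (hN : algebraMap R K l ^ N = algebraMap R K A * algebraMap R K f₀ + algebraMap R K C * D (algebraMap R K f₀))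
    (hQ : Q ∈ (s.next (curve f₀) B a b F).points) :
    ∃ P ∈ s.points, ∀ μ, HasMeasure D f₀ l N s P μ →
      ∃ μ', HasMeasure D f₀ l N (s.next (curve f₀) B a b F) Q μ' ∧ toLex μ' < toLex μ := by
  obtain ⟨P, hP, w, w₂, n, e, hs, hPQ, hl, c, hzc, hsQ, hbd⟩ := H.point I hf hQ
  refine ⟨P, hP.1, ?_⟩
  rintro ⟨k, m⟩ ⟨a₁, b₁, g, h, M, j, hs₁, ha₁, hg, hcomp, hord, hgap⟩
  have := hs.noeth
  have := hsQ.noeth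
  have haa : Associated a₁ (a P) := Ideal.span_singleton_eq_span_singleton.1 (ha₁.symm.trans (H.left P hP))
  have hord' := hord.congr hs₁.reg hs.reg haa
  obtain ⟨t, k', f', hgf, hord₁, hk', heq⟩ := e.exists_strict hs hPQ hl hzc hord'
  have hcomp' := (hcomp.congr haa dvd_rfl).strict e hs hPQ hl (u := ⟨_, (e.u_mem hs hPQ hl).1⟩) rfl hgf
  obtain ⟨g', hg'⟩ := exists_curve_eq_span hf (H.isModification f₀ I hf) hQ.1.1 hsQ
  have hdvd : g' ∣ f' := by
    rw [← mem_span_singleton, ← hg', ToroidalRes.mem_idealAt]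
    intro V hV hQV
    have hPV := (le_iff_mI.1 hPQ).1.trans hQV
    have h1 : (g : K) ∈ mI V := ToroidalRes.mem_idealAt.1 (hg ▸ mem_span_singleton_self g) V hV hPV
    have hu := hQV (e.u_mem hs hPQ hl).1
    rw [hgf, mI_mul_iff (pow_mem hu t) (hQV f'.2)] at h1
    refine h1.resolve_left fun h2 => I.left_notMem hP.1 (H.left P hP) hV hPV ?_
    have h3 : mon (a P : K) (b P) n ∈ mI V := by
      by_cases ht : t = 0
      · rw [ht, pow_zero] at h2
        exact absurd h2 (one_notMem_mI V)
      · exact (mI_pow_iff hu ht).1 h2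
    have h4 := (e.mon_mem_iff hs hl hQV (m := (1, 0)) (by simpa [wdot] using e.pos₁)).2 h3
    rwa [mon_left] at h4
  obtain ⟨r, rfl⟩ := id hdvd
  obtain ⟨k'', hk'', hord₂⟩ := hord₁.of_mul hsQ.reg
  have hcomp'' := hcomp'.congr (Associated.refl _) hdvd
  have hle := hcomp''.le hsQ.reg.mem_left hsQ.left_ne_zero (hsQ.base ⟨A, rfl⟩) (hsQ.base ⟨C, rfl⟩) hN
  refine ⟨(k'', N * (w.1.toNat * j) + (w.1.toNat * M + w.2.toNat) - (w.1.toNat * h + t)),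
    ⟨_, _, g', _, _, _, hsQ, hbd, hg', hcomp'', hord₂, Nat.sub_add_cancel hle⟩, ?_⟩
  rw [Prod.Lex.toLex_lt_toLex]
  rcases lt_or_eq_of_le (hk''.trans hk') with hlt | rfl
  · exact Or.inl hlt
  refine Or.inr ⟨rfl, ?_⟩
  have hk : k' = k'' := le_antisymm hk' hk''
  -- the curve passes through `P`, and does not form a cross with the boundary
  have hk0 : k'' ≠ 0 := by
    rintro rfl
    obtain ⟨V, hV, hPV⟩ := I.pass P hP.1
    have h1 : (g : K) ∈ mI V := ToroidalRes.mem_idealAt.1 (hg ▸ mem_span_singleton_self g) V hV hPV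
    obtain ⟨h2, h3⟩ := isUnit_iff_inv_mem.1 (hord'.isUnit hs.reg)
    exact notMem_mI_of_inv h2 (hPV h3) h1
  have hk1 : k'' ≠ 1 := by
    rintro rfl
    exact hP.2 ⟨_, g, H.left P hP, hg, hord'.span_eq hs.reg⟩
  obtain ⟨hw1, ht⟩ := heq hk (Nat.pos_of_ne_zero hk0)
  have hw2 := e.pos₂
  obtain ⟨v, hv⟩ := Int.eq_ofNat_of_zero_le hw2.le
  have ht' : t = k'' * v := by rw [hv] at ht; exact_mod_cast ht
  have hv0 : 0 < v := by rw [hv] at hw2; exact_mod_cast hw2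
  have h2 : 2 * v ≤ k'' * v := Nat.mul_le_mul_right v (by omega)
  have hvt : w.2.toNat = v := by rw [hv, Int.toNat_natCast]
  have h1t : w.1.toNat = 1 := by rw [hw1, Int.toNat_one]
  simp only [h1t, hvt, one_mul] at hle ⊢
  simp only at hgap
  omega

lemma exists_measure_initial {l x : R} (hl : RegPair l x) (hf0 : f₀ ≠ 0) (hlf : ¬ l ∣ f₀) {d : Derivation ℤ R R} (hd : d l = 0)
    {D : Derivation ℤ K K} (hD : ∀ r, D (algebraMap R K r) = algebraMap R K (d r)) (N : ℕ) :
    ∃ μ, HasMeasure D f₀ l N (initialStage (curve l)) origin μ := by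
  have h := smoothAt_origin hl
  have := h.noeth
  obtain ⟨g, hg⟩ := exists_curve_eq_span hf0 isModification_S origin_mem_S h
  have hdvd : g ∣ originEquiv f₀ := by
    rw [← mem_span_singleton, ← hg]
    exact algebraMap_mem_idealAt h.base
  have hlg : ¬ originEquiv l ∣ g := fun h1 => hlf ((map_dvd_iff originEquiv).1 (h1.trans hdvd))
  obtain ⟨k, e, he, hk⟩ := h.reg.exists_order hlg
  have hc : Compares D (algebraMap R K f₀) (algebraMap R K l) (originEquiv l) (originEquiv f₀) 0 0 1 :=
    { curve := ⟨1, one_mem _, by rw [pow_zero, one_mul, mul_one, coe_originEquiv]⟩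
      pole := by
        rintro _ ⟨r, rfl⟩
        exact ⟨d r, by rw [pow_zero, one_mul, hD]⟩
      tangent := ⟨0, zero_mem _, by rw [coe_originEquiv, hD, hd, map_zero, mul_zero, mul_zero]⟩
      boundary := ⟨1, one_mem _, by rw [inv_one]; exact one_mem _, one_ne_zero, by rw [pow_one, mul_one, coe_originEquiv]⟩ }
  exact ⟨(k, N * 1 + 0), _, _, g, 0, 0, 1, h, idealAt_curve hl, hg, hc.congr (Associated.refl _) hdvd, ⟨e, he, hk⟩, rfl⟩

variable {l : R} {B : ℕ → LocalSubring K → LocalSubring K} {s : ℕ → Stage}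

lemma IsExecution.inv {x : R} (hl : RegPair l x) (hf : f₀ ∈ maximalIdeal R) (hf0 : f₀ ≠ 0) (hlf : ¬ l ∣ f₀)
    (E : IsExecution (curve f₀) (curve l) B s) (k : ℕ) : Inv f₀ (chosenBranches (curve f₀) B s) (s k) := by
  induction k with
  | zero => exact E.init ▸ inv_initial hl hf hf0 hlf _
  | succ k I =>
    obtain ⟨a, b, F, H, hs⟩ := I.exists_stepData hf0 (E.step k)
    rw [hs]
    exact H.inv_next I hf0 fun P hP hB => ⟨hB, k, P, hP, rfl⟩

lemma IsExecution.exists_points_eq_empty (hl : l ∈ maximalIdeal R) (hl' : l ∉ maximalIdeal R ^ 2) (hfs : Squarefree f₀)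
    (hf : f₀ ∈ maximalIdeal R) (hf0 : f₀ ≠ 0) (hlf : ¬ l ∣ f₀) (E : IsExecution (curve f₀) (curve l) B s) :
    ∃ h, (s h).points = ∅ := by
  obtain ⟨i, j, -, hlx, -⟩ := exists_regPair hl hl'
  obtain ⟨d, hd, hdg⟩ := exists_tangent hl hl'
  obtain ⟨N, A, C, hN⟩ := exists_pow_mem hfs hlf hl hdg
  obtain ⟨D, hD⟩ := exists_extension (F := K) d
  have hN' : algebraMap R K l ^ N = algebraMap R K A * algebraMap R K f₀ + algebraMap R K C * D (algebraMap R K f₀) := by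
    rw [hD, ← map_pow, hN, map_add, map_mul, map_mul]
  have key : ∀ (μ : ℕ ×ₗ ℕ) (k : ℕ), (∀ P ∈ (s k).points, ∃ μ', HasMeasure D f₀ l N (s k) P μ' ∧ toLex μ' < μ) →
      ∃ h, (s h).points = ∅ := by
    intro μ
    induction μ using WellFoundedLT.induction with
    | ind μ ih =>
      intro k hk
      have I := E.inv hlx hf hf0 hlf k
      rcases (s k).points.eq_empty_or_nonempty with h0 | h0
      · exact ⟨k, h0⟩
      choose! m hm using hk
      obtain ⟨P₀, hP₀, hmax⟩ := Set.exists_max_image _ (fun P => toLex (m P)) (I.finite_points hf0) h0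
      refine ih _ (hm P₀ hP₀).2 (k + 1) fun Q hQ => ?_
      obtain ⟨a, b, F, H, hs⟩ := I.exists_stepData hf0 (E.step k)
      rw [hs] at hQ ⊢
      obtain ⟨P, hP, hlt⟩ := H.exists_measure_lt I hf0 hN' hQ
      obtain ⟨μ', h1, h2⟩ := hlt _ (hm P hP).1
      exact ⟨μ', h1, h2.trans_le (hmax P hP)⟩
  obtain ⟨μ, hμ⟩ := exists_measure_initial hlx hf0 hlf hd hD N
  refine key (toLex (μ.1, μ.2 + 1)) 0 fun P hP => ?_
  rw [E.init] at hP ⊢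
  obtain rfl : P = origin := hP
  exact ⟨μ, hμ, Prod.Lex.toLex_lt_toLex.2 (Or.inr ⟨rfl, Nat.lt_succ_self _⟩)⟩

/-! ### The final stage -/

/-- The generic points of the components of `C` are not modified, so only the fibre of the origin has to be considered. -/
lemma preimage_support_subset {X D C : Set (LocalSubring K)} (hX : IsModification X) (hC : ∀ V ∈ C, IsPrimeDivisor S V) (hCD : C ⊆ D)
    (h : ∀ P ∈ X, origin ≤ P → ∃ V ∈ D, P.toSubring ≤ V.toSubring) : preimage X S (support S C) ⊆ support X D := by
  rintro P ⟨hP, T, hT, hTP, -, V, hV, hTV⟩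
  have hVS := hC V hV
  have := hVS.2
  have hb := isModification_S.base_le hT
  rcases cases_S hT with rfl | d | hall
  · exact ⟨hP, h P hP hTP⟩
  · have h1 := eq_of_le_dvr hb hTV
    subst h1
    have h2 := hX.eq_of_le hP (hX.mem_of_isPrimeDivisor hVS) le_rfl hTP
    exact ⟨hP, V, hCD hV, h2 ▸ le_rfl⟩
  · obtain ⟨z, hz, hz0⟩ := exists_mem_mI V
    exact absurd hz (notMem_mI_of_inv hz0 (hTV (hall _)))

lemma IsExecution.boundary_subset {x : R} (hl : RegPair l x) (hf : f₀ ∈ maximalIdeal R) (hf0 : f₀ ≠ 0) (hlf : ¬ l ∣ f₀)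
    (E : IsExecution (curve f₀) (curve l) B s) (k : ℕ) : curve l ∪ {B 0 origin} ⊆ (s (k + 1)).boundary := by
  have key : ∀ k, (s k).boundary ∪ B k '' (s k).points ⊆ (s (k + 1)).boundary := fun k => by
    have I := E.inv hl hf hf0 hlf k
    obtain ⟨a, b, F, H, hs⟩ := I.exists_stepData hf0 (E.step k)
    rw [hs]
    exact H.subset_boundary I
  induction k with
  | zero =>
    have := key 0
    rwa [E.init, show (initialStage (curve l)).points = {origin} from rfl, Set.image_singleton] at this
  | succ k ih => exact ih.trans (Set.subset_union_left.trans (key (k + 1)))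

lemma IsExecution.isToroidalModification {x : R} (hl : RegPair l x) (hf : f₀ ∈ maximalIdeal R) (hf0 : f₀ ≠ 0) (hlf : ¬ l ∣ f₀)
    (E : IsExecution (curve f₀) (curve l) B s) {h : ℕ} (hh : (s h).points = ∅) :
    IsToroidalModification (s h).surface (s h).boundary (curve l) {B 0 origin} ∧
      BoundaryContainsTotalTransform (s h).surface (s h).boundary (curve f₀) := by
  have I := E.inv hl hf hf0 hlf h
  have I₀ := E.inv hl hf hf0 hlf 0
  obtain ⟨a, b, F, H, -⟩ := I₀.exists_stepData hf0 (E.step 0)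
  have hstep := (E.step 0).1
  rw [E.init] at I₀ H hstep
  have ho : origin ∈ (initialStage (curve l)).points := rfl
  obtain ⟨p, q, hs, hp, hq⟩ := H.cross origin ho
  have hdiv : ∀ V ∈ curve l ∪ {B 0 origin}, IsPrimeDivisor S V := by
    have := H.divisor I₀
    rwa [show (initialStage (curve l)).points = {origin} from rfl, Set.image_singleton] at this
  have hne : ∃ k, h = k + 1 := by
    refine Nat.exists_eq_succ_of_ne_zero ?_
    rintro rfl
    rw [E.init] at hh
    exact (hh ▸ ho : origin ∈ (∅ : Set (LocalSubring K)))
  obtain ⟨k, rfl⟩ := hne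
  refine ⟨⟨(hstep origin ho).1, I.modif, ⟨I.normal, I.finite, I.divisor, fun P hP => I.chart P hP (hh ▸ Set.notMem_empty P)⟩,
    ⟨I₀.normal, I₀.finite.union (Set.finite_singleton _), hdiv, fun P hP => ?_⟩,
    preimage_support_subset I.modif hdiv (E.boundary_subset hl hf hf0 hlf k) I.fibre⟩,
    preimage_support_subset I.modif (fun V hV => (mem_curve.1 hV).1) (fun V hV => ?_) I.fibre⟩
  · obtain rfl : origin = P := hP.2 origin origin_mem_S (isModification_S.base_le hP.1)
    refine hs.hasToricChart Set.univ fun z => ?_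
    have := H.mem_idealAt I₀ ho hp hq z
    rw [show (initialStage (curve l)).points = {origin} from rfl, Set.image_singleton] at this
    rw [show (initialStage (curve l)).boundary = curve l from rfl] at this
    simpa using this
  · refine (I.strict V hV).resolve_right ?_
    rintro ⟨P, hP, -⟩
    rw [hh] at hP
    exact hP

lemma IsExecution.strictTransformAvoidsSing {x : R} (hl : RegPair l x) (hf : f₀ ∈ maximalIdeal R) (hf0 : f₀ ≠ 0) (hlf : ¬ l ∣ f₀)
    (E : IsExecution (curve f₀) (curve l) B s) (h : ℕ) :
    StrictTransformAvoidsSing (s h).surface (curve f₀ \ chosenBranches (curve f₀) B s) := by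
  rintro P ⟨hP, V, hV, hPV⟩
  exact ((E.inv hl hf hf0 hlf h).sing P hP).resolve_right fun k => hV.2 (k V hV.1 hPV)

end ToroidalRes

end

open ToroidalRes in
theorem theorem3p14 (f l : R)
    (hf : Squarefree f) (hf' : f ∈ IsLocalRing.maximalIdeal R)
    (hl : l ∈ IsLocalRing.maximalIdeal R) (hl' : l ∉ IsLocalRing.maximalIdeal R ^ 2)
    (hlf : ¬ l ∣ f) :
    (∀ s : Stage, IsReachable (curve f) (curve l) s →
      s.points.Finite ∧ ∃ B s', IsStep (curve f) B s s') ∧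
    (∀ (B : ℕ → LocalSubring K → LocalSubring K) (s : ℕ → Stage),
      IsExecution (curve f) (curve l) B s →
      (∃ h, (s h).points = ∅) ∧
      ∀ h, (s h).points = ∅ →
        IsToroidalModification (s h).surface (s h).boundary (curve l) {B 0 origin} ∧
        BoundaryContainsTotalTransform (s h).surface (s h).boundary (curve f) ∧
        StrictTransformAvoidsSing (s h).surface
          (curve f \ chosenBranches (curve f) B s) ∧
        (chosenBranches (curve f) B s = ∅ →
          IsToroidalPseudoResolution (s h).surface (s h).boundary
            (curve l) {B 0 origin} (curve f))) := by
  have hf0 : f ≠ 0 := fun h => hlf (h ▸ dvd_zero l)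
  obtain ⟨i, j, -, hlx, -⟩ := exists_regPair hl hl'
  refine ⟨fun s hs => ?_, fun B s E => ⟨E.exists_points_eq_empty hl hl' hf hf' hf0 hlf, fun h hh => ?_⟩⟩
  · have I : Inv f Set.univ s := by
      induction hs with
      | refl => exact inv_initial hlx hf' hf0 hlf _
      | tail _ h I =>
        obtain ⟨B, hB⟩ := h
        obtain ⟨a, b, F, H, rfl⟩ := I.exists_stepData hf0 hB
        exact H.inv_next I hf0 fun _ _ _ => Set.mem_univ _
    exact ⟨I.finite_points hf0, I.exists_step hf0⟩
  · obtain ⟨h1, h2⟩ := E.isToroidalModification hlx hf' hf0 hlf hh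
    have h3 := E.strictTransformAvoidsSing hlx hf' hf0 hlf h
    refine ⟨h1, h2, h3, fun h0 => ⟨h1, h2, ?_⟩⟩
    rwa [h0, Set.sdiff_empty] at h3
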